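/- **Setting.** A function $f:\mathbb{R}^k\to\mathbb{R}$ is called $C^\infty_{1b}$ if it is $C^\infty$ and all its partial derivatives of nonzero order are bounded. A law on $\mathbb{R}$ is $K$-subgaussian if $\inf\{t>0:\mathbb{E}e^{x^2/t^2}\le 2\}\le K$. Fix $\sigma>0$, $\alpha>0$, a probability measure $\nu_0$ on $\mathbb{R}^2$ whose two marginals are $\sigma$-subgaussian, and $C^\infty_{1b}$ functions $F_t,G_t:\mathbb{R}^{2t+1}\to\mathbb{R}$, $t\ge 1$. For $N,d$ with $d/N=\alpha$ let - $X\in\mathbb{R}^{N\times d}$ have i.i.d. entries whose law (which may depend on $N$) is $\sigma/\sqrt N$-subgaussian with mean $0$ and variance $1/N$; - $(\theta_j,v^0_j)\sim\nu_0$ be i.i.d. over $j\in[d]$; - $\boldsymbol w^t\in\mathbb{R}^N$, $\tilde{\boldsymbol w}^t\in\mathbb{R}^d$, $t\ge1$, have i.i.d. $N(0,1)$ entries, where $X$, $(\boldsymbol\theta,\boldsymbol v^0)$, $(\boldsymbol w^t)_t$, $(\tilde{\boldsymbol w}^t)_t$ are independent. Put $\boldsymbol b^*=X\boldsymbol\theta$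 and, for $t\ge1$, with the functions applied coordinatewise, $$\boldsymbol b^t=X\boldsymbol v^{t-1},\quad \boldsymbol u^t=F_t(\boldsymbol b^*,\boldsymbol b^1,\dots,\boldsymbol b^t;\boldsymbol w^1,\dots,\boldsymbol w^t),\quad \boldsymbol h^t=X^{\top}\boldsymbol u^t,\quad \boldsymbol v^t=G_t(\boldsymbol h^1,\dots,\boldsymbol h^t;\boldsymbol v^0,\tilde{\boldsymbol w}^1,\dots,\tilde{\boldsymbol w}^t).$$ **Limit laws.** Laws $\mu_T$ on $\mathbb{R}^{2T+1}$ and $\nu_T$ on $\mathbb{R}^{2T+2}$ are defined recursively, in the order $\nu_0,\mu_0,\mu_1,\nu_1,\mu_2,\nu_2,\dots$ The law $\nu_0$ is the given law of $(\theta,v^0)$, and $\mu_0=N(0,\alpha\,\mathbb{E}_{\nu_0}[\theta^2])$ is the law of $b^*$. For $T\ge1$, $\mu_T$ is the law of $(b^*,\{b^t\}_{t=1}^T,\{u^t\}_{t=1}^T)$, where $(b^*,z^1,\dots,z^T)$ is a centered Gaussian vector whose covariance matrix is $\alpha$ times the matrix of (uncentered) second moments of $(\theta,v^0,\dots,v^{T-1})$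 under $\nu_{T-1}$, $(w^1,\dots,w^T)\sim N(0,I_T)$ is independent of it, and $$b^t=z^t+\alpha\sum_{s=1}^{t-1}\mathbb{E}_{\nu_{T-1}}[\partial_{h^s}v^{t-1}]\,u^s,\qquad u^t=F_t(b^*,b^1,\dots,b^t;w^1,\dots,w^t).$$ For $T\ge1$, $\nu_T$ is the law of $(\theta,\{h^t\}_{t=1}^T,\{v^t\}_{t=0}^T)$, where $(\theta,v^0)\sim\nu_0$, $(g^1,\dots,g^T)$ is a centered Gaussian vector whose covariance matrix is the matrix of (uncentered) second moments of $(u^1,\dots,u^T)$ under $\mu_T$, $(\tilde w^1,\dots,\tilde w^T)\sim N(0,I_T)$, these three are independent, and $$h^t=g^t+\mathbb{E}_{\mu_T}[\partial_{b^*}u^t]\,\theta+\sum_{s=1}^t\mathbb{E}_{\mu_T}[\partial_{b^s}u^t]\,v^{s-1},\qquad v^t=G_t(h^1,\dots,h^t;v^0,\tilde w^1,\dots,\tilde w^t).$$ Here the derivatives are the random variables defined recursively by the chain rule: for $\bullet\in\{*,1,2,\dots\}$, $$\partial_{b^\bullet}u^t=\mathbf 1\{\bullet=*\}\,(\partial_{b^*}F_t)+\sum_{k=1}^t(\partial_{b^k}F_t)\,\partial_{b^\bullet}b^k,\qquad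 \partial_{b^\bullet}b^k=\mathbf 1\{\bullet=k\}+\alpha\sum_{r=1}^{k-1}\mathbb{E}_{\nu_{T-1}}[\partial_{h^r}v^{k-1}]\,\partial_{b^\bullet}u^r,$$ and $\partial_{h^s}v^0=0$, $$\partial_{h^s}v^t=\sum_{k=1}^t(\partial_{h^k}G_t)\,\partial_{h^s}h^k,\qquad \partial_{h^s}h^k=\mathbf 1\{s=k\}+\sum_{r=1}^{k}\mathbb{E}_{\mu_T}[\partial_{b^r}u^k]\,\partial_{h^s}v^{r-1},$$ where the partial derivatives of $F_t$, $G_t$ are evaluated at the arguments of $F_t$, $G_t$ in the definitions of $u^t$, $v^t$. **Theorem.** Let $T\ge0$ and let $\phi:\mathbb{R}^{2T+2}\to\mathbb{R}$, $\psi:\mathbb{R}^{2T+1}\to\mathbb{R}$ be $C^\infty_{1b}$. Write $\Phi_j=\phi(\theta_j,\{h^t_j\}_{t=1}^T,\{v^t_j\}_{t=0}^T)$ for $j\in[d]$ and $\Psi_i=\psi(b^*_i,\{b^t_i\}_{t=1}^T,\{u^t_i\}_{t=1}^T)$ for $i\in[N]$. Then $\Phi_j,\Psi_i$ are square integrable,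 $\phi\in L^1(\nu_T)$, $\psi\in L^1(\mu_T)$, and as $N,d\to\infty$ with $d/N=\alpha$ fixed: 1. $\displaystyle\max_{j\in[d]}\Big|\mathbb{E}\,\Phi_j-\int\phi\,d\nu_T\Big|\to0$ and $\displaystyle\max_{i\in[N]}\Big|\mathbb{E}\,\Psi_i-\int\psi\,d\mu_T\Big|\to0$; 2. $\displaystyle\max_{j\ne j'\in[d]}\big|\mathrm{Cov}(\Phi_j,\Phi_{j'})\big|\to0$ and $\displaystyle\max_{i\ne i'\in[N]}\big|\mathrm{Cov}(\Psi_i,\Psi_{i'})\big|\to0$. -/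

import Mathlib

open MeasureTheory ProbabilityTheory Filter Topology
open scoped ENNReal Matrix

namespace DMFT

/-! Time indexing.  The vectors `b, u, h, w, w̃` and the functions `F, G` are indexed by times
`1, 2, …`; here they are indexed by `s : ℕ`, the index `s` standing for time `s + 1`.  The vector
`v` is indexed by its actual time `0, 1, …`. -/

/-- The class `C^∞_{1b}`: smooth functions all of whose derivatives of nonzero order are bounded. -/
def IsC1b {E : Type*} [NormedAddCommGroup E] [NormedSpace ℝ E] (f : E → ℝ) : Prop :=
  ContDiff ℝ (⊤ : ℕ∞) f ∧ ∀ n : ℕ, 1 ≤ n → ∃ C : ℝ, ∀ x, ‖iteratedFDeriv ℝ n f x‖ ≤ C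

/-- The subgaussian norm `inf {t > 0 : E exp(x² / t²) ≤ 2}` of a law on `ℝ` (`∞` if there is no
such `t`). -/
noncomputable def psi2Norm (ρ : Measure ℝ) : ℝ≥0∞ :=
  ⨅ (t : ℝ) (_ : 0 < t) (_ : ∫⁻ x, ENNReal.ofReal (Real.exp (x ^ 2 / t ^ 2)) ∂ρ ≤ 2),
    ENNReal.ofReal t

/-- `ρ` is `K`-subgaussian. -/
def IsSubgaussian (K : ℝ) (ρ : Measure ℝ) : Prop := psi2Norm ρ ≤ ENNReal.ofReal K

/-- The nonlinearities `F_{s+1}`, with arguments `(b^*, (b^1,…,b^{s+1}), (w^1,…,w^{s+1}))`. -/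
abbrev UFun := (s : ℕ) → ℝ × (Fin (s + 1) → ℝ) × (Fin (s + 1) → ℝ) → ℝ

/-- The nonlinearities `G_{s+1}`, with arguments
`((h^1,…,h^{s+1}), v^0, (w̃^1,…,w̃^{s+1}))`. -/
abbrev VFun := (s : ℕ) → (Fin (s + 1) → ℝ) × ℝ × (Fin (s + 1) → ℝ) → ℝ

section Orbit

variable {N d : ℕ} (F : UFun) (G : VFun) (X : Matrix (Fin N) (Fin d) ℝ) (θ v₀ : Fin d → ℝ)
  (w : ℕ → Fin N → ℝ) (w' : ℕ → Fin d → ℝ)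

/-- The vectors `v^t` of the orbit:
`v^{t+1} = G_{t+1}(h^1,…,h^{t+1}; v^0, w̃^1,…,w̃^{t+1})` where `h^{s+1} = Xᵀ u^{s+1}`,
`u^{s+1} = F_{s+1}(Xθ, b^1,…,b^{s+1}; w^1,…,w^{s+1})` and `b^{r+1} = X v^r`. -/
noncomputable def orbitV : ℕ → Fin d → ℝ
  | 0 => v₀
  | t + 1 => fun j =>
      G t (fun s : Fin (t + 1) =>
          (Xᵀ *ᵥ fun i => F s ((X *ᵥ θ) i,
            fun r : Fin (s + 1) => (X *ᵥ orbitV r) i,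
            fun r : Fin (s + 1) => w r i)) j,
        v₀ j, fun s : Fin (t + 1) => w' s j)
  termination_by t => t
  decreasing_by omega

/-- `b^* = X θ`. -/
noncomputable def orbitBStar : Fin N → ℝ := X *ᵥ θ

/-- `b^{s+1} = X v^s`. -/
noncomputable def orbitB (s : ℕ) : Fin N → ℝ := X *ᵥ orbitV F G X θ v₀ w w' s

/-- `u^{s+1} = F_{s+1}(b^*, b^1,…,b^{s+1}; w^1,…,w^{s+1})`, coordinatewise. -/
noncomputable def orbitU (s : ℕ) : Fin N → ℝ := fun i =>
  F s (orbitBStar X θ i, fun r : Fin (s + 1) => orbitB F G X θ v₀ w w' r i,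
    fun r : Fin (s + 1) => w r i)

/-- `h^{s+1} = Xᵀ u^{s+1}`. -/
noncomputable def orbitH (s : ℕ) : Fin d → ℝ := Xᵀ *ᵥ orbitU F G X θ v₀ w w' s

/-- The defining equation of `v^{t+1}` in terms of `h^1,…,h^{t+1}`. -/
theorem orbitV_succ (t : ℕ) (j : Fin d) :
    orbitV F G X θ v₀ w w' (t + 1) j =
      G t (fun s : Fin (t + 1) => orbitH F G X θ v₀ w w' s j, v₀ j,
        fun s : Fin (t + 1) => w' s j) := by
  rw [orbitV]
  rfl

/-- The trajectory `(θ_j, (h_j^t)_{1≤t≤T}, (v_j^t)_{0≤t≤T})` of the coordinate `j`. -/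
noncomputable def vTraj (T : ℕ) (j : Fin d) : ℝ × (Fin T → ℝ) × (Fin (T + 1) → ℝ) :=
  (θ j, fun t => orbitH F G X θ v₀ w w' t j, fun t => orbitV F G X θ v₀ w w' t j)

/-- The trajectory `(b^*_i, (b_i^t)_{1≤t≤T}, (u_i^t)_{1≤t≤T})` of the coordinate `i`. -/
noncomputable def uTraj (T : ℕ) (i : Fin N) : ℝ × (Fin T → ℝ) × (Fin T → ℝ) :=
  (orbitBStar X θ i, fun t => orbitB F G X θ v₀ w w' t i, fun t => orbitU F G X θ v₀ w w' t i)

end Orbit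

/-- A finite sequence, continued by `0`; the added values never enter the laws below. -/
def ext0 {T : ℕ} (x : Fin T → ℝ) : ℕ → ℝ := fun n => if h : n < T then x ⟨n, h⟩ else 0

/-! The effective process `(b^*, b^t, u^t)` as a function of the sample `(b^*, z, w)` and of the
deterministic coefficients `A t s = E[∂_{h^{s+1}} v^t]`. -/

section EffectiveU

variable (F : UFun) (α : ℝ) (A : ℕ → ℕ → ℝ) (bs : ℝ) (z w : ℕ → ℝ)

/-- `u^{t+1} = F_{t+1}(b^*, b^1,…,b^{t+1}; w^1,…,w^{t+1})`, with
`b^{k+1} = z^{k+1} + α ∑_{s<k} E[∂_{h^{s+1}} v^k] u^{s+1}`. -/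
noncomputable def effU (t : ℕ) : ℝ :=
  F t (bs, fun k : Fin (t + 1) => z k + α * ∑ s : Fin k, A k s * effU s,
    fun k : Fin (t + 1) => w k)
  termination_by t
  decreasing_by omega

/-- `b^{t+1} = z^{t+1} + α ∑_{s<t} E[∂_{h^{s+1}} v^t] u^{s+1}`. -/
noncomputable def effB (t : ℕ) : ℝ := z t + α * ∑ s : Fin t, A t s * effU F α A bs z w s

/-- The derivative of `u^{t+1}` with respect to a perturbation of the fields, by the chain rule:
`δu^{t+1} = ∂_{b^*} F_{t+1} · c + ∑_{k≤t} ∂_{b^{k+1}} F_{t+1} · δb^{k+1}` with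
`δb^{k+1} = e k + α ∑_{r<k} E[∂_{h^{r+1}} v^k] δu^{r+1}`. -/
noncomputable def effDU (c : ℝ) (e : ℕ → ℝ) (t : ℕ) : ℝ :=
  fderiv ℝ (F t)
    (bs, fun k : Fin (t + 1) => effB F α A bs z w k, fun k : Fin (t + 1) => w k)
    (c, fun k : Fin (t + 1) => e k + α * ∑ r : Fin k, A k r * effDU c e r, 0)
  termination_by t
  decreasing_by omega

/-- `∂_{b^*} u^{t+1}`. -/
noncomputable def effDUStar (t : ℕ) : ℝ := effDU F α A bs z w 1 0 t

/-- `∂_{b^{s+1}} u^{t+1}`. -/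
noncomputable def effDUField (s t : ℕ) : ℝ :=
  effDU F α A bs z w 0 (fun k => if s = k then 1 else 0) t

end EffectiveU

/-! The effective process `(θ, h^t, v^t)` as a function of the sample `(θ, v^0, g, w̃)` and of the
deterministic coefficients `m t = E[∂_{b^*} u^{t+1}]` and `R t s = E[∂_{b^{s+1}} u^{t+1}]`. -/

section EffectiveV

variable (G : VFun) (m : ℕ → ℝ) (R : ℕ → ℕ → ℝ) (θ v₀ : ℝ) (g w' : ℕ → ℝ)

/-- `v^{t+1} = G_{t+1}(h^1,…,h^{t+1}; v^0, w̃^1,…,w̃^{t+1})`, with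
`h^{k+1} = g^{k+1} + E[∂_{b^*} u^{k+1}] θ + ∑_{s≤k} E[∂_{b^{s+1}} u^{k+1}] v^s`. -/
noncomputable def effV : ℕ → ℝ
  | 0 => v₀
  | t + 1 =>
      G t (fun k : Fin (t + 1) => g k + m k * θ + ∑ s : Fin (k + 1), R k s * effV s,
        v₀, fun k : Fin (t + 1) => w' k)
  termination_by t => t
  decreasing_by omega

/-- `h^{t+1} = g^{t+1} + E[∂_{b^*} u^{t+1}] θ + ∑_{s≤t} E[∂_{b^{s+1}} u^{t+1}] v^s`. -/
noncomputable def effH (t : ℕ) : ℝ :=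
  g t + m t * θ + ∑ s : Fin (t + 1), R t s * effV G m R θ v₀ g w' s

/-- `∂_{h^{s+1}} v^t`, by the chain rule: `∂_{h^{s+1}} v^0 = 0` and
`∂_{h^{s+1}} v^{t+1} = ∑_{k≤t} ∂_{h^{k+1}} G_{t+1} · ∂_{h^{s+1}} h^{k+1}` with
`∂_{h^{s+1}} h^{k+1} = 1{s = k} + ∑_{r≤k} E[∂_{b^{r+1}} u^{k+1}] ∂_{h^{s+1}} v^r`. -/
noncomputable def effDV (s : ℕ) : ℕ → ℝ
  | 0 => 0
  | t + 1 =>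
      fderiv ℝ (G t)
        (fun k : Fin (t + 1) => effH G m R θ v₀ g w' k, v₀, fun k : Fin (t + 1) => w' k)
        (fun k : Fin (t + 1) =>
          (if s = k then 1 else 0) + ∑ r : Fin (k + 1), R k r * effDV s r, 0, 0)
  termination_by t => t
  decreasing_by omega

end EffectiveV

/-- What the definition of `μ_T` uses of `ν_{T-1}`: the second moments of `(θ, v^0, v^1, …)`
(index `0` is `θ`, index `k + 1` is `v^k`) and the responses `A t s = E[∂_{h^{s+1}} v^t]`. -/
structure VStats where
  mom : ℕ → ℕ → ℝ
  resp : ℕ → ℕ → ℝ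

/-- What the definition of `ν_T` uses of `μ_T`: the second moments `E[u^{s+1} u^{t+1}]` and the
responses `m t = E[∂_{b^*} u^{t+1}]`, `R t s = E[∂_{b^{s+1}} u^{t+1}]`. -/
structure UStats where
  mom : ℕ → ℕ → ℝ
  respStar : ℕ → ℝ
  resp : ℕ → ℕ → ℝ

/-- The space of samples `((b^*, z^1,…,z^T), (w^1,…,w^T))`. -/
abbrev USample (T : ℕ) := EuclideanSpace ℝ (Fin (T + 1)) × (Fin T → ℝ)

/-- The space of samples `((θ, v^0), (g^1,…,g^T), (w̃^1,…,w̃^T))`. -/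
abbrev VSample (T : ℕ) := (ℝ × ℝ) × EuclideanSpace ℝ (Fin T) × (Fin T → ℝ)

/-- `(b^*, z^1,…,z^T)` is a centered Gaussian vector with covariance matrix `α` times the second
moment matrix of `(θ, v^0,…,v^{T-1})`, and `(w^1,…,w^T)` is an independent standard Gaussian. -/
noncomputable def uSampleLaw (α : ℝ) (T : ℕ) (p : VStats) : Measure (USample T) :=
  (multivariateGaussian 0 (Matrix.of fun i j : Fin (T + 1) => α * p.mom i j)).prod
    (Measure.pi fun _ => gaussianReal 0 1)

/-- `(θ, v^0)` has law `ν₀`, `(g^1,…,g^T)` is a centered Gaussian vector whose covariance matrix is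
the second moment matrix of `(u^1,…,u^T)`, `(w̃^1,…,w̃^T)` is a standard Gaussian, and the three
are independent. -/
noncomputable def vSampleLaw (ν₀ : Measure (ℝ × ℝ)) (T : ℕ) (q : UStats) :
    Measure (VSample T) :=
  ν₀.prod ((multivariateGaussian 0 (Matrix.of fun i j : Fin T => q.mom i j)).prod
    (Measure.pi fun _ => gaussianReal 0 1))

section Processes

variable {T : ℕ}

/-- The field `z` of a sample. -/
def USample.z (x : USample T) : ℕ → ℝ := ext0 fun k : Fin T => x.1 k.succ

/-- `u^{t+1}` as a random variable on the sample space. -/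
noncomputable def procU (F : UFun) (α : ℝ) (p : VStats) (x : USample T) (t : ℕ) : ℝ :=
  effU F α p.resp (x.1 0) (USample.z x) (ext0 x.2) t

/-- `b^{t+1}` as a random variable on the sample space. -/
noncomputable def procB (F : UFun) (α : ℝ) (p : VStats) (x : USample T) (t : ℕ) : ℝ :=
  effB F α p.resp (x.1 0) (USample.z x) (ext0 x.2) t

/-- `v^t` as a random variable on the sample space. -/
noncomputable def procV (G : VFun) (q : UStats) (y : VSample T) (t : ℕ) : ℝ :=
  effV G q.respStar q.resp y.1.1 y.1.2 (ext0 y.2.1) (ext0 y.2.2) t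

/-- `h^{t+1}` as a random variable on the sample space. -/
noncomputable def procH (G : VFun) (q : UStats) (y : VSample T) (t : ℕ) : ℝ :=
  effH G q.respStar q.resp y.1.1 y.1.2 (ext0 y.2.1) (ext0 y.2.2) t

/-- The vector `(θ, v^0, v^1, …)`. -/
noncomputable def procThetaV (G : VFun) (q : UStats) (y : VSample T) : ℕ → ℝ
  | 0 => y.1.1
  | k + 1 => procV G q y k

end Processes

/-- The statistics of `μ_T`. -/
noncomputable def uStatsOf (F : UFun) (α : ℝ) (T : ℕ) (p : VStats) : UStats where
  mom s t := ∫ x, procU F α p x s * procU F α p x t ∂uSampleLaw α T p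
  respStar t := ∫ x, effDUStar F α p.resp (x.1 0) (USample.z x) (ext0 x.2) t ∂uSampleLaw α T p
  resp t s := ∫ x, effDUField F α p.resp (x.1 0) (USample.z x) (ext0 x.2) s t ∂uSampleLaw α T p

/-- The statistics of `ν_T`. -/
noncomputable def vStatsOf (G : VFun) (ν₀ : Measure (ℝ × ℝ)) (T : ℕ) (q : UStats) : VStats where
  mom i j := ∫ y, procThetaV G q y i * procThetaV G q y j ∂vSampleLaw ν₀ T q
  resp t s :=
    ∫ y, effDV G q.respStar q.resp y.1.1 y.1.2 (ext0 y.2.1) (ext0 y.2.2) s t ∂vSampleLaw ν₀ T q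

/-- The statistics used by `μ_T`: for `T = 0` only `E[θ²]` under `ν₀` (no response is needed), and
for `T + 1` those of `ν_T`, which in turn uses those of `μ_T`. -/
noncomputable def vStats (F : UFun) (G : VFun) (α : ℝ) (ν₀ : Measure (ℝ × ℝ)) : ℕ → VStats
  | 0 => ⟨fun _ _ => ∫ x, x.1 ^ 2 ∂ν₀, fun _ _ => 0⟩
  | T + 1 => vStatsOf G ν₀ T (uStatsOf F α T (vStats F G α ν₀ T))

/-- The statistics used by `ν_T`: those of `μ_T`. -/
noncomputable def uStats (F : UFun) (G : VFun) (α : ℝ) (ν₀ : Measure (ℝ × ℝ)) (T : ℕ) : UStats :=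
  uStatsOf F α T (vStats F G α ν₀ T)

/-- `μ_T = Law(b^*, (b^t)_{1≤t≤T}, (u^t)_{1≤t≤T})`. -/
noncomputable def muLaw (F : UFun) (G : VFun) (α : ℝ) (ν₀ : Measure (ℝ × ℝ)) (T : ℕ) :
    Measure (ℝ × (Fin T → ℝ) × (Fin T → ℝ)) :=
  (uSampleLaw α T (vStats F G α ν₀ T)).map fun x =>
    (x.1 0, fun t : Fin T => procB F α (vStats F G α ν₀ T) x t,
      fun t : Fin T => procU F α (vStats F G α ν₀ T) x t)

/-- `ν_T = Law(θ, (h^t)_{1≤t≤T}, (v^t)_{0≤t≤T})`. -/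
noncomputable def nuLaw (F : UFun) (G : VFun) (α : ℝ) (ν₀ : Measure (ℝ × ℝ)) (T : ℕ) :
    Measure (ℝ × (Fin T → ℝ) × (Fin (T + 1) → ℝ)) :=
  (vSampleLaw ν₀ T (uStats F G α ν₀ T)).map fun y =>
    (y.1.1, fun t : Fin T => procH G (uStats F G α ν₀ T) y t,
      fun t : Fin (T + 1) => procV G (uStats F G α ν₀ T) y t)

/-- The probabilistic assumptions on the matrix `X`, the initialization `(θ, v^0)` and the noises
`w, w̃` in dimension `(N, d)`. -/
structure IsRandomInput {Ω : Type*} [MeasurableSpace Ω] (P : Measure Ω) (σ : ℝ)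
    (ν₀ : Measure (ℝ × ℝ)) {N d : ℕ} (X : Ω → Matrix (Fin N) (Fin d) ℝ) (θ v₀ : Ω → Fin d → ℝ)
    (w : Ω → ℕ → Fin N → ℝ) (w' : Ω → ℕ → Fin d → ℝ) : Prop where
  /-- The entries of `X` have a common `σ/√N`-subgaussian law, of mean `0` and variance `1/N`. -/
  law_X : ∃ ρ : Measure ℝ, IsSubgaussian (σ / √(N : ℝ)) ρ ∧ ∫ x, x ∂ρ = 0 ∧
    Var[id; ρ] = 1 / (N : ℝ) ∧ ∀ i j, HasLaw (fun ω => X ω i j) ρ P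
  /-- The entries of `X` are independent. -/
  indep_X : iIndepFun (fun (p : Fin N × Fin d) ω => X ω p.1 p.2) P
  law_init : ∀ j, HasLaw (fun ω => (θ ω j, v₀ ω j)) ν₀ P
  indep_init : iIndepFun (fun (j : Fin d) ω => (θ ω j, v₀ ω j)) P
  law_w : ∀ t i, HasLaw (fun ω => w ω t i) (gaussianReal 0 1) P
  indep_w : iIndepFun (fun (p : ℕ × Fin N) ω => w ω p.1 p.2) P
  law_w' : ∀ t j, HasLaw (fun ω => w' ω t j) (gaussianReal 0 1) P
  indep_w' : iIndepFun (fun (p : ℕ × Fin d) ω => w' ω p.1 p.2) P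
  /-- The four families `X`, `(θ, v^0)`, `w`, `w̃` are independent of each other. -/
  indep_X_rest : IndepFun (fun ω (i : Fin N) (j : Fin d) => X ω i j)
    (fun ω => (θ ω, v₀ ω, w ω, w' ω)) P
  indep_init_noise : IndepFun (fun ω => (θ ω, v₀ ω)) (fun ω => (w ω, w' ω)) P
  indep_noise : IndepFun w w' P

end DMFT

set_option linter.unusedSectionVars false

namespace DMFT

open Finset (range sum_congr mem_range mul_sum sum_le_sum sum_nonneg sum_eq_zero univ
  sum_add_distrib sum_sub_distrib sum_range sum_comm sum_insert sum_const card_univ mem_univ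
  sum_range_succ induction_on single_le_sum abs_sum_le_sum_abs sum_mul mem_singleton sum_div
  sum_coe_sort sum_mul_sum sum_ite_eq)
open ENNReal (ofReal ofReal_le_ofReal ofReal_mul ofReal_ne_top ofReal_add toReal_le_of_le_ofReal
  ofReal_sum_of_nonneg ofReal_lt_top ofReal_one)
open Real (exp exp_pos exp_le_exp sq_sqrt sqrt_nonneg norm_eq_abs dist_eq exp_add add_one_le_exp)
open Sum (inl inr elim elim_inl elim_inr isLeft)
open Fintype (card sum_sum_type card_fin sum_prod_type)
open Matrix (of diagonal mulVec l2_opNorm_mul mulVec_sub of_apply zero_mulVec mulVec_smul)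
open Pi (single single_apply)
open WithLp (toLp)
open Nat (strongRecOn)

/-- The character `exp (i x)`. -/
local notation "cis(" x ")" => Complex.exp (Complex.I * ((x : ℝ) : ℂ))
/-- Families `f t i x` of nonlinearities at the times `t`, for sites `i` and fields `x`. -/
local notation "Act(" x ")" => ℕ → x → (ℕ → ℝ) → ℝ
/-- Families of partial derivatives of nonlinearities. -/
local notation "Grad(" x ")" => ℕ → ℕ → x → (ℕ → ℝ) → ℝ

noncomputable section

/-! ### Families of random variables that are bounded, or small, in every `L^p` -/

section LpCalculus

open scoped NNReal

variable {Ω : ℕ → Type*} [∀ n, MeasurableSpace (Ω n)] {P : ∀ n, Measure (Ω n)}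
  [∀ n, IsProbabilityMeasure (P n)] {J : ℕ → Type*}

/-- All moments of the family are finite, uniformly in `n` and in the index. -/
def LpBdd (P : ∀ n, Measure (Ω n)) (Z : ∀ n, J n → Ω n → ℝ) : Prop :=
  (∀ n j, Measurable (Z n j)) ∧
    ∀ p : ℕ, ∃ C : ℝ, ∀ n j, ∫⁻ ω, ofReal (|Z n j ω| ^ p) ∂P n ≤ ofReal C

/-- All moments are bounded and the first moment tends to `0`, uniformly in the index. -/
def LpSmall (P : ∀ n, Measure (Ω n)) (Z : ∀ n, J n → Ω n → ℝ) : Prop :=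
  LpBdd P Z ∧ ∀ ε : ℝ, 0 < ε →
    ∀ᶠ n in atTop, ∀ j, ∫⁻ ω, ofReal |Z n j ω| ∂P n ≤ ofReal ε

variable {Z W : ∀ n, J n → Ω n → ℝ}

theorem LpBdd.meas (hZ : LpBdd P Z) (n j) : Measurable (Z n j) := hZ.1 n j

theorem LpBdd.mono (hW : LpBdd P W) (hm : ∀ n j, Measurable (Z n j))
    (h : ∀ n j ω, |Z n j ω| ≤ |W n j ω|) : LpBdd P Z := by
  refine ⟨hm, fun p => ?_⟩
  obtain ⟨C, hC⟩ := hW.2 p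
  refine ⟨C, fun n j => (lintegral_mono fun ω => ofReal_le_ofReal ?_).trans (hC n j)⟩
  have := h n j ω
  gcongr

theorem LpBdd.of_le (hW : LpBdd P W) (hm : ∀ n j, Measurable (Z n j))
    (h : ∀ n j ω, |Z n j ω| ≤ W n j ω) : LpBdd P Z :=
  hW.mono hm fun n j ω => (h n j ω).trans (le_abs_self _)

theorem LpBdd.reindex (hZ : LpBdd P Z) {K : ℕ → Type*} (g : ∀ n, K n → J n) :
    LpBdd P (fun n k => Z n (g n k)) :=
  ⟨fun n _ => hZ.1 n _, fun p => let ⟨C, hC⟩ := hZ.2 p; ⟨C, fun n _ => hC n _⟩⟩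

theorem LpBdd.abs (hZ : LpBdd P Z) : LpBdd P (fun n j ω => |Z n j ω|) :=
  hZ.mono (fun n j => (hZ.1 n j).abs) fun n j ω => by simp

theorem LpBdd.neg (hZ : LpBdd P Z) : LpBdd P (fun n j ω => -Z n j ω) :=
  hZ.mono (fun n j => (hZ.1 n j).neg) fun n j ω => by simp

theorem LpBdd.const (c : ℝ) :
    LpBdd P (fun n (_ : J n) _ => c) :=
  ⟨fun _ _ => measurable_const, fun p => ⟨|c| ^ p, fun n j => by simp⟩⟩

theorem LpBdd.add (hZ : LpBdd P Z) (hW : LpBdd P W) :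
    LpBdd P (fun n j ω => Z n j ω + W n j ω) := by
  refine ⟨fun n j => (hZ.1 n j).add (hW.1 n j), fun p => ?_⟩
  obtain ⟨C, hC⟩ := hZ.2 p
  obtain ⟨D, hD⟩ := hW.2 p
  refine ⟨2 ^ (p - 1) * (|C| + |D|), fun n j => ?_⟩
  have hpt : ∀ ω, ofReal (|Z n j ω + W n j ω| ^ p) ≤
      ofReal (2 ^ (p - 1)) * (ofReal (|Z n j ω| ^ p)
        + ofReal (|W n j ω| ^ p)) := fun ω => by
    rw [← ofReal_add (by positivity) (by positivity),
      ← ofReal_mul (by positivity)]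
    refine ofReal_le_ofReal ?_
    calc |Z n j ω + W n j ω| ^ p ≤ (|Z n j ω| + |W n j ω|) ^ p := by
          gcongr; exact abs_add_le _ _
      _ ≤ _ := add_pow_le (abs_nonneg _) (abs_nonneg _) p
  have m1 : Measurable fun ω => ofReal (|Z n j ω| ^ p) :=
    ((hZ.1 n j).abs.pow_const p).ennreal_ofReal
  have m2 : Measurable fun ω => ofReal (|W n j ω| ^ p) :=
    ((hW.1 n j).abs.pow_const p).ennreal_ofReal
  calc _ ≤ _ := lintegral_mono hpt
    _ = ofReal (2 ^ (p - 1)) * (∫⁻ ω, ofReal (|Z n j ω| ^ p) ∂P n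
        + ∫⁻ ω, ofReal (|W n j ω| ^ p) ∂P n) := by
        rw [lintegral_const_mul' _ _ ofReal_ne_top, lintegral_add_left m1]
    _ ≤ ofReal (2 ^ (p - 1)) * (ofReal |C| + ofReal |D|) := by
        gcongr
        · exact (hC n j).trans (ofReal_le_ofReal (le_abs_self _))
        · exact (hD n j).trans (ofReal_le_ofReal (le_abs_self _))
    _ = _ := by
        rw [← ofReal_add (by positivity) (by positivity),
          ← ofReal_mul (by positivity)]

theorem LpBdd.sub (hZ : LpBdd P Z) (hW : LpBdd P W) :
    LpBdd P (fun n j ω => Z n j ω - W n j ω) := by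
  simpa [sub_eq_add_neg] using hZ.add hW.neg

theorem LpBdd.pow (hZ : LpBdd P Z) (k : ℕ) : LpBdd P (fun n j ω => Z n j ω ^ k) := by
  refine ⟨fun n j => (hZ.1 n j).pow_const k, fun p => ?_⟩
  obtain ⟨C, hC⟩ := hZ.2 (k * p)
  exact ⟨C, fun n j => by simpa [abs_pow, ← pow_mul] using hC n j⟩

theorem LpBdd.mul (hZ : LpBdd P Z) (hW : LpBdd P W) :
    LpBdd P (fun n j ω => Z n j ω * W n j ω) := by
  refine ((hZ.pow 2).add (hW.pow 2)).of_le (fun n j => (hZ.1 n j).mul (hW.1 n j)) fun n j ω => ?_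
  rw [abs_mul]
  nlinarith [sq_abs (Z n j ω), sq_abs (W n j ω), sq_nonneg (|Z n j ω| - |W n j ω|),
    abs_nonneg (Z n j ω), abs_nonneg (W n j ω)]

theorem LpBdd.const_mul (c : ℝ) (hZ : LpBdd P Z) :
    LpBdd P (fun n j ω => c * Z n j ω) :=
  (LpBdd.const c).mul hZ

theorem LpBdd.sum {κ : Type*} (s : Finset κ)
    {Z : κ → ∀ n, J n → Ω n → ℝ} (hZ : ∀ i ∈ s, LpBdd P (Z i)) :
    LpBdd P (fun n j ω => ∑ i ∈ s, Z i n j ω) := by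
  classical
  induction s using induction_on with
  | empty => simpa using LpBdd.const (P := P) (J := J) 0
  | insert a s ha ih =>
    simp only [sum_insert ha]
    exact (hZ a (by simp)).add (ih fun i hi => hZ i (by simp [hi]))

theorem LpBdd.sqrt (hZ : LpBdd P Z) :
    LpBdd P (fun n j ω => √(Z n j ω)) := by
  refine ((LpBdd.const 1).add hZ.abs).of_le (fun n j => (hZ.1 n j).sqrt) fun n j ω => ?_
  rw [abs_of_nonneg (sqrt_nonneg _)]
  refine (Real.sqrt_le_sqrt (le_abs_self _)).trans ?_
  rw [Real.sqrt_le_left (by positivity)]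
  nlinarith [abs_nonneg (Z n j ω)]

theorem card_mul_inv_le {K N : ℕ} {c : ℝ} (hc : (K : ℝ) ≤ c * N) : (K : ℝ) * (N : ℝ)⁻¹ ≤ |c| := by
  rcases Nat.eq_zero_or_pos N with rfl | hN
  · simp
  · rw [← div_eq_mul_inv, div_le_iff₀ (by positivity)]
    exact hc.trans (by gcongr; exact le_abs_self c)

theorem LpBdd.average {K : ℕ → Type*} [∀ n, Fintype (K n)] {N : ℕ → ℕ} {c : ℝ}
    (hc : ∀ n, (card (K n) : ℝ) ≤ c * N n)
    {Z : ∀ n, J n × K n → Ω n → ℝ} (hZ : LpBdd P Z) :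
    LpBdd P (fun n j ω => (N n : ℝ)⁻¹ * ∑ l, Z n (j, l) ω) := by
  refine ⟨fun n j => (Finset.measurable_fun_sum _ fun l _ => hZ.1 n _).const_mul _, fun p => ?_⟩
  rcases p with _ | p
  · exact ⟨1, fun n j => by simp⟩
  obtain ⟨C, hC⟩ := hZ.2 (p + 1)
  refine ⟨|c| ^ (p + 1) * |C|, fun n j => ?_⟩
  set a : ℝ := (N n : ℝ)⁻¹ with ha
  have ha0 : 0 ≤ a := by positivity
  set q : ℝ := (card (K n) : ℝ) with hq
  have hq0 : 0 ≤ q := by positivity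
  have hpt : ∀ ω, ofReal (|a * ∑ l, Z n (j, l) ω| ^ (p + 1)) ≤
      ofReal (a ^ (p + 1) * q ^ p) * ∑ l, ofReal (|Z n (j, l) ω| ^ (p + 1)) := by
    intro ω
    rw [← ofReal_sum_of_nonneg fun _ _ => by positivity,
      ← ofReal_mul (by positivity)]
    refine ofReal_le_ofReal ?_
    rw [abs_mul, mul_pow, abs_of_nonneg ha0, mul_assoc]
    gcongr
    calc |∑ l, Z n (j, l) ω| ^ (p + 1) ≤ (∑ l, |Z n (j, l) ω|) ^ (p + 1) := by
          gcongr; exact abs_sum_le_sum_abs _ _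
      _ ≤ _ := pow_sum_le_card_mul_sum_pow (s := univ) (fun _ _ => abs_nonneg _) p
  have hm : ∀ l, Measurable fun ω => ofReal (|Z n (j, l) ω| ^ (p + 1)) := fun l =>
    ((hZ.1 n (j, l)).abs.pow_const _).ennreal_ofReal
  calc _ ≤ _ := lintegral_mono hpt
    _ = ofReal (a ^ (p + 1) * q ^ p) *
        ∑ l, ∫⁻ ω, ofReal (|Z n (j, l) ω| ^ (p + 1)) ∂P n := by
        rw [lintegral_const_mul' _ _ ofReal_ne_top, lintegral_finsetSum _ fun l _ => hm l]
    _ ≤ ofReal (a ^ (p + 1) * q ^ p) * ∑ _l : K n, ofReal |C| := by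
        gcongr with l
        exact (hC n (j, l)).trans (ofReal_le_ofReal (le_abs_self _))
    _ = ofReal ((q * a) ^ (p + 1) * |C|) := by
        rw [← ofReal_sum_of_nonneg fun _ _ => by positivity,
          ← ofReal_mul (by positivity)]
        congr 1
        rw [sum_const, card_univ, nsmul_eq_mul, ← hq]
        ring
    _ ≤ _ := by
        refine ofReal_le_ofReal ?_
        have := card_mul_inv_le (hc n)
        gcongr

/-! #### Small families -/

theorem LpSmall.bdd (hZ : LpSmall P Z) : LpBdd P Z := hZ.1

theorem LpSmall.meas (hZ : LpSmall P Z) (n j) : Measurable (Z n j) := hZ.1.1 n j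

theorem LpSmall.mono (hW : LpSmall P W) (hm : ∀ n j, Measurable (Z n j))
    (h : ∀ n j ω, |Z n j ω| ≤ |W n j ω|) : LpSmall P Z := by
  refine ⟨hW.1.mono hm h, fun ε hε => (hW.2 ε hε).mono fun n hn j => ?_⟩
  exact (lintegral_mono fun ω => ofReal_le_ofReal (h n j ω)).trans (hn j)

theorem LpSmall.of_le (hW : LpSmall P W) (hm : ∀ n j, Measurable (Z n j))
    (h : ∀ n j ω, |Z n j ω| ≤ W n j ω) : LpSmall P Z :=
  hW.mono hm fun n j ω => (h n j ω).trans (le_abs_self _)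

theorem LpSmall.reindex (hZ : LpSmall P Z) {K : ℕ → Type*} (g : ∀ n, K n → J n) :
    LpSmall P (fun n k => Z n (g n k)) :=
  ⟨hZ.1.reindex g, fun ε hε => (hZ.2 ε hε).mono fun _ hn _ => hn _⟩

theorem LpSmall.abs (hZ : LpSmall P Z) : LpSmall P (fun n j ω => |Z n j ω|) :=
  hZ.mono (fun n j => (hZ.meas n j).abs) fun n j ω => by simp

theorem LpSmall.neg (hZ : LpSmall P Z) : LpSmall P (fun n j ω => -Z n j ω) :=
  hZ.mono (fun n j => (hZ.meas n j).neg) fun n j ω => by simp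

theorem LpSmall.zero : LpSmall P (fun n (_ : J n) _ => (0 : ℝ)) :=
  ⟨LpBdd.const 0, fun ε _ => Eventually.of_forall fun n j => by simp⟩

theorem LpSmall.add (hZ : LpSmall P Z) (hW : LpSmall P W) :
    LpSmall P (fun n j ω => Z n j ω + W n j ω) := by
  refine ⟨hZ.1.add hW.1, fun ε hε => ?_⟩
  filter_upwards [hZ.2 (ε / 2) (by positivity), hW.2 (ε / 2) (by positivity)] with n h1 h2 j
  calc _ ≤ ∫⁻ ω, (ofReal |Z n j ω| + ofReal |W n j ω|) ∂P n :=
        lintegral_mono fun ω => by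
          rw [← ofReal_add (abs_nonneg _) (abs_nonneg _)]
          exact ofReal_le_ofReal (abs_add_le _ _)
    _ = _ := lintegral_add_left (hZ.meas n j).abs.ennreal_ofReal _
    _ ≤ _ := add_le_add (h1 j) (h2 j)
    _ = _ := by rw [← ofReal_add (by positivity) (by positivity), add_halves]

theorem LpSmall.sub (hZ : LpSmall P Z) (hW : LpSmall P W) :
    LpSmall P (fun n j ω => Z n j ω - W n j ω) := by
  simpa [sub_eq_add_neg] using hZ.add hW.neg

theorem LpSmall.sum {κ : Type*} (s : Finset κ)
    {Z : κ → ∀ n, J n → Ω n → ℝ} (hZ : ∀ i ∈ s, LpSmall P (Z i)) :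
    LpSmall P (fun n j ω => ∑ i ∈ s, Z i n j ω) := by
  classical
  induction s using induction_on with
  | empty => simpa using LpSmall.zero (P := P) (J := J)
  | insert a s ha ih =>
    simp only [sum_insert ha]
    exact (hZ a (by simp)).add (ih fun i hi => hZ i (by simp [hi]))

/-- A family that is bounded in every `L^p`, and within every `δ > 0` of a multiple of a family
with small first moment up to a small multiple of a bounded one, is small. -/
theorem LpBdd.small_of_le {V : ∀ n, J n → Ω n → ℝ} (hZ : LpBdd P Z) (hW : LpBdd P W)
    (hVm : ∀ n j, Measurable (V n j))
    (hV : ∀ ε : ℝ, 0 < ε →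
      ∀ᶠ n in atTop, ∀ j, ∫⁻ ω, ofReal |V n j ω| ∂P n ≤ ofReal ε)
    (h : ∀ δ : ℝ, 0 < δ → ∃ K : ℝ, 0 < K ∧ ∀ n j ω, |Z n j ω| ≤ K * |V n j ω| + δ * |W n j ω|) :
    LpSmall P Z := by
  refine ⟨hZ, fun ε hε => ?_⟩
  obtain ⟨C, hC⟩ := hW.2 1
  obtain ⟨K, hK, hle⟩ := h (ε / (2 * (|C| + 1))) (by positivity)
  filter_upwards [hV (ε / (2 * K)) (by positivity)] with n hn j
  have m1 : Measurable fun ω => ofReal |V n j ω| := (hVm n j).abs.ennreal_ofReal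
  calc _ ≤ ∫⁻ ω, (ofReal K * ofReal |V n j ω|
          + ofReal (ε / (2 * (|C| + 1))) * ofReal |W n j ω|) ∂P n :=
        lintegral_mono fun ω => by
          rw [← ofReal_mul (by positivity), ← ofReal_mul (by positivity),
            ← ofReal_add (by positivity) (by positivity)]
          exact ofReal_le_ofReal (hle n j ω)
    _ = ofReal K * ∫⁻ ω, ofReal |V n j ω| ∂P n
        + ofReal (ε / (2 * (|C| + 1))) * ∫⁻ ω, ofReal |W n j ω| ∂P n := by
        rw [lintegral_add_left (m1.const_mul _), lintegral_const_mul' _ _ ofReal_ne_top,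
          lintegral_const_mul' _ _ ofReal_ne_top]
    _ ≤ ofReal K * ofReal (ε / (2 * K))
        + ofReal (ε / (2 * (|C| + 1))) * ofReal (|C| + 1) := by
        gcongr
        · exact hn j
        · have := hC n j
          simp only [pow_one] at this
          exact this.trans (ofReal_le_ofReal (by linarith [le_abs_self C]))
    _ = ofReal ε := by
        rw [← ofReal_mul (by positivity), ← ofReal_mul (by positivity),
            ← ofReal_add (by positivity) (by positivity)]
        congr 1
        field_simp
        norm_num

theorem LpSmall.mul_bdd (hZ : LpSmall P Z) (hW : LpBdd P W) :
    LpSmall P (fun n j ω => Z n j ω * W n j ω) := by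
  refine (hZ.1.mul hW).small_of_le (hZ.1.mul (hW.pow 2)) hZ.meas hZ.2 fun δ hδ => ?_
  refine ⟨δ⁻¹, by positivity, fun n j ω => ?_⟩
  simp only [abs_mul, abs_pow]
  have hz := abs_nonneg (Z n j ω)
  have hw := abs_nonneg (W n j ω)
  have h1 : |W n j ω| ≤ δ⁻¹ + δ * |W n j ω| ^ 2 := by
    have h2 : δ * δ⁻¹ = 1 := mul_inv_cancel₀ hδ.ne'
    have h3 : 0 < δ⁻¹ := by positivity
    nlinarith [mul_nonneg h3.le (sq_nonneg (δ * |W n j ω| - 1)), mul_nonneg hδ.le (sq_nonneg (|W n j ω|))]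
  nlinarith [mul_le_mul_of_nonneg_left h1 hz]

theorem LpBdd.mul_small (hW : LpBdd P W) (hZ : LpSmall P Z) :
    LpSmall P (fun n j ω => W n j ω * Z n j ω) := by
  simpa only [mul_comm] using hZ.mul_bdd hW

theorem LpSmall.const_mul (c : ℝ) (hZ : LpSmall P Z) :
    LpSmall P (fun n j ω => c * Z n j ω) :=
  (LpBdd.const c).mul_small hZ

theorem LpSmall.of_tendsto {a : ℕ → ℝ} (ha : Tendsto a atTop (𝓝 0)) :
    LpSmall P (fun n (_ : J n) _ => a n) := by
  refine ⟨⟨fun _ _ => measurable_const, fun p => ?_⟩, fun ε hε => ?_⟩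
  · obtain ⟨C, hC⟩ := (ha.abs.pow p).bddAbove_range
    exact ⟨C, fun n j => by simpa using ofReal_le_ofReal (hC ⟨n, rfl⟩)⟩
  · have := ha.abs
    rw [abs_zero] at this
    filter_upwards [this.eventually_le_const hε] with n hn j
    simpa using ofReal_le_ofReal hn

/-- Smallness from the first moment of an even power. -/
theorem LpBdd.small_of_pow (hZ : LpBdd P Z) {k : ℕ}
    (h : ∀ ε : ℝ, 0 < ε →
      ∀ᶠ n in atTop, ∀ j, ∫⁻ ω, ofReal (|Z n j ω| ^ (k + 1)) ∂P n ≤ ofReal ε) :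
    LpSmall P Z := by
  refine hZ.small_of_le (V := fun n j ω => |Z n j ω| ^ (k + 1)) (LpBdd.const 1)
    (fun n j => (hZ.1 n j).abs.pow_const _) (by simpa using h) fun δ hδ => ?_
  refine ⟨(δ ^ k)⁻¹, by positivity, fun n j ω => ?_⟩
  rw [abs_pow, abs_abs, abs_one, mul_one]
  rcases le_total (|Z n j ω|) δ with hle | hle
  · have : 0 ≤ (δ ^ k)⁻¹ * |Z n j ω| ^ (k + 1) := by positivity
    linarith
  · have : |Z n j ω| ≤ (δ ^ k)⁻¹ * |Z n j ω| ^ (k + 1) := by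
      rw [inv_mul_eq_div, le_div_iff₀ (by positivity), pow_succ, mul_comm]
      gcongr
    linarith

theorem LpSmall.of_pow {k : ℕ} (hm : ∀ n j, Measurable (Z n j))
    (h : LpSmall P (fun n j ω => |Z n j ω| ^ (k + 1))) : LpSmall P Z := by
  have hb : LpBdd P Z := by
    refine ((LpBdd.const 1).add h.1).of_le hm fun n j ω => ?_
    rcases le_total (|Z n j ω|) 1 with hle | hle
    · have : 0 ≤ |Z n j ω| ^ (k + 1) := by positivity
      linarith
    · have := le_self_pow₀ hle (Nat.succ_ne_zero k)
      simp only [Nat.succ_eq_add_one] at this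
      linarith
  exact hb.small_of_pow (k := k) (by simpa using h.2)

theorem LpSmall.average {K : ℕ → Type*} [∀ n, Fintype (K n)] {N : ℕ → ℕ} {c : ℝ}
    (hc : ∀ n, (card (K n) : ℝ) ≤ c * N n)
    {Z : ∀ n, J n × K n → Ω n → ℝ} (hZ : LpSmall P Z) :
    LpSmall P (fun n j ω => (N n : ℝ)⁻¹ * ∑ l, Z n (j, l) ω) := by
  refine ⟨hZ.1.average hc, fun ε hε => ?_⟩
  filter_upwards [hZ.2 (ε / (|c| + 1)) (by positivity)] with n hn j
  set a : ℝ := (N n : ℝ)⁻¹ with ha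
  have ha0 : 0 ≤ a := by positivity
  calc _ ≤ ∫⁻ ω, ofReal a * ∑ l, ofReal |Z n (j, l) ω| ∂P n :=
        lintegral_mono fun ω => by
          rw [← ofReal_sum_of_nonneg fun _ _ => by positivity,
            ← ofReal_mul (by positivity)]
          refine ofReal_le_ofReal ?_
          rw [abs_mul, abs_of_nonneg ha0]
          gcongr
          exact abs_sum_le_sum_abs _ _
    _ = ofReal a * ∑ l, ∫⁻ ω, ofReal |Z n (j, l) ω| ∂P n := by
        rw [lintegral_const_mul' _ _ ofReal_ne_top,
          lintegral_finsetSum _ fun l _ => (hZ.meas n (j, l)).abs.ennreal_ofReal]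
    _ ≤ ofReal a * ∑ _l : K n, ofReal (ε / (|c| + 1)) := by
        gcongr with l
        exact hn (j, l)
    _ = ofReal ((card (K n) * a) * (ε / (|c| + 1))) := by
        rw [← ofReal_sum_of_nonneg fun _ _ => by positivity,
          ← ofReal_mul (by positivity)]
        congr 1
        rw [sum_const, card_univ, nsmul_eq_mul]
        ring
    _ ≤ ofReal ((|c| + 1) * (ε / (|c| + 1))) := by
        refine ofReal_le_ofReal ?_
        have := card_mul_inv_le (hc n)
        gcongr
        linarith
    _ = _ := by congr 1; field_simp

/-! #### Expectations -/

theorem LpBdd.integrable (hZ : LpBdd P Z) (n j) : Integrable (Z n j) (P n) := by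
  obtain ⟨C, hC⟩ := hZ.2 1
  refine ⟨(hZ.1 n j).aestronglyMeasurable, ?_⟩
  rw [hasFiniteIntegral_iff_norm]
  refine lt_of_le_of_lt ?_ (ofReal_lt_top (r := C))
  simpa using hC n j

theorem LpBdd.memLp_two (hZ : LpBdd P Z) (n j) : MemLp (Z n j) 2 (P n) := by
  rw [memLp_two_iff_integrable_sq (hZ.1 n j).aestronglyMeasurable]
  exact (hZ.pow 2).integrable n j

theorem LpBdd.exists_integral_abs_le (hZ : LpBdd P Z) :
    ∃ C : ℝ, 0 ≤ C ∧ ∀ n j, ∫ ω, |Z n j ω| ∂P n ≤ C := by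
  obtain ⟨C, hC⟩ := hZ.2 1
  refine ⟨|C|, abs_nonneg _, fun n j => ?_⟩
  rw [integral_eq_lintegral_of_nonneg_ae (.of_forall fun _ => abs_nonneg _)
    (hZ.1 n j).abs.aestronglyMeasurable]
  refine toReal_le_of_le_ofReal (abs_nonneg _) ?_
  have := hC n j
  simp only [pow_one] at this
  exact this.trans (ofReal_le_ofReal (le_abs_self C))

theorem LpSmall.integral_abs_le (hZ : LpSmall P Z) {ε : ℝ} (hε : 0 < ε) :
    ∀ᶠ n in atTop, ∀ j, ∫ ω, |Z n j ω| ∂P n ≤ ε := by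
  filter_upwards [hZ.2 ε hε] with n hn j
  rw [integral_eq_lintegral_of_nonneg_ae (.of_forall fun _ => abs_nonneg _)
    (hZ.meas n j).abs.aestronglyMeasurable]
  exact toReal_le_of_le_ofReal hε.le (hn j)

theorem LpSmall.integral_le (hZ : LpSmall P Z) {ε : ℝ} (hε : 0 < ε) :
    ∀ᶠ n in atTop, ∀ j, |∫ ω, Z n j ω ∂P n| ≤ ε := by
  filter_upwards [hZ.integral_abs_le hε] with n hn j
  exact (abs_integral_le_integral_abs).trans (hn j)

end LpCalculus

/-! ### Euclidean norms of vectors and matrices -/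

section Norms

variable {ι : Type*} [Fintype ι]

/-- The Euclidean norm of a vector. -/
def nrm (v : ι → ℝ) : ℝ := ‖(toLp 2 v : EuclideanSpace ℝ ι)‖

theorem nrm_nonneg (v : ι → ℝ) : 0 ≤ nrm v := norm_nonneg _

theorem nrm_sq (v : ι → ℝ) : nrm v ^ 2 = ∑ i, v i ^ 2 := by
  simp [nrm, EuclideanSpace.norm_sq_eq]

theorem nrm_eq_sqrt (v : ι → ℝ) : nrm v = √(∑ i, v i ^ 2) := by
  rw [← nrm_sq, Real.sqrt_sq (nrm_nonneg v)]

theorem nrm_zero : nrm (0 : ι → ℝ) = 0 := by simp [nrm]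

theorem nrm_add_le (u v : ι → ℝ) : nrm (u + v) ≤ nrm u + nrm v := by
  simpa [nrm] using norm_add_le (toLp 2 u : EuclideanSpace ℝ ι) (toLp 2 v)

theorem nrm_smul (c : ℝ) (v : ι → ℝ) : nrm (c • v) = |c| * nrm v := by
  simp [nrm, norm_smul]

theorem nrm_sum_le {κ : Type*} (s : Finset κ) (v : κ → ι → ℝ) :
    nrm (∑ i ∈ s, v i) ≤ ∑ i ∈ s, nrm (v i) := by
  classical
  induction s using induction_on with
  | empty => simp [nrm_zero]
  | insert a s ha ih =>
    rw [sum_insert ha, sum_insert ha]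
    exact (nrm_add_le _ _).trans (by gcongr)

theorem nrm_mono {u v : ι → ℝ} (h : ∀ i, |u i| ≤ |v i|) : nrm u ≤ nrm v := by
  rw [nrm_eq_sqrt, nrm_eq_sqrt]
  exact Real.sqrt_le_sqrt (sum_le_sum fun i _ => sq_le_sq.2 (h i))

theorem nrm_le_of_abs_le {u v : ι → ℝ} (h : ∀ i, |u i| ≤ v i) : nrm u ≤ nrm v :=
  nrm_mono fun i => (h i).trans (le_abs_self _)

theorem abs_le_nrm (v : ι → ℝ) (i : ι) : |v i| ≤ nrm v := by
  rw [nrm_eq_sqrt]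
  refine Real.abs_le_sqrt ?_
  exact single_le_sum (f := fun i => v i ^ 2) (fun _ _ => sq_nonneg _) (mem_univ i)

theorem abs_dotProduct_le (u v : ι → ℝ) : |u ⬝ᵥ v| ≤ nrm u * nrm v := by
  rw [← sq_le_sq₀ (abs_nonneg _) (mul_nonneg (nrm_nonneg _) (nrm_nonneg _)), sq_abs, mul_pow,
    nrm_sq, nrm_sq]
  exact Finset.sum_mul_sq_le_sq_mul_sq _ _ _

theorem nrm_abs (v : ι → ℝ) : nrm (fun i => |v i|) = nrm v := by
  simp [nrm_eq_sqrt]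

/-- The Euclidean norm of the vector of squares, i.e. the square of the `ℓ⁴` norm. -/
def nsq (v : ι → ℝ) : ℝ := nrm fun i => v i ^ 2

theorem nsq_nonneg (v : ι → ℝ) : 0 ≤ nsq v := nrm_nonneg _

theorem nsq_sq (v : ι → ℝ) : nsq v ^ 2 = ∑ i, v i ^ 4 := by
  simp [nsq, nrm_sq, ← pow_mul]

theorem nsq_le (v : ι → ℝ) : nsq v ≤ nrm v ^ 2 := by
  rw [← sq_le_sq₀ (nsq_nonneg _) (by positivity), nsq, nrm_sq, nrm_sq]
  rw [sq (∑ i, v i ^ 2), sum_mul]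
  refine sum_le_sum fun i _ => ?_
  rw [sq (v i ^ 2)]
  gcongr
  exact single_le_sum (f := fun i => v i ^ 2) (fun _ _ => sq_nonneg _) (mem_univ i)

theorem nsq_add_le (u v : ι → ℝ) : nsq (u + v) ≤ 2 * nsq u + 2 * nsq v := by
  have : nsq (u + v) ≤ nrm ((2 : ℝ) • (fun i => u i ^ 2) + (2 : ℝ) • fun i => v i ^ 2) := by
    refine nrm_le_of_abs_le fun i => ?_
    simp only [Pi.add_apply, Pi.smul_apply, smul_eq_mul]
    rw [abs_of_nonneg (sq_nonneg _)]
    nlinarith [sq_nonneg (u i - v i)]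
  refine this.trans ((nrm_add_le _ _).trans ?_)
  rw [nrm_smul, nrm_smul, abs_of_pos two_pos]
  rfl

theorem nsq_smul (c : ℝ) (v : ι → ℝ) : nsq (c • v) = c ^ 2 * nsq v := by
  have : (fun i => (c • v) i ^ 2) = (c ^ 2) • fun i => v i ^ 2 := by
    ext i; simp [mul_pow]
  rw [nsq, this, nrm_smul, abs_of_nonneg (sq_nonneg c), nsq]

theorem nsq_sum_le {κ : Type*} (s : Finset κ) (v : κ → ι → ℝ) :
    nsq (∑ i ∈ s, v i) ≤ ∑ i ∈ s, s.card * nsq (v i) := by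
  calc nsq (∑ i ∈ s, v i) ≤ nrm (∑ i ∈ s, (s.card : ℝ) • fun j => v i j ^ 2) := by
        refine nrm_le_of_abs_le fun j => ?_
        simp only [Finset.sum_apply, Pi.smul_apply, smul_eq_mul]
        rw [abs_of_nonneg (sq_nonneg _), ← mul_sum]
        exact sq_sum_le_card_mul_sum_sq
    _ ≤ ∑ i ∈ s, nrm ((s.card : ℝ) • fun j => v i j ^ 2) := nrm_sum_le _ _
    _ = _ := sum_congr rfl fun i _ => by
        rw [nrm_smul, abs_of_nonneg (Nat.cast_nonneg _)]; rfl

theorem nrm_mul_sq_le (u v : ι → ℝ) : nrm (u * v) ^ 2 ≤ nsq u * nrm v ^ 2 := by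
  calc nrm (u * v) ^ 2 = (fun i => u i ^ 2) ⬝ᵥ fun i => v i ^ 2 := by
        simp [nrm_sq, dotProduct, mul_pow]
    _ ≤ nsq u * nsq v := (le_abs_self _).trans (abs_dotProduct_le _ _)
    _ ≤ _ := by gcongr; exacts [nsq_nonneg u, nsq_le v]

theorem nrm_mul_le (u v : ι → ℝ) : nrm (u * v) ≤ √(nsq u) * nrm v := by
  rw [← Real.sqrt_sq (nrm_nonneg v), ← Real.sqrt_mul (nsq_nonneg u)]
  exact Real.le_sqrt_of_sq_le (nrm_mul_sq_le u v)

open scoped Matrix.Norms.L2Operator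

variable [DecidableEq ι]

theorem nrm_mulVec_le (A : Matrix ι ι ℝ) (v : ι → ℝ) : nrm (A *ᵥ v) ≤ ‖A‖ * nrm v :=
  Matrix.l2_opNorm_mulVec A (toLp 2 v)

theorem norm_le_of_nrm_mulVec_le {A : Matrix ι ι ℝ} {c : ℝ} (hc : 0 ≤ c)
    (h : ∀ v, nrm (A *ᵥ v) ≤ c * nrm v) : ‖A‖ ≤ c := by
  rw [Matrix.l2_opNorm_def]
  exact ContinuousLinearMap.opNorm_le_bound _ hc fun v => h v.ofLp

theorem norm_transpose_l2 (A : Matrix ι ι ℝ) : ‖Aᵀ‖ = ‖A‖ := by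
  simpa using Matrix.l2_opNorm_conjTranspose A

theorem nrm_row_le (A : Matrix ι ι ℝ) (i : ι) : nrm (A i) ≤ ‖A‖ := by
  have h := nrm_mulVec_le Aᵀ (single i 1)
  rw [norm_transpose_l2, Matrix.mulVec_single_one] at h
  simpa [nrm, Matrix.col] using h

theorem nrm_col_le (A : Matrix ι ι ℝ) (j : ι) : nrm (fun i => A i j) ≤ ‖A‖ := by
  rw [← norm_transpose_l2]; exact nrm_row_le Aᵀ j

theorem abs_entry_le (A : Matrix ι ι ℝ) (i j : ι) : |A i j| ≤ ‖A‖ :=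
  (abs_le_nrm (A i) j).trans (nrm_row_le A i)

theorem norm_diagonal_le {v : ι → ℝ} {c : ℝ} (hc : 0 ≤ c) (h : ∀ i, |v i| ≤ c) :
    ‖(diagonal v : Matrix ι ι ℝ)‖ ≤ c := by
  rw [Matrix.l2_opNorm_diagonal]
  exact (pi_norm_le_iff_of_nonneg hc).2 h

/-- The Frobenius norm of a matrix. -/
def frob (A : Matrix ι ι ℝ) : ℝ := nrm fun q : ι × ι => A q.1 q.2

theorem frob_nonneg (A : Matrix ι ι ℝ) : 0 ≤ frob A := nrm_nonneg _

theorem frob_sq (A : Matrix ι ι ℝ) : frob A ^ 2 = ∑ i, nrm (A i) ^ 2 := by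
  simp [frob, nrm_sq, sum_prod_type]

theorem frob_add_le (A B : Matrix ι ι ℝ) : frob (A + B) ≤ frob A + frob B :=
  nrm_add_le (fun q : ι × ι => A q.1 q.2) fun q => B q.1 q.2

theorem frob_sum_le {κ : Type*} (s : Finset κ) (A : κ → Matrix ι ι ℝ) :
    frob (∑ i ∈ s, A i) ≤ ∑ i ∈ s, frob (A i) := by
  refine le_of_eq_of_le ?_ (nrm_sum_le s fun i (q : ι × ι) => A i q.1 q.2)
  unfold frob
  congr 1
  ext q
  simp [Matrix.sum_apply]

theorem frob_transpose (A : Matrix ι ι ℝ) : frob Aᵀ = frob A := by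
  rw [← sq_eq_sq₀ (frob_nonneg _) (frob_nonneg _)]
  simp only [frob_sq, nrm_sq, Matrix.transpose_apply]
  exact sum_comm

theorem frob_mul_le_frob_mul_norm (A B : Matrix ι ι ℝ) : frob (A * B) ≤ frob A * ‖B‖ := by
  rw [← sq_le_sq₀ (frob_nonneg _) (mul_nonneg (frob_nonneg _) (norm_nonneg _)), mul_pow, frob_sq,
    frob_sq, sum_mul]
  refine sum_le_sum fun i _ => ?_
  rw [← mul_pow]
  refine pow_le_pow_left₀ (nrm_nonneg _) ?_ 2
  have : (A * B) i = Bᵀ *ᵥ A i := by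
    ext j; simp [Matrix.mul_apply, mulVec, dotProduct, mul_comm]
  rw [this, mul_comm, ← norm_transpose_l2 B]
  exact nrm_mulVec_le _ _

theorem frob_mul_le_norm_mul_frob (A B : Matrix ι ι ℝ) : frob (A * B) ≤ ‖A‖ * frob B := by
  rw [← frob_transpose, Matrix.transpose_mul, ← frob_transpose B, ← norm_transpose_l2 A, mul_comm]
  exact frob_mul_le_frob_mul_norm _ _

theorem frob_diagonal (v : ι → ℝ) : frob (diagonal v) = nrm v := by
  rw [← sq_eq_sq₀ (frob_nonneg _) (nrm_nonneg _)]
  simp [frob_sq, nrm_sq, Matrix.diagonal_apply, ite_pow]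

theorem frob_sq_le_card (A : Matrix ι ι ℝ) : frob A ^ 2 ≤ card ι * ‖A‖ ^ 2 := by
  rw [frob_sq]
  calc _ ≤ ∑ _i : ι, ‖A‖ ^ 2 := sum_le_sum fun i _ =>
        pow_le_pow_left₀ (nrm_nonneg _) (nrm_row_le A i) 2
    _ = _ := by simp

theorem nrm_diag_le_frob (A : Matrix ι ι ℝ) : nrm (fun i => A i i) ≤ frob A := by
  rw [← sq_le_sq₀ (nrm_nonneg _) (frob_nonneg _), nrm_sq, frob_sq]
  refine sum_le_sum fun i _ => ?_
  rw [← sq_abs]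
  exact pow_le_pow_left₀ (abs_nonneg _) (abs_le_nrm (A i) i) 2

end Norms

/-! ### Symmetric first-order systems, their responses, and the removal of a site -/

/-- Regularity of nonlinearities `f t l`, depending on the coordinates `s < t`, with first
derivatives `p t s l`. -/
structure Reg {ι : Type*} (f : Act(ι)) (p : Grad(ι))
    (L : ℕ → ℝ) : Prop where
  L_nonneg : ∀ t, 0 ≤ L t
  lip : ∀ t l x x', |f t l x' - f t l x| ≤ L t * ∑ s ∈ range t, |x' s - x s|
  taylor : ∀ t l x x', |f t l x' - f t l x - ∑ s ∈ range t, p t s l x * (x' s - x s)| ≤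
    L t * ∑ s ∈ range t, (x' s - x s) ^ 2
  bdd : ∀ t s l x, |p t s l x| ≤ L t
  plip : ∀ t s l x x', |p t s l x' - p t s l x| ≤ L t * ∑ r ∈ range t, |x' r - x r|

section Regularity

variable {ι : Type*} {f : Act(ι)} {p : Grad(ι)} {L : ℕ → ℝ}

theorem Reg.congr (h : Reg f p L) {t : ℕ} {l : ι} {x x' : ℕ → ℝ} (hx : ∀ s < t, x' s = x s) :
    f t l x' = f t l x := by
  have := h.lip t l x x'
  rw [sum_eq_zero fun s hs => by rw [hx s (mem_range.1 hs), sub_self, abs_zero],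
    mul_zero] at this
  exact sub_eq_zero.1 (abs_nonpos_iff.1 this)

theorem Reg.congr_p (h : Reg f p L) {t s : ℕ} {l : ι} {x x' : ℕ → ℝ} (hx : ∀ s < t, x' s = x s) :
    p t s l x' = p t s l x := by
  have := h.plip t s l x x'
  rw [sum_eq_zero fun s hs => by rw [hx s (mem_range.1 hs), sub_self, abs_zero],
    mul_zero] at this
  exact sub_eq_zero.1 (abs_nonpos_iff.1 this)

theorem Reg.comap {κ : Type*} (h : Reg f p L) (g : κ → ι) :
    Reg (fun t l => f t (g l)) (fun t s l => p t s (g l)) L :=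
  ⟨h.1, fun t _ => h.2 t _, fun t _ => h.3 t _, fun t s _ => h.4 t s _, fun t s _ => h.5 t s _⟩

end Regularity

section System

open scoped Matrix.Norms.L2Operator

variable {ι : Type*} [Fintype ι] [DecidableEq ι]
  {f : Act(ι)} {p : Grad(ι)} {L : ℕ → ℝ}

/-- The orbit `y^t = f_t(M y^0, …, M y^{t-1})`, coordinatewise. -/
def sysY (f : Act(ι)) (M : Matrix ι ι ℝ) (t : ℕ) : ι → ℝ := fun l =>
  f t l fun s => if _h : s < t then (M *ᵥ sysY f M s) l else 0
  termination_by t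

/-- The fields `x^t = M y^t`. -/
def sysX (f : Act(ι)) (M : Matrix ι ι ℝ) (t : ℕ) : ι → ℝ :=
  M *ᵥ sysY f M t

theorem sysY_eq (h : Reg f p L) (M : Matrix ι ι ℝ) (t : ℕ) (l : ι) :
    sysY f M t l = f t l fun s => sysX f M s l := by
  rw [sysY]
  exact h.congr fun s hs => by rw [dif_pos hs]; rfl

/-- The derivatives of the nonlinearities along an orbit. -/
def sysP (f : Act(ι)) (p : Grad(ι))
    (M : Matrix ι ι ℝ) (t s : ℕ) (l : ι) : ℝ :=
  p t s l fun s => sysX f M s l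

/-- The response of `y^t` to a perturbation of the field `x^s`, where `P t r` is the vector of
derivatives of `y^t` with respect to `x^r`. -/
def resp (P : ℕ → ℕ → ι → ℝ) (M : Matrix ι ι ℝ) (s t : ℕ) : Matrix ι ι ℝ :=
  if s < t then diagonal (P t s) +
    ∑ r : Fin t, diagonal (P t r) * (M * resp P M s r) else 0
  termination_by t

theorem resp_of_lt (P : ℕ → ℕ → ι → ℝ) (M : Matrix ι ι ℝ) {s t : ℕ} (h : s < t) :
    resp P M s t = diagonal (P t s) +
      ∑ r ∈ range t, diagonal (P t r) * (M * resp P M s r) := by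
  rw [resp, if_pos h, sum_range]

theorem resp_of_le (P : ℕ → ℕ → ι → ℝ) (M : Matrix ι ι ℝ) {s t : ℕ} (h : t ≤ s) :
    resp P M s t = 0 := by
  rw [resp, if_neg h.not_gt]

/-- The system responses. -/
def sysR (f : Act(ι)) (p : Grad(ι))
    (M : Matrix ι ι ℝ) (s t : ℕ) : Matrix ι ι ℝ := resp (sysP f p M) M s t

theorem sysR_def (f : Act(ι)) (p : Grad(ι)) (M : Matrix ι ι ℝ) :
    sysR f p M = resp (sysP f p M) M := rfl

/-- A bound on the norm of the responses in terms of a bound on the norm of the matrix. -/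
def respBound (L : ℕ → ℝ) (B : ℝ) (t : ℕ) : ℝ :=
  L t + ∑ r : Fin t, L t * (B * respBound L B r)
  termination_by t

theorem respBound_eq (L : ℕ → ℝ) (B : ℝ) (t : ℕ) :
    respBound L B t = L t + ∑ r ∈ range t, L t * (B * respBound L B r) := by
  rw [respBound, sum_range]

theorem respBound_nonneg (hL : ∀ t, 0 ≤ L t) {B : ℝ} (hB : 0 ≤ B) (t : ℕ) :
    0 ≤ respBound L B t := by
  induction t using strongRecOn with
  | _ t ih =>
    rw [respBound_eq]
    exact add_nonneg (hL t) (sum_nonneg fun r hr =>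
      mul_nonneg (hL t) (mul_nonneg hB (ih r (mem_range.1 hr))))

theorem norm_resp_le {P : ℕ → ℕ → ι → ℝ} {M : Matrix ι ι ℝ} (hL : ∀ t, 0 ≤ L t)
    (hP : ∀ t s l, |P t s l| ≤ L t) {B : ℝ} (hB : ‖M‖ ≤ B) (s t : ℕ) :
    ‖resp P M s t‖ ≤ respBound L B t := by
  have hB0 : 0 ≤ B := (norm_nonneg _).trans hB
  induction t using strongRecOn with
  | _ t ih =>
    rcases lt_or_ge s t with h | h
    · rw [resp_of_lt _ _ h, respBound_eq]
      refine (norm_add_le _ _).trans (add_le_add (norm_diagonal_le (hL t) (hP t s)) ?_)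
      refine (norm_sum_le _ _).trans (sum_le_sum fun r hr => ?_)
      refine (l2_opNorm_mul _ _).trans ?_
      refine mul_le_mul (norm_diagonal_le (hL t) (hP t r)) ?_ (norm_nonneg _) (hL t)
      exact (l2_opNorm_mul _ _).trans
        (mul_le_mul hB (ih r (mem_range.1 hr)) (norm_nonneg _) hB0)
    · rw [resp_of_le _ _ h, norm_zero]
      exact respBound_nonneg hL hB0 t

theorem norm_sysR_le (h : Reg f p L) {M : Matrix ι ι ℝ} {B : ℝ} (hB : ‖M‖ ≤ B) (s t : ℕ) :
    ‖sysR f p M s t‖ ≤ respBound L B t :=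
  norm_resp_le h.L_nonneg (fun t s l => h.bdd t s l _) hB s t

theorem nrm_sysX_le (f : Act(ι)) (M : Matrix ι ι ℝ) (t : ℕ) :
    nrm (sysX f M t) ≤ ‖M‖ * nrm (sysY f M t) := nrm_mulVec_le _ _

theorem nrm_le_sum_of_abs_le {v : ι → ℝ} {c : ℝ} (hc : 0 ≤ c) {t : ℕ} {x : ℕ → ι → ℝ}
    (h : ∀ l, |v l| ≤ c * ∑ s ∈ range t, |x s l|) :
    nrm v ≤ c * ∑ s ∈ range t, nrm (x s) := by
  calc nrm v ≤ nrm (c • ∑ s ∈ range t, fun l => |x s l|) :=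
        nrm_le_of_abs_le fun l => by simpa [Finset.sum_apply] using h l
    _ ≤ _ := by
        rw [nrm_smul, abs_of_nonneg hc]
        gcongr
        refine (nrm_sum_le _ _).trans (sum_le_sum fun s _ => (nrm_abs _).le)

theorem nrm_sysY_le (h : Reg f p L) (M : Matrix ι ι ℝ) (t : ℕ) :
    nrm (sysY f M t) ≤ nrm (fun l => f t l 0) + L t * ∑ s ∈ range t, nrm (sysX f M s) := by
  have hd : nrm (sysY f M t - fun l => f t l 0) ≤
      L t * ∑ s ∈ range t, nrm (sysX f M s) := by
    refine nrm_le_sum_of_abs_le (h.L_nonneg t) fun l => ?_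
    rw [Pi.sub_apply, sysY_eq h]
    simpa using h.lip t l 0 fun s => sysX f M s l
  calc nrm (sysY f M t) = nrm ((fun l => f t l 0) + (sysY f M t - fun l => f t l 0)) := by
        rw [add_sub_cancel]
    _ ≤ _ := (nrm_add_le _ _).trans (by gcongr)

/-! #### Removing a site -/

/-- The matrix with the rows and columns of `S` set to `0`. -/
def mask (S : Finset ι) (M : Matrix ι ι ℝ) : Matrix ι ι ℝ :=
  of fun i j => if i ∈ S ∨ j ∈ S then 0 else M i j

theorem mask_apply (S : Finset ι) (M : Matrix ι ι ℝ) (i j : ι) :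
    mask S M i j = if i ∈ S ∨ j ∈ S then 0 else M i j := rfl

theorem mask_mask (S S' : Finset ι) (M : Matrix ι ι ℝ) : mask S (mask S' M) = mask (S ∪ S') M := by
  ext i j
  simp only [mask_apply, Finset.mem_union]
  split_ifs <;> tauto

theorem mask_symm {M : Matrix ι ι ℝ} (hM : ∀ i j, M i j = M j i) (S : Finset ι) (i j : ι) :
    mask S M i j = mask S M j i := by
  simp only [mask_apply, or_comm, hM i j]

/-- The vector with the coordinate `k` set to `0`. -/
def off (k : ι) (v : ι → ℝ) : ι → ℝ := fun l => if l = k then 0 else v l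

theorem nrm_off_le (k : ι) (v : ι → ℝ) : nrm (off k v) ≤ nrm v :=
  nrm_mono fun l => by unfold off; split_ifs <;> simp

theorem mask_mulVec (S : Finset ι) (M : Matrix ι ι ℝ) (v : ι → ℝ) :
    mask S M *ᵥ v = fun i => if i ∈ S then 0 else (M *ᵥ fun j => if j ∈ S then 0 else v j) i := by
  ext i
  simp only [mulVec, dotProduct, mask_apply]
  split_ifs with h
  · simp [h]
  · refine sum_congr rfl fun j _ => ?_
    split_ifs <;> simp_all

theorem norm_mask_le (S : Finset ι) (M : Matrix ι ι ℝ) : ‖mask S M‖ ≤ ‖M‖ := by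
  refine norm_le_of_nrm_mulVec_le (norm_nonneg _) fun v => ?_
  rw [mask_mulVec]
  calc _ ≤ nrm (M *ᵥ fun j => if j ∈ S then 0 else v j) :=
        nrm_mono fun i => by split_ifs <;> simp
    _ ≤ ‖M‖ * nrm (fun j => if j ∈ S then 0 else v j) := nrm_mulVec_le _ _
    _ ≤ _ := by
        gcongr
        exact nrm_mono fun i => by split_ifs <;> simp

variable {M : Matrix ι ι ℝ} {k : ι}

theorem mulVec_eq_mask (hM : ∀ i j, M i j = M j i) (v : ι → ℝ) {l : ι} (hl : l ≠ k) :
    (M *ᵥ v) l = (mask {k} M *ᵥ v) l + v k * M k l := by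
  simp only [mulVec, dotProduct, mask_apply, mem_singleton, hl, false_or]
  rw [← Finset.add_sum_erase _ _ (mem_univ k), ← Finset.add_sum_erase (a := k) _
    (fun i => (if i = k then 0 else M l i) * v i) (mem_univ k), if_pos rfl, zero_mul,
    zero_add, add_comm, hM l k, mul_comm (v k)]
  congr 1
  exact sum_congr rfl fun i hi => by rw [if_neg (Finset.ne_of_mem_erase hi)]

theorem mask_mulVec_off (v : ι → ℝ) : mask {k} M *ᵥ off k v = mask {k} M *ᵥ v := by
  rw [mask_mulVec, mask_mulVec]
  ext i
  simp only [off, mem_singleton]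
  congr 2
  ext j
  split_ifs <;> rfl

theorem mask_mulVec_self (v : ι → ℝ) : (mask {k} M *ᵥ v) k = 0 := by
  rw [mask_mulVec]; simp

theorem row_dotProduct_off (hk : M k k = 0) (v : ι → ℝ) : M k ⬝ᵥ off k v = M k ⬝ᵥ v := by
  refine sum_congr rfl fun i _ => ?_
  unfold off
  split_ifs with h
  · subst h; simp [hk]
  · rfl

/-- The effect on `y` of the presence of the site `k`, at the other sites. -/
def dY (f : Act(ι)) (M : Matrix ι ι ℝ) (k : ι) (t : ℕ) : ι → ℝ :=
  off k (sysY f M t - sysY f (mask {k} M) t)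

/-- The effect on `x` of the presence of the site `k`, at the other sites. -/
def dX (f : Act(ι)) (M : Matrix ι ι ℝ) (k : ι) (t : ℕ) : ι → ℝ :=
  off k (sysX f M t - sysX f (mask {k} M) t)

theorem dX_eq (hM : ∀ i j, M i j = M j i) (hk : M k k = 0) (t : ℕ) :
    dX f M k t = mask {k} M *ᵥ dY f M k t + sysY f M t k • M k := by
  ext l
  simp only [dX, dY, Pi.add_apply, Pi.smul_apply, smul_eq_mul, mask_mulVec_off]
  by_cases hl : l = k
  · subst hl
    simp [off, hk, mask_mulVec_self]
  · simp only [off, if_neg hl, Pi.sub_apply, sysX, mulVec_eq_mask hM _ hl, mulVec_sub]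
    ring

theorem abs_dY_le (h : Reg f p L) (t : ℕ) (l : ι) :
    |dY f M k t l| ≤ L t * ∑ s ∈ range t, |dX f M k s l| := by
  by_cases hl : l = k
  · subst hl; simp [dY, dX, off]
  · simp only [dY, dX, off, if_neg hl, Pi.sub_apply]
    rw [sysY_eq h, sysY_eq h]
    exact h.lip _ _ _ _

theorem nrm_dY_le (h : Reg f p L) (t : ℕ) :
    nrm (dY f M k t) ≤ L t * ∑ s ∈ range t, nrm (dX f M k s) :=
  nrm_le_sum_of_abs_le (h.L_nonneg t) (abs_dY_le h t)

theorem nrm_dX_le (hM : ∀ i j, M i j = M j i) (hk : M k k = 0) (t : ℕ) :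
    nrm (dX f M k t) ≤ ‖M‖ * nrm (dY f M k t) + |sysY f M t k| * ‖M‖ := by
  rw [dX_eq hM hk]
  refine (nrm_add_le _ _).trans (add_le_add ?_ ?_)
  · exact (nrm_mulVec_le _ _).trans (by gcongr; exacts [nrm_nonneg _, norm_mask_le _ _])
  · rw [nrm_smul]; gcongr; exact nrm_row_le _ _

theorem sysX_apply_eq (hk : M k k = 0) (t : ℕ) :
    sysX f M t k = M k ⬝ᵥ sysY f (mask {k} M) t + M k ⬝ᵥ dY f M k t := by
  rw [dY, row_dotProduct_off hk, ← dotProduct_add, add_sub_cancel]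
  rfl

/-- The linear response of `y` to the fields `c s • a` at the times `s`. -/
def linY (R : ℕ → ℕ → Matrix ι ι ℝ) (a : ι → ℝ) (c : ℕ → ℝ) (t : ℕ) : ι → ℝ :=
  ∑ s ∈ range t, c s • (R s t *ᵥ a)

/-- The linear response of the fields. -/
def linX (M' : Matrix ι ι ℝ) (R : ℕ → ℕ → Matrix ι ι ℝ) (a : ι → ℝ) (c : ℕ → ℝ)
    (t : ℕ) : ι → ℝ :=
  c t • a + M' *ᵥ linY R a c t

theorem linY_eq (P : ℕ → ℕ → ι → ℝ) (M' : Matrix ι ι ℝ) (a : ι → ℝ) (c : ℕ → ℝ) (t : ℕ) :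
    linY (resp P M') a c t =
      ∑ r ∈ range t, P t r * linX M' (resp P M') a c r := by
  have hext : ∀ r ∈ range t, linY (resp P M') a c r =
      ∑ s ∈ range t, c s • (resp P M' s r *ᵥ a) := fun r hr => by
    refine Finset.sum_subset (Finset.range_mono (mem_range.1 hr).le) fun s _ hs => ?_
    rw [resp_of_le _ _ (not_lt.1 fun h => hs (mem_range.2 h)), zero_mulVec, smul_zero]
  have hd : ∀ (v w : ι → ℝ), diagonal v *ᵥ w = v * w := fun v w => by
    ext i; simp [Matrix.mulVec_diagonal]
  have h1 : ∀ s ∈ range t, c s • (resp P M' s t *ᵥ a) = P t s * (c s • a) +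
      ∑ r ∈ range t, P t r * (M' *ᵥ (c s • (resp P M' s r *ᵥ a))) := fun s hs => by
    rw [resp_of_lt _ _ (mem_range.1 hs), Matrix.add_mulVec, smul_add, hd,
      Matrix.sum_mulVec, Finset.smul_sum, mul_smul_comm]
    congr 1
    refine sum_congr rfl fun r _ => ?_
    rw [← Matrix.mulVec_mulVec, ← Matrix.mulVec_mulVec, hd, mulVec_smul, mul_smul_comm]
  rw [linY, sum_congr rfl h1, sum_add_distrib, sum_comm,
    ← sum_add_distrib]
  refine sum_congr rfl fun r hr => ?_
  rw [linX, hext r hr, mul_add]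
  congr 1
  rw [Matrix.mulVec_sum, mul_sum]

theorem nsq_linX_le (M' : Matrix ι ι ℝ) (R : ℕ → ℕ → Matrix ι ι ℝ) (a : ι → ℝ) (c : ℕ → ℝ)
    (t : ℕ) : nsq (linX M' R a c t) ≤ 2 * (c t ^ 2 * nsq a) +
      2 * ∑ s ∈ range t, t * (c s ^ 2 * nsq ((M' * R s t) *ᵥ a)) := by
  refine (nsq_add_le _ _).trans ?_
  rw [nsq_smul]
  gcongr
  have : M' *ᵥ linY R a c t = ∑ s ∈ range t, c s • ((M' * R s t) *ᵥ a) := by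
    rw [linY, Matrix.mulVec_sum]
    exact sum_congr rfl fun s _ => by rw [mulVec_smul, Matrix.mulVec_mulVec]
  rw [this]
  refine (nsq_sum_le _ _).trans (le_of_eq ?_)
  simp only [nsq_smul, Finset.card_range]

/-- The linear response of `y` to the presence of the site `k`. -/
def lY (f : Act(ι)) (p : Grad(ι))
    (M : Matrix ι ι ℝ) (k : ι) (c : ℕ → ℝ) (t : ℕ) : ι → ℝ :=
  linY (sysR f p (mask {k} M)) (M k) c t

/-- The linear response of `x` to the presence of the site `k`. -/
def lX (f : Act(ι)) (p : Grad(ι))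
    (M : Matrix ι ι ℝ) (k : ι) (c : ℕ → ℝ) (t : ℕ) : ι → ℝ :=
  linX (mask {k} M) (sysR f p (mask {k} M)) (M k) c t

/-- The values at the site `k`. -/
def siteY (f : Act(ι)) (M : Matrix ι ι ℝ) (k : ι) (s : ℕ) : ℝ :=
  sysY f M s k

theorem dX_sub_lX (hM : ∀ i j, M i j = M j i) (hk : M k k = 0) (t : ℕ) :
    dX f M k t - lX f p M k (siteY f M k) t =
      mask {k} M *ᵥ (dY f M k t - lY f p M k (siteY f M k) t) := by
  rw [dX_eq hM hk, lX, linX, mulVec_sub, lY, siteY]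
  abel

theorem nrm_dY_sub_lY_le (h : Reg f p L) (hM : ∀ i j, M i j = M j i) (hk : M k k = 0) (t : ℕ) :
    nrm (dY f M k t - lY f p M k (siteY f M k) t) ≤
      L t * (∑ s ∈ range t, ‖M‖ * nrm (dY f M k s - lY f p M k (siteY f M k) s)) +
      L t * ∑ s ∈ range t, nsq (dX f M k s) := by
  set P' := sysP f p (mask {k} M)
  set u : ι → ℝ := ∑ s ∈ range t, P' t s * (dX f M k s - lX f p M k (siteY f M k) s) with hu
  set q : ι → ℝ := dY f M k t - ∑ s ∈ range t, P' t s * dX f M k s with hq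
  have hdec : dY f M k t - lY f p M k (siteY f M k) t = u + q := by
    rw [hu, hq, lY, sysR_def, linY_eq]
    simp only [mul_sub, sum_sub_distrib, lX, sysR_def]
    abel
  rw [hdec]
  refine (nrm_add_le _ _).trans (add_le_add ?_ ?_)
  · rw [mul_sum]
    refine (nrm_sum_le _ _).trans (sum_le_sum fun s _ => ?_)
    calc nrm (P' t s * (dX f M k s - lX f p M k (siteY f M k) s))
        ≤ nrm (L t • (dX f M k s - lX f p M k (siteY f M k) s)) := by
          refine nrm_mono fun l => ?_
          simp only [Pi.mul_apply, Pi.smul_apply, smul_eq_mul, abs_mul]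
          exact mul_le_mul_of_nonneg_right ((h.bdd _ _ _ _).trans (le_abs_self _)) (abs_nonneg _)
      _ ≤ _ := by
          rw [nrm_smul, abs_of_nonneg (h.L_nonneg t), dX_sub_lX hM hk]
          refine mul_le_mul_of_nonneg_left ((nrm_mulVec_le _ _).trans ?_) (h.L_nonneg t)
          gcongr
          exacts [nrm_nonneg _, norm_mask_le _ _]
  · have : ∀ l, |q l| ≤ L t * ∑ s ∈ range t, |dX f M k s l ^ 2| := fun l => by
      simp only [abs_sq]
      by_cases hl : l = k
      · subst hl; simp [hq, dY, dX, off]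
      · simp only [hq, Pi.sub_apply, Finset.sum_apply, Pi.mul_apply, dY, dX, off, if_neg hl]
        rw [sysY_eq h, sysY_eq h]
        exact h.taylor t l _ _
    exact nrm_le_sum_of_abs_le (x := fun s l => dX f M k s l ^ 2) (h.L_nonneg t) this

theorem nsq_dX_le (hM : ∀ i j, M i j = M j i) (hk : M k k = 0) (t : ℕ) :
    nsq (dX f M k t) ≤ 2 * nsq (lX f p M k (siteY f M k) t) +
      2 * (‖M‖ * nrm (dY f M k t - lY f p M k (siteY f M k) t)) ^ 2 := by
  have : dX f M k t = lX f p M k (siteY f M k) t + (dX f M k t - lX f p M k (siteY f M k) t) := by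
    abel
  rw [this]
  refine (nsq_add_le _ _).trans ?_
  gcongr
  refine (nsq_le _).trans ?_
  gcongr
  · exact nrm_nonneg _
  · rw [dX_sub_lX hM hk]
    exact (nrm_mulVec_le _ _).trans (by gcongr; exacts [nrm_nonneg _, norm_mask_le _ _])

theorem row_dotProduct_lY (c : ℕ → ℝ) (t : ℕ) :
    M k ⬝ᵥ lY f p M k c t =
      ∑ s ∈ range t, (M k ⬝ᵥ (sysR f p (mask {k} M) s t *ᵥ M k)) * c s := by
  rw [lY, linY, dotProduct_sum]
  exact sum_congr rfl fun s _ => by rw [dotProduct_smul, smul_eq_mul, mul_comm]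

/-! #### The response at a site -/

/-- The responses to a perturbation at the site `k`, at the other sites. -/
def colR (f : Act(ι)) (p : Grad(ι))
    (M : Matrix ι ι ℝ) (k : ι) (s t : ℕ) : ι → ℝ := off k fun l => sysR f p M s t l k

/-- The response at the site `k` to a perturbation at the site `k`. -/
def siteR (f : Act(ι)) (p : Grad(ι))
    (M : Matrix ι ι ℝ) (k : ι) (s t : ℕ) : ℝ := sysR f p M s t k k

theorem resp_apply_eq (P : ℕ → ℕ → ι → ℝ) (M : Matrix ι ι ℝ) {s t : ℕ} (h : s < t) (l k : ι) :
    resp P M s t l k = (if l = k then P t s l else 0) +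
      ∑ r ∈ range t, P t r l * (M *ᵥ fun m => resp P M s r m k) l := by
  rw [resp_of_lt _ _ h, Matrix.add_apply, Matrix.diagonal_apply, Matrix.sum_apply]
  congr 1
  refine sum_congr rfl fun r _ => ?_
  rw [Matrix.diagonal_mul]
  rfl

theorem siteR_eq (hk : M k k = 0) {s t : ℕ} (h : s < t) :
    siteR f p M k s t = sysP f p M t s k +
      ∑ r ∈ range t, sysP f p M t r k * (M k ⬝ᵥ colR f p M k s r) := by
  rw [siteR, sysR, resp_apply_eq _ _ h, if_pos rfl]
  congr 1
  refine sum_congr rfl fun r _ => ?_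
  rw [colR, row_dotProduct_off hk]
  rfl

theorem siteR_of_le {s t : ℕ} (h : t ≤ s) : siteR f p M k s t = 0 := by
  rw [siteR, sysR, resp_of_le _ _ h]; rfl

/-- The field created at the sites other than `k` by a perturbation at the site `k`. -/
def colG (f : Act(ι)) (p : Grad(ι))
    (M : Matrix ι ι ℝ) (k : ι) (s r : ℕ) : ι → ℝ :=
  siteR f p M k s r • M k + mask {k} M *ᵥ colR f p M k s r

theorem colR_eq (hM : ∀ i j, M i j = M j i) {s t : ℕ} (h : s < t) :
    colR f p M k s t = ∑ r ∈ range t, off k (sysP f p M t r) * colG f p M k s r := by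
  ext l
  simp only [Finset.sum_apply, Pi.mul_apply]
  by_cases hl : l = k
  · subst hl; simp [colR, off]
  · simp only [colR, off, if_neg hl]
    rw [sysR, resp_apply_eq _ _ h, if_neg hl, zero_add]
    refine sum_congr rfl fun r _ => ?_
    rw [mulVec_eq_mask hM _ hl]
    simp only [colG, Pi.add_apply, Pi.smul_apply, smul_eq_mul, colR, mask_mulVec_off, siteR]
    rw [add_comm]
    rfl

theorem nrm_colR_le (s t : ℕ) : nrm (colR f p M k s t) ≤ ‖sysR f p M s t‖ :=
  (nrm_off_le _ _).trans (nrm_col_le _ _)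

theorem nrm_colG_le (s r : ℕ) : nrm (colG f p M k s r) ≤ 2 * (‖M‖ * ‖sysR f p M s r‖) := by
  refine (nrm_add_le _ _).trans ?_
  have h1 : nrm (siteR f p M k s r • M k) ≤ ‖M‖ * ‖sysR f p M s r‖ := by
    rw [nrm_smul, mul_comm]
    exact mul_le_mul (nrm_row_le _ _) (abs_entry_le (sysR f p M s r) k k) (abs_nonneg _)
      (norm_nonneg _)
  have h2 : nrm (mask {k} M *ᵥ colR f p M k s r) ≤ ‖M‖ * ‖sysR f p M s r‖ :=
    (nrm_mulVec_le _ _).trans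
      (mul_le_mul (norm_mask_le _ _) (nrm_colR_le _ _) (nrm_nonneg _) (norm_nonneg _))
  linarith

theorem abs_off_sysP_sub_le (h : Reg f p L) (t r : ℕ) (l : ι) :
    |off k (sysP f p M t r - sysP f p (mask {k} M) t r) l| ≤
      L t * ∑ q ∈ range t, |dX f M k q l| := by
  by_cases hl : l = k
  · subst hl
    simp [off, dX]
  · simp only [off, dX, if_neg hl, Pi.sub_apply, sysP]
    exact h.plip _ _ _ _ _

theorem nrm_off_sysP_sub_mul_le (h : Reg f p L) (t r : ℕ) (v : ι → ℝ) :
    nrm (off k (sysP f p M t r - sysP f p (mask {k} M) t r) * v) ≤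
      L t * ∑ q ∈ range t, √(nsq (dX f M k q)) * nrm v := by
  refine (nrm_le_sum_of_abs_le (t := t) (x := fun q => dX f M k q * v) (h.L_nonneg t)
    fun l => ?_).trans ?_
  · simp only [Pi.mul_apply, abs_mul, ← sum_mul]
    rw [← mul_assoc]
    exact mul_le_mul_of_nonneg_right (abs_off_sysP_sub_le h t r l) (abs_nonneg _)
  · refine mul_le_mul_of_nonneg_left (sum_le_sum fun q _ => ?_) (h.L_nonneg t)
    exact nrm_mul_le _ _

theorem nrm_colR_sub_lY_le (h : Reg f p L) (hM : ∀ i j, M i j = M j i) (hk : M k k = 0)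
    {s t : ℕ} (hst : s < t) :
    nrm (colR f p M k s t - lY f p M k (siteR f p M k s) t) ≤
      (∑ r ∈ range t, L t * ∑ q ∈ range t,
        √(nsq (dX f M k q)) * (2 * (‖M‖ * ‖sysR f p M s r‖))) +
      ∑ r ∈ range t,
        L t * (‖M‖ * nrm (colR f p M k s r - lY f p M k (siteR f p M k s) r)) := by
  set P := sysP f p M
  set P' := sysP f p (mask {k} M)
  have hdec : colR f p M k s t - lY f p M k (siteR f p M k s) t =
      (∑ r ∈ range t, off k (P t r - P' t r) * colG f p M k s r) +
      ∑ r ∈ range t,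
        P' t r * (mask {k} M *ᵥ (colR f p M k s r - lY f p M k (siteR f p M k s) r)) := by
    rw [colR_eq hM hst, lY, sysR_def, linY_eq, ← sum_sub_distrib, ← sum_add_distrib]
    refine sum_congr rfl fun r _ => ?_
    ext l
    simp only [linX, colG, lY, sysR_def, Pi.sub_apply, Pi.mul_apply, Pi.add_apply, Pi.smul_apply,
      mulVec_sub, smul_eq_mul]
    by_cases hl : l = k
    · subst hl
      simp [off, mask_mulVec_self, hk]
    · simp only [off, if_neg hl, Pi.sub_apply, P, P']
      ring
  rw [hdec]
  refine (nrm_add_le _ _).trans (add_le_add ?_ ?_)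
  · refine (nrm_sum_le _ _).trans (sum_le_sum fun r _ => ?_)
    refine (nrm_off_sysP_sub_mul_le h t r _).trans ?_
    refine mul_le_mul_of_nonneg_left (sum_le_sum fun q _ => ?_) (h.L_nonneg t)
    exact mul_le_mul_of_nonneg_left (nrm_colG_le s r) (sqrt_nonneg _)
  · refine (nrm_sum_le _ _).trans (sum_le_sum fun r _ => ?_)
    calc _ ≤ nrm (L t • (mask {k} M *ᵥ
            (colR f p M k s r - lY f p M k (siteR f p M k s) r))) := by
          refine nrm_mono fun l => ?_
          simp only [Pi.mul_apply, Pi.smul_apply, smul_eq_mul, abs_mul]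
          exact mul_le_mul_of_nonneg_right ((h.bdd _ _ _ _).trans (le_abs_self _)) (abs_nonneg _)
      _ ≤ _ := by
          rw [nrm_smul, abs_of_nonneg (h.L_nonneg t)]
          refine mul_le_mul_of_nonneg_left ((nrm_mulVec_le _ _).trans ?_) (h.L_nonneg t)
          gcongr
          exacts [nrm_nonneg _, norm_mask_le _ _]

/-! #### Comparison of the responses with and without a site -/

theorem nrm_sysP_sub_le (h : Reg f p L) (t r : ℕ) :
    nrm (sysP f p M t r - sysP f p (mask {k} M) t r) ≤
      L t * ∑ q ∈ range t, nrm (dX f M k q) + 2 * L t := by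
  set v := sysP f p M t r - sysP f p (mask {k} M) t r with hv
  have hdec : v = off k v + single k (v k) := by
    ext l
    by_cases hl : l = k
    · subst hl; simp [off]
    · simp [off, hl]
  rw [hdec]
  refine (nrm_add_le _ _).trans (add_le_add ?_ ?_)
  · exact nrm_le_sum_of_abs_le (h.L_nonneg t) (abs_off_sysP_sub_le h t r)
  · have : nrm (single k (v k) : ι → ℝ) = |v k| := by
      simp [nrm]
    rw [this, hv, Pi.sub_apply]
    refine (abs_sub _ _).trans ?_
    have h1 := h.bdd t r k fun s => sysX f M s k
    have h2 := h.bdd t r k fun s => sysX f (mask {k} M) s k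
    simp only [sysP]
    linarith

theorem frob_sub_mask_le (hM : ∀ i j, M i j = M j i) (hk : M k k = 0) :
    frob (M - mask {k} M) ≤ 2 * ‖M‖ := by
  set A : Matrix ι ι ℝ := of fun i j => if i = k then M k j else 0 with hA
  have hdec : M - mask {k} M = A + Aᵀ := by
    ext i j
    simp only [hA, Matrix.sub_apply, mask_apply, Matrix.add_apply, of_apply,
      Matrix.transpose_apply, mem_singleton]
    by_cases hi : i = k <;> by_cases hj : j = k <;> simp [hi, hj, hk, hM i k]
  have hfA : frob A ≤ ‖M‖ := by
    refine le_trans (le_of_eq ?_) (nrm_row_le M k)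
    rw [← sq_eq_sq₀ (frob_nonneg _) (nrm_nonneg _), frob_sq,
      Finset.sum_eq_single k (fun i _ hi => ?_) (by simp)]
    · congr 2; ext j; simp [hA]
    · have : A i = 0 := by ext j; simp [hA, hi]
      rw [this, nrm_zero]; simp
  rw [hdec]
  refine (frob_add_le _ _).trans ?_
  rw [frob_transpose]
  linarith

theorem frob_sysR_sub_le (h : Reg f p L) (hM : ∀ i j, M i j = M j i) (hk : M k k = 0)
    {s t : ℕ} (hst : s < t) {D : ℝ}
    (hD : ∀ r, nrm (sysP f p M t r - sysP f p (mask {k} M) t r) ≤ D) :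
    frob (sysR f p M s t - sysR f p (mask {k} M) s t) ≤ D +
      ∑ r ∈ range t, (D * (‖M‖ * ‖sysR f p M s r‖) +
        (L t * (2 * ‖M‖ * ‖sysR f p M s r‖) +
          L t * (‖M‖ * frob (sysR f p M s r - sysR f p (mask {k} M) s r)))) := by
  set M' := mask {k} M
  have hdec : sysR f p M s t - sysR f p M' s t =
      diagonal (sysP f p M t s - sysP f p M' t s) +
      ∑ r ∈ range t,
        (diagonal (sysP f p M t r - sysP f p M' t r) * (M * sysR f p M s r) +
          (diagonal (sysP f p M' t r) * ((M - M') * sysR f p M s r) +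
            diagonal (sysP f p M' t r) * (M' * (sysR f p M s r - sysR f p M' s r)))) := by
    rw [sysR_def, sysR_def, resp_of_lt _ _ hst, resp_of_lt _ _ hst, add_sub_add_comm,
      ← sum_sub_distrib]
    congr 1
    · rw [Matrix.diagonal_sub]; rfl
    · refine sum_congr rfl fun r _ => ?_
      rw [← Matrix.mul_add, Matrix.mul_sub M', Matrix.sub_mul, sub_add_sub_cancel,
        show sysP f p M t r - sysP f p M' t r = fun i => sysP f p M t r i - sysP f p M' t r i from rfl,
        ← Matrix.diagonal_sub, Matrix.sub_mul, Matrix.mul_sub, sub_add_sub_cancel]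
  have hdiag : ∀ r, ‖(diagonal (sysP f p M' t r) : Matrix ι ι ℝ)‖ ≤ L t := fun r =>
    norm_diagonal_le (h.L_nonneg t) fun l => h.bdd _ _ _ _
  rw [hdec]
  refine (frob_add_le _ _).trans (add_le_add ((frob_diagonal _).le.trans (hD s)) ?_)
  refine (frob_sum_le _ _).trans (sum_le_sum fun r _ => ?_)
  refine (frob_add_le _ _).trans (add_le_add ?_ ((frob_add_le _ _).trans (add_le_add ?_ ?_)))
  · refine (frob_mul_le_frob_mul_norm _ _).trans ?_
    rw [frob_diagonal]
    exact mul_le_mul (hD r) (l2_opNorm_mul _ _) (norm_nonneg _) ((nrm_nonneg _).trans (hD r))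
  · refine (frob_mul_le_norm_mul_frob _ _).trans ?_
    refine mul_le_mul (hdiag r) ?_ (frob_nonneg _) (h.L_nonneg t)
    refine (frob_mul_le_frob_mul_norm _ _).trans ?_
    gcongr
    exact frob_sub_mask_le hM hk
  · refine (frob_mul_le_norm_mul_frob _ _).trans ?_
    refine mul_le_mul (hdiag r) ?_ (frob_nonneg _) (h.L_nonneg t)
    refine (frob_mul_le_norm_mul_frob _ _).trans ?_
    gcongr
    exacts [frob_nonneg _, norm_mask_le _ _]

end System

/-! ### Linear and quadratic forms in independent variables -/

section IndepForms

variable {Ω : Type*} [MeasurableSpace Ω] {P : Measure Ω} [IsProbabilityMeasure P]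

theorem lintegral_indep_eq {α β : Type*} [MeasurableSpace α] [MeasurableSpace β]
    {a : Ω → α} {Y : Ω → β} (ha : Measurable a) (hY : Measurable Y) (h : IndepFun a Y P)
    {H : α → β → ℝ≥0∞} (hH : Measurable (Function.uncurry H)) :
    ∫⁻ ω, H (a ω) (Y ω) ∂P = ∫⁻ ω', ∫⁻ ω, H (a ω) (Y ω') ∂P ∂P := by
  have h1 := (indepFun_iff_map_prod_eq_prod_map_map ha.aemeasurable hY.aemeasurable).1 h
  have : IsProbabilityMeasure (P.map a) := Measure.isProbabilityMeasure_map ha.aemeasurable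
  have : IsProbabilityMeasure (P.map Y) := Measure.isProbabilityMeasure_map hY.aemeasurable
  calc ∫⁻ ω, H (a ω) (Y ω) ∂P = ∫⁻ q, Function.uncurry H q ∂(P.map fun ω => (a ω, Y ω)) := by
        rw [lintegral_map hH (ha.prodMk hY)]; rfl
    _ = ∫⁻ y, ∫⁻ x, H x y ∂(P.map a) ∂(P.map Y) := by
        rw [h1, lintegral_prod_symm _ hH.aemeasurable]; rfl
    _ = ∫⁻ ω', ∫⁻ x, H x (Y ω') ∂(P.map a) ∂P := by
        exact lintegral_map (f := fun y => ∫⁻ x, H x y ∂(P.map a)) hH.lintegral_prod_left' hY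
    _ = _ := lintegral_congr fun ω' =>
        lintegral_map (f := fun x => H x (Y ω'))
          (hH.comp (measurable_id.prodMk (measurable_const (a := Y ω')))) ha

theorem integral_indep_eq {α β : Type*} [MeasurableSpace α] [MeasurableSpace β]
    {E : Type*} [NormedAddCommGroup E] [NormedSpace ℝ E] [CompleteSpace E]
    {a : Ω → α} {Y : Ω → β} (ha : Measurable a) (hY : Measurable Y) (h : IndepFun a Y P)
    {H : α → β → E} (hH : StronglyMeasurable (Function.uncurry H)) {C : ℝ}
    (hC : ∀ x y, ‖H x y‖ ≤ C) :
    ∫ ω, H (a ω) (Y ω) ∂P = ∫ ω', ∫ ω, H (a ω) (Y ω') ∂P ∂P := by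
  have h1 := (indepFun_iff_map_prod_eq_prod_map_map ha.aemeasurable hY.aemeasurable).1 h
  have : IsProbabilityMeasure (P.map a) := Measure.isProbabilityMeasure_map ha.aemeasurable
  have : IsProbabilityMeasure (P.map Y) := Measure.isProbabilityMeasure_map hY.aemeasurable
  calc ∫ ω, H (a ω) (Y ω) ∂P = ∫ q, Function.uncurry H q ∂(P.map fun ω => (a ω, Y ω)) := by
        rw [integral_map (ha.prodMk hY).aemeasurable hH.aestronglyMeasurable]; rfl
    _ = ∫ y, ∫ x, H x y ∂(P.map a) ∂(P.map Y) := by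
        rw [h1, integral_prod_symm]
        · rfl
        · exact Integrable.of_bound hH.aestronglyMeasurable C
            (.of_forall fun q => hC q.1 q.2)
    _ = ∫ ω', ∫ x, H x (Y ω') ∂(P.map a) ∂P := by
        rw [integral_map hY.aemeasurable]
        exact (StronglyMeasurable.integral_prod_left' hH).aestronglyMeasurable
    _ = _ := integral_congr_ae (.of_forall fun ω' => by
        dsimp only
        rw [integral_map ha.aemeasurable]
        exact (hH.comp_measurable
          (measurable_id.prodMk (measurable_const (a := Y ω')))).aestronglyMeasurable)

variable {ι : Type*} [Fintype ι] [DecidableEq ι]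

/-- The coordinates of `a` are independent and centered, with variances `v` and with moment
generating functions bounded by that of a Gaussian variable of variance of order `1 / N`. -/
structure RowLaw (P : Measure Ω) (a : Ω → ι → ℝ) (v : ι → ℝ) (c : ℝ) (N : ℕ) : Prop where
  N_pos : 0 < N
  c_nonneg : 0 ≤ c
  meas : Measurable a
  indep : iIndepFun (fun l ω => a ω l) P
  mean : ∀ l, ∫ ω, a ω l ∂P = 0
  var : ∀ l, ∫ ω, a ω l ^ 2 ∂P = v l
  mgf : ∀ l s, ∫⁻ ω, ofReal (exp (s * a ω l)) ∂P ≤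
    ofReal (exp (c * s ^ 2 / N))

variable {a : Ω → ι → ℝ} {v : ι → ℝ} {c : ℝ} {N : ℕ}

theorem RowLaw.meas_apply (h : RowLaw P a v c N) (l : ι) : Measurable fun ω => a ω l :=
  (measurable_pi_apply l).comp h.meas

theorem RowLaw.mgf_dotProduct (h : RowLaw P a v c N) (u : ι → ℝ) :
    ∫⁻ ω, ofReal (exp (a ω ⬝ᵥ u)) ∂P ≤
      ofReal (exp (c * nrm u ^ 2 / N)) := by
  have h1 : ∀ ω, ofReal (exp (a ω ⬝ᵥ u)) =
      ∏ l, ofReal (exp (u l * a ω l)) := fun ω => by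
    rw [← ENNReal.ofReal_prod_of_nonneg fun _ _ => (exp_pos _).le, ← Real.exp_sum]
    simp only [dotProduct, mul_comm]
  have hmeas : ∀ l, Measurable fun x : ℝ => ofReal (exp (u l * x)) := fun l => by
    fun_prop
  simp only [h1]
  rw [lintegral_prod_eq_prod_lintegral_of_indepFun univ
    (fun l ω => ofReal (exp (u l * a ω l)))
    (h.indep.comp (fun l x => ofReal (exp (u l * x))) hmeas)
    fun l => (hmeas l).comp (h.meas_apply l)]
  calc _ ≤ ∏ l, ofReal (exp (c * u l ^ 2 / N)) :=
        Finset.prod_le_prod' fun l _ => h.mgf l (u l)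
    _ = _ := by
        rw [← ENNReal.ofReal_prod_of_nonneg fun _ _ => (exp_pos _).le, ← Real.exp_sum,
          nrm_sq, mul_sum, sum_div]

/-- The constant in the moment bounds for linear forms. -/
def momConst (c : ℝ) (q : ℕ) : ℝ := 2 * q.factorial * exp c

theorem momConst_nonneg (c : ℝ) (q : ℕ) : 0 ≤ momConst c q := by unfold momConst; positivity

theorem abs_pow_le_factorial_mul_exp (x : ℝ) (q : ℕ) :
    |x| ^ q ≤ q.factorial * (exp x + exp (-x)) := by
  have h1 : |x| ^ q / q.factorial ≤ exp |x| := Real.pow_div_factorial_le_exp _ (abs_nonneg x) q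
  have h2 : exp |x| ≤ exp x + exp (-x) := by
    rcases abs_cases x with ⟨h, _⟩ | ⟨h, _⟩ <;> rw [h] <;> linarith [exp_pos x, exp_pos (-x)]
  rw [div_le_iff₀ (by positivity)] at h1
  calc _ ≤ _ := h1
    _ ≤ _ := by rw [mul_comm]; gcongr

theorem RowLaw.moment_dotProduct (h : RowLaw P a v c N) (u : ι → ℝ) (q : ℕ) :
    ∫⁻ ω, ofReal (|a ω ⬝ᵥ u| ^ q) ∂P ≤
      ofReal (momConst c q * (nrm u / √N) ^ q) := by
  have hN : (0 : ℝ) < N := by exact_mod_cast h.N_pos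
  rcases (nrm_nonneg u).eq_or_lt' with h0 | h0
  · have hu : u = 0 := by
      ext l; simpa [h0] using abs_le_nrm u l
    subst hu
    rcases q with _ | q
    · simp only [pow_zero, ofReal_one, lintegral_const, measure_univ, mul_one, momConst]
      rw [ENNReal.one_le_ofReal]
      simp only [Nat.factorial_zero, Nat.cast_one, mul_one]
      linarith [Real.one_le_exp h.c_nonneg]
    · simp
  set s : ℝ := √N / nrm u with hs
  have hs0 : 0 < s := by positivity
  have hpt : ∀ ω, ofReal (|a ω ⬝ᵥ u| ^ q) ≤
      ofReal (q.factorial * (nrm u / √N) ^ q) *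
        (ofReal (exp (a ω ⬝ᵥ (s • u))) +
          ofReal (exp (a ω ⬝ᵥ ((-s) • u)))) := fun ω => by
    rw [← ofReal_add (by positivity) (by positivity),
      ← ofReal_mul (by positivity)]
    refine ofReal_le_ofReal ?_
    have := abs_pow_le_factorial_mul_exp (s * (a ω ⬝ᵥ u)) q
    rw [abs_mul, mul_pow, abs_of_pos hs0] at this
    have h2 : (nrm u / √N) ^ q * s ^ q = 1 := by
      rw [← mul_pow, hs, div_mul_div_cancel₀ (by positivity), div_self h0.ne', one_pow]
    rw [dotProduct_smul, dotProduct_smul, smul_eq_mul, smul_eq_mul, neg_mul]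
    calc |a ω ⬝ᵥ u| ^ q = (nrm u / √N) ^ q * (s ^ q * |a ω ⬝ᵥ u| ^ q) := by
          rw [← mul_assoc, h2, one_mul]
      _ ≤ (nrm u / √N) ^ q * _ := mul_le_mul_of_nonneg_left this (by positivity)
      _ = _ := by ring
  have hnorm : ∀ s' : ℝ, s' ^ 2 = s ^ 2 → c * nrm (s' • u) ^ 2 / N = c := fun s' hs' => by
    rw [nrm_smul, mul_pow, sq_abs, hs', hs, div_pow, sq_sqrt hN.le]
    field_simp
  have e1 := h.mgf_dotProduct (s • u)
  have e2 := h.mgf_dotProduct ((-s) • u)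
  rw [hnorm s rfl] at e1
  rw [hnorm (-s) (neg_sq s)] at e2
  have hm : Measurable fun ω => ofReal (exp (a ω ⬝ᵥ (s • u))) := by
    have : Measurable fun ω => a ω ⬝ᵥ (s • u) :=
      Finset.measurable_fun_sum _ fun l _ => (h.meas_apply l).mul_const _
    fun_prop
  calc _ ≤ _ := lintegral_mono hpt
    _ ≤ ofReal (q.factorial * (nrm u / √N) ^ q) *
        (ofReal (exp c) + ofReal (exp c)) := by
        rw [lintegral_const_mul' _ _ ofReal_ne_top, lintegral_add_left hm]
        gcongr
    _ = _ := by
        rw [← ofReal_add (by positivity) (by positivity),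
          ← ofReal_mul (by positivity), momConst]
        congr 1
        ring

theorem RowLaw.moment_dotProduct_indep (h : RowLaw P a v c N) {β : Type*} [MeasurableSpace β]
    {Y : Ω → β} (hY : Measurable Y) (hi : IndepFun a Y P) {g : β → ι → ℝ} (hg : Measurable g)
    (q : ℕ) :
    ∫⁻ ω, ofReal (|a ω ⬝ᵥ g (Y ω)| ^ q) ∂P ≤
      ∫⁻ ω, ofReal (momConst c q * (nrm (g (Y ω)) / √N) ^ q) ∂P := by
  rw [lintegral_indep_eq (H := fun x y => ofReal (|x ⬝ᵥ g y| ^ q)) h.meas hY hi]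
  · exact lintegral_mono fun ω' => h.moment_dotProduct _ q
  · have : Measurable fun z : (ι → ℝ) × β => z.1 ⬝ᵥ g z.2 :=
      Finset.measurable_fun_sum _ fun l _ =>
        ((measurable_pi_apply l).comp measurable_fst).mul
          ((measurable_pi_apply l).comp (hg.comp measurable_snd))
    exact (this.abs.pow_const q).ennreal_ofReal

theorem RowLaw.moment_apply (h : RowLaw P a v c N) (l : ι) (q : ℕ) :
    ∫⁻ ω, ofReal (|a ω l| ^ q) ∂P ≤
      ofReal (momConst c q * (1 / √N) ^ q) := by
  have := h.moment_dotProduct (single l 1) q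
  have h1 : nrm (single l (1 : ℝ) : ι → ℝ) = 1 := by simp [nrm]
  simpa [h1] using this

theorem RowLaw.lpBdd (h : RowLaw P a v c N) :
    LpBdd (Ω := fun _ => Ω) (fun _ => P) (fun _ (l : ι) ω => a ω l) :=
  ⟨fun _ l => h.meas_apply l, fun q => ⟨_, fun _ l => h.moment_apply l q⟩⟩

theorem RowLaw.integral_abs_pow_le (h : RowLaw P a v c N) (l : ι) (q : ℕ) :
    ∫ ω, |a ω l| ^ q ∂P ≤ momConst c q * (1 / √N) ^ q := by
  rw [integral_eq_lintegral_of_nonneg_ae (.of_forall fun _ => by positivity)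
    ((h.meas_apply l).abs.pow_const q).aestronglyMeasurable]
  exact toReal_le_of_le_ofReal (mul_nonneg (momConst_nonneg _ _) (by positivity))
    (h.moment_apply l q)

theorem RowLaw.integral_dotProduct_sq_le (h : RowLaw P a v c N) (u : ι → ℝ) :
    ∫ ω, (a ω ⬝ᵥ u) ^ 2 ∂P ≤ momConst c 2 * (nrm u ^ 2 / N) := by
  have hm : Measurable fun ω => a ω ⬝ᵥ u :=
    Finset.measurable_fun_sum _ fun l _ => (h.meas_apply l).mul_const _
  rw [integral_eq_lintegral_of_nonneg_ae (.of_forall fun _ => by positivity)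
    (hm.pow_const 2).aestronglyMeasurable]
  have := h.moment_dotProduct u 2
  simp only [sq_abs, div_pow, sq_sqrt (Nat.cast_nonneg N)] at this
  exact toReal_le_of_le_ofReal (mul_nonneg (momConst_nonneg _ _) (by positivity)) this

/-- The constant in the variance bound for quadratic forms. -/
def quadConst (c : ℝ) : ℝ :=
  4 * (momConst c 2 * momConst c 2) + 4 * (momConst c 4 + momConst c 2 ^ 2)

theorem RowLaw.var_nonneg (h : RowLaw P a v c N) (l : ι) : 0 ≤ v l := by
  rw [← h.var l]; positivity

theorem RowLaw.var_le (h : RowLaw P a v c N) (l : ι) : v l ≤ momConst c 2 * (1 / N) := by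
  have := h.integral_abs_pow_le l 2
  simp only [sq_abs, h.var l, div_pow, one_pow, sq_sqrt (Nat.cast_nonneg N)] at this
  exact this

theorem RowLaw.integral_quad_sq_le (h : RowLaw P a v c N) (A : Matrix ι ι ℝ) (S : Finset ι) :
    ∫ ω, ((∑ l ∈ S, ∑ m ∈ S, A l m * (a ω l * a ω m)) - ∑ l ∈ S, v l * A l l) ^ 2 ∂P ≤
      quadConst c / N ^ 2 * ∑ l ∈ S, ∑ m ∈ S, A l m ^ 2 := by
  have hN : (0 : ℝ) < N := by exact_mod_cast h.N_pos
  induction S using induction_on with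
  | empty => simp
  | insert k S hk ih =>
    set Q : Ω → ℝ := fun ω => (∑ l ∈ S, ∑ m ∈ S, A l m * (a ω l * a ω m)) - ∑ l ∈ S, v l * A l l
      with hQ
    set u : ι → ℝ := fun m => if m ∈ S then A k m + A m k else 0 with hu
    set Λ : Ω → ℝ := fun ω => ∑ m ∈ S, (A k m + A m k) * a ω m with hΛ
    set D : Ω → ℝ := fun ω => A k k * (a ω k ^ 2 - v k) with hD
    have hΛu : ∀ ω, Λ ω = a ω ⬝ᵥ u := fun ω => by
      simp only [hΛ, hu, dotProduct, mul_ite, mul_zero, Finset.sum_ite_mem, Finset.univ_inter]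
      exact sum_congr rfl fun m _ => mul_comm _ _
    have hdec : ∀ ω, (∑ l ∈ insert k S, ∑ m ∈ insert k S, A l m * (a ω l * a ω m)) -
        ∑ l ∈ insert k S, v l * A l l = Q ω + (a ω k * Λ ω + D ω) := fun ω => by
      simp only [sum_insert hk, sum_add_distrib, hQ, hΛ, hD, add_mul, mul_add,
        mul_sum]
      have e1 : ∑ m ∈ S, A k m * (a ω k * a ω m) = ∑ m ∈ S, a ω k * (A k m * a ω m) :=
        sum_congr rfl fun m _ => by ring
      have e2 : ∑ m ∈ S, A m k * (a ω m * a ω k) = ∑ m ∈ S, a ω k * (A m k * a ω m) :=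
        sum_congr rfl fun m _ => by ring
      rw [e1, e2]
      ring
    -- moments
    have bA : ∀ l, LpBdd (Ω := fun _ => Ω) (J := fun _ => Unit) (fun _ => P)
        (fun _ _ ω => a ω l) := fun l => h.lpBdd.reindex fun _ _ => l
    have bC : ∀ x : ℝ, LpBdd (Ω := fun _ => Ω) (J := fun _ => Unit) (fun _ => P)
        (fun _ _ _ => x) := fun x => LpBdd.const x
    have bQ : LpBdd (Ω := fun _ => Ω) (J := fun _ => Unit) (fun _ => P) (fun _ _ => Q) :=
      (LpBdd.sum S fun l _ => LpBdd.sum S fun m _ => (bC (A l m)).mul ((bA l).mul (bA m))).sub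
        (bC _)
    have bΛ : LpBdd (Ω := fun _ => Ω) (J := fun _ => Unit) (fun _ => P) (fun _ _ => Λ) :=
      LpBdd.sum S fun m _ => (bC (A k m + A m k)).mul (bA m)
    have bD : LpBdd (Ω := fun _ => Ω) (J := fun _ => Unit) (fun _ => P) (fun _ _ => D) :=
      (bC (A k k)).mul (((bA k).pow 2).sub (bC (v k)))
    have bK := bA k
    -- independence
    have hind : ∀ (g₁ : (S → ℝ) → ℝ) (g₂ : ℝ → ℝ), Measurable g₁ → Measurable g₂ →
        IndepFun (fun ω => g₁ fun m : S => a ω m) (fun ω => g₂ (a ω k)) P := fun g₁ g₂ h₁ h₂ => by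
      have := h.indep.indepFun_finset S {k} (by simpa using hk) fun l => h.meas_apply l
      have h₃ : Measurable fun y : ({k} : Finset ι) → ℝ => g₂ (y ⟨k, by simp⟩) := by fun_prop
      exact this.comp h₁ h₃
    have hQf : ∀ ω, Q ω = (∑ l : S, ∑ m : S, A l m * (a ω l * a ω m)) - ∑ l ∈ S, v l * A l l :=
      fun ω => by
        simp only [hQ, fun l => sum_coe_sort S (fun m => A l m * (a ω l * a ω m))]
        rw [sum_coe_sort S (fun l => ∑ m ∈ S, A l m * (a ω l * a ω m))]
    have hΛf : ∀ ω, Λ ω = ∑ m : S, (A k m + A m k) * a ω m := fun ω =>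
      (sum_coe_sort S (fun m => (A k m + A m k) * a ω m)).symm
    have i1 : IndepFun (fun ω => Q ω * Λ ω) (fun ω => a ω k) P := by
      have := hind (fun y => ((∑ l : S, ∑ m : S, A l m * (y l * y m)) - ∑ l ∈ S, v l * A l l) *
        ∑ m : S, (A k m + A m k) * y m) id (by fun_prop) measurable_id
      simpa only [hQf, hΛf, id] using this
    have i2 : IndepFun Q D P := by
      have := hind (fun y => (∑ l : S, ∑ m : S, A l m * (y l * y m)) - ∑ l ∈ S, v l * A l l)
        (fun x => A k k * (x ^ 2 - v k)) (by fun_prop) (by fun_prop)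
      simpa only [← hQf] using this
    have i3 : IndepFun (fun ω => Λ ω ^ 2) (fun ω => a ω k ^ 2) P := by
      have := hind (fun y => (∑ m : S, (A k m + A m k) * y m) ^ 2) (fun x => x ^ 2)
        (by fun_prop) (by fun_prop)
      simpa only [← hΛf] using this
    have z1 : ∫ ω, Q ω * Λ ω * a ω k ∂P = 0 := by
      rw [i1.integral_fun_mul_eq_mul_integral ((bQ.mul bΛ).integrable 0 ()).1
        (bK.integrable 0 ()).1, h.mean k, mul_zero]
    have zD : ∫ ω, D ω ∂P = 0 := by
      rw [hD, integral_const_mul, integral_sub ((bK.pow 2).integrable 0 ())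
        ((bC (v k)).integrable 0 ()), h.var k]
      simp
    have z2 : ∫ ω, Q ω * D ω ∂P = 0 := by
      rw [i2.integral_fun_mul_eq_mul_integral (bQ.integrable 0 ()).1 (bD.integrable 0 ()).1, zD,
        mul_zero]
    have z3 : ∫ ω, Λ ω ^ 2 * a ω k ^ 2 ∂P ≤
        (momConst c 2 * (nrm u ^ 2 / N)) * (momConst c 2 * (1 / N)) := by
      rw [i3.integral_fun_mul_eq_mul_integral ((bΛ.pow 2).integrable 0 ()).1
        ((bK.pow 2).integrable 0 ()).1, h.var k]
      refine mul_le_mul ?_ (h.var_le k) (h.var_nonneg k)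
        (mul_nonneg (momConst_nonneg _ _) (by positivity))
      simp only [hΛu]
      exact h.integral_dotProduct_sq_le u
    have z4 : ∫ ω, D ω ^ 2 ∂P ≤ 2 * A k k ^ 2 * ((momConst c 4 + momConst c 2 ^ 2) / N ^ 2) := by
      have hb : ∀ ω, D ω ^ 2 ≤ 2 * A k k ^ 2 * (|a ω k| ^ 4 + v k ^ 2) := fun ω => by
        have : |a ω k| ^ 4 = (a ω k ^ 2) ^ 2 := by rw [← sq_abs (a ω k), ← pow_mul]
        rw [hD, this]
        have := sq_nonneg (a ω k ^ 2 + v k)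
        have h3 := sq_nonneg (A k k)
        calc (A k k * (a ω k ^ 2 - v k)) ^ 2 = A k k ^ 2 * (a ω k ^ 2 - v k) ^ 2 := by ring
          _ ≤ A k k ^ 2 * (2 * ((a ω k ^ 2) ^ 2 + v k ^ 2)) := by gcongr; nlinarith
          _ = _ := by ring
      have i4 := (bK.abs.pow 4).integrable 0 ()
      calc _ ≤ ∫ ω, 2 * A k k ^ 2 * (|a ω k| ^ 4 + v k ^ 2) ∂P :=
            integral_mono ((bD.pow 2).integrable 0 ())
              ((i4.add (integrable_const _)).const_mul _) hb
        _ = 2 * A k k ^ 2 * (∫ ω, |a ω k| ^ 4 ∂P + v k ^ 2) := by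
            rw [integral_const_mul, integral_add i4 (integrable_const _)]; simp
        _ ≤ _ := by
            have e4 := h.integral_abs_pow_le k 4
            have e5 : (1 / √(N : ℝ)) ^ 4 = 1 / (N : ℝ) ^ 2 := by
              rw [div_pow, one_pow, show 4 = 2 * 2 from rfl, pow_mul, sq_sqrt hN.le]
            have e6 := pow_le_pow_left₀ (h.var_nonneg k) (h.var_le k) 2
            rw [e5] at e4
            gcongr
            calc _ ≤ momConst c 4 * (1 / (N : ℝ) ^ 2) + (momConst c 2 * (1 / N)) ^ 2 :=
                  add_le_add e4 e6
              _ = _ := by ring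
    have hu2 : nrm u ^ 2 ≤ 2 * ∑ m ∈ S, A k m ^ 2 + 2 * ∑ m ∈ S, A m k ^ 2 := by
      rw [nrm_sq, hu]
      simp only [ite_pow, ne_eq, OfNat.ofNat_ne_zero, not_false_eq_true, zero_pow,
        Finset.sum_ite_mem, Finset.univ_inter]
      rw [mul_sum, mul_sum, ← sum_add_distrib]
      refine sum_le_sum fun m _ => ?_
      nlinarith [sq_nonneg (A k m - A m k)]
    have iQ := (bQ.pow 2).integrable 0 ()
    have i5 := ((bQ.mul bΛ).mul bK).integrable 0 ()
    have i6 := (bQ.mul bD).integrable 0 ()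
    have i7 := ((bΛ.pow 2).mul (bK.pow 2)).integrable 0 ()
    have i8 := (bD.pow 2).integrable 0 ()
    have j3 : Integrable (fun ω => 2 * (Λ ω ^ 2 * a ω k ^ 2) + 2 * D ω ^ 2) P :=
      (i7.const_mul 2).add (i8.const_mul 2)
    have j2 : Integrable (fun ω => 2 * (Q ω * D ω) +
        (2 * (Λ ω ^ 2 * a ω k ^ 2) + 2 * D ω ^ 2)) P := (i6.const_mul 2).add j3
    have j1 : Integrable (fun ω => 2 * (Q ω * Λ ω * a ω k) + (2 * (Q ω * D ω) +
        (2 * (Λ ω ^ 2 * a ω k ^ 2) + 2 * D ω ^ 2))) P := (i5.const_mul 2).add j2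
    calc _ ≤ ∫ ω, (Q ω ^ 2 + (2 * (Q ω * Λ ω * a ω k) + (2 * (Q ω * D ω) +
            (2 * (Λ ω ^ 2 * a ω k ^ 2) + 2 * D ω ^ 2)))) ∂P := by
          refine integral_mono ?_ (iQ.add j1) fun ω => ?_
          · simp only [hdec]
            exact ((bQ.add ((bK.mul bΛ).add bD)).pow 2).integrable 0 ()
          · simp only [hdec]
            nlinarith [sq_nonneg (a ω k * Λ ω - D ω)]
      _ = ∫ ω, Q ω ^ 2 ∂P + (2 * 0 + (2 * 0 +
            (2 * ∫ ω, Λ ω ^ 2 * a ω k ^ 2 ∂P + 2 * ∫ ω, D ω ^ 2 ∂P))) := by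
          rw [integral_add iQ j1, integral_add (i5.const_mul 2) j2,
            integral_add (i6.const_mul 2) j3,
            integral_add (i7.const_mul 2) (i8.const_mul 2), integral_const_mul,
            integral_const_mul, integral_const_mul, integral_const_mul, z1, z2]
      _ ≤ quadConst c / N ^ 2 * (∑ l ∈ S, ∑ m ∈ S, A l m ^ 2) +
            (2 * 0 + (2 * 0 + (2 * ((momConst c 2 * ((2 * ∑ m ∈ S, A k m ^ 2 +
              2 * ∑ m ∈ S, A m k ^ 2) / N)) * (momConst c 2 * (1 / N))) +
            2 * (2 * A k k ^ 2 * ((momConst c 4 + momConst c 2 ^ 2) / N ^ 2))))) := by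
          have hm := momConst_nonneg c 2
          gcongr
          refine z3.trans ?_
          gcongr
      _ ≤ quadConst c / N ^ 2 * ((∑ l ∈ S, ∑ m ∈ S, A l m ^ 2) + (∑ m ∈ S, A k m ^ 2 +
            ∑ m ∈ S, A m k ^ 2 + A k k ^ 2)) := by
          have hm2 := momConst_nonneg c 2
          have hm4 := momConst_nonneg c 4
          have s1 : 0 ≤ ∑ m ∈ S, A k m ^ 2 := sum_nonneg fun _ _ => sq_nonneg _
          have s2 : 0 ≤ ∑ m ∈ S, A m k ^ 2 := sum_nonneg fun _ _ => sq_nonneg _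
          set x1 := ∑ m ∈ S, A k m ^ 2
          set x2 := ∑ m ∈ S, A m k ^ 2
          set x0 := ∑ l ∈ S, ∑ m ∈ S, A l m ^ 2
          have : quadConst c / N ^ 2 * (x0 + (x1 + x2 + A k k ^ 2)) -
              (quadConst c / N ^ 2 * x0 + (2 * 0 + (2 * 0 + (2 * ((momConst c 2 * ((2 * x1 +
              2 * x2) / N)) * (momConst c 2 * (1 / N))) +
              2 * (2 * A k k ^ 2 * ((momConst c 4 + momConst c 2 ^ 2) / N ^ 2)))))) =
              (4 * (momConst c 2 * momConst c 2) * A k k ^ 2 +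
                4 * (momConst c 4 + momConst c 2 ^ 2) * (x1 + x2)) / N ^ 2 := by
            rw [quadConst]; field_simp; ring
          have h2 : 0 ≤ (4 * (momConst c 2 * momConst c 2) * A k k ^ 2 +
                4 * (momConst c 4 + momConst c 2 ^ 2) * (x1 + x2)) / (N : ℝ) ^ 2 := by positivity
          linarith
      _ = _ := by
          simp only [sum_insert hk, sum_add_distrib]
          ring

theorem RowLaw.lintegral_quad_sq_le (h : RowLaw P a v c N) (A : Matrix ι ι ℝ) :
    ∫⁻ ω, ofReal (|a ω ⬝ᵥ (A *ᵥ a ω) - ∑ l, v l * A l l| ^ 2) ∂P ≤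
      ofReal (quadConst c / N ^ 2 * frob A ^ 2) := by
  have e : ∀ ω, a ω ⬝ᵥ (A *ᵥ a ω) = ∑ l, ∑ m, A l m * (a ω l * a ω m) := fun ω => by
    simp only [dotProduct, mulVec, mul_sum]
    exact sum_congr rfl fun l _ => sum_congr rfl fun m _ => by ring
  have := h.integral_quad_sq_le A univ
  rw [frob_sq]
  simp only [sq_abs, nrm_sq, e]
  rw [← ofReal_integral_eq_lintegral_ofReal]
  · exact ofReal_le_ofReal this
  · have bA : ∀ l, LpBdd (Ω := fun _ => Ω) (J := fun _ => Unit) (fun _ => P)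
        (fun _ _ ω => a ω l) := fun l => h.lpBdd.reindex fun _ _ => l
    have bC : ∀ x : ℝ, LpBdd (Ω := fun _ => Ω) (J := fun _ => Unit) (fun _ => P)
        (fun _ _ _ => x) := fun x => LpBdd.const x
    exact (((LpBdd.sum univ fun l _ => LpBdd.sum univ fun m _ =>
      (bC (A l m)).mul ((bA l).mul (bA m))).sub (bC (∑ l, v l * A l l))).pow 2).integrable 0 ()
  · exact Eventually.of_forall fun _ => sq_nonneg _

/-! #### Characteristic functions of linear forms -/

theorem norm_exp_I_sub_taylor_le (x : ℝ) :
    ‖Complex.exp (Complex.I * x) - (1 + Complex.I * x - (x : ℂ) ^ 2 / 2)‖ ≤ 4 * |x| ^ 3 := by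
  rcases le_total |x| 1 with h | h
  · have h1 := Complex.norm_exp_sub_sum_le_norm_mul_exp (Complex.I * x) 3
    have h2 : ∑ m ∈ range 3, (Complex.I * x) ^ m / (m.factorial : ℂ) =
        1 + Complex.I * x - (x : ℂ) ^ 2 / 2 := by
      simp [sum_range_succ, mul_pow, Nat.factorial]
      ring
    rw [h2] at h1
    have h3 : ‖Complex.I * (x : ℂ)‖ = |x| := by simp
    rw [h3] at h1
    refine h1.trans ?_
    have : exp |x| ≤ 4 := by
      have := exp_le_exp.2 h
      linarith [Real.exp_one_lt_d9]
    have : 0 ≤ |x| ^ 3 := by positivity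
    nlinarith
  · have h1 : ‖Complex.exp (Complex.I * x)‖ = 1 := Complex.norm_exp_I_mul_ofReal x
    have h2 : ‖1 + Complex.I * x - (x : ℂ) ^ 2 / 2‖ ≤ 1 + |x| + |x| ^ 2 / 2 := by
      refine (norm_sub_le _ _).trans (add_le_add ((norm_add_le _ _).trans ?_) ?_)
      · simp
      · simp
    refine (norm_sub_le _ _).trans ?_
    rw [h1]
    have h3 : |x| ≤ |x| ^ 3 := le_self_pow₀ h (by norm_num)
    have h4 : |x| ^ 2 ≤ |x| ^ 3 := pow_le_pow_right₀ h (by norm_num)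
    linarith

theorem abs_exp_neg_sub_le {x : ℝ} (hx : 0 ≤ x) : |exp (-x) - (1 - x)| ≤ x * √x := by
  have h1 : 1 - x ≤ exp (-x) := by linarith [add_one_le_exp (-x)]
  rw [abs_of_nonneg (by linarith)]
  rcases le_total x 1 with h | h
  · have h2 := Real.abs_exp_sub_one_sub_id_le (x := -x) (by rwa [abs_neg, abs_of_nonneg hx])
    have h3 : x ≤ √x := Real.le_sqrt_of_sq_le (by nlinarith)
    have := (abs_le.1 h2).2
    nlinarith
  · have h2 : exp (-x) ≤ 1 := Real.exp_le_one_iff.2 (by linarith)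
    have h3 : 1 ≤ √x := Real.one_le_sqrt.2 h
    nlinarith

theorem norm_prod_sub_prod_le {κ : Type*} (s : Finset κ) {x y : κ → ℂ} (hx : ∀ i, ‖x i‖ ≤ 1)
    (hy : ∀ i, ‖y i‖ ≤ 1) : ‖∏ i ∈ s, x i - ∏ i ∈ s, y i‖ ≤ ∑ i ∈ s, ‖x i - y i‖ := by
  classical
  induction s using induction_on with
  | empty => simp
  | insert k s hk ih =>
    rw [Finset.prod_insert hk, Finset.prod_insert hk, sum_insert hk]
    have h1 : x k * ∏ i ∈ s, x i - y k * ∏ i ∈ s, y i =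
        (x k - y k) * ∏ i ∈ s, x i + y k * (∏ i ∈ s, x i - ∏ i ∈ s, y i) := by ring
    have h2 : ‖∏ i ∈ s, x i‖ ≤ 1 := by
      rw [norm_prod]; exact Finset.prod_le_one (fun _ _ => norm_nonneg _) fun i _ => hx i
    rw [h1]
    refine (norm_add_le _ _).trans (add_le_add ?_ ?_)
    · rw [norm_mul]; exact mul_le_of_le_one_right (norm_nonneg _) h2
    · rw [norm_mul]
      exact (mul_le_of_le_one_left (norm_nonneg _) (hy k)).trans ih

/-- The constant in the Gaussian approximation of characteristic functions. -/
def cltConst (c : ℝ) : ℝ := 4 * momConst c 3 + momConst c 2 * √(momConst c 2)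

theorem RowLaw.charFun_apply_sub_le (h : RowLaw P a v c N) (l : ι) (u : ℝ) :
    ‖∫ ω, cis(u * a ω l) ∂P -
      ((exp (-(v l * u ^ 2 / 2)) : ℝ) : ℂ)‖ ≤ cltConst c * (|u| / √N) ^ 3 := by
  have hN : (0 : ℝ) < N := by exact_mod_cast h.N_pos
  have bA : LpBdd (Ω := fun _ => Ω) (J := fun _ => Unit) (fun _ => P)
        (fun _ _ ω => a ω l) := h.lpBdd.reindex fun _ _ => l
  have i1 := bA.integrable 0 ()
  have i2 := (bA.pow 2).integrable 0 ()
  have i3 := (bA.abs.pow 3).integrable 0 ()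
  have hm := h.meas_apply l
  have e1 : ∫ ω, (1 + Complex.I * ((u * a ω l : ℝ) : ℂ) - ((u * a ω l : ℝ) : ℂ) ^ 2 / 2) ∂P =
      ((1 - v l * u ^ 2 / 2 : ℝ) : ℂ) := by
    have c1 : Integrable (fun ω => (((u * a ω l : ℝ)) : ℂ)) P := (i1.const_mul u).ofReal
    have c2 : Integrable (fun ω => (((u ^ 2 / 2 * a ω l ^ 2 : ℝ)) : ℂ)) P :=
      (i2.const_mul (u ^ 2 / 2)).ofReal
    have : ∀ ω, 1 + Complex.I * ((u * a ω l : ℝ) : ℂ) - ((u * a ω l : ℝ) : ℂ) ^ 2 / 2 =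
        (1 + Complex.I * ((u * a ω l : ℝ) : ℂ)) - ((u ^ 2 / 2 * a ω l ^ 2 : ℝ) : ℂ) := fun ω => by
      push_cast; ring
    simp only [this]
    have c3 : Integrable (fun ω => 1 + Complex.I * ((u * a ω l : ℝ) : ℂ)) P :=
      (integrable_const 1).add (c1.const_mul _)
    rw [integral_sub c3 c2, integral_add (integrable_const 1) (c1.const_mul _),
      integral_const_mul, integral_complex_ofReal, integral_complex_ofReal, integral_const_mul,
      integral_const_mul, h.mean l, h.var l]
    simp
    ring
  have hexp : Integrable (fun ω => cis(u * a ω l)) P := by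
    refine Integrable.of_bound (C := 1) ?_ (.of_forall fun ω => ?_)
    · exact Measurable.aestronglyMeasurable (by fun_prop)
    · exact (Complex.norm_exp_I_mul_ofReal _).le
  have hpol : Integrable (fun ω => 1 + Complex.I * ((u * a ω l : ℝ) : ℂ) -
      ((u * a ω l : ℝ) : ℂ) ^ 2 / 2) P := by
    have c1 : Integrable (fun ω => (((u * a ω l : ℝ)) : ℂ)) P := (i1.const_mul u).ofReal
    have c2 : Integrable (fun ω => (((u * a ω l : ℝ)) : ℂ) ^ 2) P := by
      refine ((i2.const_mul (u ^ 2)).ofReal (𝕜 := ℂ)).congr (.of_forall fun ω => ?_)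
      simp [mul_pow]
    exact ((integrable_const 1).add (c1.const_mul _)).sub (c2.div_const 2)
  have hA : ‖∫ ω, cis(u * a ω l) ∂P -
      ((1 - v l * u ^ 2 / 2 : ℝ) : ℂ)‖ ≤ 4 * momConst c 3 * (|u| / √N) ^ 3 := by
    rw [← e1, ← integral_sub hexp hpol]
    refine (norm_integral_le_integral_norm _).trans ?_
    calc _ ≤ ∫ ω, 4 * |u| ^ 3 * |a ω l| ^ 3 ∂P := by
          refine integral_mono (hexp.sub hpol).norm (i3.const_mul _) fun ω => ?_
          refine (norm_exp_I_sub_taylor_le _).trans (le_of_eq ?_)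
          rw [abs_mul, mul_pow, mul_assoc]
      _ = 4 * |u| ^ 3 * ∫ ω, |a ω l| ^ 3 ∂P := integral_const_mul _ _
      _ ≤ 4 * |u| ^ 3 * (momConst c 3 * (1 / √N) ^ 3) := by
          gcongr; exact h.integral_abs_pow_le l 3
      _ = _ := by ring
  have hB : ‖((1 - v l * u ^ 2 / 2 : ℝ) : ℂ) - ((exp (-(v l * u ^ 2 / 2)) : ℝ) : ℂ)‖ ≤
      momConst c 2 * √(momConst c 2) * (|u| / √N) ^ 3 := by
    have hv := h.var_nonneg l
    rw [← Complex.ofReal_sub, Complex.norm_real, norm_eq_abs, abs_sub_comm]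
    refine (abs_exp_neg_sub_le (by positivity)).trans ?_
    have hle : v l * u ^ 2 / 2 ≤ momConst c 2 * (|u| / √N) ^ 2 := by
      rw [div_pow, sq_abs, sq_sqrt hN.le]
      have := mul_le_mul_of_nonneg_right (h.var_le l) (sq_nonneg u)
      have h0 : 0 ≤ v l * u ^ 2 := by positivity
      calc v l * u ^ 2 / 2 ≤ v l * u ^ 2 := by linarith
        _ ≤ _ := this
        _ = _ := by ring
    calc _ ≤ (momConst c 2 * (|u| / √N) ^ 2) * √(momConst c 2 * (|u| / √N) ^ 2) := by
          have := momConst_nonneg c 2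
          gcongr
      _ = _ := by
          rw [Real.sqrt_mul (momConst_nonneg _ _), Real.sqrt_sq (by positivity)]; ring
  calc _ ≤ _ := norm_sub_le_norm_sub_add_norm_sub _ (((1 - v l * u ^ 2 / 2 : ℝ)) : ℂ) _
    _ ≤ _ := add_le_add hA hB
    _ = _ := by rw [cltConst]; ring

theorem RowLaw.charFun_dotProduct_sub_le (h : RowLaw P a v c N) (u : ι → ℝ) :
    ‖∫ ω, cis(a ω ⬝ᵥ u) ∂P -
      ((exp (-((∑ l, v l * u l ^ 2) / 2)) : ℝ) : ℂ)‖ ≤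
        cltConst c * ∑ l, (|u l| / √N) ^ 3 := by
  have e1 : ∀ ω, cis(a ω ⬝ᵥ u) =
      ∏ l, cis(u l * a ω l) := fun ω => by
    rw [← Complex.exp_sum, ← mul_sum, ← Complex.ofReal_sum]
    simp only [dotProduct, mul_comm]
  have e2 : ∫ ω, ∏ l, cis(u l * a ω l) ∂P =
      ∏ l, ∫ ω, cis(u l * a ω l) ∂P := by
    have hmeas : ∀ l, Measurable fun x : ℝ => cis(u l * x) :=
      fun l => by fun_prop
    exact (h.indep.comp (fun l x => cis(u l * x))
      hmeas).integral_fun_prod_eq_prod_integral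
        fun l => ((hmeas l).comp (h.meas_apply l)).aestronglyMeasurable
  have e3 : ((exp (-((∑ l, v l * u l ^ 2) / 2)) : ℝ) : ℂ) =
      ∏ l, ((exp (-(v l * u l ^ 2 / 2)) : ℝ) : ℂ) := by
    rw [← Complex.ofReal_prod, ← Real.exp_sum, Finset.sum_neg_distrib, sum_div]
  simp only [e1]
  rw [e2, e3]
  refine (norm_prod_sub_prod_le _ (fun l => ?_) fun l => ?_).trans ?_
  · refine (norm_integral_le_integral_norm _).trans ?_
    simp only [Complex.norm_exp_I_mul_ofReal]
    simp
  · rw [Complex.norm_real, norm_eq_abs, Real.abs_exp, Real.exp_le_one_iff]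
    have := h.var_nonneg l
    have : 0 ≤ v l * u l ^ 2 / 2 := by positivity
    linarith
  · rw [mul_sum]
    exact sum_le_sum fun l _ => h.charFun_apply_sub_le l (u l)

end IndepForms

/-! ### Convergence of expectations from convergence of characteristic functions -/

/-- The filter of large `n`, uniformly in the second index. -/
def unif (J : ℕ → Type*) : Filter (Σ n, J n) := comap Sigma.fst atTop

instance (J : ℕ → Type*) : (unif J).IsCountablyGenerated := by unfold unif; infer_instance

theorem eventually_unif {J : ℕ → Type*} {q : (Σ n, J n) → Prop} :
    (∀ᶠ x in unif J, q x) ↔ ∀ᶠ n in atTop, ∀ j, q ⟨n, j⟩ := by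
  unfold unif
  rw [eventually_comap]
  refine eventually_congr (.of_forall fun n => ⟨fun h j => h _ rfl, ?_⟩)
  rintro h ⟨_, j⟩ rfl
  exact h j

theorem unif_neBot {J : ℕ → Type*} (hJ : ∀ᶠ n in atTop, Nonempty (J n)) : (unif J).NeBot := by
  rw [neBot_iff]
  intro h
  have h1 : ∀ᶠ x in unif J, False := by rw [h]; exact eventually_bot
  rw [eventually_unif] at h1
  obtain ⟨n, h2, ⟨j⟩⟩ := (h1.and hJ).exists
  exact h2 j

theorem LpSmall.tendsto_integral_abs {Ω : ℕ → Type*} [∀ n, MeasurableSpace (Ω n)]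
    {P : ∀ n, Measure (Ω n)} [∀ n, IsProbabilityMeasure (P n)] {J : ℕ → Type*}
    {Z : ∀ n, J n → Ω n → ℝ} (hZ : LpSmall P Z) :
    Tendsto (fun x : Σ n, J n => ∫ ω, |Z x.1 x.2 ω| ∂P x.1) (unif J) (𝓝 0) := by
  rw [Metric.tendsto_nhds]
  intro ε hε
  rw [eventually_unif]
  filter_upwards [hZ.integral_abs_le (half_pos hε)] with n hn j
  rw [dist_eq, sub_zero, abs_of_nonneg (integral_nonneg fun _ => abs_nonneg _)]
  linarith [hn j]

theorem norm_exp_I_sub_le (x y : ℝ) :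
    ‖Complex.exp (Complex.I * x) - Complex.exp (Complex.I * y)‖ ≤ |x - y| := by
  have h1 : Complex.exp (Complex.I * x) - Complex.exp (Complex.I * y) =
      Complex.exp (Complex.I * y) * (cis(x - y) - 1) := by
    rw [mul_sub, ← Complex.exp_add, mul_one]
    congr 2
    push_cast
    ring
  rw [h1, norm_mul, mul_comm Complex.I (y : ℂ), Complex.norm_exp_ofReal_mul_I, one_mul]
  simpa using Real.norm_exp_I_mul_ofReal_sub_one_le (x := x - y)

section CharFun

variable {I : Type*} {𝓕 : Filter I} [𝓕.IsCountablyGenerated] {Ω : I → Type*}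
  [∀ i, MeasurableSpace (Ω i)] {P : ∀ i, Measure (Ω i)} [∀ i, IsProbabilityMeasure (P i)]
  {Ω' : Type*} [MeasurableSpace Ω'] {γ : Measure Ω'} [IsProbabilityMeasure γ]
  {κ κ' : Type*} [Fintype κ] [Fintype κ']

/-- The law of a random vector, on the Euclidean space. -/
def vecLaw {Ω : Type*} [MeasurableSpace Ω] (P : Measure Ω) [IsProbabilityMeasure P]
    {W : Ω → κ → ℝ} (hW : Measurable W) : ProbabilityMeasure (EuclideanSpace ℝ κ) :=
  ⟨P.map fun ω => toLp 2 (W ω), Measure.isProbabilityMeasure_map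
    (((WithLp.measurable_toLp 2 _).comp hW).aemeasurable)⟩

theorem charFun_vecLaw {Ω : Type*} [MeasurableSpace Ω] (P : Measure Ω) [IsProbabilityMeasure P]
    {W : Ω → κ → ℝ} (hW : Measurable W) (u : EuclideanSpace ℝ κ) :
    charFun (vecLaw P hW : Measure (EuclideanSpace ℝ κ)) u =
      ∫ ω, cis(W ω ⬝ᵥ u.ofLp) ∂P := by
  have hm : Measurable fun ω => (toLp 2 (W ω) : EuclideanSpace ℝ κ) :=
    (WithLp.measurable_toLp 2 _).comp hW
  rw [charFun_apply]
  change ∫ x, _ ∂(P.map fun ω => (toLp 2 (W ω) : EuclideanSpace ℝ κ)) = _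
  rw [integral_map hm.aemeasurable (by fun_prop)]
  refine integral_congr_ae (.of_forall fun ω => ?_)
  dsimp only
  rw [mul_comm]
  congr 3
  simp [PiLp.inner_apply, dotProduct, mul_comm]

theorem integral_vecLaw {Ω : Type*} [MeasurableSpace Ω] (P : Measure Ω) [IsProbabilityMeasure P]
    {W : Ω → κ → ℝ} (hW : Measurable W) {E : Type*} [NormedAddCommGroup E] [NormedSpace ℝ E]
    {φ : (κ → ℝ) → E} (hφ : Continuous φ) :
    ∫ x, φ x.ofLp ∂(vecLaw P hW : Measure (EuclideanSpace ℝ κ)) = ∫ ω, φ (W ω) ∂P := by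
  have hm : Measurable fun ω => (toLp 2 (W ω) : EuclideanSpace ℝ κ) :=
    (WithLp.measurable_toLp 2 _).comp hW
  change ∫ x, _ ∂(P.map fun ω => (toLp 2 (W ω) : EuclideanSpace ℝ κ)) = _
  have hφ' : Continuous fun x : EuclideanSpace ℝ κ => φ x.ofLp :=
    hφ.comp (PiLp.continuous_ofLp 2 _)
  rw [integral_map hm.aemeasurable hφ'.aestronglyMeasurable]

variable {W : ∀ i, Ω i → κ → ℝ} (hW : ∀ i, Measurable (W i)) {W' : Ω' → κ → ℝ}
  (hW' : Measurable W')
  (hch : ∀ u : κ → ℝ, Tendsto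
    (fun i => ∫ ω, cis(W i ω ⬝ᵥ u) ∂P i) 𝓕
    (𝓝 (∫ ω, cis(W' ω ⬝ᵥ u) ∂γ)))

include hW hW' hch

theorem tendsto_vecLaw :
    Tendsto (fun i => vecLaw (P i) (hW i)) 𝓕 (𝓝 (vecLaw γ hW')) := by
  refine tendsto_of_seq_tendsto fun x hx => ?_
  refine ProbabilityMeasure.tendsto_of_tendsto_charFun fun u => ?_
  simp only [Function.comp_apply, charFun_vecLaw]
  exact (hch u.ofLp).comp hx

theorem tendsto_integral_bounded {𝕜 : Type*} [RCLike 𝕜] {φ : (κ → ℝ) → 𝕜} (hφ : Continuous φ)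
    {C : ℝ} (hC : ∀ x, ‖φ x‖ ≤ C) :
    Tendsto (fun i => ∫ ω, φ (W i ω) ∂P i) 𝓕 (𝓝 (∫ ω, φ (W' ω) ∂γ)) := by
  have h1 := tendsto_vecLaw hW hW' hch
  rw [ProbabilityMeasure.tendsto_iff_forall_integral_rclike_tendsto 𝕜] at h1
  have hφ' : Continuous fun x : EuclideanSpace ℝ κ => φ x.ofLp :=
    hφ.comp (PiLp.continuous_ofLp 2 _)
  have h2 := h1 (BoundedContinuousFunction.ofNormedAddCommGroup
    (fun x : EuclideanSpace ℝ κ => φ x.ofLp) hφ' C fun x => hC _)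
  simp only [BoundedContinuousFunction.coe_ofNormedAddCommGroup] at h2
  rw [integral_vecLaw γ hW' hφ] at h2
  exact h2.congr fun i => integral_vecLaw (P i) (hW i) hφ

/-- The characteristic functions of random vectors `V i` that are close to the images of `W i` by
a continuous map. -/
theorem tendsto_charFun_of_close {e : (κ → ℝ) → κ' → ℝ} (he : Continuous e)
    {V : ∀ i, Ω i → κ' → ℝ} (hV : ∀ i, Measurable (V i))
    (hint : ∀ i a, Integrable (fun ω => V i ω a - e (W i ω) a) (P i))
    (hclose : ∀ a, Tendsto (fun i => ∫ ω, |V i ω a - e (W i ω) a| ∂P i) 𝓕 (𝓝 0)) (u : κ' → ℝ) :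
    Tendsto (fun i => ∫ ω, cis(V i ω ⬝ᵥ u) ∂P i) 𝓕
      (𝓝 (∫ ω, cis(e (W' ω) ⬝ᵥ u) ∂γ)) := by
  have hce : Continuous fun x : κ → ℝ => cis(e x ⬝ᵥ u) := by
    refine Complex.continuous_exp.comp (continuous_const.mul (Complex.continuous_ofReal.comp ?_))
    exact he.dotProduct continuous_const
  have hn : ∀ x : ℝ, ‖Complex.exp (Complex.I * (x : ℂ))‖ ≤ 1 := fun x => by
    rw [mul_comm, Complex.norm_exp_ofReal_mul_I]
  have h1 := tendsto_integral_bounded hW hW' hch hce fun x => hn (e x ⬝ᵥ u)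
  have h2 : Tendsto (fun i => ∑ a, |u a| * ∫ ω, |V i ω a - e (W i ω) a| ∂P i) 𝓕 (𝓝 0) := by
    have := tendsto_finsetSum univ fun a _ => (hclose a).const_mul |u a|
    simpa using this
  have h3 : Tendsto (fun i => ∫ ω, cis(V i ω ⬝ᵥ u) ∂P i -
      ∫ ω, cis(e (W i ω) ⬝ᵥ u) ∂P i) 𝓕 (𝓝 0) := by
    refine squeeze_zero_norm (fun i => ?_) h2
    have mV : Measurable fun ω => cis(V i ω ⬝ᵥ u) := by
      have : Measurable fun ω => V i ω ⬝ᵥ u :=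
        Finset.measurable_fun_sum _ fun l _ => ((measurable_pi_apply l).comp (hV i)).mul_const _
      fun_prop
    have mW : Measurable fun ω => cis(e (W i ω) ⬝ᵥ u) :=
      hce.measurable.comp (hW i)
    have iV : Integrable (fun ω => cis(V i ω ⬝ᵥ u)) (P i) :=
      Integrable.of_bound mV.aestronglyMeasurable 1 (.of_forall fun ω => hn _)
    have iW : Integrable (fun ω => cis(e (W i ω) ⬝ᵥ u)) (P i) :=
      Integrable.of_bound mW.aestronglyMeasurable 1 (.of_forall fun ω => hn _)
    rw [← integral_sub iV iW]
    calc _ ≤ ∫ ω, ∑ a, |u a| * |V i ω a - e (W i ω) a| ∂P i := by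
          refine norm_integral_le_of_norm_le
            (integrable_finsetSum _ fun a _ => (hint i a).abs.const_mul _)
            (.of_forall fun ω => (norm_exp_I_sub_le _ _).trans ?_)
          rw [← sub_dotProduct]
          refine (abs_sum_le_sum_abs _ _).trans (le_of_eq ?_)
          exact sum_congr rfl fun a _ => by rw [abs_mul, mul_comm]; rfl
      _ = _ := by
          rw [integral_finsetSum _ fun a _ => (hint i a).abs.const_mul _]
          simp only [integral_const_mul]
  simpa using h3.add h1

end CharFun

section Truncation

/-- Truncation of a real number at level `R`. -/
def clip (R x : ℝ) : ℝ := max (-R) (min x R)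

theorem continuous_clip (R : ℝ) : Continuous (clip R) := by unfold clip; fun_prop

theorem abs_clip_le {R : ℝ} (hR : 0 ≤ R) (x : ℝ) : |clip R x| ≤ R := by
  unfold clip
  rw [abs_le]
  exact ⟨le_max_left _ _, max_le (by linarith) (min_le_right _ _)⟩

theorem abs_sub_clip_le {R : ℝ} (hR : 0 < R) (x : ℝ) : |x - clip R x| ≤ x ^ 2 / R := by
  unfold clip
  rw [le_div_iff₀ hR]
  rcases le_total x R with h1 | h1
  · rw [min_eq_left h1]
    rcases le_total (-R) x with h2 | h2
    · rw [max_eq_right h2]; simp; positivity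
    · rw [max_eq_left h2, abs_of_nonpos (by linarith)]
      nlinarith
  · rw [min_eq_right h1, max_eq_right (by linarith), abs_of_nonneg (by linarith)]
    nlinarith

theorem abs_integral_sub_clip_le {Ω : Type*} [MeasurableSpace Ω] (P : Measure Ω)
    [IsProbabilityMeasure P] {Z : Ω → ℝ} (hZ : Measurable Z) {C : ℝ}
    (hC : ∫⁻ ω, ofReal (|Z ω| ^ 2) ∂P ≤ ofReal |C|) {R : ℝ} (hR : 0 < R) :
    |∫ ω, Z ω ∂P - ∫ ω, clip R (Z ω) ∂P| ≤ |C| / R := by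
  have i2 : Integrable (fun ω => Z ω ^ 2) P := by
    refine ⟨(hZ.pow_const 2).aestronglyMeasurable, ?_⟩
    rw [hasFiniteIntegral_iff_norm]
    refine lt_of_le_of_lt (le_of_eq ?_) (hC.trans_lt ofReal_lt_top)
    simp
  have i1 : Integrable Z P :=
    ((memLp_two_iff_integrable_sq hZ.aestronglyMeasurable).2 i2).integrable (by norm_num)
  have i3 : Integrable (fun ω => clip R (Z ω)) P :=
    Integrable.of_bound ((continuous_clip R).measurable.comp hZ).aestronglyMeasurable R
      (.of_forall fun ω => abs_clip_le hR.le _)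
  rw [← integral_sub i1 i3]
  calc |∫ ω, (Z ω - clip R (Z ω)) ∂P| ≤ ∫ ω, Z ω ^ 2 / R ∂P := by
        rw [← norm_eq_abs]
        exact norm_integral_le_of_norm_le (i2.div_const R)
          (.of_forall fun ω => abs_sub_clip_le hR _)
    _ = (∫ ω, Z ω ^ 2 ∂P) / R := integral_div _ _
    _ ≤ _ := by
        gcongr
        rw [integral_eq_lintegral_of_nonneg_ae (.of_forall fun _ => by positivity)
          i2.aestronglyMeasurable]
        refine toReal_le_of_le_ofReal (abs_nonneg _) ?_
        simpa only [sq_abs] using hC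

variable {I : Type*} {𝓕 : Filter I} {Ω : I → Type*}
  [∀ i, MeasurableSpace (Ω i)] {P : ∀ i, Measure (Ω i)} [∀ i, IsProbabilityMeasure (P i)]
  {Ω' : Type*} [MeasurableSpace Ω'] {γ : Measure Ω'} [IsProbabilityMeasure γ]
  {Z : ∀ i, Ω i → ℝ} (hZ : ∀ i, Measurable (Z i)) {Z' : Ω' → ℝ} (hZ' : Measurable Z') {C : ℝ}
  (hC : ∀ i, ∫⁻ ω, ofReal (|Z i ω| ^ 2) ∂P i ≤ ofReal C)
  (hlim : ∀ φ : ℝ → ℝ, Continuous φ → (∃ B, ∀ x, |φ x| ≤ B) →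
    Tendsto (fun i => ∫ ω, φ (Z i ω) ∂P i) 𝓕 (𝓝 (∫ ω, φ (Z' ω) ∂γ)))

include hZ hZ' hC hlim

theorem lintegral_sq_limit_le [𝓕.NeBot] :
    ∫⁻ ω, ofReal (|Z' ω| ^ 2) ∂γ ≤ ofReal |C| := by
  have h1 : ∀ m : ℕ, ∫⁻ ω, ofReal (min (|Z' ω| ^ 2) m) ∂γ ≤ ofReal |C| := by
    intro m
    have hnn : ∀ x : ℝ, 0 ≤ min (|x| ^ 2) (m : ℝ) := fun x => by positivity
    have hb : ∀ x : ℝ, |min (|x| ^ 2) (m : ℝ)| ≤ m := fun x => by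
      rw [abs_of_nonneg (hnn x)]; exact min_le_right _ _
    have hcont : Continuous fun x : ℝ => min (|x| ^ 2) (m : ℝ) := by fun_prop
    have h2 := hlim _ hcont ⟨m, hb⟩
    have h3 : ∫ ω, min (|Z' ω| ^ 2) (m : ℝ) ∂γ ≤ |C| := by
      refine le_of_tendsto h2 (.of_forall fun i => ?_)
      rw [integral_eq_lintegral_of_nonneg_ae (.of_forall fun ω => hnn _)
        (hcont.measurable.comp (hZ i)).aestronglyMeasurable]
      refine toReal_le_of_le_ofReal (abs_nonneg _) ?_
      refine (lintegral_mono fun ω => ofReal_le_ofReal (min_le_left _ _)).trans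
        ((hC i).trans (ofReal_le_ofReal (le_abs_self C)))
    have h4 : Integrable (fun ω => min (|Z' ω| ^ 2) (m : ℝ)) γ :=
      Integrable.of_bound (hcont.measurable.comp hZ').aestronglyMeasurable m
        (.of_forall fun ω => hb _)
    rw [← ofReal_integral_eq_lintegral_ofReal h4 (.of_forall fun ω => hnn _)]
    exact ofReal_le_ofReal h3
  have h2 : ∀ ω, ofReal (|Z' ω| ^ 2) =
      liminf (fun m : ℕ => ofReal (min (|Z' ω| ^ 2) m)) atTop := fun ω => by
    symm
    refine Tendsto.liminf_eq (tendsto_const_nhds.congr' ?_)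
    obtain ⟨m₀, hm₀⟩ := exists_nat_ge (|Z' ω| ^ 2)
    filter_upwards [eventually_ge_atTop m₀] with m hm
    rw [min_eq_left (hm₀.trans (by exact_mod_cast hm))]
  simp only [h2]
  refine (lintegral_liminf_le fun m => ?_).trans ?_
  · exact ((hZ'.abs.pow_const 2).min measurable_const).ennreal_ofReal
  · exact (liminf_le_limsup).trans (limsup_le_of_le (by isBoundedDefault)
      (.of_forall h1))

theorem integrable_limit [𝓕.NeBot] : Integrable Z' γ := by
  have h1 : MemLp Z' 2 γ := by
    rw [memLp_two_iff_integrable_sq hZ'.aestronglyMeasurable]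
    refine ⟨(hZ'.pow_const 2).aestronglyMeasurable, ?_⟩
    rw [hasFiniteIntegral_iff_norm]
    refine lt_of_le_of_lt (le_of_eq ?_) ((lintegral_sq_limit_le hZ hZ' hC hlim).trans_lt
      ofReal_lt_top)
    simp
  exact h1.integrable (by norm_num)

theorem tendsto_integral_of_sq_bdd :
    Tendsto (fun i => ∫ ω, Z i ω ∂P i) 𝓕 (𝓝 (∫ ω, Z' ω ∂γ)) := by
  rcases 𝓕.eq_or_neBot with rfl | _
  · exact tendsto_bot
  rw [Metric.tendsto_nhds]
  intro ε hε
  set R : ℝ := 4 * (|C| + 1) / ε with hR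
  have hR0 : 0 < R := by positivity
  have hCR : |C| / R ≤ ε / 4 := by
    rw [hR, div_le_iff₀ (by positivity)]
    field_simp
    linarith
  have h1 := hlim _ (continuous_clip R) ⟨R, abs_clip_le hR0.le⟩
  rw [Metric.tendsto_nhds] at h1
  filter_upwards [h1 (ε / 4) (by positivity)] with i hi
  have e1 := abs_integral_sub_clip_le (P i) (hZ i)
    ((hC i).trans (ofReal_le_ofReal (le_abs_self C))) hR0
  have e2 := abs_integral_sub_clip_le γ hZ' (lintegral_sq_limit_le hZ hZ' hC hlim) hR0
  rw [dist_eq] at hi ⊢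
  have e3 := abs_sub_le (∫ ω, Z i ω ∂P i) (∫ ω, clip R (Z i ω) ∂P i) (∫ ω, Z' ω ∂γ)
  have e4 := abs_sub_le (∫ ω, clip R (Z i ω) ∂P i) (∫ ω, clip R (Z' ω) ∂γ) (∫ ω, Z' ω ∂γ)
  rw [abs_sub_comm (∫ ω, clip R (Z' ω) ∂γ)] at e4
  linarith

end Truncation

/-! ### Random systems -/

section Measurability

variable {Ω : Type*} [MeasurableSpace Ω] {ι : Type*} [Fintype ι] [DecidableEq ι]
  {Ξ : Type*} [MeasurableSpace Ξ]

/-- The nonlinearity at the site `l` is determined by the type `ty l` and the side information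
`ξ l`. -/
def siteF (ty : ι → Bool) (f : Act(Bool × Ξ)) (ξ : ι → Ξ) :
    Act(ι) := fun t l => f t (ty l, ξ l)

/-- The derivatives of the nonlinearities. -/
def siteD (ty : ι → Bool) (p : Grad(Bool × Ξ)) (ξ : ι → Ξ) :
    Grad(ι) := fun t s l => p t s (ty l, ξ l)

/-- Entrywise measurability of a random matrix. -/
def MeasM (A : Ω → Matrix ι ι ℝ) : Prop := ∀ i j, Measurable fun ω => A ω i j

theorem measurable_nrm : Measurable (nrm : (ι → ℝ) → ℝ) := by
  have : (nrm : (ι → ℝ) → ℝ) = fun v => √(∑ i, v i ^ 2) := funext nrm_eq_sqrt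
  rw [this]
  fun_prop

theorem measurable_nsq : Measurable (nsq : (ι → ℝ) → ℝ) := by
  unfold nsq
  exact measurable_nrm.comp (by fun_prop)

theorem measurable_off (k : ι) : Measurable (off k) := by
  unfold off
  refine measurable_pi_iff.2 fun l => ?_
  split_ifs
  · exact measurable_const
  · exact measurable_pi_apply l

variable {A B : Ω → Matrix ι ι ℝ}

theorem MeasM.mask (hA : MeasM A) (S : Finset ι) : MeasM fun ω => mask S (A ω) := fun i j => by
  simp only [mask_apply]
  split_ifs
  · exact measurable_const
  · exact hA i j

theorem MeasM.mul (hA : MeasM A) (hB : MeasM B) : MeasM fun ω => A ω * B ω := fun i j => by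
  simp only [Matrix.mul_apply]
  exact Finset.measurable_fun_sum _ fun l _ => (hA i l).mul (hB l j)

theorem MeasM.sub (hA : MeasM A) (hB : MeasM B) : MeasM fun ω => A ω - B ω := fun i j => by
  simp only [Matrix.sub_apply]
  exact (hA i j).sub (hB i j)

theorem MeasM.row (hA : MeasM A) (k : ι) : Measurable fun ω => (A ω k : ι → ℝ) :=
  measurable_pi_iff.2 fun l => hA k l

theorem MeasM.mulVec (hA : MeasM A) {v : Ω → ι → ℝ} (hv : Measurable v) :
    Measurable fun ω => A ω *ᵥ v ω :=
  measurable_pi_iff.2 fun i => Finset.measurable_fun_sum _ fun l _ =>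
    (hA i l).mul ((measurable_pi_apply l).comp hv)

theorem MeasM.frob (hA : MeasM A) : Measurable fun ω => frob (A ω) :=
  measurable_nrm.comp (measurable_pi_iff.2 fun q => hA q.1 q.2)

theorem measurable_dotProduct {u v : Ω → ι → ℝ} (hu : Measurable u) (hv : Measurable v) :
    Measurable fun ω => u ω ⬝ᵥ v ω :=
  Finset.measurable_fun_sum _ fun l _ =>
    ((measurable_pi_apply l).comp hu).mul ((measurable_pi_apply l).comp hv)

theorem MeasM.resp {Q : Ω → ℕ → ℕ → ι → ℝ} (hQ : ∀ t s, Measurable fun ω => Q ω t s)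
    (hA : MeasM A) (s t : ℕ) : MeasM fun ω => resp (Q ω) (A ω) s t := by
  induction t using strongRecOn with
  | _ t ih =>
    rcases lt_or_ge s t with hst | hst
    · intro i j
      simp only [resp_apply_eq _ _ hst]
      refine Measurable.add ?_ (Finset.measurable_fun_sum _ fun r hr => Measurable.mul ?_ ?_)
      · split_ifs
        · exact (measurable_pi_apply i).comp (hQ t s)
        · exact measurable_const
      · exact (measurable_pi_apply i).comp (hQ t r)
      · exact (measurable_pi_apply i).comp (hA.mulVec
          (measurable_pi_iff.2 fun m => ih r (mem_range.1 hr) m j))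
    · intro i j
      simp only [resp_of_le _ _ hst]
      exact measurable_const

variable {ty : ι → Bool} {f : Act(Bool × Ξ)} {p : Grad(Bool × Ξ)}
  {ξ : Ω → ι → Ξ}

theorem measurable_sysY (hf : ∀ t, Measurable fun q : (Bool × Ξ) × (ℕ → ℝ) => f t q.1 q.2)
    (hξ : Measurable ξ) (hA : MeasM A) (t : ℕ) :
    Measurable fun ω => sysY (siteF ty f (ξ ω)) (A ω) t := by
  induction t using strongRecOn with
  | _ t ih =>
    refine measurable_pi_iff.2 fun l => ?_
    have e : ∀ ω, sysY (siteF ty f (ξ ω)) (A ω) t l = f t (ty l, ξ ω l) fun s =>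
        if s < t then (A ω *ᵥ sysY (siteF ty f (ξ ω)) (A ω) s) l else 0 := fun ω => by
      rw [sysY]; rfl
    simp only [e]
    have hx : Measurable fun ω => (fun s =>
        if s < t then (A ω *ᵥ sysY (siteF ty f (ξ ω)) (A ω) s) l else 0 : ℕ → ℝ) := by
      refine measurable_pi_iff.2 fun s => ?_
      by_cases hs : s < t
      · simp only [if_pos hs]
        exact (measurable_pi_apply l).comp (hA.mulVec (ih s hs))
      · simp only [if_neg hs]
        exact measurable_const
    exact (hf t).comp (Measurable.prodMk (measurable_const.prodMk
      ((measurable_pi_apply l).comp hξ)) hx)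

theorem measurable_sysX (hf : ∀ t, Measurable fun q : (Bool × Ξ) × (ℕ → ℝ) => f t q.1 q.2)
    (hξ : Measurable ξ) (hA : MeasM A) (t : ℕ) :
    Measurable fun ω => sysX (siteF ty f (ξ ω)) (A ω) t :=
  hA.mulVec (measurable_sysY hf hξ hA t)

theorem measurable_sysP (hf : ∀ t, Measurable fun q : (Bool × Ξ) × (ℕ → ℝ) => f t q.1 q.2)
    (hp : ∀ t s, Measurable fun q : (Bool × Ξ) × (ℕ → ℝ) => p t s q.1 q.2)
    (hξ : Measurable ξ) (hA : MeasM A) (t s : ℕ) :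
    Measurable fun ω => sysP (siteF ty f (ξ ω)) (siteD ty p (ξ ω)) (A ω) t s := by
  refine measurable_pi_iff.2 fun l => ?_
  refine (hp t s).comp (Measurable.prodMk (measurable_const.prodMk
    ((measurable_pi_apply l).comp hξ)) (measurable_pi_iff.2 fun r => ?_))
  exact (measurable_pi_apply l).comp (measurable_sysX hf hξ hA r)

theorem measM_sysR (hf : ∀ t, Measurable fun q : (Bool × Ξ) × (ℕ → ℝ) => f t q.1 q.2)
    (hp : ∀ t s, Measurable fun q : (Bool × Ξ) × (ℕ → ℝ) => p t s q.1 q.2)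
    (hξ : Measurable ξ) (hA : MeasM A) (s t : ℕ) :
    MeasM fun ω => sysR (siteF ty f (ξ ω)) (siteD ty p (ξ ω)) (A ω) s t :=
  MeasM.resp (fun t s => measurable_sysP hf hp hξ hA t s) hA s t

end Measurability

section RandomSystem

open scoped Matrix.Norms.L2Operator

variable {Ω : ℕ → Type*} [∀ n, MeasurableSpace (Ω n)] {P : ∀ n, Measure (Ω n)}
  [∀ n, IsProbabilityMeasure (P n)] {ι : ℕ → Type} [∀ n, Fintype (ι n)] [∀ n, DecidableEq (ι n)]
  {Ξ : Type*} [MeasurableSpace Ξ] {N : ℕ → ℕ} {ty : ∀ n, ι n → Bool}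
  {M : ∀ n, Ω n → Matrix (ι n) (ι n) ℝ} {ξ : ∀ n, Ω n → ι n → Ξ}
  {f : Act(Bool × Ξ)} {p : Grad(Bool × Ξ)} {L : ℕ → ℝ} {c : ℝ}
  {J : ℕ → Type}

theorem mask_empty {κ : Type*} [DecidableEq κ] (A : Matrix κ κ ℝ) : mask ∅ A = A := by
  ext i j; simp [mask_apply]

theorem LpSmall.sqrt_of_nonneg {J : ℕ → Type*} {Z : ∀ n, J n → Ω n → ℝ} (hZ : LpSmall P Z)
    (h0 : ∀ n j ω, 0 ≤ Z n j ω) : LpSmall P fun n j ω => √(Z n j ω) :=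
  LpSmall.of_pow (k := 1) (fun n j => (hZ.meas n j).sqrt) <|
    hZ.mono (fun n j => ((hZ.meas n j).sqrt.abs.pow_const 2)) fun n j ω => by
      rw [abs_of_nonneg (sqrt_nonneg _), sq_sqrt (h0 n j ω)]

theorem abs_exp_neg_half_sub_le {a q : ℝ} (ha : 0 ≤ a) (hq : 0 ≤ q) :
    |exp (-(a / 2)) - exp (-(q / 2))| ≤ |a - q| / 2 := by
  have key : ∀ {x y : ℝ}, 0 ≤ x → x ≤ y →
      exp (-(x / 2)) - exp (-(y / 2)) ≤ (y - x) / 2 := by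
    intro x y hx hxy
    have h1 : exp (-(y / 2)) = exp (-(x / 2)) * exp (-((y - x) / 2)) := by
      rw [← exp_add]; congr 1; ring
    have h2 := add_one_le_exp (-((y - x) / 2))
    have h3 : exp (-(x / 2)) ≤ 1 := Real.exp_le_one_iff.2 (by linarith)
    have h4 := exp_pos (-(x / 2))
    rw [h1]
    nlinarith
  rcases le_total a q with h | h
  · rw [abs_of_nonneg (sub_nonneg.2 (exp_le_exp.2 (by linarith))), abs_sub_comm,
      abs_of_nonneg (sub_nonneg.2 h)]
    exact key ha h
  · rw [abs_sub_comm, abs_of_nonneg (sub_nonneg.2 (exp_le_exp.2 (by linarith))),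
      abs_of_nonneg (sub_nonneg.2 h)]
    exact key hq h

/-- The variances of the entries of the random matrix: only sites of different types interact. -/
def varProfile (N : ℕ) {ι : Type*} (ty : ι → Bool) (k l : ι) : ℝ :=
  if ty k = ty l then 0 else (N : ℝ)⁻¹

/-- A sequence of random symmetric first-order systems with independent entries, in which only
sites of different types interact. -/
structure CavityModel (P : ∀ n, Measure (Ω n)) (N : ℕ → ℕ) (ty : ∀ n, ι n → Bool)
    (M : ∀ n, Ω n → Matrix (ι n) (ι n) ℝ) (ξ : ∀ n, Ω n → ι n → Ξ)
    (f : Act(Bool × Ξ)) (p : Grad(Bool × Ξ)) (L : ℕ → ℝ) (c : ℝ) :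
    Prop where
  N_tendsto : Tendsto N atTop atTop
  card_le : ∀ n, (card (ι n) : ℝ) ≤ c * N n
  reg : Reg f p L
  meas_f : ∀ t, Measurable fun q : (Bool × Ξ) × (ℕ → ℝ) => f t q.1 q.2
  meas_p : ∀ t s, Measurable fun q : (Bool × Ξ) × (ℕ → ℝ) => p t s q.1 q.2
  meas_M : ∀ n, MeasM (M n)
  meas_ξ : ∀ n, Measurable (ξ n)
  symm : ∀ n ω k l, M n ω k l = M n ω l k
  same : ∀ n ω k l, ty n k = ty n l → M n ω k l = 0
  norm_bdd : LpBdd P fun n (_ : Unit) ω => ‖M n ω‖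
  f_bdd : ∀ t, LpBdd P fun n (l : ι n) ω => f t (ty n l, ξ n ω l) 0
  row : ∀ n k, RowLaw (P n) (fun ω => M n ω k) (varProfile (N n) (ty n) k) c (N n)
  row_indep : ∀ n k, IndepFun (fun ω => (M n ω k : ι n → ℝ))
    (fun ω => ((fun i j => mask {k} (M n ω) i j : ι n → ι n → ℝ), ξ n ω)) (P n)

local notation:max "V[" n "]" => varProfile (N n) (ty n)
local notation:max "sF[" n "," ω "]" => siteF (ty n) f (ξ n ω)
local notation:max "sD[" n "," ω "]" => siteD (ty n) p (ξ n ω)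

namespace CavityModel

variable (h : CavityModel P N ty M ξ f p L c)

include h

theorem N_pos (n : ℕ) (k : ι n) : (0 : ℝ) < N n := by exact_mod_cast (h.row n k).N_pos

theorem diag_zero (n : ℕ) (ω : Ω n) (k : ι n) : M n ω k k = 0 := h.same n ω k k rfl

theorem mask_diag_zero (n : ℕ) (ω : Ω n) (S : Finset (ι n)) (k : ι n) :
    mask S (M n ω) k k = 0 := by
  rw [mask_apply]; split_ifs; exacts [rfl, h.diag_zero n ω k]

theorem siteReg (n : ℕ) (ω : Ω n) :
    Reg sF[n,ω] sD[n,ω] L :=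
  h.reg.comap fun l => (ty n l, ξ n ω l)

theorem normB : LpBdd P fun n (_ : J n) ω => ‖M n ω‖ := h.norm_bdd.reindex fun _ _ => ()

theorem respBoundB (t : ℕ) : LpBdd P fun n (_ : J n) ω => respBound L ‖M n ω‖ t := by
  induction t using strongRecOn with
  | _ t ih =>
    simp only [respBound_eq L _ t]
    exact (LpBdd.const (L t)).add (LpBdd.sum _ fun r hr =>
      (h.normB.mul (ih r (mem_range.1 hr))).const_mul (L t))

theorem nrm_sysY_bdd (t : ℕ) : LpBdd P fun n (S : Finset (ι n)) ω =>
    nrm (sysY sF[n,ω] (mask S (M n ω)) t) / √(N n) := by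
  have hm : ∀ t n (S : Finset (ι n)), Measurable fun ω =>
      nrm (sysY sF[n,ω] (mask S (M n ω)) t) / √(N n) := fun t n S =>
    (measurable_nrm.comp
      (measurable_sysY h.meas_f (h.meas_ξ n) ((h.meas_M n).mask S) t)).div_const _
  have h0 : ∀ t, LpBdd P fun n (_ : Finset (ι n)) ω =>
      nrm (fun l => sF[n,ω] t l 0) / √(N n) := fun t => by
    have := (((h.f_bdd t).pow 2).reindex (K := fun n => Finset (ι n) × ι n) fun n q => q.2).average
      h.card_le |>.sqrt
    refine this.of_le (fun n S => (measurable_nrm.comp (measurable_pi_iff.2 fun l =>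
      (h.f_bdd t).meas n l)).div_const _) fun n S ω => ?_
    rw [abs_of_nonneg (div_nonneg (nrm_nonneg _) (sqrt_nonneg _)), nrm_eq_sqrt,
      ← Real.sqrt_div' _ (Nat.cast_nonneg _), div_eq_inv_mul]
    rfl
  induction t using strongRecOn with
  | _ t ih =>
    refine ((h0 t).add (LpBdd.sum (range t) (Z := fun s n S ω => L t * (‖M n ω‖ *
      (nrm (sysY sF[n,ω] (mask S (M n ω)) s) / √(N n)))) fun s hs =>
        (h.normB.mul (ih s (mem_range.1 hs))).const_mul (L t))).of_le (hm t)
          fun n S ω => ?_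
    rw [abs_of_nonneg (div_nonneg (nrm_nonneg _) (sqrt_nonneg _))]
    calc _ ≤ (nrm (fun l => sF[n,ω] t l 0) + L t * ∑ s ∈ range t,
          ‖M n ω‖ * nrm (sysY sF[n,ω] (mask S (M n ω)) s)) / √(N n) := by
          gcongr
          refine (nrm_sysY_le (h.siteReg n ω) _ t).trans ?_
          have := h.reg.L_nonneg t
          gcongr with s
          refine (nrm_sysX_le _ _ s).trans ?_
          gcongr
          exacts [nrm_nonneg _, norm_mask_le _ _]
      _ = _ := by
          rw [add_div, mul_sum, sum_div]
          congr 1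
          exact sum_congr rfl fun s _ => by ring

/-- A linear form in the row `k`, with coefficients that do not depend on the site `k`. -/
theorem dotProduct_bdd (k : ∀ n, J n → ι n) (g : ∀ n, J n → Ω n → ι n → ℝ)
    (G : ∀ n, J n → (ι n → ι n → ℝ) × (ι n → Ξ) → ι n → ℝ) (hG : ∀ n j, Measurable (G n j))
    (hgG : ∀ n j ω, g n j ω = G n j ((fun i j' => mask {k n j} (M n ω) i j'), ξ n ω))
    (hb : LpBdd P fun n j ω => nrm (g n j ω) / √(N n)) :
    LpBdd P fun n j ω => M n ω (k n j) ⬝ᵥ g n j ω := by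
  have hE : ∀ n j, Measurable fun ω =>
      ((fun i j' => mask {k n j} (M n ω) i j' : ι n → ι n → ℝ), ξ n ω) := fun n j =>
    (measurable_pi_iff.2 fun i => measurable_pi_iff.2 fun j' =>
      (h.meas_M n).mask _ i j').prodMk (h.meas_ξ n)
  refine ⟨fun n j => measurable_dotProduct ((h.meas_M n).row _) ?_, fun q => ?_⟩
  · have : g n j = fun ω => G n j ((fun i j' => mask {k n j} (M n ω) i j'), ξ n ω) :=
      funext (hgG n j)
    rw [this]
    exact (hG n j).comp (hE n j)
  · obtain ⟨C, hC⟩ := hb.2 q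
    refine ⟨momConst c q * C, fun n j => ?_⟩
    have := (h.row n (k n j)).moment_dotProduct_indep (hE n j) (h.row_indep n (k n j)) (hG n j) q
    simp only [← hgG] at this
    refine this.trans ?_
    simp only [ofReal_mul (momConst_nonneg c q)]
    rw [lintegral_const_mul' _ _ ofReal_ne_top]
    gcongr
    simpa only [abs_of_nonneg (div_nonneg (nrm_nonneg _) (sqrt_nonneg _))] using hC n j

theorem measM_mask (n : ℕ) (S : Finset (ι n)) : MeasM fun ω => mask S (M n ω) :=
  (h.meas_M n).mask S

theorem meas_sysY (n : ℕ) (S : Finset (ι n)) (t : ℕ) :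
    Measurable fun ω => sysY sF[n,ω] (mask S (M n ω)) t :=
  measurable_sysY h.meas_f (h.meas_ξ n) (h.measM_mask n S) t

theorem meas_sysX (n : ℕ) (S : Finset (ι n)) (t : ℕ) :
    Measurable fun ω => sysX sF[n,ω] (mask S (M n ω)) t :=
  measurable_sysX h.meas_f (h.meas_ξ n) (h.measM_mask n S) t

theorem meas_dY (n : ℕ) (S : Finset (ι n)) (k : ι n) (t : ℕ) :
    Measurable fun ω => dY sF[n,ω] (mask S (M n ω)) k t := by
  refine (measurable_off k).comp ((h.meas_sysY n S t).sub ?_)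
  simp only [mask_mask]
  exact h.meas_sysY n _ t

theorem meas_dX (n : ℕ) (S : Finset (ι n)) (k : ι n) (t : ℕ) :
    Measurable fun ω => dX sF[n,ω] (mask S (M n ω)) k t := by
  refine (measurable_off k).comp ((h.meas_sysX n S t).sub ?_)
  simp only [mask_mask]
  exact h.meas_sysX n _ t

theorem sysY_apply_bdd_of (t : ℕ)
    (hx : ∀ s < t, LpBdd P fun n (j : Finset (ι n) × ι n) ω =>
      sysX sF[n,ω] (mask j.1 (M n ω)) s j.2) :
    LpBdd P fun n (j : Finset (ι n) × ι n) ω =>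
      sysY sF[n,ω] (mask j.1 (M n ω)) t j.2 := by
  refine (((h.f_bdd t).reindex (K := fun n => Finset (ι n) × ι n) fun n j => j.2).abs.add
    ((LpBdd.sum (range t) fun s hs =>
      (hx s (mem_range.1 hs)).abs).const_mul (L t))).of_le
      (fun n j => (measurable_pi_apply j.2).comp (h.meas_sysY n j.1 t)) fun n j ω => ?_
  have := h.reg.lip t (ty n j.2, ξ n ω j.2) 0
    fun s => sysX sF[n,ω] (mask j.1 (M n ω)) s j.2
  rw [sysY_eq (h.siteReg n ω)]
  simp only [siteF, Pi.zero_apply, sub_zero] at this ⊢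
  have h2 := abs_sub_abs_le_abs_sub (f t (ty n j.2, ξ n ω j.2) fun s =>
    sysX sF[n,ω] (mask j.1 (M n ω)) s j.2) (f t (ty n j.2, ξ n ω j.2) 0)
  linarith

theorem nrm_dX_bdd_of (t : ℕ)
    (hy : ∀ s < t, LpBdd P fun n (j : Finset (ι n) × ι n) ω =>
      sysY sF[n,ω] (mask j.1 (M n ω)) s j.2) (s : ℕ) :
    (s ≤ t → LpBdd P fun n (j : Finset (ι n) × ι n) ω =>
      nrm (dY sF[n,ω] (mask j.1 (M n ω)) j.2 s)) ∧
    (s < t → LpBdd P fun n (j : Finset (ι n) × ι n) ω =>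
      nrm (dX sF[n,ω] (mask j.1 (M n ω)) j.2 s)) := by
  induction s using strongRecOn with
  | _ s ih =>
    have hY : s ≤ t → LpBdd P fun n (j : Finset (ι n) × ι n) ω =>
        nrm (dY sF[n,ω] (mask j.1 (M n ω)) j.2 s) := fun hs => by
      refine ((LpBdd.sum (range s) fun r hr => (ih r (mem_range.1 hr)).2
        ((mem_range.1 hr).trans_le hs)).const_mul (L s)).of_le
        (fun n j => measurable_nrm.comp (h.meas_dY n j.1 j.2 s)) fun n j ω => ?_
      rw [abs_of_nonneg (nrm_nonneg _)]
      exact nrm_dY_le (h.siteReg n ω) s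
    refine ⟨hY, fun hs => ?_⟩
    refine ((h.normB.mul (hY hs.le)).add ((hy s hs).abs.mul h.normB)).of_le
      (fun n j => measurable_nrm.comp (h.meas_dX n j.1 j.2 s)) fun n j ω => ?_
    rw [abs_of_nonneg (nrm_nonneg _)]
    refine (nrm_dX_le (mask_symm (h.symm n ω) _) (h.mask_diag_zero n ω _ _) s).trans ?_
    have := norm_mask_le j.1 (M n ω)
    gcongr
    exact nrm_nonneg _

/-- The cavity field of a site: the field created by the system without that site. -/
theorem cavityField_bdd (t : ℕ) : LpBdd P fun n (j : Finset (ι n) × ι n) ω =>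
    mask j.1 (M n ω) j.2 ⬝ᵥ
      sysY sF[n,ω] (mask {j.2} (mask j.1 (M n ω))) t := by
  have e : ∀ n (j : Finset (ι n) × ι n) ω (v : ι n → ℝ), mask j.1 (M n ω) j.2 ⬝ᵥ v =
      M n ω j.2 ⬝ᵥ fun l => if j.2 ∈ j.1 ∨ l ∈ j.1 then 0 else v l := fun n j ω v => by
    refine sum_congr rfl fun l _ => ?_
    rw [mask_apply]
    dsimp only
    by_cases hS : j.2 ∈ j.1 ∨ l ∈ j.1
    · rw [if_pos hS, if_pos hS, zero_mul, mul_zero]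
    · rw [if_neg hS, if_neg hS]
  simp only [e]
  refine h.dotProduct_bdd (J := fun n => Finset (ι n) × ι n) (fun n j => j.2) _
    (fun n j q l => if j.2 ∈ j.1 ∨ l ∈ j.1 then 0 else
      sysY (siteF (ty n) f q.2) (mask j.1 (of q.1)) t l) (fun n j => ?_)
    (fun n j ω => ?_) ?_
  · refine measurable_pi_iff.2 fun l => ?_
    split_ifs
    · exact measurable_const
    · refine (measurable_pi_apply l).comp (measurable_sysY h.meas_f measurable_snd
        (MeasM.mask (fun i j' => ?_) j.1) t)
      exact (measurable_pi_apply j').comp ((measurable_pi_apply i).comp measurable_fst)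
  · ext l
    have : of (fun i j' => mask {j.2} (M n ω) i j') = mask {j.2} (M n ω) := rfl
    simp only [this, mask_mask, Finset.union_comm]
  · refine ((h.nrm_sysY_bdd t).reindex (K := fun n => Finset (ι n) × ι n)
      fun n j => {j.2} ∪ j.1).of_le (fun n j => ?_) fun n j ω => ?_
    · refine (measurable_nrm.comp (measurable_pi_iff.2 fun l => ?_)).div_const _
      split_ifs
      · exact measurable_const
      · simp only [mask_mask]
        exact (measurable_pi_apply l).comp (h.meas_sysY n _ t)
    · rw [abs_of_nonneg (div_nonneg (nrm_nonneg _) (sqrt_nonneg _)), mask_mask]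
      gcongr
      exact nrm_mono fun l => by split_ifs <;> simp

theorem sysX_apply_bdd (t : ℕ) : LpBdd P fun n (j : Finset (ι n) × ι n) ω =>
    sysX sF[n,ω] (mask j.1 (M n ω)) t j.2 := by
  induction t using strongRecOn with
  | _ t ih =>
    have hy : ∀ s < t, LpBdd P fun n (j : Finset (ι n) × ι n) ω =>
        sysY sF[n,ω] (mask j.1 (M n ω)) s j.2 := fun s hs =>
      h.sysY_apply_bdd_of s fun r hr => ih r (hr.trans hs)
    refine ((h.cavityField_bdd t).abs.add
      (h.normB.mul ((h.nrm_dX_bdd_of t hy t).1 le_rfl))).of_le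
      (fun n j => (measurable_pi_apply j.2).comp (h.meas_sysX n j.1 t)) fun n j ω => ?_
    rw [sysX_apply_eq (h.mask_diag_zero n ω _ _)]
    refine (abs_add_le _ _).trans (add_le_add le_rfl ((abs_dotProduct_le _ _).trans ?_))
    gcongr
    · exact nrm_nonneg _
    · exact (nrm_row_le _ _).trans (norm_mask_le _ _)

theorem sysY_apply_bdd (t : ℕ) : LpBdd P fun n (j : Finset (ι n) × ι n) ω =>
    sysY sF[n,ω] (mask j.1 (M n ω)) t j.2 :=
  h.sysY_apply_bdd_of t fun s _ => h.sysX_apply_bdd s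

theorem nrm_dX_bdd (t : ℕ) : LpBdd P fun n (j : Finset (ι n) × ι n) ω =>
    nrm (dX sF[n,ω] (mask j.1 (M n ω)) j.2 t) :=
  (h.nrm_dX_bdd_of (t + 1) (fun s _ => h.sysY_apply_bdd s) t).2 t.lt_succ_self

theorem nrm_dY_bdd (t : ℕ) : LpBdd P fun n (j : Finset (ι n) × ι n) ω =>
    nrm (dY sF[n,ω] (mask j.1 (M n ω)) j.2 t) :=
  (h.nrm_dX_bdd_of (t + 1) (fun s _ => h.sysY_apply_bdd s) t).1 t.le_succ

theorem tendsto_const_div_N (C : ℝ) : Tendsto (fun n => C / (N n : ℝ)) atTop (𝓝 0) :=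
  tendsto_const_nhds.div_atTop (tendsto_natCast_atTop_atTop.comp h.N_tendsto)

theorem c_nonneg {n : ℕ} (k : ι n) : 0 ≤ c := (h.row n k).c_nonneg

theorem meas_cavEnv (n : ℕ) (k : ι n) : Measurable fun ω =>
    ((fun i j => mask {k} (M n ω) i j : ι n → ι n → ℝ), ξ n ω) :=
  (measurable_pi_iff.2 fun i => measurable_pi_iff.2 fun j =>
    (h.meas_M n).mask _ i j).prodMk (h.meas_ξ n)

theorem card_div_sq_le (n : ℕ) (k : ι n) :
    (card (ι n) : ℝ) / (N n : ℝ) ^ 2 ≤ c / N n := by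
  have hN := h.N_pos n k
  rw [div_le_div_iff₀ (by positivity) hN]
  nlinarith [h.card_le n]

section Forms

variable (A : ∀ n, ι n → Ω n → Matrix (ι n) (ι n) ℝ)
  (G : ∀ n, ι n → (ι n → ι n → ℝ) × (ι n → Ξ) → Matrix (ι n) (ι n) ℝ)
  (hG : ∀ n k, MeasM (G n k))
  (hAG : ∀ n k ω, A n k ω = G n k ((fun i j => mask {k} (M n ω) i j), ξ n ω))
  {b : ∀ n, ι n → Ω n → ℝ} (hb : LpBdd P b) (hAb : ∀ n k ω, ‖A n k ω‖ ≤ b n k ω)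

include hG hAG hb hAb

theorem measM_of_cavEnv (n : ℕ) (k : ι n) : MeasM (A n k) := fun i j => by
  simp only [hAG]
  exact (hG n k i j).comp (h.meas_cavEnv n k)

theorem nsq_mulVec_row_small : LpSmall P fun n k ω => nsq (A n k ω *ᵥ M n ω k) := by
  have hAm := h.measM_of_cavEnv A G hG hAG hb hAb
  have hm : ∀ n k, Measurable fun ω => nsq (A n k ω *ᵥ M n ω k) := fun n k =>
    measurable_nsq.comp ((hAm n k).mulVec ((h.meas_M n).row k))
  have hbd : LpBdd P fun n k ω => nsq (A n k ω *ᵥ M n ω k) := by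
    refine ((hb.mul h.normB).pow 2).of_le hm fun n k ω => ?_
    rw [abs_of_nonneg (nsq_nonneg _)]
    refine (nsq_le _).trans ?_
    refine pow_le_pow_left₀ (nrm_nonneg _) ((nrm_mulVec_le _ _).trans ?_) 2
    exact mul_le_mul (hAb n k ω) (nrm_row_le _ _) (nrm_nonneg _)
      ((norm_nonneg _).trans (hAb n k ω))
  obtain ⟨C, hC⟩ := hb.2 4
  refine hbd.small_of_pow (k := 1) fun ε hε => ?_
  filter_upwards [(h.tendsto_const_div_N (momConst c 4 * |C| * c)).eventually_le_const hε]
    with n hn k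
  have hN := h.N_pos n k
  have hc := h.c_nonneg k
  have e : ∀ ω, |nsq (A n k ω *ᵥ M n ω k)| ^ (1 + 1) = ∑ l, |M n ω k ⬝ᵥ A n k ω l| ^ 4 :=
    fun ω => by
      rw [sq_abs, nsq_sq]
      refine sum_congr rfl fun l _ => ?_
      rw [Even.pow_abs ⟨2, rfl⟩, dotProduct_comm]
      rfl
  simp only [e]
  calc ∫⁻ ω, ofReal (∑ l, |M n ω k ⬝ᵥ A n k ω l| ^ 4) ∂P n
      = ∑ l, ∫⁻ ω, ofReal (|M n ω k ⬝ᵥ A n k ω l| ^ 4) ∂P n := by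
        rw [← lintegral_finsetSum]
        · exact lintegral_congr fun ω => ofReal_sum_of_nonneg fun _ _ => by positivity
        · exact fun l _ => ((measurable_dotProduct ((h.meas_M n).row k)
            ((hAm n k).row l)).abs.pow_const 4).ennreal_ofReal
    _ ≤ ∑ _l : ι n, ofReal (momConst c 4 / N n ^ 2 * |C|) := by
        refine sum_le_sum fun l _ => ?_
        have h1 := (h.row n k).moment_dotProduct_indep (h.meas_cavEnv n k) (h.row_indep n k)
          (g := fun q => (G n k q l : ι n → ℝ)) ((hG n k).row l) 4
        simp only [← hAG] at h1
        refine h1.trans ?_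
        calc _ ≤ ∫⁻ ω, ofReal (momConst c 4 / N n ^ 2) *
              ofReal (|b n k ω| ^ 4) ∂P n := by
              refine lintegral_mono fun ω => ?_
              have hm4 := momConst_nonneg c 4
              rw [← ofReal_mul (by positivity)]
              refine ofReal_le_ofReal ?_
              have h2 : nrm (A n k ω l) ≤ |b n k ω| :=
                (nrm_row_le _ _).trans ((hAb n k ω).trans (le_abs_self _))
              have h3 : √(N n : ℝ) ^ 4 = (N n : ℝ) ^ 2 := by
                rw [show 4 = 2 * 2 from rfl, pow_mul, sq_sqrt hN.le]
              have h4 := pow_le_pow_left₀ (nrm_nonneg _) h2 4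
              rw [div_pow, h3]
              calc _ ≤ momConst c 4 * (|b n k ω| ^ 4 / N n ^ 2) := by gcongr
                _ = _ := by ring
          _ ≤ _ := by
              have hm4 := momConst_nonneg c 4
              rw [lintegral_const_mul' _ _ ofReal_ne_top,
                ofReal_mul (by positivity)]
              gcongr
              exact (hC n k).trans (ofReal_le_ofReal (le_abs_self _))
    _ = ofReal (card (ι n) / N n ^ 2 * (momConst c 4 * |C|)) := by
        have hm4 := momConst_nonneg c 4
        rw [← ofReal_sum_of_nonneg fun _ _ => by positivity, sum_const,
          card_univ, nsmul_eq_mul]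
        congr 1
        ring
    _ ≤ ofReal ε := by
        refine ofReal_le_ofReal (le_trans ?_ hn)
        have hm4 := momConst_nonneg c 4
        calc _ ≤ c / N n * (momConst c 4 * |C|) :=
            mul_le_mul_of_nonneg_right (h.card_div_sq_le n k) (by positivity)
          _ = _ := by ring

theorem quad_row_small : LpSmall P fun n k ω =>
    M n ω k ⬝ᵥ (A n k ω *ᵥ M n ω k) - ∑ l, V[n] k l * A n k ω l l := by
  have hAm := h.measM_of_cavEnv A G hG hAG hb hAb
  have hm : ∀ n k, Measurable fun ω =>
      M n ω k ⬝ᵥ (A n k ω *ᵥ M n ω k) - ∑ l, V[n] k l * A n k ω l l :=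
    fun n k => (measurable_dotProduct ((h.meas_M n).row k)
      ((hAm n k).mulVec ((h.meas_M n).row k))).sub
      (Finset.measurable_fun_sum _ fun l _ => (hAm n k l l).const_mul _)
  have hbd : LpBdd P fun n k ω =>
      M n ω k ⬝ᵥ (A n k ω *ᵥ M n ω k) - ∑ l, V[n] k l * A n k ω l l := by
    refine ((h.normB.mul (hb.mul h.normB)).add (hb.const_mul c)).of_le hm fun n k ω => ?_
    have hN := h.N_pos n k
    refine (abs_sub _ _).trans (add_le_add ((abs_dotProduct_le _ _).trans ?_) ?_)
    · refine mul_le_mul (nrm_row_le _ _) ((nrm_mulVec_le _ _).trans ?_) (nrm_nonneg _)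
        (norm_nonneg _)
      exact mul_le_mul (hAb n k ω) (nrm_row_le _ _) (nrm_nonneg _)
        ((norm_nonneg _).trans (hAb n k ω))
    · calc _ ≤ ∑ _l : ι n, (N n : ℝ)⁻¹ * b n k ω := by
            refine (abs_sum_le_sum_abs _ _).trans (sum_le_sum fun l _ => ?_)
            rw [abs_mul]
            refine mul_le_mul ?_ ((abs_entry_le _ _ _).trans (hAb n k ω)) (abs_nonneg _)
              (by positivity)
            unfold varProfile
            split_ifs
            · simp
            · rw [abs_of_nonneg (by positivity)]
        _ = card (ι n) / N n * b n k ω := by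
            rw [sum_const, card_univ, nsmul_eq_mul]; ring
        _ ≤ _ := by
            gcongr
            · exact (norm_nonneg _).trans (hAb n k ω)
            · rw [div_le_iff₀ hN]; exact h.card_le n
  obtain ⟨C, hC⟩ := hb.2 2
  refine hbd.small_of_pow (k := 1) fun ε hε => ?_
  filter_upwards [(h.tendsto_const_div_N (quadConst c * |C| * c)).eventually_le_const hε]
    with n hn k
  have hN := h.N_pos n k
  have hc := h.c_nonneg k
  have hq : 0 ≤ quadConst c := by
    have := momConst_nonneg c 2
    have := momConst_nonneg c 4
    unfold quadConst; positivity
  have hH : Measurable (Function.uncurry fun (x : ι n → ℝ) (q : (ι n → ι n → ℝ) × (ι n → Ξ)) =>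
      ofReal (|x ⬝ᵥ (G n k q *ᵥ x) -
        ∑ l, V[n] k l * G n k q l l| ^ (1 + 1))) := by
    have hG' : MeasM fun z : (ι n → ℝ) × ((ι n → ι n → ℝ) × (ι n → Ξ)) => G n k z.2 :=
      fun i j => (hG n k i j).comp measurable_snd
    exact ((((measurable_dotProduct measurable_fst (hG'.mulVec measurable_fst)).sub
      (Finset.measurable_fun_sum _ fun l _ => (hG' l l).const_mul _)).abs.pow_const
        _).ennreal_ofReal)
  have h1 := lintegral_indep_eq ((h.meas_M n).row k) (h.meas_cavEnv n k) (h.row_indep n k) hH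
  simp only [← hAG] at h1
  rw [h1]
  calc _ ≤ ∫⁻ ω, ofReal (quadConst c / N n ^ 2 * card (ι n)) *
        ofReal (|b n k ω| ^ 2) ∂P n := by
        refine lintegral_mono fun ω' => ((h.row n k).lintegral_quad_sq_le (A n k ω')).trans ?_
        rw [← ofReal_mul (by positivity), mul_assoc]
        refine ofReal_le_ofReal (mul_le_mul_of_nonneg_left ?_ (by positivity))
        refine (frob_sq_le_card _).trans ?_
        gcongr
        exact (hAb n k ω').trans (le_abs_self _)
    _ ≤ ofReal (quadConst c / N n ^ 2 * card (ι n)) * ofReal |C| := by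
        rw [lintegral_const_mul' _ _ ofReal_ne_top]
        gcongr
        exact (hC n k).trans (ofReal_le_ofReal (le_abs_self _))
    _ = ofReal (card (ι n) / N n ^ 2 * (quadConst c * |C|)) := by
        rw [← ofReal_mul (by positivity)]
        congr 1
        ring
    _ ≤ ofReal ε := by
        refine ofReal_le_ofReal (le_trans ?_ hn)
        calc _ ≤ c / N n * (quadConst c * |C|) :=
            mul_le_mul_of_nonneg_right (h.card_div_sq_le n k) (by positivity)
          _ = _ := by ring

end Forms

/-! #### Bounds for the full system -/

theorem siteX_bdd (t : ℕ) : LpBdd P fun n k ω =>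
    sysX sF[n,ω] (M n ω) t k := by
  simpa only [mask_empty] using (h.sysX_apply_bdd t).reindex (K := ι) fun n k => (∅, k)

theorem siteY_bdd (t : ℕ) : LpBdd P fun n k ω => siteY sF[n,ω] (M n ω) k t := by
  have := (h.sysY_apply_bdd t).reindex (K := ι) fun n k => (∅, k)
  simp only [mask_empty] at this
  exact this

theorem fullDX_bdd (t : ℕ) : LpBdd P fun n k ω =>
    nrm (dX sF[n,ω] (M n ω) k t) := by
  simpa only [mask_empty] using (h.nrm_dX_bdd t).reindex (K := ι) fun n k => (∅, k)

theorem cavityField_bdd' (t : ℕ) : LpBdd P fun n k ω =>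
    M n ω k ⬝ᵥ sysY sF[n,ω] (mask {k} (M n ω)) t := by
  simpa only [mask_empty] using (h.cavityField_bdd t).reindex (K := ι) fun n k => (∅, k)

theorem meas_siteY (n : ℕ) (k : ι n) (t : ℕ) :
    Measurable fun ω => siteY sF[n,ω] (M n ω) k t :=
  (measurable_pi_apply k).comp (measurable_sysY h.meas_f (h.meas_ξ n) (h.meas_M n) t)

theorem meas_fullDX (n : ℕ) (k : ι n) (t : ℕ) :
    Measurable fun ω => dX sF[n,ω] (M n ω) k t := by
  simpa only [mask_empty] using h.meas_dX n ∅ k t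

theorem meas_fullDY (n : ℕ) (k : ι n) (t : ℕ) :
    Measurable fun ω => dY sF[n,ω] (M n ω) k t := by
  simpa only [mask_empty] using h.meas_dY n ∅ k t

theorem measM_sysR (n : ℕ) (s t : ℕ) :
    MeasM fun ω => sysR sF[n,ω] sD[n,ω] (M n ω) s t :=
  DMFT.measM_sysR h.meas_f h.meas_p (h.meas_ξ n) (h.meas_M n) s t

theorem measM_cavR (n : ℕ) (k : ι n) (s t : ℕ) : MeasM fun ω =>
    sysR sF[n,ω] sD[n,ω] (mask {k} (M n ω)) s t :=
  DMFT.measM_sysR h.meas_f h.meas_p (h.meas_ξ n) (h.measM_mask n {k}) s t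

theorem measM_envR (n : ℕ) (s t : ℕ) : MeasM fun q : (ι n → ι n → ℝ) × (ι n → Ξ) =>
    sysR (siteF (ty n) f q.2) (siteD (ty n) p q.2) (of q.1) s t :=
  DMFT.measM_sysR h.meas_f h.meas_p measurable_snd
    (fun i j => (measurable_pi_apply j).comp ((measurable_pi_apply i).comp measurable_fst)) s t

theorem norm_cavR_le (n : ℕ) (k : ι n) (ω : Ω n) (s t : ℕ) :
    ‖sysR sF[n,ω] sD[n,ω] (mask {k} (M n ω)) s t‖ ≤
      respBound L ‖M n ω‖ t :=
  norm_sysR_le (h.siteReg n ω) (norm_mask_le _ _) s t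

theorem norm_fullR_le (n : ℕ) (ω : Ω n) (s t : ℕ) :
    ‖sysR sF[n,ω] sD[n,ω] (M n ω) s t‖ ≤
      respBound L ‖M n ω‖ t :=
  norm_sysR_le (h.siteReg n ω) le_rfl s t

theorem meas_lY (n : ℕ) (k : ι n) {a : Ω n → ℕ → ℝ} (ha : ∀ t, Measurable fun ω => a ω t)
    (t : ℕ) : Measurable fun ω =>
      lY sF[n,ω] sD[n,ω] (M n ω) k (a ω) t := by
  unfold lY linY
  exact Finset.measurable_fun_sum _ fun s _ =>
    (ha s).smul ((h.measM_cavR n k s t).mulVec ((h.meas_M n).row k))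

theorem meas_lX (n : ℕ) (k : ι n) {a : Ω n → ℕ → ℝ} (ha : ∀ t, Measurable fun ω => a ω t)
    (t : ℕ) : Measurable fun ω =>
      lX sF[n,ω] sD[n,ω] (M n ω) k (a ω) t := by
  unfold lX linX
  exact ((ha t).smul ((h.meas_M n).row k)).add
    ((h.measM_mask n {k}).mulVec (h.meas_lY n k ha t))

theorem nsq_lX_small (t : ℕ) : LpSmall P fun n k ω =>
    nsq (lX sF[n,ω] sD[n,ω] (M n ω) k
      (siteY sF[n,ω] (M n ω) k) t) := by
  have h1 : LpSmall P fun n k ω => nsq (M n ω k) := by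
    have := h.nsq_mulVec_row_small (fun n _ _ => 1) (fun n _ _ => 1)
      (fun n k i j => measurable_const) (fun _ _ _ => rfl) (LpBdd.const 1)
      (fun n k ω => by
        rw [← Matrix.diagonal_one]
        exact norm_diagonal_le zero_le_one fun i => by simp)
    simpa only [Matrix.one_mulVec] using this
  have h2 : ∀ s, LpSmall P fun n k ω => nsq ((mask {k} (M n ω) *
      sysR sF[n,ω] sD[n,ω] (mask {k} (M n ω)) s t) *ᵥ
        M n ω k) := fun s =>
    h.nsq_mulVec_row_small (fun n k ω => mask {k} (M n ω) *
      sysR sF[n,ω] sD[n,ω] (mask {k} (M n ω)) s t)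
      (fun n k q => of q.1 * sysR (siteF (ty n) f q.2) (siteD (ty n) p q.2)
        (of q.1) s t)
      (fun n k => MeasM.mul (fun i j => (measurable_pi_apply j).comp
        ((measurable_pi_apply i).comp measurable_fst)) (h.measM_envR n s t))
      (fun _ _ _ => rfl) (h.normB.mul (h.respBoundB t))
      (fun n k ω => (l2_opNorm_mul _ _).trans
        (mul_le_mul (norm_mask_le _ _) (h.norm_cavR_le n k ω s t) (norm_nonneg _)
          (norm_nonneg _)))
  refine ((((h.siteY_bdd t).pow 2).mul_small h1).const_mul 2 |>.add
    ((LpSmall.sum (range t) fun s _ =>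
      (((h.siteY_bdd s).pow 2).mul_small (h2 s)).const_mul (t : ℝ)).const_mul 2)).of_le
      (fun n k => measurable_nsq.comp (h.meas_lX n k (h.meas_siteY n k) t)) fun n k ω => ?_
  rw [abs_of_nonneg (nsq_nonneg _)]
  exact nsq_linX_le _ _ _ _ _

theorem linError_small (t : ℕ) : LpSmall P fun n k ω =>
    nrm (dY sF[n,ω] (M n ω) k t -
      lY sF[n,ω] sD[n,ω] (M n ω) k
        (siteY sF[n,ω] (M n ω) k) t) := by
  induction t using strongRecOn with
  | _ t ih =>
    refine (((LpSmall.sum (range t) fun s hs =>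
      h.normB.mul_small (ih s (mem_range.1 hs))).const_mul (L t)).add
      ((LpSmall.sum (range t) fun s hs => ((h.nsq_lX_small s).const_mul 2).add
        (((h.normB.mul_small (ih s (mem_range.1 hs))).mul_bdd
          (h.normB.mul_small (ih s (mem_range.1 hs))).bdd).const_mul 2)).const_mul
            (L t))).of_le (fun n k => measurable_nrm.comp ((h.meas_fullDY n k t).sub
              (h.meas_lY n k (h.meas_siteY n k) t))) fun n k ω => ?_
    rw [abs_of_nonneg (nrm_nonneg _)]
    refine (nrm_dY_sub_lY_le (h.siteReg n ω) (h.symm n ω) (h.diag_zero n ω k) t).trans ?_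
    have := h.reg.L_nonneg t
    gcongr with s
    refine (nsq_dX_le (p := sD[n,ω]) (h.symm n ω) (h.diag_zero n ω k) s).trans ?_
    rw [sq]

theorem nsq_dX_small (t : ℕ) : LpSmall P fun n k ω =>
    nsq (dX sF[n,ω] (M n ω) k t) := by
  refine (((h.nsq_lX_small t).const_mul 2).add
        (((h.normB.mul_small (h.linError_small t)).mul_bdd
          (h.normB.mul_small (h.linError_small t)).bdd).const_mul 2)).of_le
    (fun n k => measurable_nsq.comp (h.meas_fullDX n k t)) fun n k ω => ?_
  rw [abs_of_nonneg (nsq_nonneg _)]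
  refine (nsq_dX_le (p := sD[n,ω]) (h.symm n ω) (h.diag_zero n ω k) t).trans ?_
  rw [sq]

/-- The self-interaction of a site through the rest of the system. -/
theorem quad_bdd (s t : ℕ) : LpBdd P fun n k ω => M n ω k ⬝ᵥ
    (sysR sF[n,ω] sD[n,ω] (mask {k} (M n ω)) s t *ᵥ M n ω k) := by
  refine (h.normB.mul ((h.respBoundB t).mul h.normB)).of_le (fun n k => measurable_dotProduct
    ((h.meas_M n).row k) ((h.measM_cavR n k s t).mulVec ((h.meas_M n).row k))) fun n k ω => ?_
  refine (abs_dotProduct_le _ _).trans ?_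
  refine mul_le_mul (nrm_row_le _ _) ((nrm_mulVec_le _ _).trans ?_) (nrm_nonneg _)
    (norm_nonneg _)
  exact mul_le_mul (h.norm_cavR_le n k ω s t) (nrm_row_le _ _) (nrm_nonneg _)
    (respBound_nonneg h.reg.L_nonneg (norm_nonneg _) t)

/-- The cavity equation for the field at a site. -/
theorem field_small (t : ℕ) : LpSmall P fun n k ω =>
    sysX sF[n,ω] (M n ω) t k -
      (M n ω k ⬝ᵥ sysY sF[n,ω] (mask {k} (M n ω)) t +
        ∑ s ∈ range t, (M n ω k ⬝ᵥ (sysR sF[n,ω]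
          sD[n,ω] (mask {k} (M n ω)) s t *ᵥ M n ω k)) *
            siteY sF[n,ω] (M n ω) k s) := by
  have hm : ∀ n k, Measurable fun ω => M n ω k ⬝ᵥ (dY sF[n,ω] (M n ω) k t -
      lY sF[n,ω] sD[n,ω] (M n ω) k
        (siteY sF[n,ω] (M n ω) k) t) := fun n k =>
    measurable_dotProduct ((h.meas_M n).row k) ((h.meas_fullDY n k t).sub
      (h.meas_lY n k (h.meas_siteY n k) t))
  have := (h.normB.mul_small (h.linError_small t)).of_le hm fun n k ω => by
    refine (abs_dotProduct_le _ _).trans ?_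
    gcongr
    exacts [nrm_nonneg _, nrm_row_le _ _]
  refine this.mono (fun n k => ?_) fun n k ω => ?_
  · exact ((measurable_pi_apply k).comp
      (measurable_sysX h.meas_f (h.meas_ξ n) (h.meas_M n) t)).sub
      ((h.cavityField_bdd' t).meas n k |>.add (Finset.measurable_fun_sum _ fun s _ =>
        ((h.quad_bdd s t).meas n k).mul (h.meas_siteY n k s)))
  · rw [sysX_apply_eq (h.diag_zero n ω k), dotProduct_sub, row_dotProduct_lY, add_sub_add_left_eq_sub]

/-! #### The response at a site -/

theorem meas_siteR (n : ℕ) (k : ι n) (s t : ℕ) : Measurable fun ω =>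
    siteR sF[n,ω] sD[n,ω] (M n ω) k s t :=
  h.measM_sysR n s t k k

theorem siteR_bdd (s t : ℕ) : LpBdd P fun n k ω =>
    siteR sF[n,ω] sD[n,ω] (M n ω) k s t :=
  (h.respBoundB t).of_le (fun n k => h.meas_siteR n k s t) fun n k ω =>
    (abs_entry_le (sysR sF[n,ω] sD[n,ω] (M n ω) s t) k k).trans
      (h.norm_fullR_le n ω s t)

theorem meas_colR (n : ℕ) (k : ι n) (s t : ℕ) : Measurable fun ω =>
    colR sF[n,ω] sD[n,ω] (M n ω) k s t :=
  (measurable_off k).comp (measurable_pi_iff.2 fun l => h.measM_sysR n s t l k)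

theorem colError_small (s t : ℕ) : LpSmall P fun n k ω =>
    nrm (colR sF[n,ω] sD[n,ω] (M n ω) k s t -
      lY sF[n,ω] sD[n,ω] (M n ω) k
        (siteR sF[n,ω] sD[n,ω] (M n ω) k s) t) := by
  induction t using strongRecOn with
  | _ t ih =>
    have hm : ∀ n k, Measurable fun ω =>
        nrm (colR sF[n,ω] sD[n,ω] (M n ω) k s t -
      lY sF[n,ω] sD[n,ω] (M n ω) k
        (siteR sF[n,ω] sD[n,ω] (M n ω) k s) t) := fun n k =>
      measurable_nrm.comp ((h.meas_colR n k s t).sub (h.meas_lY n k (h.meas_siteR n k s) t))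
    rcases lt_or_ge s t with hst | hst
    · have hsq : ∀ q, LpSmall P fun n k ω => √(nsq (dX sF[n,ω] (M n ω) k q)) :=
        fun q => LpSmall.sqrt_of_nonneg (h.nsq_dX_small q) fun _ _ _ => nsq_nonneg _
      refine ((LpSmall.sum (range t) fun r _ => (LpSmall.sum (range t) fun q _ =>
        (hsq q).mul_bdd ((h.normB.mul (h.respBoundB r)).const_mul 2)).const_mul (L t)).add
        (LpSmall.sum (range t) fun r hr =>
          (h.normB.mul_small (ih r (mem_range.1 hr))).const_mul (L t))).of_le hm
          fun n k ω => ?_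
      rw [abs_of_nonneg (nrm_nonneg _)]
      refine (nrm_colR_sub_lY_le (h.siteReg n ω) (h.symm n ω) (h.diag_zero n ω k) hst).trans ?_
      have := h.reg.L_nonneg t
      gcongr with r
      exact h.norm_fullR_le n ω s r
    · refine LpSmall.zero.mono hm fun n k ω => le_of_eq ?_
      have e1 : colR sF[n,ω] sD[n,ω] (M n ω) k s t = 0 := by
        rw [colR, sysR, resp_of_le _ _ hst]
        ext l; simp [off]
      have e2 : lY sF[n,ω] sD[n,ω] (M n ω) k
          (siteR sF[n,ω] sD[n,ω] (M n ω) k s) t = 0 := by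
        rw [lY, linY]
        refine sum_eq_zero fun r hr => ?_
        rw [siteR_of_le ((mem_range.1 hr).le.trans hst), zero_smul]
      rw [e1, e2, sub_zero, nrm_zero]

theorem siteP_bdd (t s : ℕ) : LpBdd P fun n k ω =>
    sysP sF[n,ω] sD[n,ω] (M n ω) t s k :=
  (LpBdd.const (L t)).of_le (fun n k => (measurable_pi_apply k).comp
    (measurable_sysP h.meas_f h.meas_p (h.meas_ξ n) (h.meas_M n) t s)) fun _ _ _ =>
      h.reg.bdd t s _ _

/-- The cavity equation for the response at a site. -/
theorem response_small {s t : ℕ} (hst : s < t) : LpSmall P fun n k ω =>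
    siteR sF[n,ω] sD[n,ω] (M n ω) k s t -
      (sysP sF[n,ω] sD[n,ω] (M n ω) t s k +
        ∑ r ∈ range t,
          sysP sF[n,ω] sD[n,ω] (M n ω) t r k *
          ∑ q ∈ range r, (M n ω k ⬝ᵥ (sysR sF[n,ω]
          sD[n,ω] (mask {k} (M n ω)) q r *ᵥ M n ω k)) *
            siteR sF[n,ω] sD[n,ω] (M n ω) k s q) := by
  refine (LpSmall.sum (range t) fun r _ => (h.siteP_bdd t r).mul_small
    ((h.normB.mul_small (h.colError_small s r)).of_le (Z := fun n k ω => M n ω k ⬝ᵥ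
      (colR sF[n,ω] sD[n,ω] (M n ω) k s r -
      lY sF[n,ω] sD[n,ω] (M n ω) k
        (siteR sF[n,ω] sD[n,ω] (M n ω) k s) r))
      (fun n k => measurable_dotProduct ((h.meas_M n).row k) ((h.meas_colR n k s r).sub
        (h.meas_lY n k (h.meas_siteR n k s) r))) fun n k ω => ?_)).mono
    (fun n k => ?_) fun n k ω => le_of_eq ?_
  · refine (abs_dotProduct_le _ _).trans ?_
    gcongr
    exacts [nrm_nonneg _, nrm_row_le _ _]
  · exact (h.meas_siteR n k s t).sub (((h.siteP_bdd t s).meas n k).add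
      (Finset.measurable_fun_sum _ fun r _ => ((h.siteP_bdd t r).meas n k).mul
        (Finset.measurable_fun_sum _ fun q _ => ((h.quad_bdd q r).meas n k).mul
          (h.meas_siteR n k s q))))
  · rw [siteR_eq (h.diag_zero n ω k) hst, add_sub_add_left_eq_sub, ← sum_sub_distrib]
    congr 1
    refine sum_congr rfl fun r _ => ?_
    rw [dotProduct_sub, row_dotProduct_lY, mul_sub]

/-! #### Comparison of the self-interaction with the average response -/

theorem frobError_bdd (s t : ℕ) : LpBdd P fun n k ω =>
    frob (sysR sF[n,ω] sD[n,ω] (M n ω) s t -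
      sysR sF[n,ω] sD[n,ω] (mask {k} (M n ω)) s t) := by
  induction t using strongRecOn with
  | _ t ih =>
    have hm : ∀ n k, Measurable fun ω =>
      frob (sysR sF[n,ω] sD[n,ω] (M n ω) s t -
      sysR sF[n,ω] sD[n,ω] (mask {k} (M n ω)) s t) :=
      fun n k => ((h.measM_sysR n s t).sub (h.measM_cavR n k s t)).frob
    rcases lt_or_ge s t with hst | hst
    · have hD : LpBdd P fun n k ω => L t * ∑ q ∈ range t,
          nrm (dX sF[n,ω] (M n ω) k q) + 2 * L t :=
        ((LpBdd.sum (range t) fun q _ => h.fullDX_bdd q).const_mul (L t)).add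
          (LpBdd.const (2 * L t))
      refine (hD.add (LpBdd.sum (range t) fun r hr =>
        (hD.mul (h.normB.mul (h.respBoundB r))).add
        ((((h.normB.const_mul 2).mul (h.respBoundB r)).const_mul (L t)).add
        ((h.normB.mul (ih r (mem_range.1 hr))).const_mul (L t))))).of_le hm fun n k ω => ?_
      rw [abs_of_nonneg (frob_nonneg _)]
      have hL := h.reg.L_nonneg t
      refine (frob_sysR_sub_le (h.siteReg n ω) (h.symm n ω) (h.diag_zero n ω k) hst
        fun r => nrm_sysP_sub_le (h.siteReg n ω) t r).trans ?_
      have hD0 : 0 ≤ L t * ∑ q ∈ range t,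
          nrm (dX sF[n,ω] (M n ω) k q) + 2 * L t :=
        add_nonneg (mul_nonneg hL (sum_nonneg fun _ _ => nrm_nonneg _)) (by positivity)
      gcongr with r
      · exact h.norm_fullR_le n ω s r
      · exact h.norm_fullR_le n ω s r
    · refine (LpBdd.const 0).of_le hm fun n k ω => le_of_eq ?_
      have : frob (0 : Matrix (ι n) (ι n) ℝ) = 0 := nrm_zero
      rw [sysR, sysR, resp_of_le _ _ hst, resp_of_le _ _ hst, sub_zero, this, abs_zero]

/-- The self-interaction of a site is close to the average of the responses. -/
theorem quad_sub_average_small (s t : ℕ) : LpSmall P fun n k ω => M n ω k ⬝ᵥ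
    (sysR sF[n,ω] sD[n,ω] (mask {k} (M n ω)) s t *ᵥ M n ω k) -
      ∑ l, V[n] k l *
        siteR sF[n,ω] sD[n,ω] (M n ω) l s t := by
  have h1 := h.quad_row_small (fun n k ω => sysR sF[n,ω] sD[n,ω]
    (mask {k} (M n ω)) s t) (fun n k q => sysR (siteF (ty n) f q.2) (siteD (ty n) p q.2)
        (of q.1) s t) (fun n k => h.measM_envR n s t) (fun _ _ _ => rfl)
    (h.respBoundB t) (fun n k ω => h.norm_cavR_le n k ω s t)
  have h2 : LpSmall P fun n k ω => ∑ l, V[n] k l *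
      (sysR sF[n,ω] sD[n,ω] (M n ω) s t l l -
      sysR sF[n,ω] sD[n,ω] (mask {k} (M n ω)) s t l l) := by
    have hs : LpSmall P fun n (_ : ι n) (_ : Ω n) => √(|c| / N n) := by
      refine LpSmall.of_tendsto ?_
      have := (h.tendsto_const_div_N |c|).sqrt
      rwa [Real.sqrt_zero] at this
    refine (hs.mul_bdd (h.frobError_bdd s t)).of_le (fun n k =>
      Finset.measurable_fun_sum _ fun l _ => ((h.measM_sysR n s t l l).sub
        (h.measM_cavR n k s t l l)).const_mul _) fun n k ω => ?_
    refine (abs_dotProduct_le (V[n] k) fun l =>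
      sysR sF[n,ω] sD[n,ω] (M n ω) s t l l -
      sysR sF[n,ω] sD[n,ω] (mask {k} (M n ω)) s t l l).trans ?_
    refine mul_le_mul ?_ (nrm_diag_le_frob (sysR sF[n,ω]
      sD[n,ω] (M n ω) s t - sysR sF[n,ω]
      sD[n,ω] (mask {k} (M n ω)) s t)) (nrm_nonneg _) (sqrt_nonneg _)
    rw [nrm_eq_sqrt]
    refine Real.sqrt_le_sqrt ?_
    have hN := h.N_pos n k
    calc ∑ l, V[n] k l ^ 2 ≤ ∑ _l : ι n, ((N n : ℝ)⁻¹) ^ 2 := by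
          refine sum_le_sum fun l _ => ?_
          unfold varProfile
          split_ifs
          · rw [zero_pow two_ne_zero]; positivity
          · exact le_rfl
      _ = card (ι n) / N n ^ 2 := by
          rw [sum_const, card_univ, nsmul_eq_mul]; ring
      _ ≤ c / N n := h.card_div_sq_le n k
      _ ≤ _ := by gcongr; exact le_abs_self c
  refine (h1.sub h2).mono (fun n k => ((h.quad_bdd s t).meas n k).sub
    (Finset.measurable_fun_sum _ fun l _ => (h.meas_siteR n l s t).const_mul _)) fun n k ω => ?_
  refine le_of_eq (congrArg _ ?_)
  rw [sub_sub, ← sum_add_distrib]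
  congr 1
  refine sum_congr rfl fun l _ => ?_
  rw [siteR]
  ring

/-! ### The central limit theorem for the cavity fields -/

theorem inv_sqrt_small : LpSmall P fun n (_ : J n) (_ : Ω n) => (√(N n : ℝ))⁻¹ := by
  refine LpSmall.of_tendsto ?_
  exact tendsto_inv_atTop_zero.comp (Real.tendsto_sqrt_atTop.comp
    (tendsto_natCast_atTop_atTop.comp h.N_tendsto))

section RowForms

variable (k : ∀ n, J n → ι n) (g : ∀ n, J n → Ω n → ι n → ℝ)
    (G : ∀ n, J n → (ι n → ι n → ℝ) × (ι n → Ξ) → ι n → ℝ) (hG : ∀ n j, Measurable (G n j))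
    (hgG : ∀ n j ω, g n j ω = G n j ((fun i j' => mask {k n j} (M n ω) i j'), ξ n ω))

include hG hgG

theorem dotProduct_small (hb : LpSmall P fun n j ω => nrm (g n j ω) / √(N n)) :
    LpSmall P fun n j ω => M n ω (k n j) ⬝ᵥ g n j ω := by
  refine (h.dotProduct_bdd k g G hG hgG hb.bdd).small_of_pow (k := 1) fun ε hε => ?_
  have hm2 := momConst_nonneg c 2
  filter_upwards [(hb.mul_bdd hb.bdd).2 (ε / (momConst c 2 + 1)) (by positivity)] with n hn j
  have := (h.row n (k n j)).moment_dotProduct_indep (h.meas_cavEnv n (k n j))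
    (h.row_indep n (k n j)) (hG n j) 2
  simp only [← hgG] at this
  refine this.trans ?_
  simp only [ofReal_mul hm2]
  rw [lintegral_const_mul' _ _ ofReal_ne_top]
  have h2 : ∫⁻ ω, ofReal ((nrm (g n j ω) / √(N n)) ^ 2) ∂P n ≤
      ofReal (ε / (momConst c 2 + 1)) := by
    refine le_trans (le_of_eq (lintegral_congr fun ω => ?_)) (hn j)
    rw [abs_mul_self, sq]
  calc _ ≤ ofReal (momConst c 2) * ofReal (ε / (momConst c 2 + 1)) := by gcongr
    _ = ofReal (momConst c 2 * (ε / (momConst c 2 + 1))) := by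
        rw [ofReal_mul hm2]
    _ ≤ ofReal ε := by
        refine ofReal_le_ofReal ?_
        rw [mul_div_assoc', div_le_iff₀ (by positivity)]
        nlinarith

/-- Conditionally on the rest of the system, a linear form in the row of a site is asymptotically
Gaussian. -/
theorem tendsto_charFun_row (H : ∀ n, J n → Ω n → ℂ)
    (H' : ∀ n, J n → (ι n → ι n → ℝ) × (ι n → Ξ) → ℂ) (hH' : ∀ n j, Measurable (H' n j))
    (hHH' : ∀ n j ω, H n j ω = H' n j ((fun i j' => mask {k n j} (M n ω) i j'), ξ n ω))
    (hH1 : ∀ n j q, ‖H' n j q‖ ≤ 1) {q : ℝ} (hq0 : 0 ≤ q)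
    (hq : LpSmall P fun n j ω =>
      ∑ l, V[n] (k n j) l * g n j ω l ^ 2 - q)
    (hb : LpBdd P fun n (jl : J n × ι n) ω => g n jl.1 ω jl.2) :
    Tendsto (fun x : Σ n, J n =>
      ∫ ω, cis(M x.1 ω (k x.1 x.2) ⬝ᵥ g x.1 x.2 ω) *
        H x.1 x.2 ω ∂P x.1 -
      ((exp (-(q / 2)) : ℝ) : ℂ) * ∫ ω, H x.1 x.2 ω ∂P x.1) (unif J) (𝓝 0) := by
  have herr : LpSmall P fun n j ω => cltConst c * ∑ l, (|g n j ω l| / √(N n)) ^ 3 +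
      |∑ l, V[n] (k n j) l * g n j ω l ^ 2 - q| * (1 / 2) := by
    refine LpSmall.add (LpSmall.const_mul _ ?_) (hq.abs.mul_bdd (LpBdd.const _))
    refine (h.inv_sqrt_small.mul_bdd ((hb.abs.pow 3).average h.card_le)).mono (fun n j => ?_)
      fun n j ω => le_of_eq ?_
    · exact Finset.measurable_fun_sum _ fun l _ => ((hb.meas n (j, l)).abs.div_const _).pow_const _
    · congr 1
      rw [mul_sum, mul_sum]
      refine sum_congr rfl fun l _ => ?_
      have h1 : (√(N n : ℝ)) ^ 2 = N n := sq_sqrt (Nat.cast_nonneg _)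
      have h2 : (N n : ℝ)⁻¹ = (√(N n : ℝ))⁻¹ ^ 2 := by rw [inv_pow, h1]
      rw [h2]
      ring
  refine squeeze_zero_norm (fun x => ?_) herr.tendsto_integral_abs
  obtain ⟨n, j⟩ := x
  dsimp only
  set E : Ω n → (ι n → ι n → ℝ) × (ι n → Ξ) := fun ω =>
    ((fun i j' => mask {k n j} (M n ω) i j'), ξ n ω) with hE
  have hEm : Measurable E := h.meas_cavEnv n (k n j)
  have hn1 : ∀ x : ℝ, ‖Complex.exp (Complex.I * (x : ℂ))‖ = 1 := fun x => by
    rw [mul_comm, Complex.norm_exp_ofReal_mul_I]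
  have hfm : Measurable fun z : (ι n → ℝ) × ((ι n → ι n → ℝ) × (ι n → Ξ)) =>
      cis(z.1 ⬝ᵥ G n j z.2) := by
    have := measurable_dotProduct (measurable_fst (α := ι n → ℝ)
      (β := (ι n → ι n → ℝ) × (ι n → Ξ))) ((hG n j).comp measurable_snd)
    simp only [Function.comp_apply] at this
    fun_prop
  have e1 : ∫ ω, cis(M n ω (k n j) ⬝ᵥ g n j ω) * H n j ω ∂P n =
      ∫ ω', (∫ ω, cis(M n ω (k n j) ⬝ᵥ g n j ω') ∂P n) *
        H n j ω' ∂P n := by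
    have := integral_indep_eq (P := P n) ((h.meas_M n).row (k n j)) hEm (h.row_indep n (k n j))
      (H := fun x y => cis(x ⬝ᵥ G n j y) * H' n j y) (C := 1)
      (hfm.mul ((hH' n j).comp measurable_snd)).stronglyMeasurable
      (fun x y => by rw [norm_mul, hn1, one_mul]; exact hH1 n j y)
    simp only [hE, ← hgG, ← hHH', integral_mul_const] at this
    exact this
  set Φ : Ω n → ℂ := fun ω' =>
    ∫ ω, cis(M n ω (k n j) ⬝ᵥ g n j ω') ∂P n with hΦ
  have mΦ : StronglyMeasurable Φ := by
    have h1 : Measurable fun z : ((ι n → ι n → ℝ) × (ι n → Ξ)) × Ω n =>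
        cis(M n z.2 (k n j) ⬝ᵥ G n j z.1) :=
      hfm.comp ((((h.meas_M n).row (k n j)).comp measurable_snd).prodMk measurable_fst)
    have h2 := (h1.stronglyMeasurable.integral_prod_right' (ν := P n)).comp_measurable hEm
    simp only [hE, Function.comp_def, ← hgG] at h2
    exact h2
  have mH : Measurable (H n j) := by
    have : H n j = fun ω => H' n j (E ω) := funext (hHH' n j)
    rw [this]
    exact (hH' n j).comp hEm
  have nH : ∀ ω, ‖H n j ω‖ ≤ 1 := fun ω => by rw [hHH']; exact hH1 _ _ _
  have nΦ : ∀ ω, ‖Φ ω‖ ≤ 1 := fun ω' => by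
    refine (norm_integral_le_of_norm_le_const (C := 1) (.of_forall fun ω => ?_)).trans ?_
    · rw [hn1]
    · simp
  have iH : Integrable (H n j) (P n) :=
    Integrable.of_bound mH.aestronglyMeasurable 1 (.of_forall nH)
  have iΦH : Integrable (fun ω => Φ ω * H n j ω) (P n) :=
    Integrable.of_bound (mΦ.mul mH.stronglyMeasurable).aestronglyMeasurable 1
      (.of_forall fun ω => by
        rw [norm_mul]; exact mul_le_one₀ (nΦ ω) (norm_nonneg _) (nH ω))
  rw [e1, ← integral_const_mul, ← integral_sub iΦH (iH.const_mul _)]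
  refine norm_integral_le_of_norm_le (herr.bdd.integrable n j).abs
    (.of_forall fun ω' => ?_)
  rw [← sub_mul, norm_mul]
  refine (mul_le_of_le_one_right (norm_nonneg _) (nH ω')).trans (le_trans ?_ (le_abs_self _))
  have h1 := (h.row n (k n j)).charFun_dotProduct_sub_le (g n j ω')
  set a := ∑ l, V[n] (k n j) l * g n j ω' l ^ 2 with ha
  have ha0 : 0 ≤ a := sum_nonneg fun l _ =>
    mul_nonneg ((h.row n (k n j)).var_nonneg l) (sq_nonneg _)
  have h2 := abs_exp_neg_half_sub_le ha0 hq0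
  calc _ ≤ _ := norm_sub_le_norm_sub_add_norm_sub _ ((exp (-(a / 2)) : ℝ) : ℂ) _
    _ ≤ _ := add_le_add h1 (by
      rw [← Complex.ofReal_sub, Complex.norm_real, norm_eq_abs]
      linarith)

end RowForms

/-! #### Removing further sites -/

theorem abs_varProfile_sum_le (n : ℕ) (k : ι n) (u v : ι n → ℝ) :
    |∑ l, V[n] k l * (u l * v l)| ≤ nrm (fun l => if ty n k = ty n l then 0 else u l) *
      (√(N n : ℝ))⁻¹ * (nrm v / √(N n)) := by
  have hN := h.N_pos n k
  have e : ∑ l, V[n] k l * (u l * v l) =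
      (N n : ℝ)⁻¹ * ((fun l => if ty n k = ty n l then 0 else u l) ⬝ᵥ v) := by
    rw [dotProduct, mul_sum]
    refine sum_congr rfl fun l _ => ?_
    unfold varProfile
    split_ifs <;> simp
  rw [e, abs_mul, abs_of_nonneg (by positivity : (0 : ℝ) ≤ (N n : ℝ)⁻¹)]
  have h1 : (N n : ℝ)⁻¹ = (√(N n : ℝ))⁻¹ * (√(N n : ℝ))⁻¹ := by
    rw [← mul_inv, Real.mul_self_sqrt hN.le]
  calc _ ≤ (N n : ℝ)⁻¹ * (nrm (fun l => if ty n k = ty n l then 0 else u l) * nrm v) := by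
        gcongr; exact abs_dotProduct_le _ _
    _ = _ := by rw [h1]; ring

/-- Removing a site does not change the empirical second moments of the sites of the other
type. -/
theorem moment_mask_small (S : ∀ n, J n → Finset (ι n)) (k k' : ∀ n, J n → ι n)
    (hk : ∀ n j, ty n (k n j) = ty n (k' n j)) (s t : ℕ) :
    LpSmall P fun n j ω => ∑ l, V[n] (k n j) l *
        (sysY sF[n,ω] (mask (S n j) (M n ω)) s l *
          sysY sF[n,ω] (mask (S n j) (M n ω)) t l) -
      ∑ l, V[n] (k n j) l *
        (sysY sF[n,ω] (mask {k' n j} (mask (S n j) (M n ω))) s l *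
          sysY sF[n,ω] (mask {k' n j} (mask (S n j) (M n ω))) t l) := by
  have hd : ∀ r, LpSmall P fun n (j : J n) ω =>
      nrm (dY sF[n,ω] (mask (S n j) (M n ω)) (k' n j) r) * (√(N n : ℝ))⁻¹ :=
    fun r => ((h.nrm_dY_bdd r).reindex (K := J) fun n j => (S n j, k' n j)).mul_small
      h.inv_sqrt_small
  have hy : ∀ r, LpBdd P fun n (j : J n) ω =>
      nrm (sysY sF[n,ω] (mask (S n j) (M n ω)) r) / √(N n) := fun r =>
    (h.nrm_sysY_bdd r).reindex (K := J) S
  have hy' : ∀ r, LpBdd P fun n (j : J n) ω =>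
      nrm (sysY sF[n,ω] (mask {k' n j} (mask (S n j) (M n ω))) r) / √(N n) :=
    fun r => by
      simp only [mask_mask]
      exact (h.nrm_sysY_bdd r).reindex (K := J) fun n j => {k' n j} ∪ S n j
  have hm : ∀ r n (j : J n) l, Measurable fun ω =>
      sysY sF[n,ω] (mask (S n j) (M n ω)) r l := fun r n j l =>
    (measurable_pi_apply l).comp (h.meas_sysY n _ r)
  have hm' : ∀ r n (j : J n) l, Measurable fun ω =>
      sysY sF[n,ω] (mask {k' n j} (mask (S n j) (M n ω))) r l :=
    fun r n j l => by
      simp only [mask_mask]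
      exact (measurable_pi_apply l).comp (h.meas_sysY n _ r)
  refine (((hd s).mul_bdd (hy t)).add ((hd t).mul_bdd (hy' s))).of_le (fun n j => ?_)
    fun n j ω => ?_
  · exact (Finset.measurable_fun_sum _ fun l _ => ((hm s n j l).mul (hm t n j l)).const_mul _).sub
      (Finset.measurable_fun_sum _ fun l _ => ((hm' s n j l).mul (hm' t n j l)).const_mul _)
  · set A := mask (S n j) (M n ω)
    set φ := sF[n,ω]
    have e : ∑ l, V[n] (k n j) l * (sysY φ A s l * sysY φ A t l) -
        ∑ l, V[n] (k n j) l *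
          (sysY φ (mask {k' n j} A) s l * sysY φ (mask {k' n j} A) t l) =
        ∑ l, V[n] (k n j) l *
          ((sysY φ A s - sysY φ (mask {k' n j} A) s) l * sysY φ A t l) +
        ∑ l, V[n] (k n j) l *
          ((sysY φ A t - sysY φ (mask {k' n j} A) t) l * sysY φ (mask {k' n j} A) s l) := by
      rw [← sum_sub_distrib, ← sum_add_distrib]
      refine sum_congr rfl fun l _ => ?_
      simp only [Pi.sub_apply]
      ring
    have hle : ∀ r, nrm (fun l => if ty n (k n j) = ty n l then 0 else
        (sysY φ A r - sysY φ (mask {k' n j} A) r) l) ≤ nrm (dY φ A (k' n j) r) := fun r =>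
      nrm_mono fun l => by
        unfold dY off
        by_cases hl : l = k' n j
        · subst hl; simp [hk n j]
        · rw [if_neg hl]
          split_ifs <;> simp
    rw [e]
    refine (abs_add_le _ _).trans (add_le_add
      ((h.abs_varProfile_sum_le n _ _ _).trans ?_) ((h.abs_varProfile_sum_le n _ _ _).trans ?_))
    · have := hle s
      have := nrm_nonneg (sysY φ A t)
      gcongr
    · have := hle t
      have := nrm_nonneg (sysY φ (mask {k' n j} A) s)
      gcongr

/-- Removing a second site of the same type does not change the cavity field of a site. -/
theorem cavityField_pair_small (k k' : ∀ n, J n → ι n)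
    (hk : ∀ n j, ty n (k n j) = ty n (k' n j)) (t : ℕ) :
    LpSmall P fun n j ω =>
      M n ω (k n j) ⬝ᵥ sysY sF[n,ω] (mask {k n j} (M n ω)) t -
      M n ω (k n j) ⬝ᵥ sysY sF[n,ω] (mask {k' n j} (mask {k n j} (M n ω))) t := by
  have h1 : LpSmall P fun n j ω => M n ω (k n j) ⬝ᵥ
      dY sF[n,ω] (mask {k n j} (M n ω)) (k' n j) t := by
    refine h.dotProduct_small k _ (fun n j q =>
      dY (siteF (ty n) f q.2) (of q.1) (k' n j) t) (fun n j => ?_) (fun n j ω => rfl) ?_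
    · have hq : MeasM fun q : (ι n → ι n → ℝ) × (ι n → Ξ) => of q.1 := fun i j' =>
        (measurable_pi_apply j').comp ((measurable_pi_apply i).comp measurable_fst)
      exact (measurable_off _).comp ((measurable_sysY h.meas_f measurable_snd hq t).sub
        (measurable_sysY h.meas_f measurable_snd (hq.mask _) t))
    · simp only [div_eq_mul_inv]
      exact ((h.nrm_dY_bdd t).reindex (K := J) fun n j => ({k n j}, k' n j)).mul_small
        h.inv_sqrt_small
  refine h1.mono (fun n j => ?_) fun n j ω => le_of_eq (congrArg _ ?_)
  · refine (measurable_dotProduct ((h.meas_M n).row _) (h.meas_sysY n _ t)).sub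
      (measurable_dotProduct ((h.meas_M n).row _) ?_)
    simp only [mask_mask]
    exact h.meas_sysY n _ t
  · rw [← dotProduct_sub]
    refine sum_congr rfl fun l _ => ?_
    unfold dY off
    by_cases hl : l = k' n j
    · subst hl
      rw [h.same n ω _ _ (hk n j), zero_mul, zero_mul]
    · rw [if_neg hl]

end CavityModel

end RandomSystem

/-! ### The effective process of a site -/

section Effective

/-- The effective field of a site: `x^t = z^t + ∑_{s<t} Γ^{t,s} y^s`, `y^s = f_s(x^{<s})`. -/
def effX (f : ℕ → (ℕ → ℝ) → ℝ) (Γ : ℕ → ℕ → ℝ) (z : ℕ → ℝ) (t : ℕ) : ℝ :=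
  z t + ∑ s : Fin t, Γ t s * f s fun r => if _h : r < s then effX f Γ z r else 0
  termination_by t
  decreasing_by omega

/-- The effective response of a site at time `t` to a perturbation of its field at time `s`, where
`P t s` are the derivatives of the nonlinearities. -/
def effD (P : ℕ → ℕ → ℝ) (Γ : ℕ → ℕ → ℝ) (s t : ℕ) : ℝ :=
  if s < t then P t s + ∑ r : Fin t, P t r * ∑ q : Fin r, Γ r q * effD P Γ s q else 0
  termination_by t
  decreasing_by omega

theorem effX_eq {ι : Type*} {f : Act(ι)} {p : Grad(ι)} {L : ℕ → ℝ}
    (h : Reg f p L) (k : ι) (Γ : ℕ → ℕ → ℝ) (z : ℕ → ℝ) (t : ℕ) :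
    effX (fun s => f s k) Γ z t =
      z t + ∑ s ∈ range t, Γ t s * f s k (effX (fun s => f s k) Γ z) := by
  rw [effX, sum_range]
  congr 1
  refine sum_congr rfl fun s _ => ?_
  congr 1
  exact h.congr fun r hr => by rw [dif_pos hr]

theorem effX_congr (f : ℕ → (ℕ → ℝ) → ℝ) (Γ : ℕ → ℕ → ℝ) {z z' : ℕ → ℝ} {t : ℕ}
    (hz : ∀ s ≤ t, z s = z' s) : effX f Γ z t = effX f Γ z' t := by
  induction t using strongRecOn with
  | _ t ih =>
    rw [effX, effX, hz t le_rfl]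
    congr 1
    refine sum_congr rfl fun s _ => ?_
    congr 2
    funext r
    split_ifs with hr
    · exact ih r (hr.trans s.2) fun q hq => hz q (hq.trans (hr.trans s.2).le)
    · rfl

theorem effD_of_lt (P : ℕ → ℕ → ℝ) (Γ : ℕ → ℕ → ℝ) {s t : ℕ} (hst : s < t) :
    effD P Γ s t = P t s + ∑ r ∈ range t, P t r *
      ∑ q ∈ range r, Γ r q * effD P Γ s q := by
  rw [effD, if_pos hst, sum_range]
  simp only [sum_range]

theorem effD_of_le (P : ℕ → ℕ → ℝ) (Γ : ℕ → ℕ → ℝ) {s t : ℕ} (hst : t ≤ s) :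
    effD P Γ s t = 0 := by
  rw [effD, if_neg hst.not_gt]

theorem effD_congr {P P' : ℕ → ℕ → ℝ} (Γ : ℕ → ℕ → ℝ) (s : ℕ) {t : ℕ}
    (h : ∀ r ≤ t, ∀ q < r, P r q = P' r q) : effD P Γ s t = effD P' Γ s t := by
  induction t using strongRecOn with
  | _ t ih =>
    rcases lt_or_ge s t with hst | hst
    · rw [effD_of_lt _ _ hst, effD_of_lt _ _ hst, h t le_rfl s hst]
      congr 1
      refine sum_congr rfl fun r hr => ?_
      rw [mem_range] at hr
      rw [h t le_rfl r hr]
      congr 1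
      refine sum_congr rfl fun q hq => ?_
      rw [mem_range] at hq
      rw [ih q (hq.trans hr) fun r' hr' => h r' (hr'.trans (hq.trans hr).le)]
    · rw [effD_of_le _ _ hst, effD_of_le _ _ hst]

variable {X : Type*} [TopologicalSpace X]

theorem continuous_effX {f : X → ℕ → (ℕ → ℝ) → ℝ}
    (hf : ∀ t, Continuous fun q : X × (ℕ → ℝ) => f q.1 t q.2) (Γ : ℕ → ℕ → ℝ)
    {z : X → ℕ → ℝ} (hz : Continuous z) (t : ℕ) : Continuous fun x => effX (f x) Γ (z x) t := by
  induction t using strongRecOn with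
  | _ t ih =>
    have e : ∀ x, effX (f x) Γ (z x) t = z x t + ∑ s : Fin t, Γ t s *
        f x s fun r => if _h : r < s then effX (f x) Γ (z x) r else 0 := fun x => by
      rw [effX]
    simp only [e]
    have hc : ∀ (s : Fin t) (r : ℕ), Continuous fun x =>
        if _h : r < s then effX (f x) Γ (z x) r else 0 := fun s r => by
      by_cases hr : r < s
      · simp only [dif_pos hr]
        exact ih r (hr.trans s.2)
      · simp only [dif_neg hr]
        exact continuous_const
    exact ((continuous_apply t).comp hz).add (continuous_finsetSum _ fun s _ =>
      continuous_const.mul ((hf s).comp (continuous_id.prodMk (continuous_pi (hc s)))))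

theorem continuous_effD {P : X → ℕ → ℕ → ℝ} (hP : ∀ t s, Continuous fun x => P x t s)
    (Γ : ℕ → ℕ → ℝ) (s t : ℕ) : Continuous fun x => effD (P x) Γ s t := by
  induction t using strongRecOn with
  | _ t ih =>
    rcases lt_or_ge s t with hst | hst
    · simp only [effD_of_lt _ _ hst]
      exact (hP t s).add (continuous_finsetSum _ fun r hr => (hP t r).mul
        (continuous_finsetSum _ fun q hq => continuous_const.mul
          (ih q ((mem_range.1 hq).trans (mem_range.1 hr)))))
    · simp only [effD_of_le _ _ hst]
      exact continuous_const

end Effective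

section Horizon

open scoped Matrix.Norms.L2Operator

variable {Ω : ℕ → Type*} [∀ n, MeasurableSpace (Ω n)] {P : ∀ n, Measure (Ω n)}
  [∀ n, IsProbabilityMeasure (P n)] {ι : ℕ → Type} [∀ n, Fintype (ι n)] [∀ n, DecidableEq (ι n)]
  {κ : Type} [Fintype κ] {N : ℕ → ℕ} {ty : ∀ n, ι n → Bool}
  {M : ∀ n, Ω n → Matrix (ι n) (ι n) ℝ} {ξ : ∀ n, Ω n → ι n → (κ → ℝ)}
  {f : Act(Bool × (κ → ℝ))} {p : Grad(Bool × (κ → ℝ))}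
  {L : ℕ → ℝ} {c : ℝ} {J : ℕ → Type}

/-- The sites of type `b`. -/
abbrev Sites (ty : ∀ n, ι n → Bool) (b : Bool) (n : ℕ) : Type := {k : ι n // ty n k = b}

/-- The pairs of distinct sites of type `b`. -/
abbrev Pairs (ty : ∀ n, ι n → Bool) (b : Bool) (n : ℕ) : Type :=
  {q : ι n × ι n // q.1 ≠ q.2 ∧ ty n q.1 = b ∧ ty n q.2 = b}

/-- The pair in the other order. -/
def Pairs.swap {b : Bool} {n : ℕ} (q : Pairs ty b n) : Pairs ty b n :=
  ⟨(q.1.2, q.1.1), q.2.1.symm, q.2.2.2, q.2.2.1⟩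

/-- The first site of a pair. -/
def Pairs.site {b : Bool} {n : ℕ} (q : Pairs ty b n) : Sites ty b n := ⟨q.1.1, q.2.2.1⟩

/-- The convergence, up to the time `τ`, of the statistics of the sites that interact with the
sites of type `b`; and the limit `(Z, ζ)` of the cavity fields and the side information of the
sites of type `b`. -/
structure HorizonLimit (P : ∀ n, Measure (Ω n)) (N : ℕ → ℕ) (ty : ∀ n, ι n → Bool)
    (M : ∀ n, Ω n → Matrix (ι n) (ι n) ℝ) (ξ : ∀ n, Ω n → ι n → (κ → ℝ))
    (f : Act(Bool × (κ → ℝ))) (p : Grad(Bool × (κ → ℝ)))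
    (b : Bool) (τ : ℕ) (C Γ : ℕ → ℕ → ℝ) {Ω' : Type*} [MeasurableSpace Ω'] (γ : Measure Ω')
    (Z : Ω' → Fin τ → ℝ) (ζ : Ω' → κ → ℝ) : Prop where
  moment : ∀ s t, s < τ → t < τ → LpSmall P fun n (k : Sites ty b n) ω =>
    ∑ l, varProfile (N n) (ty n) k.1 l * (siteY (siteF (ty n) f (ξ n ω)) (M n ω) l s *
      siteY (siteF (ty n) f (ξ n ω)) (M n ω) l t) - C s t
  response : ∀ s t, s < t → t < τ → LpSmall P fun n (k : Sites ty b n) ω =>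
    ∑ l, varProfile (N n) (ty n) k.1 l *
      siteR (siteF (ty n) f (ξ n ω)) (siteD (ty n) p (ξ n ω)) (M n ω) l s t - Γ t s
  psd : ∀ u : Fin τ → ℝ, 0 ≤ ∑ s, ∑ t, u s * u t * C s t
  cont_f : ∀ t, Continuous fun q : (κ → ℝ) × (ℕ → ℝ) => f t (b, q.1) q.2
  cont_p : ∀ t s, Continuous fun q : (κ → ℝ) × (ℕ → ℝ) => p t s (b, q.1) q.2
  meas_Z : Measurable Z
  meas_ζ : Measurable ζ
  charFun_limit : ∀ u r, ∫ ω, cis(Z ω ⬝ᵥ u + ζ ω ⬝ᵥ r) ∂γ =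
    ((exp (-((∑ s, ∑ t, u s * u t * C s t) / 2)) : ℝ) : ℂ) *
      ∫ ω, cis(ζ ω ⬝ᵥ r) ∂γ
  law_ξ : ∀ n (k : Sites ty b n) r, ∫ ω, cis(ξ n ω k.1 ⬝ᵥ r) ∂P n =
    ∫ ω, cis(ζ ω ⬝ᵥ r) ∂γ
  indep_ξ : ∀ n (q : Pairs ty b n), IndepFun (fun ω => ξ n ω q.1.1) (fun ω => ξ n ω q.1.2) (P n)
  exists_pair : ∀ᶠ n in atTop, Nonempty (Sites ty b n) ∧
    ∀ k : Sites ty b n, ∃ q : Pairs ty b n, q.site = k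

variable {b : Bool} {τ : ℕ} {C Γ : ℕ → ℕ → ℝ} {Ω' : Type*} [MeasurableSpace Ω'] {γ : Measure Ω'}
    [IsProbabilityMeasure γ] {Z : Ω' → Fin τ → ℝ} {ζ : Ω' → κ → ℝ}

/-- The field at the first site of a pair created by the system without the pair. -/
def pairField (M : ∀ n, Ω n → Matrix (ι n) (ι n) ℝ) (ξ : ∀ n, Ω n → ι n → (κ → ℝ))
    (f : Act(Bool × (κ → ℝ))) {ty : ∀ n, ι n → Bool} {b : Bool} (n : ℕ)
    (q : Pairs ty b n) (ω : Ω n) (t : ℕ) : ℝ :=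
  M n ω q.1.1 ⬝ᵥ sysY (siteF (ty n) f (ξ n ω)) (mask {q.1.1, q.1.2} (M n ω)) t

theorem pair_mask {ι : Type*} [Fintype ι] [DecidableEq ι] (k k' : ι) (A : Matrix ι ι ℝ) :
    mask {k, k'} A = mask {k'} (mask {k} A) := by
  rw [mask_mask, Finset.insert_eq, Finset.union_comm]

/-- The fields up to time `τ` and the side information of a site. -/
def siteV (ty : ∀ n, ι n → Bool) (M : ∀ n, Ω n → Matrix (ι n) (ι n) ℝ)
    (ξ : ∀ n, Ω n → ι n → (κ → ℝ)) (f : Act(Bool × (κ → ℝ))) (τ : ℕ) (n : ℕ)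
    (k : ι n) (ω : Ω n) : Fin τ ⊕ κ → ℝ :=
  elim (fun t => sysX (siteF (ty n) f (ξ n ω)) (M n ω) t k) (ξ n ω k)

/-- The effective fields as a function of the cavity fields and the side information. -/
def effVec (f : Act(Bool × (κ → ℝ))) (b : Bool) (Γ : ℕ → ℕ → ℝ)
    {τ : ℕ} (v : Fin τ ⊕ κ → ℝ) : Fin τ ⊕ κ → ℝ :=
  elim (fun t => effX (fun s => f s (b, fun a => v (inr a))) Γ
    (ext0 fun t => v (inl t)) t) fun a => v (inr a)

theorem continuous_ext0 {T : ℕ} : Continuous (ext0 : (Fin T → ℝ) → ℕ → ℝ) := by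
  unfold ext0
  refine continuous_pi fun n => ?_
  by_cases hn : n < T
  · simp only [dif_pos hn]; exact continuous_apply _
  · simp only [dif_neg hn]; exact continuous_const

theorem continuous_effVec (hf : ∀ t, Continuous fun q : (κ → ℝ) × (ℕ → ℝ) => f t (b, q.1) q.2) :
    Continuous (effVec f b Γ (τ := τ)) := by
  have hr : Continuous fun v : Fin τ ⊕ κ → ℝ => fun a => v (inr a) :=
    continuous_pi fun a => continuous_apply _
  refine continuous_pi fun a => ?_
  rcases a with t | a
  · exact continuous_effX (f := fun (v : Fin τ ⊕ κ → ℝ) s => f s (b, fun a => v (inr a)))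
      (fun s => (hf s).comp ((hr.comp continuous_fst).prodMk continuous_snd)) Γ
      (continuous_ext0.comp (continuous_pi fun t => continuous_apply _)) t
  · exact continuous_apply _

theorem sum_varProfile {n : ℕ} (k : Sites ty (!b) n) (a : ι n → ℝ) :
    ∑ l, varProfile (N n) (ty n) k.1 l * a l =
      (N n : ℝ)⁻¹ * ∑ l : Sites ty b n, a l.1 := by
  rw [← Finset.sum_subtype (univ.filter fun l => ty n l = b) (by simp) a, mul_sum,
    Finset.sum_filter]
  refine sum_congr rfl fun l _ => ?_
  unfold varProfile
  rw [k.2]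
  cases b <;> cases ty n l <;> simp

local notation:max "V[" n "]" => varProfile (N n) (ty n)
local notation:max "sF[" n "," ω "]" => siteF (ty n) f (ξ n ω)
local notation:max "sD[" n "," ω "]" => siteD (ty n) p (ξ n ω)
local notation:max "sV[" n "," k "," ω "]" => siteV ty M ξ f τ n k ω

/-- The fields of a site vector, continued by `0`. -/
def vecX {τ : ℕ} (v : Fin τ ⊕ κ → ℝ) : ℕ → ℝ := ext0 fun t => v (inl t)

/-- The side information of a site vector. -/
def vecΞ {τ : ℕ} (v : Fin τ ⊕ κ → ℝ) : κ → ℝ := fun a => v (inr a)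

theorem continuous_vecX : Continuous (vecX : (Fin τ ⊕ κ → ℝ) → ℕ → ℝ) :=
  continuous_ext0.comp (continuous_pi fun _ => continuous_apply _)

theorem continuous_vecΞ : Continuous (vecΞ : (Fin τ ⊕ κ → ℝ) → κ → ℝ) :=
  continuous_pi fun _ => continuous_apply _

theorem vecX_siteV {n : ℕ} (k : ι n) (ω : Ω n) {t : ℕ} (ht : t < τ) :
    vecX sV[n,k,ω] t = sysX sF[n,ω] (M n ω) t k := by
  rw [vecX, ext0, dif_pos ht]
  rfl

namespace CavityModel

variable (h : CavityModel P N ty M ξ f p L c)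
include h

theorem meas_pairField (n : ℕ) (q : Pairs ty b n) (t : ℕ) :
    Measurable fun ω => pairField M ξ f n q ω t :=
  measurable_dotProduct ((h.meas_M n).row _) (h.meas_sysY n _ t)

theorem meas_siteV (n : ℕ) (k : ι n) : Measurable (siteV ty M ξ f τ n k) := by
  refine measurable_pi_iff.2 fun a => ?_
  rcases a with t | a
  · exact (h.siteX_bdd t).meas n k
  · exact (measurable_pi_apply a).comp ((measurable_pi_apply k).comp (h.meas_ξ n))

theorem card_sites_le (b : Bool) (n : ℕ) : (card (Sites ty b n) : ℝ) ≤ c * N n :=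
  le_trans (by exact_mod_cast Fintype.card_subtype_le _) (h.card_le n)

/-- A weak law of large numbers under asymptotic pairwise decorrelation. -/
theorem average_small {U : ∀ n, Sites ty b n → Ω n → ℝ} (hU : LpBdd P U)
    (hpair : ∀ ε > 0, ∀ᶠ n in atTop, ∀ q : Pairs ty b n,
      |∫ ω, U n q.site ω * U n q.swap.site ω ∂P n| < ε) :
    LpSmall P fun n (_ : J n) ω => (N n : ℝ)⁻¹ * ∑ l, U n l ω := by
  have hbd : LpBdd P fun n (_ : J n) ω => (N n : ℝ)⁻¹ * ∑ l, U n l ω :=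
    (hU.reindex (K := fun n => J n × Sites ty b n) fun n jl => jl.2).average (h.card_sites_le b)
  refine hbd.small_of_pow (k := 1) fun ε hε => ?_
  obtain ⟨D, hD0, hD⟩ := (hU.pow 2).exists_integral_abs_le
  set ε' : ℝ := ε / (2 * (|c| ^ 2 + 1)) with hε'
  have hε'0 : 0 < ε' := by positivity
  filter_upwards [hpair ε' hε'0, (h.tendsto_const_div_N (|c| * D)).eventually_le_const
    (half_pos hε)] with n h1 h2 j
  set a : ℝ := (N n : ℝ)⁻¹ with ha
  have ha0 : 0 ≤ a := by positivity
  set K : ℝ := (card (Sites ty b n) : ℝ) with hK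
  have hK0 : 0 ≤ K := by positivity
  have hKa : K * a ≤ |c| := card_mul_inv_le (h.card_sites_le b n)
  have hint : ∀ l l', Integrable (fun ω => U n l ω * U n l' ω) (P n) := fun l l' =>
    ((hU.reindex (K := fun n => Sites ty b n × Sites ty b n) fun n jl => jl.1).mul
      (hU.reindex fun n jl => jl.2)).integrable n (l, l')
  have hint2 : Integrable (fun ω => (a * ∑ l, U n l ω) ^ 2) (P n) := (hbd.pow 2).integrable n j
  have hle : ∀ l l', ∫ ω, U n l ω * U n l' ω ∂P n ≤ (if l = l' then D else 0) + ε' := by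
    intro l l'
    by_cases hll : l = l'
    · subst hll
      rw [if_pos rfl]
      have := hD n l
      simp only [abs_pow, sq_abs] at this
      simp only [← sq]
      linarith
    · rw [if_neg hll, zero_add]
      exact ((le_abs_self _).trans_lt (h1 ⟨(l.1, l'.1), fun e => hll (Subtype.ext e), l.2, l'.2⟩)).le
  have e : ∫ ω, (a * ∑ l, U n l ω) ^ 2 ∂P n = a ^ 2 * ∑ l, ∑ l', ∫ ω, U n l ω * U n l' ω ∂P n := by
    simp only [mul_pow, integral_const_mul]
    congr 1
    simp only [sq, sum_mul_sum]
    rw [integral_finsetSum _ fun l _ => integrable_finsetSum _ fun l' _ => hint l l']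
    exact sum_congr rfl fun l _ => integral_finsetSum _ fun l' _ => hint l l'
  have hfin : ∫ ω, (a * ∑ l, U n l ω) ^ 2 ∂P n ≤ ε := by
    rw [e]
    calc _ ≤ a ^ 2 * ∑ l : Sites ty b n, ∑ l' : Sites ty b n, ((if l = l' then D else 0) + ε') := by
          gcongr with l _ l' _
          exact hle l l'
      _ = (K * a) * D * a + (K * a) ^ 2 * ε' := by
          simp only [sum_add_distrib, sum_ite_eq, mem_univ, if_true,
            sum_const, card_univ, nsmul_eq_mul, ← hK]
          ring
      _ ≤ |c| * D * a + |c| ^ 2 * ε' := by gcongr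
      _ ≤ ε / 2 + ε / 2 := by
          refine add_le_add ?_ ?_
          · rw [ha, ← div_eq_mul_inv]; exact h2
          · rw [hε', mul_div_assoc', div_le_div_iff₀ (by positivity) (by positivity)]
            nlinarith [sq_nonneg |c|]
      _ = ε := add_halves ε
  calc ∫⁻ ω, ofReal (|a * ∑ l, U n l ω| ^ (1 + 1)) ∂P n
      = ofReal (∫ ω, (a * ∑ l, U n l ω) ^ 2 ∂P n) := by
        rw [ofReal_integral_eq_lintegral_ofReal hint2 (.of_forall fun _ => sq_nonneg _)]
        simp only [Nat.reduceAdd, sq_abs]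
    _ ≤ _ := ofReal_le_ofReal hfin

theorem siteY_eq {n : ℕ} (k : Sites ty b n) (ω : Ω n) {t : ℕ} (ht : t ≤ τ) :
    siteY sF[n,ω] (M n ω) k.1 t =
      f t (b, vecΞ sV[n,k.1,ω]) (vecX sV[n,k.1,ω]) := by
  rw [siteY, sysY_eq (h.siteReg n ω), siteF, k.2]
  exact h.reg.congr fun s hs => (vecX_siteV k.1 ω (hs.trans_le ht)).symm

theorem sysP_eq {n : ℕ} (k : Sites ty b n) (ω : Ω n) {t : ℕ} (ht : t ≤ τ) (s : ℕ) :
    sysP sF[n,ω] sD[n,ω] (M n ω) t s k.1 =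
      p t s (b, vecΞ sV[n,k.1,ω]) (vecX sV[n,k.1,ω]) := by
  rw [sysP, siteD, k.2]
  exact h.reg.congr_p fun s hs => (vecX_siteV k.1 ω (hs.trans_le ht)).symm

end CavityModel

namespace HorizonLimit

variable (H : HorizonLimit P N ty M ξ f p b τ C Γ γ Z ζ) (h : CavityModel P N ty M ξ f p L c)

include H h

theorem pair_moment_small (u : Fin τ → ℝ) : LpSmall P fun n (q : Pairs ty b n) ω =>
    ∑ l, V[n] q.1.1 l * (∑ t : Fin τ, u t *
      sysY sF[n,ω] (mask {q.1.1, q.1.2} (M n ω)) t l) ^ 2 -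
        ∑ s, ∑ t, u s * u t * C s t := by
  have hm : ∀ n (q : Pairs ty b n) (t : ℕ) l, Measurable fun ω =>
      sysY sF[n,ω] (mask {q.1.1, q.1.2} (M n ω)) t l := fun n q t l =>
    (measurable_pi_apply l).comp (h.meas_sysY n {q.1.1, q.1.2} t)
  have key : ∀ s t : Fin τ, LpSmall P fun n (q : Pairs ty b n) ω =>
      ∑ l, V[n] q.1.1 l *
        (sysY sF[n,ω] (mask {q.1.1, q.1.2} (M n ω)) s l *
        sysY sF[n,ω] (mask {q.1.1, q.1.2} (M n ω)) t l) - C s t := fun s t => by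
    have h1 := (H.moment s t s.2 t.2).reindex (K := Pairs ty b) fun n q => q.site
    have h2 := h.moment_mask_small (J := Pairs ty b) (fun n q => ∅) (fun n q => q.1.1)
      (fun n q => q.1.1) (fun _ _ => rfl) s t
    have h3 := h.moment_mask_small (J := Pairs ty b) (fun n q => {q.1.1}) (fun n q => q.1.1)
      (fun n q => q.1.2) (fun n q => q.2.2.1.trans q.2.2.2.symm) s t
    simp only [mask_empty] at h2
    refine ((h1.sub h2).sub h3).mono (fun n q => ?_) fun n q ω => le_of_eq (congrArg _ ?_)
    · exact (Finset.measurable_fun_sum _ fun l _ =>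
        ((hm n q s l).mul (hm n q t l)).const_mul _).sub_const _
    · simp only [pair_mask, Pairs.site, siteY]
      ring
  have hs : LpSmall P fun n (q : Pairs ty b n) ω => ∑ s : Fin τ, ∑ t : Fin τ, u s * u t *
      (∑ l, V[n] q.1.1 l *
        (sysY sF[n,ω] (mask {q.1.1, q.1.2} (M n ω)) s l *
        sysY sF[n,ω] (mask {q.1.1, q.1.2} (M n ω)) t l) - C s t) :=
    LpSmall.sum _ fun s _ => LpSmall.sum _ fun t _ => (key s t).const_mul (u s * u t)
  refine hs.mono (fun n q => ?_) fun n q ω => le_of_eq (congrArg _ ?_)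
  · refine Measurable.sub_const (Finset.measurable_fun_sum _ fun l _ => Measurable.const_mul
      (Measurable.pow_const (Finset.measurable_fun_sum _ fun t _ => ?_) 2) _) _
    exact (hm n q t l).const_mul _
  · simp only [mul_sub, sum_sub_distrib]
    congr 1
    calc _ = ∑ l, ∑ s : Fin τ, ∑ t : Fin τ, u s * u t * (V[n] q.1.1 l *
          (sysY sF[n,ω] (mask {q.1.1, q.1.2} (M n ω)) s l *
          sysY sF[n,ω] (mask {q.1.1, q.1.2} (M n ω)) t l)) := by
          refine sum_congr rfl fun l _ => ?_
          rw [sq, sum_mul_sum, mul_sum]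
          refine sum_congr rfl fun s _ => ?_
          rw [mul_sum]
          exact sum_congr rfl fun t _ => by ring
      _ = _ := by
          rw [sum_comm]
          refine sum_congr rfl fun s _ => ?_
          rw [sum_comm]
          exact sum_congr rfl fun t _ => by rw [mul_sum]

theorem tendsto_charFun_pairField (u : Fin τ → ℝ) (B : ∀ n, Pairs ty b n → Ω n → ℝ)
    (B' : ∀ n, Pairs ty b n → (ι n → ι n → ℝ) × (ι n → κ → ℝ) → ℝ)
    (hB' : ∀ n q, Measurable (B' n q))
    (hBB' : ∀ n q ω, B n q ω = B' n q ((fun i j' => mask {q.1.1} (M n ω) i j'), ξ n ω)) :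
    Tendsto (fun x : Σ n, Pairs ty b n =>
      ∫ ω, cis(∑ t : Fin τ, u t * pairField M ξ f x.1 x.2 ω t +
        B x.1 x.2 ω) ∂P x.1 -
      ((exp (-((∑ s, ∑ t, u s * u t * C s t) / 2)) : ℝ) : ℂ) *
        ∫ ω, cis(B x.1 x.2 ω) ∂P x.1) (unif (Pairs ty b))
        (𝓝 0) := by
  have hn1 : ∀ x : ℝ, ‖Complex.exp (Complex.I * (x : ℂ))‖ ≤ 1 := fun x => by
    rw [mul_comm, Complex.norm_exp_ofReal_mul_I]
  have h1 := h.tendsto_charFun_row (J := Pairs ty b) (fun n q => q.1.1)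
    (fun n q ω l => ∑ t : Fin τ, u t *
      sysY sF[n,ω] (mask {q.1.1, q.1.2} (M n ω)) t l)
    (fun n q e l => ∑ t : Fin τ, u t *
      sysY (siteF (ty n) f e.2) (mask {q.1.2} (of e.1)) t l)
    (fun n q => ?_) (fun n q ω => ?_)
    (fun n q ω => cis(B n q ω))
    (fun n q e => cis(B' n q e)) (fun n q => ?_)
    (fun n q ω => by rw [hBB']) (fun n q e => hn1 _) (H.psd u) (H.pair_moment_small h u) ?_
  · refine h1.congr fun x => ?_
    congr 2
    funext ω
    rw [← Complex.exp_add, ← mul_add, ← Complex.ofReal_add]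
    congr 4
    simp only [pairField, dotProduct, mul_sum]
    rw [sum_comm]
    exact sum_congr rfl fun t _ => sum_congr rfl fun l _ => by ring
  · have hq : MeasM fun q : (ι n → ι n → ℝ) × (ι n → κ → ℝ) => of q.1 := fun i j' =>
      (measurable_pi_apply j').comp ((measurable_pi_apply i).comp measurable_fst)
    exact measurable_pi_iff.2 fun l => Finset.measurable_fun_sum _ fun t _ =>
      ((measurable_pi_apply l).comp (measurable_sysY h.meas_f measurable_snd
        (hq.mask _) t)).const_mul _
  · ext l
    rw [pair_mask]
    rfl
  · have := hB' n q
    fun_prop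
  · exact LpBdd.sum _ fun t _ => ((h.sysY_apply_bdd t).reindex
      (K := fun n => Pairs ty b n × ι n) fun n jl => ({jl.1.1.1, jl.1.1.2}, jl.2)).const_mul _

/-- The joint characteristic function of the cavity fields and the side information of a pair. -/
theorem tendsto_charFun_pair (u u' : Fin τ → ℝ) (r r' : κ → ℝ) :
    Tendsto (fun x : Σ n, Pairs ty b n =>
      ∫ ω, cis((∑ t : Fin τ, u t * pairField M ξ f x.1 x.2 ω t +
        ξ x.1 ω x.2.1.1 ⬝ᵥ r) + (∑ t : Fin τ, u' t * pairField M ξ f x.1 x.2.swap ω t +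
        ξ x.1 ω x.2.1.2 ⬝ᵥ r')) ∂P x.1) (unif (Pairs ty b))
      (𝓝 ((∫ ω, cis(Z ω ⬝ᵥ u + ζ ω ⬝ᵥ r) ∂γ) *
        ∫ ω, cis(Z ω ⬝ᵥ u' + ζ ω ⬝ᵥ r') ∂γ)) := by
  have hd : ∀ (n : ℕ) (l : ι n) (r : κ → ℝ), Measurable
      fun e : (ι n → ι n → ℝ) × (ι n → κ → ℝ) => e.2 l ⬝ᵥ r := fun n l r =>
    Finset.measurable_fun_sum _ fun a _ => ((measurable_pi_apply a).comp
      ((measurable_pi_apply l).comp measurable_snd)).mul_const _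
  have h1 := H.tendsto_charFun_pairField h u (fun n q ω => ξ n ω q.1.1 ⬝ᵥ r +
      (∑ t : Fin τ, u' t * pairField M ξ f n q.swap ω t + ξ n ω q.1.2 ⬝ᵥ r'))
    (fun n q e => e.2 q.1.1 ⬝ᵥ r + (∑ t : Fin τ, u' t * ((fun l => e.1 q.1.2 l) ⬝ᵥ
      sysY (siteF (ty n) f e.2) (mask {q.1.2} (of e.1)) t) + e.2 q.1.2 ⬝ᵥ r'))
    (fun n q => ?_) (fun n q ω => ?_)
  · have h2 := H.tendsto_charFun_pairField h u' (fun n q ω => ξ n ω q.1.2 ⬝ᵥ r +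
        ξ n ω q.1.1 ⬝ᵥ r') (fun n q e => e.2 q.1.2 ⬝ᵥ r + e.2 q.1.1 ⬝ᵥ r')
      (fun n q => (hd n _ r).add (hd n _ r')) (fun n q ω => rfl)
    have hsw : Tendsto (fun x : Σ n, Pairs ty b n => (⟨x.1, x.2.swap⟩ : Σ n, Pairs ty b n))
        (unif (Pairs ty b)) (unif (Pairs ty b)) :=
      tendsto_comap_iff.2 tendsto_comap
    have h2' := h2.comp hsw
    have h3 : ∀ x : Σ n, Pairs ty b n, ∫ ω, Complex.exp (Complex.I *
        ((ξ x.1 ω x.2.1.1 ⬝ᵥ r + ξ x.1 ω x.2.1.2 ⬝ᵥ r' : ℝ) : ℂ)) ∂P x.1 =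
        (∫ ω, cis(ζ ω ⬝ᵥ r) ∂γ) *
        ∫ ω, cis(ζ ω ⬝ᵥ r') ∂γ := by
      rintro ⟨n, q⟩
      have hm : ∀ r : κ → ℝ, Measurable fun v : κ → ℝ =>
          cis(v ⬝ᵥ r) := fun r => by
        have : Measurable fun v : κ → ℝ => v ⬝ᵥ r :=
          Finset.measurable_fun_sum _ fun a _ => (measurable_pi_apply a).mul_const _
        fun_prop
      have hx : ∀ l, Measurable fun ω => ξ n ω l := fun l =>
        (measurable_pi_apply l).comp (h.meas_ξ n)
      have hi := (H.indep_ξ n q).comp (hm r) (hm r')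
      have := hi.integral_fun_mul_eq_mul_integral
        ((hm r).comp (hx _)).aestronglyMeasurable ((hm r').comp (hx _)).aestronglyMeasurable
      simp only [Function.comp_apply] at this
      have l1 := H.law_ξ n q.site r
      have l2 := H.law_ξ n q.swap.site r'
      simp only [Pairs.site, Pairs.swap] at l1 l2
      rw [l1, l2] at this
      rw [← this]
      refine integral_congr_ae (.of_forall fun ω => ?_)
      dsimp only
      rw [← Complex.exp_add, ← mul_add, ← Complex.ofReal_add]
    rw [H.charFun_limit, H.charFun_limit]
    set a : ℂ := ((exp (-((∑ s, ∑ t, u s * u t * C s t) / 2)) : ℝ) : ℂ)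
    set a' : ℂ := ((exp (-((∑ s, ∑ t, u' s * u' t * C s t) / 2)) : ℝ) : ℂ)
    have h4 := (h1.add (h2'.const_mul a)).add_const (a * (a' *
      ((∫ ω, cis(ζ ω ⬝ᵥ r) ∂γ) *
        ∫ ω, cis(ζ ω ⬝ᵥ r') ∂γ)))
    rw [mul_zero, zero_add, zero_add] at h4
    refine (h4.congr fun x => ?_).trans (le_of_eq (congrArg _ (by ring)))
    rw [← h3 x]
    simp only [Function.comp_apply, Pairs.swap]
    have i1 : ∀ ω, ∑ t, u t * pairField M ξ f x.fst x.snd ω t +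
        (ξ x.1 ω x.2.1.1 ⬝ᵥ r + (∑ t, u' t * pairField M ξ f x.1 x.2.swap ω t +
          ξ x.1 ω x.2.1.2 ⬝ᵥ r')) = (∑ t, u t * pairField M ξ f x.fst x.snd ω t +
        ξ x.1 ω x.2.1.1 ⬝ᵥ r) + (∑ t, u' t * pairField M ξ f x.1 x.2.swap ω t +
          ξ x.1 ω x.2.1.2 ⬝ᵥ r') := fun ω => (add_assoc _ _ _).symm
    have i2 : ∀ ω, ∑ t, u' t * pairField M ξ f x.1 x.2.swap ω t +
        (ξ x.1 ω x.2.1.1 ⬝ᵥ r + ξ x.1 ω x.2.1.2 ⬝ᵥ r') = ξ x.1 ω x.2.1.1 ⬝ᵥ r +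
        (∑ t, u' t * pairField M ξ f x.1 x.2.swap ω t + ξ x.1 ω x.2.1.2 ⬝ᵥ r') :=
      fun ω => add_left_comm _ _ _
    simp only [Pairs.swap] at i1 i2
    simp only [i1, i2]
    ring
  · refine (hd n _ r).add ((Finset.measurable_fun_sum _ fun t _ => (measurable_dotProduct ?_
      ?_).const_mul _).add (hd n _ r'))
    · exact (measurable_pi_apply _).comp measurable_fst
    · have hq : MeasM fun q : (ι n → ι n → ℝ) × (ι n → κ → ℝ) => of q.1 := fun i j' =>
        (measurable_pi_apply j').comp ((measurable_pi_apply i).comp measurable_fst)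
      exact measurable_sysY h.meas_f measurable_snd (hq.mask _) t
  · congr 2
    refine sum_congr rfl fun t _ => ?_
    congr 1
    rw [pairField, Pairs.swap]
    dsimp only
    rw [Finset.pair_comm, pair_mask]
    refine sum_congr rfl fun l _ => ?_
    congr 1
    change _ = mask {q.1.1} (M n ω) q.1.2 l
    rw [mask_apply]
    by_cases hl : l = q.1.1
    · subst hl
      rw [h.same n ω _ _ (q.2.2.2.trans q.2.2.1.symm)]
      simp
    · rw [if_neg]
      simp [hl, q.2.1.symm]

/-! ### The limit law of a pair of sites -/

theorem self_small {s t : ℕ} (hst : s < t) (ht : t < τ) :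
    LpSmall P fun n (k : Sites ty b n) ω => M n ω k.1 ⬝ᵥ (sysR sF[n,ω]
      sD[n,ω] (mask {k.1} (M n ω)) s t *ᵥ M n ω k.1) - Γ t s := by
  refine (((h.quad_sub_average_small s t).reindex (K := Sites ty b) fun n k => k.1).add
    (H.response s t hst ht)).mono (fun n k => ((h.quad_bdd s t).meas n k.1).sub_const _)
      fun n k ω => le_of_eq (congrArg _ ?_)
  ring

theorem meas_effX_pair (n : ℕ) (q : Pairs ty b n) (t : ℕ) : Measurable fun ω =>
    effX (fun s => f s (b, ξ n ω q.1.1)) Γ (pairField M ξ f n q ω) t := by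
  have h1 := continuous_effX (f := fun (v : (κ → ℝ) × (ℕ → ℝ)) s => f s (b, v.1))
    (fun s => (H.cont_f s).comp ((continuous_fst.comp continuous_fst).prodMk continuous_snd)) Γ
    (z := fun v => v.2) continuous_snd t
  refine h1.measurable.comp (f := fun ω => (ξ n ω q.1.1, pairField M ξ f n q ω)) ?_
  exact ((measurable_pi_apply _).comp (h.meas_ξ n)).prodMk
    (measurable_pi_iff.2 fun t => h.meas_pairField n q t)

/-- The field at a site is close to the effective field driven by the cavity field. -/
theorem siteX_sub_effX_small {t : ℕ} (ht : t < τ) : LpSmall P fun n (q : Pairs ty b n) ω =>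
    sysX sF[n,ω] (M n ω) t q.1.1 -
      effX (fun s => f s (b, ξ n ω q.1.1)) Γ (pairField M ξ f n q ω) t := by
  induction t using strongRecOn with
  | _ t ih =>
    have h1 := (h.field_small t).reindex (K := Pairs ty b) fun n q => q.1.1
    have h2 := h.cavityField_pair_small (J := Pairs ty b) (fun n q => q.1.1) (fun n q => q.1.2)
      (fun n q => q.2.2.1.trans q.2.2.2.symm) t
    have h3 : LpSmall P fun n (q : Pairs ty b n) ω => ∑ s ∈ range t,
        (M n ω q.1.1 ⬝ᵥ (sysR sF[n,ω] sD[n,ω]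
          (mask {q.1.1} (M n ω)) s t *ᵥ M n ω q.1.1) - Γ t s) *
          siteY sF[n,ω] (M n ω) q.1.1 s :=
      LpSmall.sum _ fun s hs => ((H.self_small h (mem_range.1 hs) ht).reindex
        (K := Pairs ty b) fun n q => q.site).mul_bdd ((h.siteY_bdd s).reindex
          (K := Pairs ty b) fun n q => q.1.1)
    have h4 : LpSmall P fun n (q : Pairs ty b n) ω => ∑ s ∈ range t, Γ t s *
        (siteY sF[n,ω] (M n ω) q.1.1 s -
          f s (b, ξ n ω q.1.1) (effX (fun s => f s (b, ξ n ω q.1.1)) Γ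
            (pairField M ξ f n q ω))) := by
      refine LpSmall.sum _ fun s hs => LpSmall.const_mul _ ?_
      have hst := mem_range.1 hs
      have h5 : LpSmall P fun n (q : Pairs ty b n) ω => L s * ∑ r ∈ range s,
          |sysX sF[n,ω] (M n ω) r q.1.1 -
            effX (fun s => f s (b, ξ n ω q.1.1)) Γ (pairField M ξ f n q ω) r| :=
        (LpSmall.sum _ fun r hr => (ih r ((mem_range.1 hr).trans hst)
          (((mem_range.1 hr).trans hst).trans ht)).abs).const_mul _
      refine h5.of_le (fun n q => ?_) fun n q ω => ?_
      · refine (h.meas_siteY n _ s).sub ?_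
        have h6 : Measurable fun ω => ((b, ξ n ω q.1.1), effX (fun s => f s (b, ξ n ω q.1.1)) Γ
            (pairField M ξ f n q ω)) :=
          (measurable_const.prodMk ((measurable_pi_apply _).comp (h.meas_ξ n))).prodMk
            (measurable_pi_iff.2 fun r => H.meas_effX_pair h n q r)
        exact (h.meas_f s).comp h6
      · rw [siteY, sysY_eq (h.siteReg n ω)]
        have := h.reg.lip s (b, ξ n ω q.1.1) (effX (fun s => f s (b, ξ n ω q.1.1)) Γ
            (pairField M ξ f n q ω)) fun s => sysX sF[n,ω] (M n ω) s q.1.1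
        simp only [siteF, q.2.2.1] at this ⊢
        exact this
    refine (((h1.add h2).add h3).add h4).mono (fun n q => ((h.siteX_bdd t).meas n _).sub
      (H.meas_effX_pair h n q t)) fun n q ω => le_of_eq (congrArg _ ?_)
    have e := effX_eq h.reg (b, ξ n ω q.1.1) Γ (pairField M ξ f n q ω) t
    rw [e]
    simp only [sub_mul, mul_sub, sum_sub_distrib, pairField, pair_mask]
    ring

/-- The vector of cavity fields and side information of a pair. -/
def cavVec (M : ∀ n, Ω n → Matrix (ι n) (ι n) ℝ) (ξ : ∀ n, Ω n → ι n → (κ → ℝ))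
    (f : Act(Bool × (κ → ℝ))) {ty : ∀ n, ι n → Bool} {b : Bool} (τ : ℕ) (n : ℕ)
    (q : Pairs ty b n) (ω : Ω n) : (Fin τ ⊕ κ) ⊕ (Fin τ ⊕ κ) → ℝ :=
  elim (elim (fun t => pairField M ξ f n q ω t) (ξ n ω q.1.1))
    (elim (fun t => pairField M ξ f n q.swap ω t) (ξ n ω q.1.2))

omit H in
theorem meas_cavVec (n : ℕ) (q : Pairs ty b n) : Measurable (cavVec M ξ f τ n q) := by
  refine measurable_pi_iff.2 fun a => ?_
  rcases a with (t | a) | (t | a)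
  · exact h.meas_pairField n q t
  · exact (measurable_pi_apply a).comp ((measurable_pi_apply _).comp (h.meas_ξ n))
  · exact h.meas_pairField n q.swap t
  · exact (measurable_pi_apply a).comp ((measurable_pi_apply _).comp (h.meas_ξ n))

omit h in
theorem meas_limVec : Measurable fun ω => elim (Z ω) (ζ ω) := by
  refine measurable_pi_iff.2 fun a => ?_
  rcases a with t | a
  · exact (measurable_pi_apply t).comp H.meas_Z
  · exact (measurable_pi_apply a).comp H.meas_ζ

theorem tendsto_charFun_cavVec (u : (Fin τ ⊕ κ) ⊕ (Fin τ ⊕ κ) → ℝ) :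
    Tendsto (fun x : Σ n, Pairs ty b n =>
      ∫ ω, cis(cavVec M ξ f τ x.1 x.2 ω ⬝ᵥ u) ∂P x.1)
      (unif (Pairs ty b))
      (𝓝 (∫ ω, cis(elim (elim (Z ω.1) (ζ ω.1))
        (elim (Z ω.2) (ζ ω.2)) ⬝ᵥ u) ∂(γ.prod γ))) := by
  have h1 := H.tendsto_charFun_pair h (fun t => u (inl (inl t)))
    (fun t => u (inr (inl t))) (fun t => u (inl (inr t)))
    (fun t => u (inr (inr t)))
  rw [← integral_prod_mul] at h1
  refine (h1.congr fun x => ?_).trans (le_of_eq (congrArg _ ?_))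
  · refine congrArg (fun F : Ω x.1 → ℂ => ∫ ω, F ω ∂P x.1) (funext fun ω => ?_)
    congr 3
    simp only [dotProduct, cavVec, sum_sum_type, elim_inl, elim_inr]
    simp only [mul_comm (u _)]
  · refine congrArg (fun F : Ω' × Ω' → ℂ => ∫ ω, F ω ∂(γ.prod γ)) (funext fun ω => ?_)
    rw [← Complex.exp_add, ← mul_add, ← Complex.ofReal_add]
    congr 3
    simp only [dotProduct, sum_sum_type, elim_inl, elim_inr]

/-- The image of a pair of vectors. -/
def effPair (f : Act(Bool × (κ → ℝ))) (b : Bool) (Γ : ℕ → ℕ → ℝ)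
    {τ : ℕ} (v : (Fin τ ⊕ κ) ⊕ (Fin τ ⊕ κ) → ℝ) : (Fin τ ⊕ κ) ⊕ (Fin τ ⊕ κ) → ℝ :=
  elim (effVec f b Γ fun a => v (inl a)) (effVec f b Γ fun a => v (inr a))

omit h in
theorem continuous_effPair : Continuous (effPair f b Γ (τ := τ)) := by
  have h1 := continuous_effVec (Γ := Γ) (τ := τ) H.cont_f
  refine continuous_pi fun a => ?_
  rcases a with a | a
  · change Continuous fun v : (Fin τ ⊕ κ) ⊕ (Fin τ ⊕ κ) → ℝ => effVec f b Γ (fun a => v (inl a)) a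
    have h2 : Continuous fun (v : (Fin τ ⊕ κ) ⊕ (Fin τ ⊕ κ) → ℝ) a => v (inl a) :=
      continuous_pi fun a => continuous_apply (inl a)
    exact ((continuous_apply a).comp h1).comp h2
  · change Continuous fun v : (Fin τ ⊕ κ) ⊕ (Fin τ ⊕ κ) → ℝ => effVec f b Γ (fun a => v (inr a)) a
    have h2 : Continuous fun (v : (Fin τ ⊕ κ) ⊕ (Fin τ ⊕ κ) → ℝ) a => v (inr a) :=
      continuous_pi fun a => continuous_apply (inr a)
    exact ((continuous_apply a).comp h1).comp h2

theorem siteV_sub_effPair_small (a : (Fin τ ⊕ κ) ⊕ (Fin τ ⊕ κ)) :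
    LpSmall P fun n (q : Pairs ty b n) ω =>
      elim sV[n,q.1.1,ω] sV[n,q.1.2,ω] a -
        effPair f b Γ (cavVec M ξ f τ n q ω) a := by
  have key : ∀ t : Fin τ, LpSmall P fun n (q : Pairs ty b n) ω =>
      sysX sF[n,ω] (M n ω) t q.1.1 -
        effX (fun s => f s (b, ξ n ω q.1.1)) Γ
          (ext0 fun t : Fin τ => pairField M ξ f n q ω t) t := fun t => by
    have e : ∀ n (q : Pairs ty b n) ω, effX (fun s => f s (b, ξ n ω q.1.1)) Γ
        (ext0 fun t : Fin τ => pairField M ξ f n q ω t) t =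
        effX (fun s => f s (b, ξ n ω q.1.1)) Γ (pairField M ξ f n q ω) t := fun n q ω =>
      effX_congr _ _ fun s hs => by rw [ext0, dif_pos (hs.trans_lt t.2)]
    simp only [e]
    exact H.siteX_sub_effX_small h t.2
  rcases a with (t | a) | (t | a)
  · exact key t
  · refine LpSmall.zero.mono (fun n q => ?_) fun n q ω => le_of_eq (congrArg _ (sub_self _))
    exact ((measurable_pi_apply a).comp ((measurable_pi_apply _).comp (h.meas_ξ n))).sub
      ((measurable_pi_apply a).comp ((measurable_pi_apply _).comp (h.meas_ξ n)))
  · exact (key t).reindex (K := Pairs ty b) fun n q => q.swap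
  · refine LpSmall.zero.mono (fun n q => ?_) fun n q ω => le_of_eq (congrArg _ (sub_self _))
    exact ((measurable_pi_apply a).comp ((measurable_pi_apply _).comp (h.meas_ξ n))).sub
      ((measurable_pi_apply a).comp ((measurable_pi_apply _).comp (h.meas_ξ n)))

theorem tendsto_pair_bounded {φ : ((Fin τ ⊕ κ) ⊕ (Fin τ ⊕ κ) → ℝ) → ℝ} (hφ : Continuous φ)
    {B : ℝ} (hB : ∀ x, |φ x| ≤ B) :
    Tendsto (fun x : Σ n, Pairs ty b n => ∫ ω, φ (elim (siteV ty M ξ f τ x.1 x.2.1.1 ω)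
      (siteV ty M ξ f τ x.1 x.2.1.2 ω)) ∂P x.1) (unif (Pairs ty b))
      (𝓝 (∫ ω, φ (elim (effVec f b Γ (elim (Z ω.1) (ζ ω.1)))
        (effVec f b Γ (elim (Z ω.2) (ζ ω.2)))) ∂(γ.prod γ))) := by
  have mW' : Measurable fun ω : Ω' × Ω' => elim (elim (Z ω.1) (ζ ω.1))
      (elim (Z ω.2) (ζ ω.2)) := by
    refine measurable_pi_iff.2 fun a => ?_
    rcases a with a | a
    · exact (measurable_pi_apply a).comp (H.meas_limVec.comp measurable_fst)
    · exact (measurable_pi_apply a).comp (H.meas_limVec.comp measurable_snd)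
  have mV : ∀ x : Σ n, Pairs ty b n, Measurable fun ω =>
      elim (siteV ty M ξ f τ x.1 x.2.1.1 ω) (siteV ty M ξ f τ x.1 x.2.1.2 ω) := fun x => by
    refine measurable_pi_iff.2 fun a => ?_
    rcases a with a | a
    · exact (measurable_pi_apply a).comp (h.meas_siteV x.1 _)
    · exact (measurable_pi_apply a).comp (h.meas_siteV x.1 _)
  have h1 := fun u => tendsto_charFun_of_close (P := fun x : Σ n, Pairs ty b n => P x.1)
    (fun x => meas_cavVec h x.1 x.2) mW' (H.tendsto_charFun_cavVec h) H.continuous_effPair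
    mV (fun x a => (H.siteV_sub_effPair_small h a).bdd.integrable x.1 x.2)
    (fun a => (H.siteV_sub_effPair_small h a).tendsto_integral_abs) u
  exact tendsto_integral_bounded mV (H.continuous_effPair.measurable.comp mW') h1 hφ hB

section TestFunctions

variable {ψ ψ' : (Fin τ ⊕ κ → ℝ) → ℝ} (hψ : Continuous ψ) (hψ' : Continuous ψ')
  (bψ : LpBdd P fun n (k : Sites ty b n) ω => ψ (siteV ty M ξ f τ n k.1 ω))
  (bψ' : LpBdd P fun n (k : Sites ty b n) ω => ψ' (siteV ty M ξ f τ n k.1 ω))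

omit h in
theorem meas_test (hψ : Continuous ψ) :
    Measurable fun ω => ψ (effVec f b Γ (elim (Z ω) (ζ ω))) :=
  (hψ.comp (continuous_effVec H.cont_f)).measurable.comp H.meas_limVec

include hψ bψ in
theorem integrable_test : Integrable (fun ω => ψ (effVec f b Γ (elim (Z ω) (ζ ω)))) γ := by
  have : (unif (Pairs ty b)).NeBot := unif_neBot (H.exists_pair.mono fun n hn =>
    let ⟨⟨k⟩, h2⟩ := hn; let ⟨q, _⟩ := h2 k; ⟨q⟩)
  obtain ⟨D, hD⟩ := bψ.2 2
  refine integrable_limit (𝓕 := unif (Pairs ty b)) (P := fun x => P x.1)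
    (Z := fun x ω => ψ (siteV ty M ξ f τ x.1 x.2.1.1 ω))
    (fun x => bψ.meas x.1 x.2.site) (H.meas_test hψ) (C := D) (fun x => hD x.1 x.2.site)
    fun φ hφ hB => ?_
  obtain ⟨B, hB⟩ := hB
  have h1 := H.tendsto_pair_bounded h (φ := fun v => φ (ψ fun a => v (inl a)))
    (hφ.comp (hψ.comp (continuous_pi fun a => continuous_apply _))) fun x => hB _
  simp only [elim_inl] at h1
  refine h1.trans (le_of_eq (congrArg _ ?_))
  have := integral_prod_mul (μ := γ) (ν := γ)
    (fun ω => φ (ψ (effVec f b Γ (elim (Z ω) (ζ ω))))) fun _ => (1 : ℝ)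
  simpa using this

include hψ bψ hψ' bψ' in
/-- Asymptotic independence of the fields of two sites. -/
theorem tendsto_pair :
    Tendsto (fun x : Σ n, Pairs ty b n => ∫ ω, ψ (siteV ty M ξ f τ x.1 x.2.1.1 ω) *
      ψ' (siteV ty M ξ f τ x.1 x.2.1.2 ω) ∂P x.1) (unif (Pairs ty b))
      (𝓝 ((∫ ω, ψ (effVec f b Γ (elim (Z ω) (ζ ω))) ∂γ) *
        ∫ ω, ψ' (effVec f b Γ (elim (Z ω) (ζ ω))) ∂γ)) := by
  rw [← integral_prod_mul]
  have hb := (bψ.reindex (K := Pairs ty b) fun n q => q.site).mul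
    (bψ'.reindex (K := Pairs ty b) fun n q => q.swap.site)
  obtain ⟨D, hD⟩ := hb.2 2
  refine tendsto_integral_of_sq_bdd (P := fun x : Σ n, Pairs ty b n => P x.1)
    (fun x => hb.meas x.1 x.2) (Z' := fun ω : Ω' × Ω' =>
      ψ (effVec f b Γ (elim (Z ω.1) (ζ ω.1))) * ψ' (effVec f b Γ (elim (Z ω.2) (ζ ω.2))))
    (((H.meas_test hψ).comp measurable_fst).mul ((H.meas_test hψ').comp measurable_snd))
    (C := D) (fun x => hD x.1 x.2) fun φ hφ hB => ?_
  obtain ⟨B, hB⟩ := hB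
  have h1 := H.tendsto_pair_bounded h
    (φ := fun v => φ ((ψ fun a => v (inl a)) * ψ' fun a => v (inr a)))
    (hφ.comp ((hψ.comp (continuous_pi fun a => continuous_apply _)).mul
      (hψ'.comp (continuous_pi fun a => continuous_apply _)))) fun x => hB _
  simp only [elim_inl, elim_inr] at h1
  exact h1

include hψ bψ in
theorem expectation_site {ε : ℝ} (hε : 0 < ε) : ∀ᶠ n in atTop, ∀ k : Sites ty b n,
    |∫ ω, ψ sV[n,k.1,ω] ∂P n -
      ∫ ω, ψ (effVec f b Γ (elim (Z ω) (ζ ω))) ∂γ| < ε := by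
  have h1 := H.tendsto_pair h hψ (continuous_const (y := (1 : ℝ))) bψ (LpBdd.const 1)
  rw [Metric.tendsto_nhds] at h1
  have h2 := eventually_unif.1 (h1 ε hε)
  filter_upwards [h2, H.exists_pair] with n hn he k
  obtain ⟨q, rfl⟩ := he.2 k
  have := hn q
  rw [dist_eq] at this
  simpa [Pairs.site] using this

include hψ bψ in
theorem covariance_pair {ε : ℝ} (hε : 0 < ε) : ∀ᶠ n in atTop, ∀ q : Pairs ty b n,
    |cov[fun ω => ψ sV[n,q.1.1,ω], fun ω => ψ sV[n,q.1.2,ω];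
      P n]| < ε := by
  set m := ∫ ω, ψ (effVec f b Γ (elim (Z ω) (ζ ω))) ∂γ with hm
  have h1 := H.tendsto_pair h hψ hψ bψ bψ
  have h2 : Tendsto (fun x : Σ n, Pairs ty b n =>
      ∫ ω, ψ (siteV ty M ξ f τ x.1 x.2.1.1 ω) ∂P x.1) (unif (Pairs ty b)) (𝓝 m) := by
    rw [Metric.tendsto_nhds]
    intro ε hε
    rw [eventually_unif]
    filter_upwards [H.expectation_site h hψ bψ hε] with n hn q
    rw [dist_eq]
    exact hn q.site
  have h3 : Tendsto (fun x : Σ n, Pairs ty b n =>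
      ∫ ω, ψ (siteV ty M ξ f τ x.1 x.2.1.2 ω) ∂P x.1) (unif (Pairs ty b)) (𝓝 m) := by
    rw [Metric.tendsto_nhds]
    intro ε hε
    rw [eventually_unif]
    filter_upwards [H.expectation_site h hψ bψ hε] with n hn q
    rw [dist_eq]
    exact hn q.swap.site
  have h4 := h1.sub (h2.mul h3)
  rw [sub_self, Metric.tendsto_nhds] at h4
  filter_upwards [eventually_unif.1 (h4 ε hε)] with n hn q
  have := hn q
  rw [dist_eq, sub_zero] at this
  have e := covariance_eq_sub (bψ.memLp_two n q.site) (bψ.memLp_two n q.swap.site)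
  simp only [Pairs.site, Pairs.swap] at e
  rw [e]
  exact this

end TestFunctions

/-! ### Laws of large numbers for the sites of one type -/

/-- The empirical averages over the sites of type `b` converge. -/
theorem average_test_small {ψ : (Fin τ ⊕ κ → ℝ) → ℝ} (hψ : Continuous ψ) {Y : ∀ n, Sites ty b n → Ω n → ℝ}
    (hY : LpBdd P Y) (bψ : LpBdd P fun n (k : Sites ty b n) ω => ψ sV[n,k.1,ω])
    (hYψ : LpSmall P fun n (k : Sites ty b n) ω => Y n k ω - ψ sV[n,k.1,ω])
    {ρ : ℝ} (hρ : ∀ n, (N n : ℝ)⁻¹ * card (Sites ty b n) = ρ) :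
    LpSmall P fun n (_ : J n) ω => (N n : ℝ)⁻¹ * ∑ l, Y n l ω -
      ρ * ∫ ω, ψ (effVec f b Γ (elim (Z ω) (ζ ω))) ∂γ := by
  set m := ∫ ω, ψ (effVec f b Γ (elim (Z ω) (ζ ω))) ∂γ with hm
  have h1 : LpSmall P fun n (_ : J n) ω => (N n : ℝ)⁻¹ * ∑ l : Sites ty b n,
      (ψ sV[n,l.1,ω] - m) := by
    refine h.average_small (bψ.sub (LpBdd.const m)) fun ε hε => ?_
    have hi : Integrable (fun ω => ψ (effVec f b Γ (elim (Z ω) (ζ ω)))) γ :=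
      H.integrable_test h hψ bψ
    have h2 := H.tendsto_pair h (ψ := fun v => ψ v - m) (ψ' := fun v => ψ v - m)
      (hψ.sub continuous_const) (hψ.sub continuous_const) (bψ.sub (LpBdd.const m))
      (bψ.sub (LpBdd.const m))
    have h3 : ∫ ω, (ψ (effVec f b Γ (elim (Z ω) (ζ ω))) - m) ∂γ = 0 := by
      rw [integral_sub hi (integrable_const _)]
      simp [hm]
    rw [h3, mul_zero, Metric.tendsto_nhds] at h2
    filter_upwards [eventually_unif.1 (h2 ε hε)] with n hn q
    have := hn q
    rw [dist_eq, sub_zero] at this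
    exact this
  have h2 : LpSmall P fun n (_ : J n) ω => (N n : ℝ)⁻¹ * ∑ l : Sites ty b n,
      (Y n l ω - ψ sV[n,l.1,ω]) :=
    (hYψ.reindex (K := fun n => J n × Sites ty b n) fun n jl => jl.2).average (h.card_sites_le b)
  refine (h1.add h2).mono (fun n j => ?_) fun n j ω => le_of_eq (congrArg _ ?_)
  · exact ((Finset.measurable_fun_sum _ fun l _ => hY.meas n l).const_mul _).sub_const _
  · simp only [sum_sub_distrib, sum_const, card_univ, nsmul_eq_mul]
    rw [← hρ n]
    ring

/-- The empirical second moments of the sites of type `b`. -/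
theorem moment_limit {s t : ℕ} (hs : s ≤ τ) (ht : t ≤ τ) {ρ : ℝ}
    (hρ : ∀ n, (N n : ℝ)⁻¹ * card (Sites ty b n) = ρ) :
    LpSmall P fun n (k : Sites ty (!b) n) ω => ∑ l, V[n] k.1 l *
      (siteY sF[n,ω] (M n ω) l s * siteY sF[n,ω] (M n ω) l t) -
      ρ * ∫ ω, f s (b, ζ ω) (vecX (effVec f b Γ (elim (Z ω) (ζ ω)))) *
        f t (b, ζ ω) (vecX (effVec f b Γ (elim (Z ω) (ζ ω)))) ∂γ := by
  have hb : LpBdd P fun n (l : Sites ty b n) ω =>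
      siteY sF[n,ω] (M n ω) l.1 s * siteY sF[n,ω] (M n ω) l.1 t :=
    ((h.siteY_bdd s).mul (h.siteY_bdd t)).reindex (K := Sites ty b) fun n l => l.1
  have hb' := hb
  simp only [h.siteY_eq _ _ hs, h.siteY_eq _ _ ht] at hb'
  have hc : ∀ r, Continuous fun v : Fin τ ⊕ κ → ℝ => f r (b, vecΞ v) (vecX v) := fun r =>
    (H.cont_f r).comp (continuous_vecΞ.prodMk continuous_vecX)
  have h1 := H.average_test_small h (J := Sites ty (!b))
    (ψ := fun v => f s (b, vecΞ v) (vecX v) * f t (b, vecΞ v) (vecX v))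
    ((hc s).mul (hc t)) hb hb' (LpSmall.zero.mono (fun n k => (hb.meas n k).sub (hb'.meas n k))
      fun n k ω => le_of_eq (congrArg _ ?_)) hρ
  · simp only [sum_varProfile]
    exact h1
  · rw [h.siteY_eq k ω hs, h.siteY_eq k ω ht, sub_self]

/-- The effective response as a function of the vector of a site. -/
def effResp (p : Grad(Bool × (κ → ℝ))) (b : Bool)
    (Γ : ℕ → ℕ → ℝ) (s t : ℕ) {τ : ℕ} (v : Fin τ ⊕ κ → ℝ) : ℝ :=
  effD (fun t s => p t s (b, vecΞ v) (vecX v)) Γ s t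

omit h in
theorem continuous_effResp (s t : ℕ) :
    Continuous fun v : Fin τ ⊕ κ → ℝ => effResp p b Γ s t v :=
  continuous_effD (fun t s => (H.cont_p t s).comp (continuous_vecΞ.prodMk continuous_vecX)) Γ s t

theorem effResp_bdd (s t : ℕ) : LpBdd P fun n (k : Sites ty b n) ω =>
    effResp p b Γ s t sV[n,k.1,ω] := by
  have hm : ∀ s t n (k : Sites ty b n), Measurable fun ω =>
      effResp p b Γ s t sV[n,k.1,ω] := fun s t n k =>
    (H.continuous_effResp s t).measurable.comp (h.meas_siteV n k.1)
  induction t using strongRecOn with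
  | _ t ih =>
    rcases lt_or_ge s t with hst | hst
    · have hP : ∀ r, LpBdd P fun n (k : Sites ty b n) ω =>
          p t r (b, vecΞ sV[n,k.1,ω]) (vecX sV[n,k.1,ω]) := fun r =>
        (LpBdd.const (L t)).of_le (fun n k => ((H.cont_p t r).comp
          (continuous_vecΞ.prodMk continuous_vecX)).measurable.comp (h.meas_siteV n k.1))
          fun n k ω => h.reg.bdd t r _ _
      unfold effResp
      simp only [effD_of_lt _ _ hst]
      exact (hP s).add (LpBdd.sum _ fun r hr => (hP r).mul (LpBdd.sum _ fun q hq =>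
        (ih q ((mem_range.1 hq).trans (mem_range.1 hr))).const_mul _))
    · unfold effResp
      simp only [effD_of_le _ _ hst]
      exact LpBdd.const 0

theorem response_sub_small {s t : ℕ} (ht : t ≤ τ) : LpSmall P fun n (k : Sites ty b n) ω =>
    siteR sF[n,ω] sD[n,ω] (M n ω) k.1 s t -
      effResp p b Γ s t sV[n,k.1,ω] := by
  have hm : ∀ t n (k : Sites ty b n), Measurable fun ω =>
      siteR sF[n,ω] sD[n,ω] (M n ω) k.1 s t -
      effResp p b Γ s t sV[n,k.1,ω] := fun t n k =>
    (h.meas_siteR n k.1 s t).sub ((H.effResp_bdd h s t).meas n k)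
  induction t using strongRecOn with
  | _ t ih =>
    rcases lt_or_ge s t with hst | hst
    · have h1 := (h.response_small hst).reindex (K := Sites ty b) fun n k => k.1
      have h2 : LpSmall P fun n (k : Sites ty b n) ω => ∑ r ∈ range t,
          sysP sF[n,ω] sD[n,ω] (M n ω) t r k.1 *
            ∑ q ∈ range r, ((M n ω k.1 ⬝ᵥ (sysR sF[n,ω]
            sD[n,ω] (mask {k.1} (M n ω)) q r *ᵥ M n ω k.1) - Γ r q) *
            siteR sF[n,ω] sD[n,ω] (M n ω) k.1 s q +
            Γ r q * (siteR sF[n,ω] sD[n,ω] (M n ω) k.1 s q -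
              effResp p b Γ s q sV[n,k.1,ω])) :=
        LpSmall.sum _ fun r hr => ((h.siteP_bdd t r).reindex (K := Sites ty b)
          fun n k => k.1).mul_small (LpSmall.sum _ fun q hq => by
            have hrt := mem_range.1 hr
            have hqr := mem_range.1 hq
            exact ((H.self_small h hqr (hrt.trans_le ht)).mul_bdd
              ((h.siteR_bdd s q).reindex (K := Sites ty b) fun n k => k.1)).add
              ((ih q (hqr.trans hrt) ((hqr.trans hrt).le.trans ht)).const_mul _))
      refine (h1.add h2).mono (hm t) fun n k ω => le_of_eq (congrArg _ ?_)
      have e : effResp p b Γ s t sV[n,k.1,ω] =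
          sysP sF[n,ω] sD[n,ω] (M n ω) t s k.1 +
          ∑ r ∈ range t,
            sysP sF[n,ω] sD[n,ω] (M n ω) t r k.1 *
            ∑ q ∈ range r, Γ r q * effResp p b Γ s q sV[n,k.1,ω] := by
        simp only [h.sysP_eq k ω ht]
        exact effD_of_lt _ _ hst
      rw [e]
      simp only [sub_mul, mul_sub, sum_sub_distrib, sum_add_distrib, mul_add]
      ring
    · refine LpSmall.zero.mono (hm t) fun n k ω => le_of_eq (congrArg _ ?_)
      rw [siteR_of_le hst, effResp, effD_of_le _ _ hst, sub_self]

/-- The average response of the sites of type `b`. -/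
theorem response_limit {s t : ℕ} (ht : t ≤ τ) {ρ : ℝ}
    (hρ : ∀ n, (N n : ℝ)⁻¹ * card (Sites ty b n) = ρ) :
    LpSmall P fun n (k : Sites ty (!b) n) ω => ∑ l, V[n] k.1 l *
      siteR sF[n,ω] sD[n,ω] (M n ω) l s t -
      ρ * ∫ ω, effResp p b Γ s t (effVec f b Γ (elim (Z ω) (ζ ω))) ∂γ := by
  have h1 := H.average_test_small h (J := Sites ty (!b)) (H.continuous_effResp s t)
    ((h.siteR_bdd s t).reindex (K := Sites ty b) fun n l => l.1) (H.effResp_bdd h s t)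
    (H.response_sub_small h ht) hρ
  simp only [sum_varProfile]
  exact h1

end HorizonLimit

end Horizon

/-! ### Subgaussian laws -/

section Subgaussian

theorem IsSubgaussian.exists_lt {K : ℝ} (hK : 0 < K) {ρ : Measure ℝ} (h : IsSubgaussian K ρ) :
    ∃ t, 0 < t ∧ t < 2 * K ∧ ∫⁻ x, ofReal (exp (x ^ 2 / t ^ 2)) ∂ρ ≤ 2 := by
  have h1 : psi2Norm ρ < ofReal (2 * K) :=
    h.trans_lt ((ENNReal.ofReal_lt_ofReal_iff (by positivity)).2 (by linarith))
  unfold psi2Norm at h1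
  simp only [iInf_lt_iff] at h1
  obtain ⟨t, ht, h2, h3⟩ := h1
  exact ⟨t, ht, (ENNReal.ofReal_lt_ofReal_iff (by positivity)).1 h3, h2⟩

theorem exp_le_add_exp_sq (x : ℝ) : exp x ≤ x + exp (x ^ 2) := by
  have h1 : ∀ y : ℝ, 0 ≤ y → exp (-y) ≤ 1 - y + y ^ 2 := by
    intro y hy
    have hq := Real.quadratic_le_exp_of_nonneg hy
    rw [Real.exp_neg, inv_le_comm₀ (exp_pos _) (by nlinarith)]
    refine le_trans ?_ hq
    rw [inv_le_iff_one_le_mul₀ (by nlinarith)]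
    nlinarith [mul_nonneg hy hy, mul_nonneg hy (mul_nonneg hy hy), sq_nonneg (y * (y - 1 / 2)),
      mul_nonneg (mul_nonneg hy hy) (mul_nonneg hy hy)]
  have h2 := add_one_le_exp (x ^ 2)
  rcases le_total x 0 with hx | hx
  · have := h1 (-x) (by linarith)
    rw [neg_neg] at this
    nlinarith
  rcases le_total x 1 with h3 | h3
  · have := Real.abs_exp_sub_one_sub_id_le (x := x) (by rwa [abs_of_nonneg hx])
    have := (abs_le.1 this).2
    linarith
  · have : exp x ≤ exp (x ^ 2) := exp_le_exp.2 (by nlinarith)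
    linarith

theorem exp_mul_le_of_le_one {θ : ℝ} (h0 : 0 ≤ θ) (h1 : θ ≤ 1) (z : ℝ) :
    exp (θ * z) ≤ 1 + θ * (exp z - 1) := by
  have := convexOn_exp.2 (Set.mem_univ z) (Set.mem_univ 0) h0 (sub_nonneg.2 h1) (by ring)
  simp only [smul_eq_mul, mul_zero, add_zero, Real.exp_zero, mul_one] at this
  linarith

variable {ρ : Measure ℝ} [IsProbabilityMeasure ρ] {t : ℝ} (ht : 0 < t)
  (h : ∫⁻ x, ofReal (exp (x ^ 2 / t ^ 2)) ∂ρ ≤ 2)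

include ht h

theorem integrable_exp_sq : Integrable (fun x => exp (x ^ 2 / t ^ 2)) ρ := by
  refine ⟨by fun_prop, ?_⟩
  rw [hasFiniteIntegral_iff_ofReal (.of_forall fun _ => (exp_pos _).le)]
  exact h.trans_lt ENNReal.ofNat_lt_top

theorem integral_exp_sq_le : ∫ x, exp (x ^ 2 / t ^ 2) ∂ρ ≤ 2 := by
  rw [integral_eq_lintegral_of_nonneg_ae (.of_forall fun _ => (exp_pos _).le)
    (integrable_exp_sq ht h).aestronglyMeasurable]
  exact toReal_le_of_le_ofReal (by norm_num) (by simpa using h)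

theorem moment_le_of_exp_sq (q : ℕ) :
    ∫⁻ x, ofReal (|x| ^ q) ∂ρ ≤ ofReal (1 + t ^ (2 * q) * q.factorial * 2) := by
  have hpt : ∀ x : ℝ, |x| ^ q ≤ 1 + t ^ (2 * q) * q.factorial * exp (x ^ 2 / t ^ 2) := by
    intro x
    have h1 := Real.pow_div_factorial_le_exp (x ^ 2 / t ^ 2) (by positivity) q
    rw [div_le_iff₀ (by positivity), div_pow, div_le_iff₀ (by positivity), ← pow_mul] at h1
    have h2 : |x| ^ q ≤ 1 + x ^ (2 * q) := by
      have : x ^ (2 * q) = (|x| ^ q) ^ 2 := by rw [pow_mul, ← sq_abs, ← pow_mul, mul_comm, pow_mul]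
      rw [this]
      nlinarith [sq_nonneg (|x| ^ q - 1)]
    have h3 : (t ^ 2) ^ q = t ^ (2 * q) := (pow_mul _ _ _).symm
    rw [h3] at h1
    nlinarith
  have hi := integrable_exp_sq ht h
  have hi2 : Integrable (fun x => 1 + t ^ (2 * q) * q.factorial * exp (x ^ 2 / t ^ 2)) ρ :=
    (integrable_const _).add (hi.const_mul _)
  calc _ ≤ ∫⁻ x, ofReal (1 + t ^ (2 * q) * q.factorial * exp (x ^ 2 / t ^ 2)) ∂ρ :=
        lintegral_mono fun x => ofReal_le_ofReal (hpt x)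
    _ = ofReal (∫ x, (1 + t ^ (2 * q) * q.factorial * exp (x ^ 2 / t ^ 2)) ∂ρ) := by
        rw [ofReal_integral_eq_lintegral_ofReal hi2 (.of_forall fun x => by positivity)]
    _ ≤ _ := by
        refine ofReal_le_ofReal ?_
        rw [integral_add (integrable_const _) (hi.const_mul _), integral_const_mul]
        simp only [integral_const, probReal_univ, smul_eq_mul, one_mul]
        gcongr
        exact integral_exp_sq_le ht h

theorem integrable_id_of_exp_sq : Integrable (fun x => x) ρ := by
  refine ⟨by fun_prop, ?_⟩
  rw [hasFiniteIntegral_iff_norm]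
  have := moment_le_of_exp_sq ht h 1
  simp only [pow_one] at this
  exact this.trans_lt ofReal_lt_top

theorem mgf_le_of_exp_sq (hmean : ∫ x, x ∂ρ = 0) (s : ℝ) :
    ∫⁻ x, ofReal (exp (s * x)) ∂ρ ≤ ofReal (exp (2 * s ^ 2 * t ^ 2)) := by
  have hi := integrable_exp_sq ht h
  have h2 := integral_exp_sq_le ht h
  have hix := integrable_id_of_exp_sq ht h
  have hst : 0 ≤ s ^ 2 * t ^ 2 := by positivity
  rcases le_total (s ^ 2 * t ^ 2) 1 with h1 | h1
  · have hpt : ∀ x : ℝ, exp (s * x) ≤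
        s * x + (1 + s ^ 2 * t ^ 2 * (exp (x ^ 2 / t ^ 2) - 1)) := fun x => by
      refine (exp_le_add_exp_sq _).trans (add_le_add le_rfl ?_)
      have := exp_mul_le_of_le_one hst h1 (x ^ 2 / t ^ 2)
      rwa [show s ^ 2 * t ^ 2 * (x ^ 2 / t ^ 2) = (s * x) ^ 2 by field_simp] at this
    have i1 : Integrable (fun x => s ^ 2 * t ^ 2 * (exp (x ^ 2 / t ^ 2) - 1)) ρ :=
      (hi.sub (integrable_const _)).const_mul _
    have i2 : Integrable (fun x => 1 + s ^ 2 * t ^ 2 * (exp (x ^ 2 / t ^ 2) - 1)) ρ :=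
      (integrable_const _).add i1
    have hi2 : Integrable (fun x => s * x + (1 + s ^ 2 * t ^ 2 * (exp (x ^ 2 / t ^ 2) - 1)))
        ρ := (hix.const_mul s).add i2
    calc _ ≤ ∫⁻ x, ofReal (s * x + (1 + s ^ 2 * t ^ 2 * (exp (x ^ 2 / t ^ 2) - 1))) ∂ρ :=
          lintegral_mono fun x => ofReal_le_ofReal (hpt x)
      _ = ofReal (∫ x, (s * x + (1 + s ^ 2 * t ^ 2 * (exp (x ^ 2 / t ^ 2) - 1))) ∂ρ) := by
          rw [ofReal_integral_eq_lintegral_ofReal hi2 (.of_forall fun x =>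
            (exp_pos _).le.trans (hpt x))]
      _ ≤ _ := by
          refine ofReal_le_ofReal ?_
          rw [integral_add (hix.const_mul s) i2, integral_add (integrable_const _) i1,
            integral_const_mul, integral_const_mul,
            integral_sub hi (integrable_const _), hmean]
          simp only [integral_const, probReal_univ, smul_eq_mul, one_mul, mul_zero, zero_add]
          have := add_one_le_exp (2 * s ^ 2 * t ^ 2)
          nlinarith
  · have hpt : ∀ x : ℝ, exp (s * x) ≤
        exp (s ^ 2 * t ^ 2) * exp (x ^ 2 / t ^ 2) := fun x => by
      rw [← exp_add]
      refine exp_le_exp.2 ?_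
      have : s * x = (s * t) * (x / t) := by field_simp
      rw [this, ← mul_pow, ← div_pow]
      nlinarith [sq_nonneg (s * t - x / t), sq_nonneg (s * t), sq_nonneg (x / t)]
    calc _ ≤ ∫⁻ x, ofReal (exp (s ^ 2 * t ^ 2) * exp (x ^ 2 / t ^ 2)) ∂ρ :=
          lintegral_mono fun x => ofReal_le_ofReal (hpt x)
      _ = ofReal (exp (s ^ 2 * t ^ 2) * ∫ x, exp (x ^ 2 / t ^ 2) ∂ρ) := by
          rw [← integral_const_mul, ofReal_integral_eq_lintegral_ofReal (hi.const_mul _)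
            (.of_forall fun x => by positivity)]
      _ ≤ _ := by
          refine ofReal_le_ofReal ?_
          rw [show 2 * s ^ 2 * t ^ 2 = s ^ 2 * t ^ 2 + s ^ 2 * t ^ 2 by ring, exp_add]
          gcongr
          have := add_one_le_exp (s ^ 2 * t ^ 2)
          linarith

end Subgaussian

/-! ### The norm of a random matrix -/

section OperatorNorm

open scoped Matrix.Norms.L2Operator

variable {Ω : Type*} [MeasurableSpace Ω] {P : Measure Ω} [IsProbabilityMeasure P]
  {ι : Type*} [Fintype ι] [DecidableEq ι] {M : Ω → Matrix ι ι ℝ}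

theorem exists_nearly_maximal (A : Matrix ι ι ℝ) : ∃ u v : EuclideanSpace ℝ ι, ‖u‖ ≤ 1 ∧ ‖v‖ ≤ 1 ∧
    15 / 16 * ‖A‖ ≤ u.ofLp ⬝ᵥ (A *ᵥ v.ofLp) := by
  rcases (norm_nonneg A).eq_or_lt' with h0 | h0
  · exact ⟨0, 0, by simp, by simp, by simp [h0]⟩
  · have h1 : ¬ ∀ v : ι → ℝ, nrm (A *ᵥ v) ≤ 15 / 16 * ‖A‖ * nrm v := fun hv => by
      have := norm_le_of_nrm_mulVec_le (by positivity) hv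
      linarith
    push Not at h1
    obtain ⟨v, hv⟩ := h1
    have hv0 : 0 < nrm v := by
      rcases (nrm_nonneg v).eq_or_lt' with h | h
      · exfalso
        have := nrm_mulVec_le A v
        rw [h] at hv this
        linarith
      · exact h
    have hAv : 0 < nrm (A *ᵥ v) := lt_of_le_of_lt (by positivity) hv
    refine ⟨toLp 2 ((nrm (A *ᵥ v))⁻¹ • (A *ᵥ v)), toLp 2 ((nrm v)⁻¹ • v), ?_, ?_, ?_⟩
    · change nrm ((nrm (A *ᵥ v))⁻¹ • (A *ᵥ v)) ≤ 1
      rw [nrm_smul, abs_of_pos (by positivity), inv_mul_cancel₀ hAv.ne']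
    · change nrm ((nrm v)⁻¹ • v) ≤ 1
      rw [nrm_smul, abs_of_pos (by positivity), inv_mul_cancel₀ hv0.ne']
    · simp only [mulVec_smul, dotProduct_smul, smul_dotProduct, smul_eq_mul]
      have h3 : (A *ᵥ v) ⬝ᵥ (A *ᵥ v) = nrm (A *ᵥ v) ^ 2 := by
        rw [nrm_sq]; exact sum_congr rfl fun i _ => (sq _).symm
      rw [h3, sq, inv_mul_cancel_left₀ hAv.ne', inv_mul_eq_div, le_div_iff₀ hv0]
      exact hv.le

theorem abs_bilin_le (A : Matrix ι ι ℝ) (u v : EuclideanSpace ℝ ι) :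
    |u.ofLp ⬝ᵥ (A *ᵥ v.ofLp)| ≤ ‖A‖ * (‖u‖ * ‖v‖) := by
  refine (abs_dotProduct_le _ _).trans ?_
  have := nrm_mulVec_le A v.ofLp
  calc nrm u.ofLp * nrm (A *ᵥ v.ofLp) ≤ nrm u.ofLp * (‖A‖ * nrm v.ofLp) := by
        gcongr; exact nrm_nonneg _
    _ = _ := by unfold nrm; simp only [WithLp.toLp_ofLp]; ring

theorem bilin_ge {A : Matrix ι ι ℝ} {u v u' v' : EuclideanSpace ℝ ι} (hu : ‖u‖ ≤ 1) (hv : ‖v‖ ≤ 1)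
    (h : 15 / 16 * ‖A‖ ≤ u.ofLp ⬝ᵥ (A *ᵥ v.ofLp)) (hu' : ‖u' - u‖ ≤ 1 / 4)
    (hv' : ‖v' - v‖ ≤ 1 / 4) : 3 / 8 * ‖A‖ ≤ u'.ofLp ⬝ᵥ (A *ᵥ v'.ofLp) := by
  have e : u'.ofLp ⬝ᵥ (A *ᵥ v'.ofLp) = u.ofLp ⬝ᵥ (A *ᵥ v.ofLp) + (u' - u).ofLp ⬝ᵥ (A *ᵥ v.ofLp) +
      u.ofLp ⬝ᵥ (A *ᵥ (v' - v).ofLp) + (u' - u).ofLp ⬝ᵥ (A *ᵥ (v' - v).ofLp) := by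
    simp only [WithLp.ofLp_sub, mulVec_sub, dotProduct_sub, sub_dotProduct]
    ring
  have hA := norm_nonneg A
  have h1 := (abs_le.1 (abs_bilin_le A (u' - u) v)).1
  have h2 := (abs_le.1 (abs_bilin_le A u (v' - v))).1
  have h3 := (abs_le.1 (abs_bilin_le A (u' - u) (v' - v))).1
  have b1 : ‖A‖ * (‖u' - u‖ * ‖v‖) ≤ ‖A‖ * (1 / 4 * 1) := by gcongr
  have b2 : ‖A‖ * (‖u‖ * ‖v' - v‖) ≤ ‖A‖ * (1 * (1 / 4)) := by gcongr
  have b3 : ‖A‖ * (‖u' - u‖ * ‖v' - v‖) ≤ ‖A‖ * (1 / 4 * (1 / 4)) := by gcongr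
  rw [e]
  linarith

/-- An exponential moment of the norm of a matrix with subgaussian bilinear forms. -/
theorem lintegral_exp_norm_le (hM : MeasM M) {N a : ℝ} (hN : 0 < N) (ha : 0 ≤ a)
    (hsub : ∀ u v : ι → ℝ, ∫⁻ ω, ofReal (exp (u ⬝ᵥ (M ω *ᵥ v))) ∂P ≤
      ofReal (exp (a * (nrm u ^ 2 * nrm v ^ 2) / N))) :
    ∫⁻ ω, ofReal (exp (3 / 8 * N * ‖M ω‖)) ∂P ≤
      ofReal (25 ^ card ι * exp (3 * a * N)) := by
  set μ : Measure (EuclideanSpace ℝ ι) := volume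
  have hball : ∀ (x : EuclideanSpace ℝ ι) {r : ℝ}, 0 ≤ r → μ (Metric.closedBall x r) =
      ofReal (r ^ card ι) * μ (Metric.closedBall 0 1) := fun x r hr => by
    have := Measure.addHaar_closedBall_mul μ x hr (zero_le_one)
    rw [mul_one, finrank_euclideanSpace] at this
    exact this
  set m := μ (Metric.closedBall 0 1) with hm
  have hm0 : m ≠ 0 := (Metric.measure_closedBall_pos μ 0 one_pos).ne'
  have hmt : m ≠ ∞ := measure_closedBall_lt_top.ne
  set q : ℝ := (1 / 4 : ℝ) ^ card ι with hq
  have hq0 : 0 < q := by positivity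
  set S : Set (EuclideanSpace ℝ ι × EuclideanSpace ℝ ι) :=
    Metric.closedBall 0 (5 / 4) ×ˢ Metric.closedBall 0 (5 / 4) with hS
  have hmeas : Measurable fun z : Ω × (EuclideanSpace ℝ ι × EuclideanSpace ℝ ι) =>
      ofReal (exp (N * (z.2.1.ofLp ⬝ᵥ (M z.1 *ᵥ z.2.2.ofLp)))) := by
    have h1 : Measurable fun z : Ω × (EuclideanSpace ℝ ι × EuclideanSpace ℝ ι) => z.2.1.ofLp :=
      (WithLp.measurable_ofLp 2 _).comp (measurable_fst.comp measurable_snd)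
    have h2 : Measurable fun z : Ω × (EuclideanSpace ℝ ι × EuclideanSpace ℝ ι) => z.2.2.ofLp :=
      (WithLp.measurable_ofLp 2 _).comp (measurable_snd.comp measurable_snd)
    have h3 : MeasM fun z : Ω × (EuclideanSpace ℝ ι × EuclideanSpace ℝ ι) => M z.1 :=
      fun i j => (hM i j).comp measurable_fst
    exact (((measurable_dotProduct h1 (h3.mulVec h2)).const_mul N).exp).ennreal_ofReal
  have key : ∀ ω, ofReal (exp (3 / 8 * N * ‖M ω‖)) * (ofReal q * m) ^ 2 ≤
      ∫⁻ x in S, ofReal (exp (N * (x.1.ofLp ⬝ᵥ (M ω *ᵥ x.2.ofLp)))) ∂(μ.prod μ) := by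
    intro ω
    obtain ⟨u, v, hu, hv, huv⟩ := exists_nearly_maximal (M ω)
    set S' : Set (EuclideanSpace ℝ ι × EuclideanSpace ℝ ι) :=
      Metric.closedBall u (1 / 4) ×ˢ Metric.closedBall v (1 / 4) with hS'
    have hsubset : S' ⊆ S := by
      refine Set.prod_mono (Metric.closedBall_subset_closedBall' ?_)
        (Metric.closedBall_subset_closedBall' ?_)
      · rw [dist_zero_right]; linarith
      · rw [dist_zero_right]; linarith
    calc _ = ∫⁻ _x in S', ofReal (exp (3 / 8 * N * ‖M ω‖)) ∂(μ.prod μ) := by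
          rw [setLIntegral_const, hS', Measure.prod_prod, hball u (by norm_num),
            hball v (by norm_num), sq]
      _ ≤ ∫⁻ x in S', ofReal (exp (N * (x.1.ofLp ⬝ᵥ (M ω *ᵥ x.2.ofLp))))
            ∂(μ.prod μ) := by
          refine setLIntegral_mono' (Metric.isClosed_closedBall.measurableSet.prod
            Metric.isClosed_closedBall.measurableSet) fun x hx => ?_
          refine ofReal_le_ofReal (exp_le_exp.2 ?_)
          have h1 := hx.1
          have h2 := hx.2
          rw [Metric.mem_closedBall, dist_eq_norm] at h1 h2
          have := bilin_ge hu hv huv h1 h2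
          nlinarith
      _ ≤ _ := lintegral_mono_set hsubset
  have hint : (∫⁻ ω, ofReal (exp (3 / 8 * N * ‖M ω‖)) ∂P) *
      (ofReal q * m) ^ 2 ≤
      ofReal (exp (3 * a * N)) * (ofReal ((5 / 4) ^ card ι) * m) ^ 2 := by
    have hfin : (ofReal q * m) ^ 2 ≠ ∞ :=
      ENNReal.pow_ne_top (ENNReal.mul_ne_top ofReal_ne_top hmt)
    rw [← lintegral_mul_const' _ _ hfin]
    calc _ ≤ ∫⁻ ω, ∫⁻ x in S, ofReal (exp (N * (x.1.ofLp ⬝ᵥ (M ω *ᵥ x.2.ofLp))))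
          ∂(μ.prod μ) ∂P := lintegral_mono key
      _ = ∫⁻ x in S, ∫⁻ ω, ofReal (exp (N * (x.1.ofLp ⬝ᵥ (M ω *ᵥ x.2.ofLp)))) ∂P
          ∂(μ.prod μ) := lintegral_lintegral_swap hmeas.aemeasurable
      _ ≤ ∫⁻ _x in S, ofReal (exp (3 * a * N)) ∂(μ.prod μ) := by
          refine setLIntegral_mono' (Metric.isClosed_closedBall.measurableSet.prod
            Metric.isClosed_closedBall.measurableSet) fun x hx => ?_
          have h1 := hx.1
          have h2 := hx.2
          rw [Metric.mem_closedBall, dist_zero_right] at h1 h2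
          have := hsub (N • x.1.ofLp) x.2.ofLp
          simp only [smul_dotProduct, smul_eq_mul] at this
          refine this.trans (ofReal_le_ofReal (exp_le_exp.2 ?_))
          rw [nrm_smul, abs_of_pos hN]
          have e1 : nrm x.1.ofLp = ‖x.1‖ := rfl
          have e2 : nrm x.2.ofLp = ‖x.2‖ := rfl
          rw [e1, e2]
          have h3 : ‖x.1‖ ^ 2 * ‖x.2‖ ^ 2 ≤ 3 := by
            calc ‖x.1‖ ^ 2 * ‖x.2‖ ^ 2 ≤ (5 / 4) ^ 2 * (5 / 4) ^ 2 := by gcongr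
              _ ≤ 3 := by norm_num
          calc a * ((N * ‖x.1‖) ^ 2 * ‖x.2‖ ^ 2) / N = a * N * (‖x.1‖ ^ 2 * ‖x.2‖ ^ 2) := by
                field_simp
            _ ≤ a * N * 3 := by gcongr
            _ = _ := by ring
      _ = _ := by
          rw [setLIntegral_const, hS, Measure.prod_prod, hball 0 (by norm_num), sq]
  have h54 : (5 / 4 : ℝ) ^ card ι = 5 ^ card ι * q := by
    rw [hq, ← mul_pow]; norm_num
  have hR : ofReal (exp (3 * a * N)) *
      (ofReal ((5 / 4) ^ card ι) * m) ^ 2 =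
      ofReal (25 ^ card ι * exp (3 * a * N)) * (ofReal q * m) ^ 2 := by
    have h25 : (25 : ℝ) ^ card ι = (5 ^ card ι) ^ 2 := by
      rw [← pow_mul, mul_comm, pow_mul]; norm_num
    rw [h54, h25, ofReal_mul (by positivity), ofReal_mul (by positivity),
      ENNReal.ofReal_pow (p := 5 ^ card ι) (by positivity) 2]
    ring
  rw [hR] at hint
  refine (ENNReal.mul_le_mul_iff_left (pow_ne_zero _ (mul_ne_zero (by simpa using hq0) hm0))
    (ENNReal.pow_ne_top (ENNReal.mul_ne_top ofReal_ne_top hmt))).1 hint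

theorem MeasM.norm (hM : MeasM M) : Measurable fun ω => ‖M ω‖ := by
  have h1 : Continuous fun A : ι → ι → ℝ => ‖(of A : Matrix ι ι ℝ)‖ :=
    continuous_norm (E := Matrix ι ι ℝ)
  exact h1.measurable.comp
    (measurable_pi_lambda _ fun i => measurable_pi_lambda _ fun j => hM i j)

/-- The norms of a sequence of random matrices with subgaussian bilinear forms are bounded in every
`L^p`. -/
theorem lpBdd_norm {Ω : ℕ → Type*} [∀ n, MeasurableSpace (Ω n)] {P : ∀ n, Measure (Ω n)}
    [∀ n, IsProbabilityMeasure (P n)] {ι : ℕ → Type} [∀ n, Fintype (ι n)]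
    [∀ n, DecidableEq (ι n)] {N : ℕ → ℕ} {M : ∀ n, Ω n → Matrix (ι n) (ι n) ℝ}
    (hM : ∀ n, MeasM (M n)) {a c : ℝ} (ha : 0 ≤ a) (hN : ∀ n, 0 < N n)
    (hc : ∀ n, (card (ι n) : ℝ) ≤ c * N n)
    (hsub : ∀ n (u v : ι n → ℝ), ∫⁻ ω, ofReal (exp (u ⬝ᵥ (M n ω *ᵥ v))) ∂P n ≤
      ofReal (exp (a * (nrm u ^ 2 * nrm v ^ 2) / N n))) :
    LpBdd P fun n (_ : Unit) ω => ‖M n ω‖ := by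
  set K : ℝ := 3 * a + c * Real.log 25 with hK
  have hexp : ∀ n, ∫⁻ ω, ofReal (exp (N n * (3 / 8 * ‖M n ω‖ - K))) ∂P n ≤ 1 := by
    intro n
    have hN' : (0 : ℝ) < N n := by exact_mod_cast hN n
    have h1 := lintegral_exp_norm_le (hM n) hN' ha (hsub n)
    have h2 : (25 : ℝ) ^ card (ι n) * exp (3 * a * N n) ≤ exp (N n * K) := by
      have : (25 : ℝ) ^ card (ι n) = exp (card (ι n) * Real.log 25) := by
        rw [mul_comm, Real.exp_mul, Real.exp_log (by norm_num), Real.rpow_natCast]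
      rw [this, ← exp_add, exp_le_exp, hK]
      have := mul_le_mul_of_nonneg_right (hc n) (Real.log_nonneg (by norm_num : (1 : ℝ) ≤ 25))
      linarith
    have e : ∀ ω, ofReal (exp (N n * (3 / 8 * ‖M n ω‖ - K))) =
        ofReal (exp (3 / 8 * N n * ‖M n ω‖)) *
          ofReal (exp (-(N n * K))) := fun ω => by
      rw [← ofReal_mul (by positivity), ← exp_add]
      ring_nf
    simp only [e]
    rw [lintegral_mul_const' _ _ ofReal_ne_top]
    calc _ ≤ ofReal (exp (N n * K)) * ofReal (exp (-(N n * K))) := by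
          gcongr
          exact h1.trans (ofReal_le_ofReal h2)
      _ = 1 := by
          rw [← ofReal_mul (by positivity), ← exp_add]
          simp
  have hmax : LpBdd P fun n (_ : Unit) ω => max (3 / 8 * ‖M n ω‖ - K) 0 := by
    refine ⟨fun n _ => (((hM n).norm.const_mul _).sub_const _).max measurable_const, fun p =>
      ⟨p.factorial * 2, fun n _ => ?_⟩⟩
    have hN' : (1 : ℝ) ≤ N n := by exact_mod_cast hN n
    have hpt : ∀ ω, |max (3 / 8 * ‖M n ω‖ - K) 0| ^ p ≤
        p.factorial * (1 + exp (N n * (3 / 8 * ‖M n ω‖ - K))) := fun ω => by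
      set y := 3 / 8 * ‖M n ω‖ - K
      rw [abs_of_nonneg (le_max_right _ _)]
      have h1 := Real.pow_div_factorial_le_exp (max y 0) (le_max_right _ _) p
      rw [div_le_iff₀ (by positivity), mul_comm] at h1
      refine h1.trans ?_
      gcongr
      rcases le_total y 0 with hy | hy
      · rw [max_eq_right hy, Real.exp_zero]
        linarith [exp_pos (N n * y)]
      · rw [max_eq_left hy]
        have : exp y ≤ exp (N n * y) := exp_le_exp.2 (by nlinarith)
        linarith
    calc _ ≤ ∫⁻ ω, ofReal p.factorial *
          (1 + ofReal (exp (N n * (3 / 8 * ‖M n ω‖ - K)))) ∂P n := by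
          refine lintegral_mono fun ω => ?_
          rw [← ofReal_one, ← ofReal_add zero_le_one (exp_pos _).le,
            ← ofReal_mul (by positivity)]
          exact ofReal_le_ofReal (hpt ω)
      _ ≤ ofReal p.factorial * (1 + 1) := by
          rw [lintegral_const_mul' _ _ ofReal_ne_top, lintegral_add_left measurable_const]
          gcongr
          · simp
          · exact hexp n
      _ = _ := by
          rw [ofReal_mul (by positivity)]
          norm_num
  refine ((hmax.add (LpBdd.const |K|)).const_mul (8 / 3)).of_le (fun n _ => (hM n).norm)
    fun n _ ω => ?_
  rw [abs_of_nonneg (norm_nonneg _)]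
  have h1 := le_max_left (3 / 8 * ‖M n ω‖ - K) 0
  have h2 := le_abs_self K
  linarith

end OperatorNorm

/-! ### Functions of class `C^∞_{1b}` -/

section Smooth

variable {E : Type*} [NormedAddCommGroup E] [NormedSpace ℝ E] {h : E → ℝ}

theorem IsC1b.differentiable (hh : IsC1b h) : Differentiable ℝ h :=
  hh.1.differentiable (by simp)

theorem IsC1b.exists_fderiv_le (hh : IsC1b h) : ∃ C, 0 ≤ C ∧ ∀ x, ‖fderiv ℝ h x‖ ≤ C := by
  obtain ⟨C, hC⟩ := hh.2 1 le_rfl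
  refine ⟨C, (norm_nonneg _).trans (hC 0), fun x => ?_⟩
  rw [← norm_iteratedFDeriv_one]
  exact hC x

theorem IsC1b.exists_fderiv_lipschitz (hh : IsC1b h) :
    ∃ C, 0 ≤ C ∧ ∀ x y, ‖fderiv ℝ h y - fderiv ℝ h x‖ ≤ C * ‖y - x‖ := by
  obtain ⟨C, hC⟩ := hh.2 2 (by norm_num)
  refine ⟨C, (norm_nonneg _).trans (hC 0), fun x y => ?_⟩
  refine convex_univ.norm_image_sub_le_of_norm_fderiv_le (𝕜 := ℝ) (f := fderiv ℝ h)
    (fun z _ => ?_) (fun z _ => ?_) (Set.mem_univ x) (Set.mem_univ y)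
  · exact ((hh.1.fderiv_right (m := 1) (by norm_cast)).differentiable (by simp)) z
  · rw [← norm_iteratedFDeriv_one, norm_iteratedFDeriv_fderiv]
    exact hC z

theorem IsC1b.exists_lipschitz (hh : IsC1b h) : ∃ C, 0 ≤ C ∧ ∀ x y, |h y - h x| ≤ C * ‖y - x‖ := by
  obtain ⟨C, h0, hC⟩ := hh.exists_fderiv_le
  exact ⟨C, h0, fun x y => convex_univ.norm_image_sub_le_of_norm_fderiv_le (𝕜 := ℝ)
    (fun z _ => hh.differentiable z) (fun z _ => hC z) (Set.mem_univ x) (Set.mem_univ y)⟩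

/-- The regularity at one time required of a nonlinearity. -/
def RegAt (t : ℕ) (L : ℝ) (g : (ℕ → ℝ) → ℝ) (q : ℕ → (ℕ → ℝ) → ℝ) : Prop :=
  (∀ x x', |g x' - g x| ≤ L * ∑ s ∈ range t, |x' s - x s|) ∧
  (∀ x x', |g x' - g x - ∑ s ∈ range t, q s x * (x' s - x s)| ≤
    L * ∑ s ∈ range t, (x' s - x s) ^ 2) ∧
  (∀ s x, |q s x| ≤ L) ∧
  ∀ s x x', |q s x' - q s x| ≤ L * ∑ r ∈ range t, |x' r - x r|

theorem RegAt.mono {t : ℕ} {L L' : ℝ} {g : (ℕ → ℝ) → ℝ} {q : ℕ → (ℕ → ℝ) → ℝ}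
    (h : RegAt t L g q) (hL : L ≤ L') : RegAt t L' g q := by
  have h1 : ∀ x x' : ℕ → ℝ, 0 ≤ ∑ s ∈ range t, |x' s - x s| := fun x x' =>
    sum_nonneg fun _ _ => abs_nonneg _
  have h2 : ∀ x x' : ℕ → ℝ, 0 ≤ ∑ s ∈ range t, (x' s - x s) ^ 2 := fun x x' =>
    sum_nonneg fun _ _ => sq_nonneg _
  exact ⟨fun x x' => (h.1 x x').trans (mul_le_mul_of_nonneg_right hL (h1 x x')),
    fun x x' => (h.2.1 x x').trans (mul_le_mul_of_nonneg_right hL (h2 x x')),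
    fun s x => (h.2.2.1 s x).trans hL,
    fun s x x' => (h.2.2.2 s x x').trans (mul_le_mul_of_nonneg_right hL (h1 x x'))⟩

theorem regAt_const (t : ℕ) {L : ℝ} (hL : 0 ≤ L) (a : ℝ) : RegAt t L (fun _ => a) fun _ _ => 0 :=
  RegAt.mono (L := 0) ⟨fun _ _ => by simp, fun _ _ => by simp, fun _ _ => by simp,
    fun _ _ _ => by simp⟩ hL

theorem reg_of_regAt {ι : Type*} {f : Act(ι)} {p : Grad(ι)}
    (h : ∀ t, ∃ L, 0 ≤ L ∧ ∀ l, RegAt t L (f t l) fun s => p t s l) : ∃ L, Reg f p L := by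
  choose L h0 hL using h
  exact ⟨L, h0, fun t l => (hL t l).1, fun t l => (hL t l).2.1, fun t s l => (hL t l).2.2.1 s,
    fun t s l => (hL t l).2.2.2 s⟩

/-- Regularity of a smooth function of an affine image of the fields. -/
theorem IsC1b.exists_regAt (hh : IsC1b h) (Λ : (ℕ → ℝ) →ₗ[ℝ] E) (t : ℕ)
    (hΛ : ∀ x, Λ x = ∑ s ∈ range t, x s • Λ (single s 1)) :
    ∃ L, 0 ≤ L ∧ ∀ c, RegAt t L (fun x => h (c + Λ x))
      fun s x => fderiv ℝ h (c + Λ x) (Λ (single s 1)) := by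
  obtain ⟨C, hC0, hC⟩ := hh.exists_fderiv_le
  obtain ⟨D, hD0, hD⟩ := hh.exists_fderiv_lipschitz
  obtain ⟨K, hK0, hK⟩ := hh.exists_lipschitz
  set B := ∑ s ∈ range t, ‖Λ (single s 1)‖ with hB
  have hB0 : 0 ≤ B := sum_nonneg fun _ _ => norm_nonneg _
  have hle : ∀ s ∈ range t, ‖Λ (single s 1)‖ ≤ B := fun s hs =>
    single_le_sum (f := fun s => ‖Λ (single s 1)‖) (fun _ _ => norm_nonneg _) hs
  have hb : ∀ s, ‖Λ (single s 1)‖ ≤ B := fun s => by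
    by_cases hs : s < t
    · exact hle s (mem_range.2 hs)
    · rw [hΛ, sum_eq_zero fun r hr => ?_, norm_zero]
      · exact hB0
      · rw [single_apply, if_neg (by rintro rfl; exact hs (mem_range.1 hr)), zero_smul]
  have hn : ∀ x x' : ℕ → ℝ, ‖Λ x' - Λ x‖ ≤ B * ∑ s ∈ range t, |x' s - x s| := by
    intro x x'
    rw [← map_sub, hΛ, mul_sum]
    refine norm_sum_le_of_le _ fun s hs => ?_
    rw [norm_smul, mul_comm, Pi.sub_apply, norm_eq_abs]
    exact mul_le_mul_of_nonneg_right (hb s) (abs_nonneg _)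
  have hsq : ∀ x x' : ℕ → ℝ, (∑ s ∈ range t, |x' s - x s|) ^ 2 ≤
      t * ∑ s ∈ range t, (x' s - x s) ^ 2 := fun x x' => by
    have := sq_sum_le_card_mul_sum_sq (s := range t) (f := fun s => |x' s - x s|)
    simpa using this
  have e : ∀ (c : E) (x x' : ℕ → ℝ), c + Λ x' - (c + Λ x) = Λ x' - Λ x := fun c x x' => by abel
  refine ⟨K * B + D * B ^ 2 * t + C * B + D * B * B, by positivity, fun c =>
    ⟨fun x x' => ?_, fun x x' => ?_, fun s x => ?_, fun s x x' => ?_⟩⟩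
  · have hS : 0 ≤ ∑ s ∈ range t, |x' s - x s| := sum_nonneg fun _ _ => abs_nonneg _
    refine (hK _ _).trans ?_
    rw [e]
    calc _ ≤ K * (B * ∑ s ∈ range t, |x' s - x s|) := by gcongr; exact hn x x'
      _ = (K * B) * ∑ s ∈ range t, |x' s - x s| := by ring
      _ ≤ _ := by
          refine mul_le_mul_of_nonneg_right ?_ hS
          have : 0 ≤ D * B ^ 2 * t + C * B + D * B * B := by positivity
          linarith
  · set δ := Λ x' - Λ x with hδ
    have hsum : ∑ s ∈ range t, fderiv ℝ h (c + Λ x) (Λ (single s 1)) * (x' s - x s) =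
        fderiv ℝ h (c + Λ x) δ := by
      rw [hδ, ← map_sub, hΛ (x' - x), map_sum]
      refine sum_congr rfl fun s _ => ?_
      rw [map_smul, smul_eq_mul, mul_comm, Pi.sub_apply]
    have h1 := (convex_closedBall (c + Λ x) ‖δ‖).norm_image_sub_le_of_norm_fderiv_le' (𝕜 := ℝ)
      (f := h) (φ := fderiv ℝ h (c + Λ x)) (C := D * ‖δ‖) (fun z _ => hh.differentiable z)
      (fun z hz => (hD _ _).trans (by
        gcongr
        rwa [Metric.mem_closedBall, dist_eq_norm] at hz))
      (Metric.mem_closedBall_self (norm_nonneg _)) (y := c + Λ x') (by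
        rw [Metric.mem_closedBall, dist_eq_norm, e])
    rw [e, ← hδ] at h1
    rw [hsum, ← norm_eq_abs]
    refine h1.trans ?_
    have hS : 0 ≤ ∑ s ∈ range t, (x' s - x s) ^ 2 := sum_nonneg fun _ _ => sq_nonneg _
    calc D * ‖δ‖ * ‖δ‖ = D * ‖δ‖ ^ 2 := by ring
      _ ≤ D * (B * ∑ s ∈ range t, |x' s - x s|) ^ 2 := by gcongr; exact hn x x'
      _ = D * B ^ 2 * (∑ s ∈ range t, |x' s - x s|) ^ 2 := by ring
      _ ≤ D * B ^ 2 * (t * ∑ s ∈ range t, (x' s - x s) ^ 2) := by gcongr; exact hsq x x'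
      _ = D * B ^ 2 * t * ∑ s ∈ range t, (x' s - x s) ^ 2 := by ring
      _ ≤ _ := by
          refine mul_le_mul_of_nonneg_right ?_ hS
          have : 0 ≤ K * B + C * B + D * B * B := by positivity
          linarith
  · refine ((fderiv ℝ h (c + Λ x)).le_opNorm _).trans ?_
    have : ‖fderiv ℝ h (c + Λ x)‖ * ‖Λ (single s 1)‖ ≤ C * B :=
      mul_le_mul (hC _) (hb s) (norm_nonneg _) hC0
    have h2 : 0 ≤ K * B + D * B ^ 2 * t + D * B * B := by positivity
    linarith
  · rw [← sub_apply]
    refine ((fderiv ℝ h (c + Λ x') - fderiv ℝ h (c + Λ x)).le_opNorm _).trans ?_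
    have hS : 0 ≤ ∑ s ∈ range t, |x' s - x s| := sum_nonneg fun _ _ => abs_nonneg _
    calc _ ≤ (D * (B * ∑ s ∈ range t, |x' s - x s|)) * B := by
          refine mul_le_mul ((hD _ _).trans ?_) (hb s) (norm_nonneg _) (by positivity)
          rw [e]
          gcongr
          exact hn x x'
      _ = D * B * B * ∑ s ∈ range t, |x' s - x s| := by ring
      _ ≤ _ := by
          refine mul_le_mul_of_nonneg_right ?_ hS
          have : 0 ≤ K * B + D * B ^ 2 * t + C * B := by positivity
          linarith

end Smooth

/-! ### The system of the algorithm -/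

section Nonlinearities

/-- The value at the time `t` of a sequence that equals `a` at time `0`, `v k` at time `2 k + 1` and
`u k` at time `2 k + 2`. -/
def onTime {β : Type*} (a : β) (v u : ℕ → β) (t : ℕ) : β :=
  if t = 0 then a else if t % 2 = 1 then v (t / 2) else u (t / 2 - 1)

theorem time_cases (t : ℕ) : t = 0 ∨ (∃ k, t = 2 * k + 1) ∨ ∃ k, t = 2 * k + 2 := by
  rcases Nat.even_or_odd' t with ⟨k, rfl | rfl⟩
  · rcases k with _ | k
    · exact Or.inl rfl
    · exact Or.inr (Or.inr ⟨k, by ring⟩)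
  · exact Or.inr (Or.inl ⟨k, rfl⟩)

variable {β : Type*} (a : β) (v u : ℕ → β)

@[simp] theorem onTime_zero : onTime a v u 0 = a := rfl

@[simp] theorem onTime_odd (k : ℕ) : onTime a v u (2 * k + 1) = v k := by
  rw [onTime, if_neg (by omega), if_pos (by omega)]
  congr 1
  omega

@[simp] theorem onTime_even (k : ℕ) : onTime a v u (2 * k + 2) = u k := by
  rw [onTime, if_neg (by omega), if_neg (by omega)]
  congr 1
  omega

theorem sum_range_odd (g : ℕ → ℝ) (k : ℕ) : ∑ s ∈ range (2 * k + 1), g s =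
    g 0 + ∑ r ∈ range k, (g (2 * r + 1) + g (2 * r + 2)) := by
  induction k with
  | zero => simp
  | succ k ih =>
    rw [show 2 * (k + 1) + 1 = 2 * k + 1 + 1 + 1 by ring, sum_range_succ,
      sum_range_succ, ih, sum_range_succ]
    ring

theorem sum_range_even (g : ℕ → ℝ) (k : ℕ) : ∑ s ∈ range (2 * k + 2), g s =
    g 0 + ∑ r ∈ range k, (g (2 * r + 1) + g (2 * r + 2)) + g (2 * k + 1) := by
  rw [sum_range_succ, sum_range_odd]

/-- The side information of a coordinate: `θ`, `v^0` and the noises `w^1,…,w^T`. -/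
abbrev Side (T : ℕ) := Fin 2 ⊕ Fin T

variable {T : ℕ}

/-- The noises, continued by `0`. -/
def noise (ξ : Side T → ℝ) : ℕ → ℝ := ext0 fun i => ξ (inr i)

theorem continuous_noise : Continuous (noise : (Side T → ℝ) → ℕ → ℝ) :=
  continuous_ext0.comp (continuous_pi fun _ => continuous_apply _)

/-- The arguments of `F_{k+1}`. -/
def uPoint (k : ℕ) (ξ : Side T → ℝ) (x : ℕ → ℝ) : ℝ × (Fin (k + 1) → ℝ) × (Fin (k + 1) → ℝ) :=
  (x 0, fun r => x (2 * r + 1), fun r => noise ξ r)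

/-- The arguments of `G_{k+1}`. -/
def vPoint (k : ℕ) (ξ : Side T → ℝ) (x : ℕ → ℝ) : (Fin (k + 1) → ℝ) × ℝ × (Fin (k + 1) → ℝ) :=
  (fun r => x (2 * r + 2), ξ (inl 1), fun r => noise ξ r)

/-- The dependence of the arguments of `F_{k+1}` on the fields. -/
def uDir (k : ℕ) : (ℕ → ℝ) →ₗ[ℝ] ℝ × (Fin (k + 1) → ℝ) × (Fin (k + 1) → ℝ) where
  toFun x := (x 0, fun r => x (2 * r + 1), 0)
  map_add' x y := by ext <;> simp
  map_smul' a x := by ext <;> simp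

/-- The dependence of the arguments of `G_{k+1}` on the fields. -/
def vDir (k : ℕ) : (ℕ → ℝ) →ₗ[ℝ] (Fin (k + 1) → ℝ) × ℝ × (Fin (k + 1) → ℝ) where
  toFun x := (fun r => x (2 * r + 2), 0, 0)
  map_add' x y := by ext <;> simp
  map_smul' a x := by ext <;> simp

theorem uPoint_eq (k : ℕ) (ξ : Side T → ℝ) (x : ℕ → ℝ) :
    uPoint k ξ x = uPoint k ξ 0 + uDir k x := by
  ext <;> simp [uPoint, uDir]

theorem vPoint_eq (k : ℕ) (ξ : Side T → ℝ) (x : ℕ → ℝ) :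
    vPoint k ξ x = vPoint k ξ 0 + vDir k x := by
  ext <;> simp [vPoint, vDir]

theorem uDir_eq_sum (k : ℕ) (x : ℕ → ℝ) : uDir k x =
    ∑ s ∈ range (2 * k + 2), x s • uDir k (single s 1) := by
  have hs : ∀ r ∈ range (2 * k + 2),
      x r = ∑ s ∈ range (2 * k + 2), x s * (single s 1 : ℕ → ℝ) r := fun r hr => by
    simp only [single_apply, mul_ite, mul_one, mul_zero, sum_ite_eq, if_pos hr]
  refine Prod.ext ?_ (Prod.ext (funext fun r => ?_) (funext fun r => ?_))
  · simp only [uDir, LinearMap.coe_mk, AddHom.coe_mk, Prod.smul_mk, Prod.fst_sum, smul_eq_mul]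
    exact hs 0 (by simp)
  · simp only [uDir, LinearMap.coe_mk, AddHom.coe_mk, Prod.smul_mk, Prod.fst_sum, Prod.snd_sum,
      Finset.sum_apply, Pi.smul_apply, smul_eq_mul]
    exact hs _ (mem_range.2 (by omega))
  · simp [uDir, Prod.snd_sum]

theorem vDir_eq_sum (k : ℕ) (x : ℕ → ℝ) : vDir k x =
    ∑ s ∈ range (2 * k + 3), x s • vDir k (single s 1) := by
  have hs : ∀ r ∈ range (2 * k + 3),
      x r = ∑ s ∈ range (2 * k + 3), x s * (single s 1 : ℕ → ℝ) r := fun r hr => by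
    simp only [single_apply, mul_ite, mul_one, mul_zero, sum_ite_eq, if_pos hr]
  refine Prod.ext (funext fun r => ?_) (Prod.ext ?_ (funext fun r => ?_))
  · simp only [vDir, LinearMap.coe_mk, AddHom.coe_mk, Prod.smul_mk, Prod.fst_sum,
      Finset.sum_apply, Pi.smul_apply, smul_eq_mul]
    exact hs _ (mem_range.2 (by omega))
  · simp [vDir, Prod.snd_sum]
  · simp [vDir, Prod.snd_sum]

variable (F : UFun) (G : VFun)

/-- The action `v^t` of a coordinate `j`. -/
def vAct (ξ : Side T → ℝ) (x : ℕ → ℝ) : ℕ → ℝ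
  | 0 => ξ (inl 1)
  | k + 1 => G k (vPoint k ξ x)

/-- The derivatives of `v^t`. -/
def vActD (s : ℕ) (ξ : Side T → ℝ) (x : ℕ → ℝ) : ℕ → ℝ
  | 0 => 0
  | k + 1 => fderiv ℝ (G k) (vPoint k ξ x) (vDir k (single s 1))

/-- The algorithm as a first-order system: the coordinates `i` (of type `true`) play `u^{k+1}` at
time `2 k + 2`, the coordinates `j` (of type `false`) play `θ` at time `0` and `v^k` at time
`2 k + 1`. -/
def dmftF (t : ℕ) (l : Bool × (Side T → ℝ)) (x : ℕ → ℝ) : ℝ :=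
  if l.1 = true then onTime 0 0 (fun k => F k (uPoint k l.2 x)) t
  else onTime (l.2 (inl 0)) (vAct G l.2 x) 0 t

/-- The derivatives of `dmftF`. -/
def dmftP (t s : ℕ) (l : Bool × (Side T → ℝ)) (x : ℕ → ℝ) : ℝ :=
  if l.1 = true then
    onTime 0 0 (fun k => fderiv ℝ (F k) (uPoint k l.2 x) (uDir k (single s 1))) t
  else onTime 0 (vActD G s l.2 x) 0 t

variable (ξ : Side T → ℝ) (x : ℕ → ℝ) (s k : ℕ)

@[simp] theorem dmftF_true_zero : dmftF F G 0 (true, ξ) x = 0 := by simp [dmftF]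

@[simp] theorem dmftF_true_odd : dmftF F G (2 * k + 1) (true, ξ) x = 0 := by simp [dmftF]

@[simp] theorem dmftF_true_even :
    dmftF F G (2 * k + 2) (true, ξ) x = F k (uPoint k ξ x) := by simp [dmftF]

@[simp] theorem dmftF_false_zero : dmftF F G 0 (false, ξ) x = ξ (inl 0) := by simp [dmftF]

@[simp] theorem dmftF_false_odd :
    dmftF F G (2 * k + 1) (false, ξ) x = vAct G ξ x k := by simp [dmftF]

@[simp] theorem dmftF_false_even : dmftF F G (2 * k + 2) (false, ξ) x = 0 := by simp [dmftF]

@[simp] theorem dmftP_true_zero : dmftP F G 0 s (true, ξ) x = 0 := by simp [dmftP]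

@[simp] theorem dmftP_true_odd : dmftP F G (2 * k + 1) s (true, ξ) x = 0 := by simp [dmftP]

@[simp] theorem dmftP_true_even : dmftP F G (2 * k + 2) s (true, ξ) x =
    fderiv ℝ (F k) (uPoint k ξ x) (uDir k (single s 1)) := by simp [dmftP]

@[simp] theorem dmftP_false_zero : dmftP F G 0 s (false, ξ) x = 0 := by simp [dmftP]

@[simp] theorem dmftP_false_odd :
    dmftP F G (2 * k + 1) s (false, ξ) x = vActD G s ξ x k := by simp [dmftP]

@[simp] theorem dmftP_false_even : dmftP F G (2 * k + 2) s (false, ξ) x = 0 := by simp [dmftP]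

variable {F G} (hF : ∀ s, IsC1b (F s)) (hG : ∀ s, IsC1b (G s))
include hF hG

theorem exists_reg : ∃ L, Reg (dmftF (T := T) F G) (dmftP F G) L := by
  refine reg_of_regAt fun t => ?_
  have hu : ∃ L, 0 ≤ L ∧ ∀ ξ : Side T → ℝ, RegAt t L (fun x => dmftF F G t (true, ξ) x)
      fun s x => dmftP F G t s (true, ξ) x := by
    rcases time_cases t with rfl | ⟨k, rfl⟩ | ⟨k, rfl⟩
    · refine ⟨0, le_rfl, fun ξ => ?_⟩
      simp only [dmftF_true_zero, dmftP_true_zero]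
      exact regAt_const _ le_rfl 0
    · refine ⟨0, le_rfl, fun ξ => ?_⟩
      simp only [dmftF_true_odd, dmftP_true_odd]
      exact regAt_const _ le_rfl 0
    · obtain ⟨L, h0, hL⟩ := (hF k).exists_regAt (uDir k) (2 * k + 2) (uDir_eq_sum k)
      refine ⟨L, h0, fun ξ => ?_⟩
      have := hL (uPoint k ξ 0)
      simp only [← uPoint_eq k ξ] at this
      simp only [dmftF_true_even, dmftP_true_even]
      exact this
  have hv : ∃ L, 0 ≤ L ∧ ∀ ξ : Side T → ℝ, RegAt t L (fun x => dmftF F G t (false, ξ) x)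
      fun s x => dmftP F G t s (false, ξ) x := by
    rcases time_cases t with rfl | ⟨k, rfl⟩ | ⟨k, rfl⟩
    · refine ⟨0, le_rfl, fun ξ => ?_⟩
      simp only [dmftF_false_zero, dmftP_false_zero]
      exact regAt_const _ le_rfl _
    · rcases k with _ | k
      · refine ⟨0, le_rfl, fun ξ => ?_⟩
        simp only [dmftF_false_odd, dmftP_false_odd, vAct, vActD]
        exact regAt_const _ le_rfl _
      · obtain ⟨L, h0, hL⟩ := (hG k).exists_regAt (vDir k) (2 * k + 3) (vDir_eq_sum k)
        refine ⟨L, h0, fun ξ => ?_⟩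
        have := hL (vPoint k ξ 0)
        simp only [← vPoint_eq k ξ] at this
        simp only [dmftF_false_odd, dmftP_false_odd, vAct, vActD]
        exact this
    · refine ⟨0, le_rfl, fun ξ => ?_⟩
      simp only [dmftF_false_even, dmftP_false_even]
      exact regAt_const _ le_rfl 0
  obtain ⟨L, h0, hL⟩ := hu
  obtain ⟨L', h0', hL'⟩ := hv
  refine ⟨L + L', by positivity, fun l => ?_⟩
  rcases l with ⟨_ | _, ξ⟩
  · exact (hL' ξ).mono (by linarith)
  · exact (hL ξ).mono (by linarith)

omit hF hG in
theorem continuous_uPoint (k : ℕ) :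
    Continuous fun q : (Side T → ℝ) × (ℕ → ℝ) => uPoint k q.1 q.2 := by
  have := continuous_noise (T := T)
  have h1 : ∀ r, Continuous fun q : (Side T → ℝ) × (ℕ → ℝ) => noise q.1 r := fun r =>
    (continuous_apply r).comp (this.comp continuous_fst)
  unfold uPoint
  fun_prop

omit hF hG in
theorem continuous_vPoint (k : ℕ) :
    Continuous fun q : (Side T → ℝ) × (ℕ → ℝ) => vPoint k q.1 q.2 := by
  have := continuous_noise (T := T)
  have h1 : ∀ r, Continuous fun q : (Side T → ℝ) × (ℕ → ℝ) => noise q.1 r := fun r =>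
    (continuous_apply r).comp (this.comp continuous_fst)
  unfold vPoint
  fun_prop

theorem continuous_dmftF (b : Bool) (t : ℕ) :
    Continuous fun q : (Side T → ℝ) × (ℕ → ℝ) => dmftF F G t (b, q.1) q.2 := by
  have h1 := fun k => ((hF k).1.continuous).comp (continuous_uPoint (T := T) k)
  have h2 := fun k => ((hG k).1.continuous).comp (continuous_vPoint (T := T) k)
  have h3 : ∀ a, Continuous fun q : (Side T → ℝ) × (ℕ → ℝ) => q.1 a := fun a => by fun_prop
  rcases b with _ | _ <;> simp only [dmftF, Bool.false_eq_true, if_false, if_true] <;>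
    rcases time_cases t with rfl | ⟨k, rfl⟩ | ⟨k, rfl⟩ <;>
    simp only [onTime_zero, onTime_odd, onTime_even]
  · exact h3 _
  · rcases k with _ | k
    · exact h3 _
    · exact h2 k
  · exact continuous_const
  · exact continuous_const
  · exact continuous_const
  · exact h1 k

theorem continuous_dmftP (b : Bool) (t s : ℕ) :
    Continuous fun q : (Side T → ℝ) × (ℕ → ℝ) => dmftP F G t s (b, q.1) q.2 := by
  have h1 := fun k => (((hF k).1.continuous_fderiv (by simp)).comp
    (continuous_uPoint (T := T) k)).clm_apply (continuous_const (y := uDir k (single s 1)))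
  have h2 := fun k => (((hG k).1.continuous_fderiv (by simp)).comp
    (continuous_vPoint (T := T) k)).clm_apply (continuous_const (y := vDir k (single s 1)))
  rcases b with _ | _ <;> simp only [dmftP, Bool.false_eq_true, if_false, if_true] <;>
    rcases time_cases t with rfl | ⟨k, rfl⟩ | ⟨k, rfl⟩ <;>
    simp only [onTime_zero, onTime_odd, onTime_even]
  · exact continuous_const
  · rcases k with _ | k
    · exact continuous_const
    · exact h2 k
  · exact continuous_const
  · exact continuous_const
  · exact continuous_const
  · exact h1 k

omit hF hG in
theorem measurable_of_bool {g : Bool × (Side T → ℝ) → (ℕ → ℝ) → ℝ}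
    (hg : ∀ b, Continuous fun q : (Side T → ℝ) × (ℕ → ℝ) => g (b, q.1) q.2) :
    Measurable fun q : (Bool × (Side T → ℝ)) × (ℕ → ℝ) => g q.1 q.2 := by
  have h : ∀ b, Measurable fun q : (Bool × (Side T → ℝ)) × (ℕ → ℝ) => g (b, q.1.2) q.2 := fun b =>
    (hg b).measurable.comp ((measurable_snd.comp measurable_fst).prodMk measurable_snd)
  have hs : MeasurableSet {q : (Bool × (Side T → ℝ)) × (ℕ → ℝ) | q.1.1 = true} :=
    (measurable_fst.comp measurable_fst) (measurableSet_singleton true)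
  have e : (fun q : (Bool × (Side T → ℝ)) × (ℕ → ℝ) => g q.1 q.2) = fun q =>
      if q.1.1 = true then g (true, q.1.2) q.2 else g (false, q.1.2) q.2 := by
    funext ⟨⟨b, ξ⟩, x⟩
    rcases b with _ | _ <;> simp
  rw [e]
  exact Measurable.ite hs (h true) (h false)

end Nonlinearities

/-! ### The effective processes of the algorithm -/

section Matching

/-- The limiting covariance of the fields at the coordinates `i`. -/
def uCov (α : ℝ) (m : VStats) (s t : ℕ) : ℝ :=
  onTime (onTime (α * m.mom 0 0) (fun l => α * m.mom 0 (l + 1)) 0 t)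
    (fun k => onTime (α * m.mom (k + 1) 0) (fun l => α * m.mom (k + 1) (l + 1)) 0 t) 0 s

/-- The limiting reaction at the coordinates `i`. -/
def uReact (α : ℝ) (m : VStats) (t s : ℕ) : ℝ :=
  onTime 0 (fun k => onTime 0 0 (fun r => α * m.resp k r) s) 0 t

/-- The limiting covariance of the fields at the coordinates `j`. -/
def vCov (m : UStats) (s t : ℕ) : ℝ :=
  onTime 0 0 (fun k => onTime 0 0 (fun l => m.mom k l) t) s

/-- The limiting reaction at the coordinates `j`. -/
def vReact (m : UStats) (t s : ℕ) : ℝ :=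
  onTime 0 0 (fun k => onTime (m.respStar k) (fun r => m.resp k r) 0 s) t

theorem effD_eq {P : ℕ → ℕ → ℝ} (hP : ∀ t s, t ≤ s → P t s = 0) (Γ : ℕ → ℕ → ℝ) (s t : ℕ) :
    effD P Γ s t = P t s + ∑ r ∈ range t, P t r *
      ∑ q ∈ range r, Γ r q * effD P Γ s q := by
  rcases lt_or_ge s t with h | h
  · exact effD_of_lt P Γ h
  · rw [effD_of_le P Γ h, hP t s h, zero_add]
    refine (sum_eq_zero fun r hr => ?_).symm
    rw [sum_eq_zero fun q hq => ?_, mul_zero]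
    rw [effD_of_le, mul_zero]
    have := mem_range.1 hr
    have := mem_range.1 hq
    omega

variable {T : ℕ} {F : UFun} {G : VFun} {L : ℕ → ℝ} (ξ : Side T → ℝ)

theorem dmftP_of_le (b : Bool) (x : ℕ → ℝ) {t s : ℕ} (h : t ≤ s) : dmftP F G t s (b, ξ) x = 0 := by
  rcases b with _ | _ <;> rcases time_cases t with rfl | ⟨k, rfl⟩ | ⟨k, rfl⟩
  · simp
  · rcases k with _ | k
    · simp [dmftP_false_odd F G ξ x s 0, vActD]
    · rw [dmftP_false_odd, vActD, vDir_eq_sum, sum_eq_zero fun r hr => ?_, map_zero]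
      rw [single_apply, if_neg (by have := mem_range.1 hr; omega), zero_smul]
  · simp
  · simp
  · simp
  · rw [dmftP_true_even, uDir_eq_sum, sum_eq_zero fun r hr => ?_, map_zero]
    rw [single_apply, if_neg (by have := mem_range.1 hr; omega), zero_smul]

theorem effU_eq (F : UFun) (α : ℝ) (A : ℕ → ℕ → ℝ) (bs : ℝ) (z w : ℕ → ℝ) (t : ℕ) :
    effU F α A bs z w t = F t (bs, fun k : Fin (t + 1) => effB F α A bs z w k,
      fun k : Fin (t + 1) => w k) := by
  rw [effU]
  rfl

theorem effV_succ (G : VFun) (m : ℕ → ℝ) (R : ℕ → ℕ → ℝ) (θ v₀ : ℝ) (g w' : ℕ → ℝ) (t : ℕ) :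
    effV G m R θ v₀ g w' (t + 1) = G t (fun k : Fin (t + 1) => effH G m R θ v₀ g w' k, v₀,
      fun k : Fin (t + 1) => w' k) := by
  rw [effV]
  rfl

theorem uPoint_congr {k : ℕ} {x x' : ℕ → ℝ} (h : ∀ s < 2 * k + 2, x s = x' s) :
    uPoint k ξ x = uPoint k ξ x' := by
  refine Prod.ext (h 0 (by omega)) (Prod.ext (funext fun r => h _ (by omega)) rfl)

theorem vAct_congr {k : ℕ} {x x' : ℕ → ℝ} (h : ∀ s < 2 * k + 1, x s = x' s) :
    vAct G ξ x k = vAct G ξ x' k := by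
  rcases k with _ | k
  · rfl
  · refine congrArg (G k) (Prod.ext (funext fun r => h _ (by omega)) rfl)

section U

variable (α : ℝ) (m : VStats) (bs : ℝ) (z : ℕ → ℝ)

/-- The effective fields at the coordinates `i`. -/
def uFields (F : UFun) (ξ : Side T → ℝ) : ℕ → ℝ :=
  onTime bs (effB F α m.resp bs z (noise ξ)) 0

theorem apply_uPoint_uFields (k : ℕ) : F k (uPoint k ξ (uFields α m bs z F ξ)) =
    effU F α m.resp bs z (noise ξ) k := by
  rw [effU_eq]
  simp only [uPoint, uFields, onTime_zero, onTime_odd]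

theorem effX_true (h : Reg (dmftF (T := T) F G) (dmftP F G) L) (t : ℕ) :
    effX (fun s => dmftF F G s (true, ξ)) (uReact α m) (onTime bs z 0) t =
      uFields α m bs z F ξ t := by
  induction t using strongRecOn with
  | _ t ih =>
    rw [effX_eq h (true, ξ)]
    rcases time_cases t with rfl | ⟨k, rfl⟩ | ⟨k, rfl⟩
    · simp [uFields]
    · rw [sum_range_odd]
      have hr : ∀ r ∈ range k, uReact α m (2 * k + 1) (2 * r + 1) *
          dmftF F G (2 * r + 1) (true, ξ) (effX (fun s => dmftF F G s (true, ξ)) (uReact α m)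
            (onTime bs z 0)) + uReact α m (2 * k + 1) (2 * r + 2) *
          dmftF F G (2 * r + 2) (true, ξ) (effX (fun s => dmftF F G s (true, ξ)) (uReact α m)
            (onTime bs z 0)) = α * (m.resp k r * effU F α m.resp bs z (noise ξ) r) := by
        intro r hr
        have hr := mem_range.1 hr
        rw [dmftF_true_odd, dmftF_true_even, uPoint_congr ξ fun s hs => ih s (by omega),
          apply_uPoint_uFields (F := F)]
        simp [uReact, mul_assoc]
      rw [sum_congr rfl hr, dmftF_true_zero, mul_zero, zero_add, ← mul_sum,
        uFields, onTime_odd, onTime_odd, effB, sum_range]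
    · rw [sum_eq_zero fun s _ => by rw [uReact, onTime_even, Pi.zero_apply, zero_mul]]
      simp [uFields]

theorem effD_true_of_odd (x : ℕ → ℝ) (Γ : ℕ → ℕ → ℝ) (s k : ℕ) :
    effD (fun t s => dmftP F G t s (true, ξ) x) Γ s (2 * k + 1) = 0 := by
  rw [effD_eq fun t s => dmftP_of_le ξ true x]
  simp

theorem effD_true {s : ℕ} {c : ℝ} {e : ℕ → ℝ} (hc : c = (single s 1 : ℕ → ℝ) 0)
    (he : ∀ r, e r = (single s 1 : ℕ → ℝ) (2 * r + 1)) (k : ℕ) :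
    effD (fun t s => dmftP F G t s (true, ξ) (uFields α m bs z F ξ)) (uReact α m) s (2 * k + 2) =
      effDU F α m.resp bs z (noise ξ) c e k := by
  induction k using strongRecOn with
  | _ k ih =>
    set D := effD (fun t s => dmftP F G t s (true, ξ) (uFields α m bs z F ξ)) (uReact α m) s
      with hD
    have hpt : uPoint k ξ (uFields α m bs z F ξ) = (bs, fun r : Fin (k + 1) =>
        effB F α m.resp bs z (noise ξ) r, fun r : Fin (k + 1) => noise ξ r) := by
      simp only [uPoint, uFields, onTime_zero, onTime_odd]
    set Y : ℕ → ℝ := fun r => ∑ q ∈ range r, uReact α m r q * D q with hY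
    have hdir : uDir k (single s 1 + Y) = (c, fun r : Fin (k + 1) =>
        e r + α * ∑ q : Fin r, m.resp r q * effDU F α m.resp bs z (noise ξ) c e q, 0) := by
      refine Prod.ext ?_ (Prod.ext (funext fun r => ?_) rfl)
      · simp [uDir, hY, hc]
      · change (single s 1 + Y : ℕ → ℝ) (2 * r + 1) = _
        rw [Pi.add_apply, ← he]
        simp only [hY]
        rw [sum_range_odd, mul_sum, sum_range]
        simp only [uReact, onTime_odd, onTime_zero, onTime_even, Pi.zero_apply, zero_mul, zero_add]
        congr 1
        refine sum_congr rfl fun q _ => ?_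
        rw [ih q (by omega), mul_assoc]
    rw [hD, effD_eq fun t s => dmftP_of_le ξ true _, ← hD, effDU, ← hpt, ← hdir, map_add, map_add]
    simp only [dmftP_true_even]
    congr 1
    rw [uDir_eq_sum k Y, map_sum]
    refine sum_congr rfl fun r _ => ?_
    rw [map_smul, smul_eq_mul, mul_comm]

theorem effD_true_star (k : ℕ) :
    effD (fun t s => dmftP F G t s (true, ξ) (uFields α m bs z F ξ)) (uReact α m) 0 (2 * k + 2) =
      effDUStar F α m.resp bs z (noise ξ) k :=
  effD_true ξ α m bs z (by simp) (fun r => by simp) k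

theorem effD_true_field (s k : ℕ) :
    effD (fun t s => dmftP F G t s (true, ξ) (uFields α m bs z F ξ)) (uReact α m) (2 * s + 1)
      (2 * k + 2) = effDUField F α m.resp bs z (noise ξ) s k :=
  effD_true ξ α m bs z (by simp) (fun r => by
    simp only [single_apply]
    exact if_congr (by omega) rfl rfl) k

end U

section V

variable (m : UStats) (g : ℕ → ℝ)

/-- The effective fields at the coordinates `j`. -/
def vFields (G : VFun) (ξ : Side T → ℝ) : ℕ → ℝ :=
  onTime 0 0 (effH G m.respStar m.resp (ξ (inl 0)) (ξ (inl 1)) g (noise ξ))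

theorem vAct_vFields (k : ℕ) : vAct G ξ (vFields m g G ξ) k =
    effV G m.respStar m.resp (ξ (inl 0)) (ξ (inl 1)) g (noise ξ) k := by
  rcases k with _ | k
  · rw [effV, vAct]
  · rw [effV_succ, vAct]
    simp only [vPoint, vFields, onTime_even]

theorem effX_false (h : Reg (dmftF (T := T) F G) (dmftP F G) L) (t : ℕ) :
    effX (fun s => dmftF F G s (false, ξ)) (vReact m) (onTime 0 0 g) t =
      vFields m g G ξ t := by
  induction t using strongRecOn with
  | _ t ih =>
    rw [effX_eq h (false, ξ)]
    rcases time_cases t with rfl | ⟨k, rfl⟩ | ⟨k, rfl⟩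
    · simp [vFields]
    · rw [sum_eq_zero fun s _ => by rw [vReact, onTime_odd, Pi.zero_apply, zero_mul]]
      simp [vFields]
    · rw [sum_range_even]
      have hv : ∀ r ≤ k, vAct G ξ (effX (fun s => dmftF F G s (false, ξ)) (vReact m)
          (onTime 0 0 g)) r =
          effV G m.respStar m.resp (ξ (inl 0)) (ξ (inl 1)) g (noise ξ) r := by
        intro r hr
        rw [vAct_congr ξ fun s hs => ih s (by omega), vAct_vFields]
      simp only [dmftF_false_odd, dmftF_false_even, dmftF_false_zero, mul_zero, add_zero, vReact,
        onTime_even, onTime_odd, onTime_zero]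
      rw [hv k le_rfl, sum_congr rfl fun r hr => by
        rw [hv r (mem_range.1 hr).le], add_assoc, ← sum_range_succ
          (fun r => m.resp k r * effV G m.respStar m.resp (ξ (inl 0)) (ξ (inl 1)) g
            (noise ξ) r), vFields, onTime_even, effH, sum_range, add_assoc]

theorem effD_false (s k : ℕ) :
    effD (fun t s => dmftP F G t s (false, ξ) (vFields m g G ξ)) (vReact m) (2 * s + 2)
      (2 * k + 1) =
      effDV G m.respStar m.resp (ξ (inl 0)) (ξ (inl 1)) g (noise ξ) s k := by
  induction k using strongRecOn with
  | _ k ih =>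
    set D := effD (fun t s => dmftP F G t s (false, ξ) (vFields m g G ξ)) (vReact m) (2 * s + 2)
      with hD
    rcases k with _ | k
    · rw [hD, effD_eq fun t s => dmftP_of_le ξ false _]
      rw [effDV]
      simp only [dmftP_false_odd, vActD]
      simp
    have hpt : vPoint k ξ (vFields m g G ξ) = (fun r : Fin (k + 1) =>
        effH G m.respStar m.resp (ξ (inl 0)) (ξ (inl 1)) g (noise ξ) r, ξ (inl 1),
        fun r : Fin (k + 1) => noise ξ r) := by
      simp only [vPoint, vFields, onTime_even]
    set Y : ℕ → ℝ := fun r => ∑ q ∈ range r, vReact m r q * D q with hY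
    have hdir : vDir k (single (2 * s + 2) 1 + Y) = (fun r : Fin (k + 1) =>
        (if s = r then 1 else 0) + ∑ q : Fin (r + 1), m.resp r q * effDV G m.respStar m.resp
          (ξ (inl 0)) (ξ (inl 1)) g (noise ξ) s q, 0, 0) := by
      refine Prod.ext (funext fun r => ?_) rfl
      change (single (2 * s + 2) 1 + Y : ℕ → ℝ) (2 * r + 2) = _
      rw [Pi.add_apply, single_apply]
      congr 1
      · exact if_congr (by omega) rfl rfl
      simp only [hY]
      rw [sum_range_even]
      simp only [vReact, onTime_odd, onTime_zero, onTime_even, Pi.zero_apply, zero_mul, add_zero]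
      rw [hD, effD_of_le _ _ (Nat.zero_le _), ← hD, mul_zero, zero_add,
        ← sum_range_succ (fun q => m.resp r q * D (2 * q + 1)), sum_range]
      refine sum_congr rfl fun q _ => ?_
      rw [ih q (by omega)]
    rw [hD, effD_eq fun t s => dmftP_of_le ξ false _, ← hD, effDV, ← hpt, ← hdir, map_add, map_add]
    simp only [dmftP_false_odd, vActD]
    congr 1
    rw [vDir_eq_sum k Y, map_sum]
    refine sum_congr rfl fun r _ => ?_
    rw [map_smul, smul_eq_mul, mul_comm]

end V

end Matching

/-! ### The space of the limiting samples -/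

section LimitSpace

/-- A Gaussian vector, the pair `(θ, v^0)`, and noises. -/
abbrev LimSpace (m T : ℕ) := EuclideanSpace ℝ (Fin m) × ((ℝ × ℝ) × (Fin T → ℝ))

/-- The law of `(θ, v^0)` and of standard Gaussian noises. -/
def sideLaw (ν₀ : Measure (ℝ × ℝ)) (T : ℕ) : Measure ((ℝ × ℝ) × (Fin T → ℝ)) :=
  ν₀.prod (Measure.pi fun _ => gaussianReal 0 1)

/-- A centered Gaussian vector with covariance `S`, and independent side information. -/
def limLaw (ν₀ : Measure (ℝ × ℝ)) {m : ℕ} (S : Matrix (Fin m) (Fin m) ℝ) (T : ℕ) :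
    Measure (LimSpace m T) :=
  (multivariateGaussian 0 S).prod (sideLaw ν₀ T)

/-- The side information of a coordinate of type `b`. -/
def side {T : ℕ} (b : Bool) (y : (ℝ × ℝ) × (Fin T → ℝ)) : Side T → ℝ :=
  elim (if b = true then 0 else ![y.1.1, y.1.2]) y.2

theorem continuous_side {T : ℕ} (b : Bool) : Continuous (side (T := T) b) := by
  refine continuous_pi fun a => ?_
  rcases a with a | a
  · rcases b with _ | _
    · fin_cases a <;> simp only [side, elim_inl, Bool.false_eq_true, if_false] <;>
        simp <;> fun_prop
    · simp only [side, elim_inl, if_true]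
      exact continuous_const
  · simp only [side, elim_inr]
    fun_prop

variable {ν₀ : Measure (ℝ × ℝ)} [IsProbabilityMeasure ν₀] {m T τ : ℕ}

instance : IsProbabilityMeasure (sideLaw ν₀ T) := by
  unfold sideLaw; infer_instance

instance {S : Matrix (Fin m) (Fin m) ℝ} : IsProbabilityMeasure (limLaw ν₀ S T) := by
  unfold limLaw; infer_instance

theorem quadratic_eq {S : Matrix (Fin m) (Fin m) ℝ} {C : ℕ → ℕ → ℝ} {e : Fin m → Fin τ}
    (he : Function.Injective e) (hC : ∀ i j, C (e i) (e j) = S i j)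
    (hC0 : ∀ s t : Fin τ, s ∉ Set.range e ∨ t ∉ Set.range e → C s t = 0) (u : Fin τ → ℝ) :
    ∑ s, ∑ t, u s * u t * C s t = (u ∘ e) ⬝ᵥ (S *ᵥ (u ∘ e)) := by
  symm
  refine Fintype.sum_of_injective e he _ _ (fun s hs => ?_) fun i => ?_
  · exact sum_eq_zero fun t _ => by rw [hC0 s t (Or.inl hs), mul_zero]
  · rw [mulVec, dotProduct, mul_sum]
    refine Fintype.sum_of_injective e he _ _ (fun t ht => ?_) fun j => ?_
    · rw [hC0 _ t (Or.inr ht), mul_zero]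
    · rw [hC, Function.comp_apply, Function.comp_apply]
      ring

theorem posSemidef_of_psd {S : Matrix (Fin m) (Fin m) ℝ} {C : ℕ → ℕ → ℝ} {e : Fin m → Fin τ}
    (he : Function.Injective e) (hC : ∀ i j, C (e i) (e j) = S i j)
    (hC0 : ∀ s t : Fin τ, s ∉ Set.range e ∨ t ∉ Set.range e → C s t = 0)
    (hS : ∀ i j, S i j = S j i) (hpsd : ∀ u : Fin τ → ℝ, 0 ≤ ∑ s, ∑ t, u s * u t * C s t) :
    S.PosSemidef := by
  refine .of_dotProduct_mulVec_nonneg (Matrix.IsHermitian.ext fun i j => hS j i) fun a => ?_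
  have := hpsd (Function.extend e a 0)
  rw [quadratic_eq he hC hC0, Function.extend_comp he] at this
  simpa using this

theorem charFun_limLaw {S : Matrix (Fin m) (Fin m) ℝ} (hS : S.PosSemidef) {C : ℕ → ℕ → ℝ}
    {e : Fin m → Fin τ} (he : Function.Injective e) (hC : ∀ i j, C (e i) (e j) = S i j)
    (hC0 : ∀ s t : Fin τ, s ∉ Set.range e ∨ t ∉ Set.range e → C s t = 0)
    {Z : EuclideanSpace ℝ (Fin m) → Fin τ → ℝ} (hZ : ∀ x i, Z x (e i) = x i)
    (hZ0 : ∀ x s, s ∉ Set.range e → Z x s = 0) (b : Bool) (u : Fin τ → ℝ) (r : Side T → ℝ) :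
    ∫ ω, cis(Z ω.1 ⬝ᵥ u + side b ω.2 ⬝ᵥ r) ∂limLaw ν₀ S T =
      ((exp (-((∑ s, ∑ t, u s * u t * C s t) / 2)) : ℝ) : ℂ) *
        ∫ ω, cis(side b ω.2 ⬝ᵥ r) ∂limLaw ν₀ S T := by
  have hdot : ∀ x, Z x ⬝ᵥ u = inner ℝ x (toLp 2 (u ∘ e)) := fun x => by
    rw [PiLp.inner_apply]
    symm
    refine Fintype.sum_of_injective e he _ _ (fun s hs => ?_) fun i => ?_
    · rw [hZ0 x s hs, zero_mul]
    · rw [hZ]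
      simp [mul_comm]
  have h1 : ∀ ω : LimSpace m T,
      cis(Z ω.1 ⬝ᵥ u + side b ω.2 ⬝ᵥ r) =
      Complex.exp (((inner ℝ ω.1 (toLp 2 (u ∘ e)) : ℝ) : ℂ) * Complex.I) *
        cis(side b ω.2 ⬝ᵥ r) := fun ω => by
    rw [← Complex.exp_add, hdot]
    push_cast
    ring_nf
  simp only [h1]
  unfold limLaw
  rw [integral_prod_mul (fun x => Complex.exp (((inner ℝ x (toLp 2 (u ∘ e)) : ℝ) : ℂ) *
    Complex.I)) fun y => cis(side b y ⬝ᵥ r),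
    integral_fun_snd (fun y => cis(side b y ⬝ᵥ r)),
    ← charFun_apply, charFun_multivariateGaussian hS, quadratic_eq he hC hC0]
  simp

end LimitSpace

section Ensemble

variable {Ω : ℕ → Type*} [∀ n, MeasurableSpace (Ω n)] {P : ∀ n, Measure (Ω n)}
  [∀ n, IsProbabilityMeasure (P n)] {ι : ℕ → Type} [∀ n, Fintype (ι n)] [∀ n, DecidableEq (ι n)]
  {N : ℕ → ℕ} {ty : ∀ n, ι n → Bool} {M : ∀ n, Ω n → Matrix (ι n) (ι n) ℝ}

/-- Nonnegativity of limiting second moments. -/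
theorem psd_of_moment {κ : Type} [Fintype κ] {ξ : ∀ n, Ω n → ι n → (κ → ℝ)}
    {f : Act(Bool × (κ → ℝ))} {b : Bool} {τ : ℕ} {C : ℕ → ℕ → ℝ}
    (hmom : ∀ s t, s < τ → t < τ → LpSmall P fun n (k : Sites ty b n) ω =>
      ∑ l, varProfile (N n) (ty n) k.1 l * (siteY (siteF (ty n) f (ξ n ω)) (M n ω) l s *
        siteY (siteF (ty n) f (ξ n ω)) (M n ω) l t) - C s t)
    (hne : ∀ᶠ n in atTop, Nonempty (Sites ty b n)) (u : Fin τ → ℝ) :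
    0 ≤ ∑ s, ∑ t, u s * u t * C s t := by
  by_contra! hneg
  set Q := ∑ s, ∑ t, u s * u t * C s t with hQ
  have h1 := LpSmall.sum univ fun (s : Fin τ) _ => LpSmall.sum univ
    fun (t : Fin τ) _ => (hmom s t s.2 t.2).const_mul (u s * u t)
  obtain ⟨n, hn, ⟨k⟩⟩ := ((h1.integral_le (half_pos (neg_pos.2 hneg))).and hne).exists
  have h2 := hn k
  have e : ∀ ω, ∑ s : Fin τ, ∑ t : Fin τ, u s * u t * (∑ l, varProfile (N n) (ty n) k.1 l *
      (siteY (siteF (ty n) f (ξ n ω)) (M n ω) l s *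
        siteY (siteF (ty n) f (ξ n ω)) (M n ω) l t) - C s t) =
      ∑ l, varProfile (N n) (ty n) k.1 l *
        (∑ s : Fin τ, u s * siteY (siteF (ty n) f (ξ n ω)) (M n ω) l s) ^ 2 - Q := fun ω => by
    simp only [mul_sub, sum_sub_distrib, ← hQ]
    congr 1
    simp only [mul_sum]
    rw [sum_congr rfl fun s _ => sum_comm, sum_comm]
    refine sum_congr rfl fun l _ => ?_
    rw [sq, sum_mul_sum, mul_sum]
    refine sum_congr rfl fun s _ => ?_
    rw [mul_sum]
    exact sum_congr rfl fun t _ => by ring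
  simp only [e] at h2
  have h3 : -Q ≤ ∫ ω, (∑ l, varProfile (N n) (ty n) k.1 l *
      (∑ s : Fin τ, u s * siteY (siteF (ty n) f (ξ n ω)) (M n ω) l s) ^ 2 - Q) ∂P n := by
    have hi : Integrable (fun ω => ∑ l, varProfile (N n) (ty n) k.1 l *
        (∑ s : Fin τ, u s * siteY (siteF (ty n) f (ξ n ω)) (M n ω) l s) ^ 2 - Q) (P n) := by
      have := h1.bdd.integrable n k
      simp only [e] at this
      exact this
    calc -Q = ∫ _, -Q ∂P n := by simp
      _ ≤ _ := by
          refine integral_mono (integrable_const _) hi fun ω => ?_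
          have : 0 ≤ ∑ l, varProfile (N n) (ty n) k.1 l *
              (∑ s : Fin τ, u s * siteY (siteF (ty n) f (ξ n ω)) (M n ω) l s) ^ 2 :=
            sum_nonneg fun l _ => mul_nonneg (by unfold varProfile; positivity)
              (sq_nonneg _)
          simp only
          linarith
  have h4 := (abs_le.1 h2).2
  linarith

variable {T : ℕ} {ξ : ∀ n, Ω n → ι n → (Side T → ℝ)} {F : UFun} {G : VFun} {L : ℕ → ℝ} {c : ℝ}
  {ν₀ : Measure (ℝ × ℝ)} [IsProbabilityMeasure ν₀] {α : ℝ}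

/-- The random system of the algorithm. -/
structure Ensemble (P : ∀ n, Measure (Ω n)) (N : ℕ → ℕ) (ty : ∀ n, ι n → Bool)
    (M : ∀ n, Ω n → Matrix (ι n) (ι n) ℝ) (ξ : ∀ n, Ω n → ι n → (Side T → ℝ)) (F : UFun) (G : VFun)
    (L : ℕ → ℝ) (c : ℝ) (ν₀ : Measure (ℝ × ℝ)) (α : ℝ) : Prop where
  smooth_F : ∀ s, IsC1b (F s)
  smooth_G : ∀ s, IsC1b (G s)
  model : CavityModel P N ty M ξ (dmftF F G) (dmftP F G) L c
  law_side : ∀ b n (k : Sites ty b n), (P n).map (fun ω => ξ n ω k.1) = (sideLaw ν₀ T).map (side b)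
  indep_side : ∀ b n (q : Pairs ty b n),
    IndepFun (fun ω => ξ n ω q.1.1) (fun ω => ξ n ω q.1.2) (P n)
  exists_pair : ∀ b, ∀ᶠ n in atTop, Nonempty (Sites ty b n) ∧
    ∀ k : Sites ty b n, ∃ q : Pairs ty b n, q.site = k
  density_true : ∀ n, (N n : ℝ)⁻¹ * card (Sites ty true n) = 1
  density_false : ∀ n, (N n : ℝ)⁻¹ * card (Sites ty false n) = α

/-- The fields at the coordinates `i` created by a Gaussian vector. -/
def uGauss {m : ℕ} (x : EuclideanSpace ℝ (Fin (m + 1))) : ℕ → ℝ :=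
  onTime (x 0) (ext0 fun k : Fin m => x k.succ) 0

/-- The fields at the coordinates `j` created by a Gaussian vector. -/
def vGauss {m : ℕ} (x : EuclideanSpace ℝ (Fin m)) : ℕ → ℝ := onTime 0 0 (ext0 x)

theorem continuous_uGauss {m : ℕ} : Continuous (uGauss (m := m)) := by
  have h : Continuous fun x : EuclideanSpace ℝ (Fin (m + 1)) => ext0 fun k : Fin m => x k.succ :=
    continuous_ext0.comp (by fun_prop)
  refine continuous_pi fun t => ?_
  unfold uGauss
  rcases time_cases t with rfl | ⟨k, rfl⟩ | ⟨k, rfl⟩ <;>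
    simp only [onTime_zero, onTime_odd, onTime_even]
  · fun_prop
  · exact (continuous_apply k).comp h
  · exact continuous_const

theorem continuous_vGauss {m : ℕ} : Continuous (vGauss (m := m)) := by
  have h : Continuous fun x : EuclideanSpace ℝ (Fin m) => ext0 x := continuous_ext0.comp (by fun_prop)
  refine continuous_pi fun t => ?_
  unfold vGauss
  rcases time_cases t with rfl | ⟨k, rfl⟩ | ⟨k, rfl⟩ <;>
    simp only [onTime_zero, onTime_odd, onTime_even]
  · exact continuous_const
  · exact continuous_const
  · exact (continuous_apply k).comp h

namespace Ensemble

variable (h : Ensemble P N ty M ξ F G L c ν₀ α)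
include h

theorem integral_side {m : ℕ} (S : Matrix (Fin m) (Fin m) ℝ) (b : Bool) (n : ℕ)
    (k : Sites ty b n) (r : Side T → ℝ) :
    ∫ ω, cis(ξ n ω k.1 ⬝ᵥ r) ∂P n =
      ∫ ω, cis(side b ω.2 ⬝ᵥ r) ∂limLaw ν₀ S T := by
  have hc : Continuous fun y : Side T → ℝ => cis(y ⬝ᵥ r) := by
    unfold dotProduct
    fun_prop
  unfold limLaw
  rw [integral_fun_snd (fun y => cis(side b y ⬝ᵥ r)),
    ← integral_map (f := fun y : Side T → ℝ => cis(y ⬝ᵥ r))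
      ((measurable_pi_iff.1 (h.model.meas_ξ n) k.1).aemeasurable) hc.aestronglyMeasurable,
    h.law_side, integral_map (continuous_side b).aemeasurable hc.aestronglyMeasurable]
  simp

/-- The convergence of the coordinates `i`, given the statistics of the coordinates `j`. -/
theorem horizon_true (m : VStats) (hm : ∀ i j, m.mom i j = m.mom j i) {K : ℕ}
    (hmom : ∀ s t, s < 2 * K + 1 → t < 2 * K + 1 → LpSmall P fun n (k : Sites ty true n) ω =>
      ∑ l, varProfile (N n) (ty n) k.1 l * (siteY (siteF (ty n) (dmftF F G) (ξ n ω)) (M n ω) l s *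
        siteY (siteF (ty n) (dmftF F G) (ξ n ω)) (M n ω) l t) - uCov α m s t)
    (hresp : ∀ s t, s < t → t < 2 * K + 1 → LpSmall P fun n (k : Sites ty true n) ω =>
      ∑ l, varProfile (N n) (ty n) k.1 l * siteR (siteF (ty n) (dmftF F G) (ξ n ω))
        (siteD (ty n) (dmftP F G) (ξ n ω)) (M n ω) l s t - uReact α m t s) :
    HorizonLimit P N ty M ξ (dmftF F G) (dmftP F G) true (2 * K + 1) (uCov α m) (uReact α m)
      (limLaw ν₀ (of fun i j : Fin (K + 1) => α * m.mom i j) T)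
      (fun ω t => uGauss ω.1 t) (fun ω => side true ω.2) := by
  set e : Fin (K + 1) → Fin (2 * K + 1) := fun i => ⟨2 * i - 1, by omega⟩ with he
  have he0 : e 0 = ⟨0, by omega⟩ := rfl
  have hes : ∀ k : Fin K, e k.succ = ⟨2 * k + 1, by omega⟩ := fun k => by
    simp only [he, Fin.mk.injEq, Fin.val_succ]; omega
  have hinj : Function.Injective e := fun i j hij => by
    have : 2 * (i : ℕ) - 1 = 2 * j - 1 := congrArg Fin.val hij
    exact Fin.ext (by omega)
  have hrange : ∀ s : Fin (2 * K + 1), s ∉ Set.range e → ∃ k, (s : ℕ) = 2 * k + 2 := by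
    intro s hs
    rcases time_cases s with h0 | ⟨k, hk⟩ | h2
    · exact (hs ⟨0, by rw [he0]; exact Fin.ext h0.symm⟩).elim
    · exact (hs ⟨Fin.succ ⟨k, by omega⟩, by rw [hes]; exact Fin.ext hk.symm⟩).elim
    · exact h2
  have hC : ∀ i j, uCov α m (e i) (e j) = of (fun i j : Fin (K + 1) => α * m.mom i j) i j := by
    intro i j
    induction i using Fin.cases <;> induction j using Fin.cases <;>
      simp only [he0, hes, uCov, onTime_zero, onTime_odd, of_apply, Fin.val_zero,
        Fin.val_succ]
  have hC0 : ∀ s t : Fin (2 * K + 1), s ∉ Set.range e ∨ t ∉ Set.range e → uCov α m s t = 0 := by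
    rintro s t (hs | ht)
    · obtain ⟨k, hk⟩ := hrange s hs
      rw [hk, uCov, onTime_even, Pi.zero_apply]
    · obtain ⟨k, hk⟩ := hrange t ht
      rw [hk]
      rcases time_cases s with h0 | ⟨l, hl⟩ | ⟨l, hl⟩
      · rw [h0]; simp [uCov]
      · rw [hl]; simp [uCov]
      · rw [hl]; simp [uCov]
  have hpsd := psd_of_moment hmom ((h.exists_pair true).mono fun n hn => hn.1)
  have hS := posSemidef_of_psd hinj hC hC0 (fun i j => by simp [hm i j]) hpsd
  refine ⟨hmom, hresp, hpsd, continuous_dmftF h.smooth_F h.smooth_G true,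
    continuous_dmftP h.smooth_F h.smooth_G true, ?_, ?_, ?_, fun n k r => h.integral_side _ true n k r,
    h.indep_side true, h.exists_pair true⟩
  · exact measurable_pi_lambda _ fun t => ((continuous_apply (t : ℕ)).comp
      (continuous_uGauss.comp continuous_fst)).measurable
  · exact ((continuous_side true).comp continuous_snd).measurable
  · refine fun u r => charFun_limLaw hS hinj hC hC0 (Z := fun x t => uGauss x t) (fun x i => ?_)
      (fun x s hs => ?_) true u r
    · induction i using Fin.cases with
      | zero => rw [he0]; simp [uGauss]
      | succ k => rw [hes]; simp [uGauss, ext0]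
    · obtain ⟨k, hk⟩ := hrange s hs
      simp only [hk, uGauss, onTime_even, Pi.zero_apply]

/-- The convergence of the coordinates `j`, given the statistics of the coordinates `i`. -/
theorem horizon_false (m : UStats) (hm : ∀ i j, m.mom i j = m.mom j i) {K τ : ℕ}
    (hK : ∀ k < K, 2 * k + 2 < τ) (hτ : τ ≤ 2 * K + 2)
    (hmom : ∀ s t, s < τ → t < τ → LpSmall P fun n (k : Sites ty false n) ω =>
      ∑ l, varProfile (N n) (ty n) k.1 l * (siteY (siteF (ty n) (dmftF F G) (ξ n ω)) (M n ω) l s *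
        siteY (siteF (ty n) (dmftF F G) (ξ n ω)) (M n ω) l t) - vCov m s t)
    (hresp : ∀ s t, s < t → t < τ → LpSmall P fun n (k : Sites ty false n) ω =>
      ∑ l, varProfile (N n) (ty n) k.1 l * siteR (siteF (ty n) (dmftF F G) (ξ n ω))
        (siteD (ty n) (dmftP F G) (ξ n ω)) (M n ω) l s t - vReact m t s) :
    HorizonLimit P N ty M ξ (dmftF F G) (dmftP F G) false τ (vCov m) (vReact m)
      (limLaw ν₀ (of fun i j : Fin K => m.mom i j) T)
      (fun ω t => vGauss ω.1 t) (fun ω => side false ω.2) := by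
  set e : Fin K → Fin τ := fun k => ⟨2 * k + 2, hK k k.2⟩ with he
  have hinj : Function.Injective e := fun i j hij => by
    have : 2 * (i : ℕ) + 2 = 2 * j + 2 := congrArg Fin.val hij
    exact Fin.ext (by omega)
  have hrange : ∀ s : Fin τ, s ∉ Set.range e → (s : ℕ) = 0 ∨ ∃ k, (s : ℕ) = 2 * k + 1 := by
    intro s hs
    rcases time_cases s with h0 | h1 | ⟨k, hk⟩
    · exact Or.inl h0
    · exact Or.inr h1
    · exact (hs ⟨⟨k, by omega⟩, Fin.ext hk.symm⟩).elim
  have hC : ∀ i j, vCov m (e i) (e j) = of (fun i j : Fin K => m.mom i j) i j := by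
    intro i j
    simp only [he, vCov, onTime_even, of_apply]
  have hC0 : ∀ s t : Fin τ, s ∉ Set.range e ∨ t ∉ Set.range e → vCov m s t = 0 := by
    rintro s t (hs | ht)
    · rcases hrange s hs with h0 | ⟨k, hk⟩
      · rw [h0]; simp [vCov]
      · rw [hk]; simp [vCov]
    · rcases time_cases s with h0 | ⟨l, hl⟩ | ⟨l, hl⟩
      · rw [h0]; simp [vCov]
      · rw [hl]; simp [vCov]
      · rcases hrange t ht with h0 | ⟨k, hk⟩
        · rw [hl, h0]; simp [vCov]
        · rw [hl, hk]; simp [vCov]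
  have hpsd := psd_of_moment hmom ((h.exists_pair false).mono fun n hn => hn.1)
  have hS := posSemidef_of_psd hinj hC hC0 (fun i j => by simp [hm i j]) hpsd
  refine ⟨hmom, hresp, hpsd, continuous_dmftF h.smooth_F h.smooth_G false,
    continuous_dmftP h.smooth_F h.smooth_G false, ?_, ?_, ?_,
    fun n k r => h.integral_side _ false n k r, h.indep_side false, h.exists_pair false⟩
  · exact measurable_pi_lambda _ fun t => ((continuous_apply (t : ℕ)).comp
      (continuous_vGauss.comp continuous_fst)).measurable
  · exact ((continuous_side false).comp continuous_snd).measurable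
  · refine fun u r => charFun_limLaw hS hinj hC hC0 (Z := fun x t => vGauss x t) (fun x i => ?_)
      (fun x s hs => ?_) false u r
    · simp [he, vGauss, ext0]
    · rcases hrange s hs with h0 | ⟨k, hk⟩
      · simp only [h0, vGauss, onTime_zero]
      · simp only [hk, vGauss, onTime_odd, Pi.zero_apply]

end Ensemble

end Ensemble

/-! ### Continuity of the effective processes, and their dependence on the noise -/

section Processes

section Continuity

variable {X : Type*} [TopologicalSpace X] {T : ℕ} {F : UFun} {G : VFun}
  (hF : ∀ s, IsC1b (F s)) (hG : ∀ s, IsC1b (G s)) {ξ : X → Side T → ℝ} (hξ : Continuous ξ)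
  (α : ℝ) (m : VStats) (q : UStats) {bs : X → ℝ} {z : X → ℕ → ℝ} (hbs : Continuous bs)
  (hz : Continuous z)

theorem continuous_onTime {a : X → ℝ} {v u : X → ℕ → ℝ} (ha : Continuous a) (hv : Continuous v)
    (hu : Continuous u) : Continuous fun x => onTime (a x) (v x) (u x) := by
  refine continuous_pi fun t => ?_
  rcases time_cases t with rfl | ⟨k, rfl⟩ | ⟨k, rfl⟩ <;>
    simp only [onTime_zero, onTime_odd, onTime_even]
  · exact ha
  · exact (continuous_apply k).comp hv
  · exact (continuous_apply k).comp hu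

include hF hG hξ

theorem continuous_dmftF_comp (b : Bool) (t : ℕ) {x : X → ℕ → ℝ} (hx : Continuous x) :
    Continuous fun a => dmftF F G t (b, ξ a) (x a) :=
  (continuous_dmftF hF hG b t).comp (hξ.prodMk hx)

theorem continuous_dmftP_comp (b : Bool) (t s : ℕ) {x : X → ℕ → ℝ} (hx : Continuous x) :
    Continuous fun a => dmftP F G t s (b, ξ a) (x a) :=
  (continuous_dmftP hF hG b t s).comp (hξ.prodMk hx)

section U

include hbs hz

theorem continuous_uFields : Continuous fun x => uFields α m (bs x) (z x) F (ξ x) := by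
  obtain ⟨L, hL⟩ := exists_reg (T := T) hF hG
  refine continuous_pi fun t => ?_
  simp only [← effX_true _ α m _ _ hL]
  exact continuous_effX (fun s => continuous_dmftF_comp hF hG (hξ.comp continuous_fst) true s
    continuous_snd) _ (continuous_onTime hbs hz continuous_const) t

theorem continuous_effB (t : ℕ) :
    Continuous fun x => effB F α m.resp (bs x) (z x) (noise (ξ x)) t := by
  have := (continuous_apply (2 * t + 1)).comp (continuous_uFields hF hG hξ α m hbs hz)
  simpa only [Function.comp_def, uFields, onTime_odd] using this

theorem continuous_effU (t : ℕ) :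
    Continuous fun x => effU F α m.resp (bs x) (z x) (noise (ξ x)) t := by
  have := continuous_dmftF_comp hF hG hξ true (2 * t + 2)
    (continuous_uFields hF hG hξ α m hbs hz)
  simpa only [dmftF_true_even, apply_uPoint_uFields (F := F)] using this

theorem continuous_effDUStar (t : ℕ) :
    Continuous fun x => effDUStar F α m.resp (bs x) (z x) (noise (ξ x)) t := by
  simp only [← effD_true_star (G := G) _ α m]
  exact continuous_effD (fun t s => continuous_dmftP_comp hF hG hξ true t s
    (continuous_uFields hF hG hξ α m hbs hz)) _ _ _

theorem continuous_effDUField (s t : ℕ) :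
    Continuous fun x => effDUField F α m.resp (bs x) (z x) (noise (ξ x)) s t := by
  simp only [← effD_true_field (G := G) _ α m]
  exact continuous_effD (fun t s => continuous_dmftP_comp hF hG hξ true t s
    (continuous_uFields hF hG hξ α m hbs hz)) _ _ _

end U

section V

include hz

theorem continuous_vFields : Continuous fun x => vFields q (z x) G (ξ x) := by
  obtain ⟨L, hL⟩ := exists_reg (T := T) hF hG
  refine continuous_pi fun t => ?_
  simp only [← effX_false _ q _ hL]
  exact continuous_effX (fun s => continuous_dmftF_comp hF hG (hξ.comp continuous_fst) false s
    continuous_snd) _ (continuous_onTime continuous_const continuous_const hz) t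

theorem continuous_effH (t : ℕ) : Continuous fun x =>
    effH G q.respStar q.resp (ξ x (inl 0)) (ξ x (inl 1)) (z x) (noise (ξ x)) t := by
  have := (continuous_apply (2 * t + 2)).comp (continuous_vFields hF hG hξ q hz)
  simpa only [Function.comp_def, vFields, onTime_even] using this

theorem continuous_effV (t : ℕ) : Continuous fun x =>
    effV G q.respStar q.resp (ξ x (inl 0)) (ξ x (inl 1)) (z x) (noise (ξ x)) t := by
  have := continuous_dmftF_comp hF hG hξ false (2 * t + 1) (continuous_vFields hF hG hξ q hz)
  simpa only [dmftF_false_odd, vAct_vFields] using this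

theorem continuous_effDV (s t : ℕ) : Continuous fun x =>
    effDV G q.respStar q.resp (ξ x (inl 0)) (ξ x (inl 1)) (z x) (noise (ξ x)) s t := by
  simp only [← effD_false (F := F) _ q]
  exact continuous_effD (fun t s => continuous_dmftP_comp hF hG hξ false t s
    (continuous_vFields hF hG hξ q hz)) _ _ _

end V

end Continuity

section Noise

variable {n : ℕ} {w w' : ℕ → ℝ} (hw : ∀ k < n, w k = w' k)
include hw

theorem effU_congr (F : UFun) (α : ℝ) (A : ℕ → ℕ → ℝ) (bs : ℝ) (z : ℕ → ℝ) {t : ℕ} (ht : t < n) :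
    effU F α A bs z w t = effU F α A bs z w' t := by
  induction t using strongRecOn with
  | _ t ih =>
    rw [effU, effU]
    refine congrArg (F t) (Prod.ext rfl (Prod.ext (funext fun k => ?_) (funext fun k =>
      hw k (by omega))))
    simp only
    congr 2
    exact sum_congr rfl fun s _ => by rw [ih s (by omega) (by omega)]

theorem effB_congr (F : UFun) (α : ℝ) (A : ℕ → ℕ → ℝ) (bs : ℝ) (z : ℕ → ℝ) {t : ℕ} (ht : t < n) :
    effB F α A bs z w t = effB F α A bs z w' t := by
  rw [effB, effB]
  congr 2
  exact sum_congr rfl fun s _ => by rw [effU_congr hw F α A bs z (by omega)]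

theorem effDU_congr (F : UFun) (α : ℝ) (A : ℕ → ℕ → ℝ) (bs : ℝ) (z : ℕ → ℝ) (c : ℝ) (e : ℕ → ℝ)
    {t : ℕ} (ht : t < n) : effDU F α A bs z w c e t = effDU F α A bs z w' c e t := by
  induction t using strongRecOn with
  | _ t ih =>
    rw [effDU, effDU]
    have h1 : (fun k : Fin (t + 1) => effB F α A bs z w k) = fun k : Fin (t + 1) =>
        effB F α A bs z w' k := funext fun k => effB_congr hw F α A bs z (by omega)
    have h2 : (fun k : Fin (t + 1) => w k) = fun k : Fin (t + 1) => w' k :=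
      funext fun k => hw k (by omega)
    have h3 : (fun k : Fin (t + 1) => e k + α * ∑ r : Fin k, A k r * effDU F α A bs z w c e r) =
        fun k : Fin (t + 1) => e k + α * ∑ r : Fin k, A k r * effDU F α A bs z w' c e r := by
      funext k
      congr 2
      exact sum_congr rfl fun s _ => by rw [ih s (by omega) (by omega)]
    rw [h1, h2, h3]

theorem effV_congr (G : VFun) (m : ℕ → ℝ) (R : ℕ → ℕ → ℝ) (θ v₀ : ℝ) (g : ℕ → ℝ) {t : ℕ}
    (ht : t ≤ n) : effV G m R θ v₀ g w t = effV G m R θ v₀ g w' t := by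
  induction t using strongRecOn with
  | _ t ih =>
    rcases t with _ | t
    · rw [effV, effV]
    rw [effV, effV]
    refine congrArg (G t) (Prod.ext (funext fun k => ?_) (Prod.ext rfl (funext fun k =>
      hw k (by omega))))
    simp only
    congr 1
    exact sum_congr rfl fun s _ => by rw [ih s (by omega) (by omega)]

theorem effH_congr (G : VFun) (m : ℕ → ℝ) (R : ℕ → ℕ → ℝ) (θ v₀ : ℝ) (g : ℕ → ℝ) {t : ℕ}
    (ht : t ≤ n) : effH G m R θ v₀ g w t = effH G m R θ v₀ g w' t := by
  rw [effH, effH]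
  congr 1
  exact sum_congr rfl fun s _ => by rw [effV_congr hw G m R θ v₀ g (by omega)]

theorem effDV_congr (G : VFun) (m : ℕ → ℝ) (R : ℕ → ℕ → ℝ) (θ v₀ : ℝ) (g : ℕ → ℝ) (s : ℕ) {t : ℕ}
    (ht : t ≤ n) : effDV G m R θ v₀ g w s t = effDV G m R θ v₀ g w' s t := by
  induction t using strongRecOn with
  | _ t ih =>
    rcases t with _ | t
    · rw [effDV, effDV]
    rw [effDV, effDV]
    have h1 : (fun k : Fin (t + 1) => effH G m R θ v₀ g w k) = fun k : Fin (t + 1) =>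
        effH G m R θ v₀ g w' k := funext fun k => effH_congr hw G m R θ v₀ g (by omega)
    have h2 : (fun k : Fin (t + 1) => w k) = fun k : Fin (t + 1) => w' k :=
      funext fun k => hw k (by omega)
    have h3 : (fun k : Fin (t + 1) => (if s = k then 1 else 0) +
        ∑ r : Fin (k + 1), R k r * effDV G m R θ v₀ g w s r) = fun k : Fin (t + 1) =>
        (if s = k then 1 else 0) + ∑ r : Fin (k + 1), R k r * effDV G m R θ v₀ g w' s r := by
      funext k
      congr 1
      exact sum_congr rfl fun s _ => by rw [ih s (by omega) (by omega)]
    rw [h1, h2, h3]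

end Noise

end Processes

/-! ### The laws of the samples -/

section Samples

variable {ν₀ : Measure (ℝ × ℝ)} [IsProbabilityMeasure ν₀] {T K : ℕ} (hK : K ≤ T)

/-- The sample of the effective process at a coordinate `i`. -/
def toU (ω : LimSpace (K + 1) T) : USample K := (ω.1, fun i => ω.2.2 (Fin.castLE hK i))

/-- The sample of the effective process at a coordinate `j`. -/
def toV (ω : LimSpace K T) : VSample K := (ω.2.1, ω.1, fun i => ω.2.2 (Fin.castLE hK i))

theorem measurePreserving_castLE : MeasurePreserving
    (fun (w : Fin T → ℝ) i => w (Fin.castLE hK i)) (Measure.pi fun _ => gaussianReal 0 1)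
    (Measure.pi fun _ => gaussianReal 0 1) := by
  have h1 : iIndepFun (fun (i : Fin T) (w : Fin T → ℝ) => w i)
      (Measure.pi fun _ => gaussianReal 0 1) := iIndepFun_pi (X := fun _ x => x) fun _ => aemeasurable_id
  have h2 := (h1.precomp (Fin.castLE_injective hK)).hasLaw_pi (μ := fun _ => gaussianReal 0 1)
    fun i => (measurePreserving_eval (fun _ => gaussianReal 0 1) (Fin.castLE hK i)).hasLaw
  exact h2.measurePreserving (by fun_prop)

theorem hasLaw_toU (α : ℝ) (m : VStats) : HasLaw (toU hK) (uSampleLaw α K m)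
    (limLaw ν₀ (of fun i j : Fin (K + 1) => α * m.mom i j) T) :=
  ((MeasurePreserving.id _).prod
    ((measurePreserving_castLE hK).comp measurePreserving_snd)).hasLaw

theorem hasLaw_toV (q : UStats) : HasLaw (toV hK) (vSampleLaw ν₀ K q)
    (limLaw ν₀ (of fun i j : Fin K => q.mom i j) T) := by
  set g := multivariateGaussian 0 (of fun i j : Fin K => q.mom i j)
  set π : ∀ k : ℕ, Measure (Fin k → ℝ) := fun k => Measure.pi fun _ => gaussianReal 0 1
  have h1 : MeasurePreserving (fun ω : LimSpace K T => ((ω.1, ω.2.1), ω.2.2))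
      (g.prod (ν₀.prod (π T))) ((g.prod ν₀).prod (π T)) :=
    (measurePreserving_prodAssoc g ν₀ (π T)).symm
  have h2 : MeasurePreserving (fun ω : (EuclideanSpace ℝ (Fin K) × (ℝ × ℝ)) × (Fin T → ℝ) =>
      ((ω.1.2, ω.1.1), fun i => ω.2 (Fin.castLE hK i))) ((g.prod ν₀).prod (π T))
      ((ν₀.prod g).prod (π K)) :=
    Measure.measurePreserving_swap.prod (measurePreserving_castLE hK)
  exact ((measurePreserving_prodAssoc ν₀ g (π K)).comp (h2.comp h1)).hasLaw

theorem noise_side_eq (b : Bool) (y : (ℝ × ℝ) × (Fin T → ℝ)) {k : ℕ} (hk : k < K) :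
    noise (side b y) k = ext0 (fun i => y.2 (Fin.castLE hK i)) k := by
  simp only [noise, side, ext0, elim_inr]
  rw [dif_pos hk, dif_pos (hk.trans_le hK)]
  rfl

end Samples

/-! ### The induction over time -/

section Induction

theorem effD_eq_zero {P : ℕ → ℕ → ℝ} {s : ℕ} (hP : ∀ t, P t s = 0) (Γ : ℕ → ℕ → ℝ) (t : ℕ) :
    effD P Γ s t = 0 := by
  induction t using strongRecOn with
  | _ t ih =>
    rcases lt_or_ge s t with h | h
    · rw [effD_of_lt P Γ h, hP, zero_add]
      refine sum_eq_zero fun r hr => ?_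
      rw [sum_eq_zero fun q hq => ?_, mul_zero]
      rw [ih q ((mem_range.1 hq).trans (mem_range.1 hr)), mul_zero]
    · exact effD_of_le P Γ h

theorem effD_eq_zero' {P : ℕ → ℕ → ℝ} {t : ℕ} (hP : ∀ s, P t s = 0) (Γ : ℕ → ℕ → ℝ) (s : ℕ) :
    effD P Γ s t = 0 := by
  rcases lt_or_ge s t with h | h
  · rw [effD_of_lt P Γ h, hP, zero_add]
    exact sum_eq_zero fun r _ => by rw [hP, zero_mul]
  · exact effD_of_le P Γ h

variable {T : ℕ} {F : UFun} {G : VFun}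

theorem dmftP_true_of_even (ξ : Side T → ℝ) (x : ℕ → ℝ) (t r : ℕ) :
    dmftP F G t (2 * r + 2) (true, ξ) x = 0 := by
  rcases time_cases t with rfl | ⟨k, rfl⟩ | ⟨k, rfl⟩
  · simp
  · simp
  · have : uDir k (single (2 * r + 2) 1) = 0 := by
      refine Prod.ext ?_ (Prod.ext (funext fun q => ?_) rfl)
      · simp [uDir]
      · simp only [uDir, LinearMap.coe_mk, AddHom.coe_mk, single_apply]
        exact if_neg (by omega)
    rw [dmftP_true_even, this, map_zero]

theorem dmftP_false_of_ne (ξ : Side T → ℝ) (x : ℕ → ℝ) (t : ℕ) {s : ℕ} (hs : ∀ r, s ≠ 2 * r + 2) :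
    dmftP F G t s (false, ξ) x = 0 := by
  rcases time_cases t with rfl | ⟨k, rfl⟩ | ⟨k, rfl⟩
  · simp
  · rcases k with _ | k
    · rw [dmftP_false_odd, vActD]
    · have : vDir k (single s 1) = 0 := by
        refine Prod.ext (funext fun q => ?_) rfl
        simp only [vDir, LinearMap.coe_mk, AddHom.coe_mk, single_apply]
        exact if_neg fun h => hs q h.symm
      rw [dmftP_false_odd, vActD, this, map_zero]
  · simp

theorem effD_true_of_even (ξ : Side T → ℝ) (x : ℕ → ℝ) (Γ : ℕ → ℕ → ℝ) (r t : ℕ) :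
    effD (fun t s => dmftP F G t s (true, ξ) x) Γ (2 * r + 2) t = 0 :=
  effD_eq_zero (fun t => dmftP_true_of_even ξ x t r) Γ t

theorem effD_false_of_ne (ξ : Side T → ℝ) (x : ℕ → ℝ) (Γ : ℕ → ℕ → ℝ) {s : ℕ}
    (hs : ∀ r, s ≠ 2 * r + 2) (t : ℕ) : effD (fun t s => dmftP F G t s (false, ξ) x) Γ s t = 0 :=
  effD_eq_zero (fun t => dmftP_false_of_ne ξ x t hs) Γ t

theorem effD_false_of_even (ξ : Side T → ℝ) (x : ℕ → ℝ) (Γ : ℕ → ℕ → ℝ) (s k : ℕ) :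
    effD (fun t s => dmftP F G t s (false, ξ) x) Γ s (2 * k + 2) = 0 :=
  effD_eq_zero' (fun s => dmftP_false_even F G ξ x s k) Γ s

theorem integral_eq_of_hasLaw {Ω 𝓧 : Type*} [MeasurableSpace Ω] [MeasurableSpace 𝓧]
    {P : Measure Ω} {μ : Measure 𝓧} {X : Ω → 𝓧} (hX : HasLaw X μ P) {f : 𝓧 → ℝ} {g : Ω → ℝ}
    (hf : AEStronglyMeasurable f μ) (hfg : ∀ ω, f (X ω) = g ω) : ∫ x, f x ∂μ = ∫ ω, g ω ∂P := by
  rw [← hX.integral_comp hf]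
  exact integral_congr_ae (.of_forall hfg)

variable {L : ℕ → ℝ} {α : ℝ} {m : VStats} {q : UStats} {K : ℕ}

/-- The vector of effective fields and side information of a coordinate `i`. -/
def uLimVec (F : UFun) (G : VFun) (α : ℝ) (m : VStats) (ω : LimSpace (K + 1) T) :
    Fin (2 * K + 1) ⊕ Side T → ℝ :=
  effVec (dmftF F G) true (uReact α m) (elim (fun t => uGauss ω.1 t) (side true ω.2))

/-- The vector of effective fields and side information of a coordinate `j`. -/
def vLimVec (F : UFun) (G : VFun) (q : UStats) {τ : ℕ} (ω : LimSpace K T) :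
    Fin τ ⊕ Side T → ℝ :=
  effVec (dmftF F G) false (vReact q) (elim (fun t => vGauss ω.1 t) (side false ω.2))

section Values

variable (h : Reg (dmftF (T := T) F G) (dmftP F G) L)
include h

theorem vecX_uLimVec (ω : LimSpace (K + 1) T) {t : ℕ} (ht : t < 2 * K + 1) :
    vecX (uLimVec F G α m ω) t =
      uFields α m (ω.1 0) (ext0 fun k : Fin K => ω.1 k.succ) F (side true ω.2) t := by
  rw [← effX_true _ α m _ _ h, vecX, ext0, dif_pos ht]
  exact effX_congr _ _ fun s hs => by rw [ext0, dif_pos (hs.trans_lt ht)]; rfl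

theorem vecX_vLimVec {τ : ℕ} (ω : LimSpace K T) {t : ℕ} (ht : t < τ) :
    vecX (vLimVec F G q ω (τ := τ)) t = vFields q (ext0 ω.1) G (side false ω.2) t := by
  rw [← effX_false _ q _ h, vecX, ext0, dif_pos ht]
  exact effX_congr _ _ fun s hs => by rw [ext0, dif_pos (hs.trans_lt ht)]; rfl

theorem dmftF_uLimVec (ω : LimSpace (K + 1) T) {k : ℕ} (hk : k < K) :
    dmftF F G (2 * k + 2) (true, side true ω.2) (vecX (uLimVec F G α m ω)) =
      effU F α m.resp (ω.1 0) (ext0 fun k : Fin K => ω.1 k.succ) (noise (side true ω.2)) k := by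
  rw [h.congr fun s hs => vecX_uLimVec h ω (by omega), dmftF_true_even,
    apply_uPoint_uFields (F := F)]

theorem dmftF_vLimVec {τ : ℕ} (ω : LimSpace K T) {k : ℕ} (hk : 2 * k + 1 ≤ τ) :
    dmftF F G (2 * k + 1) (false, side false ω.2) (vecX (vLimVec F G q ω (τ := τ))) =
      effV G q.respStar q.resp ω.2.1.1 ω.2.1.2 (ext0 ω.1) (noise (side false ω.2)) k := by
  rw [h.congr fun s hs => vecX_vLimVec h ω (by omega), dmftF_false_odd, vAct_vFields]
  rfl

theorem effResp_uLimVec (ω : LimSpace (K + 1) T) (s : ℕ) {t : ℕ} (ht : t ≤ 2 * K + 1) :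
    HorizonLimit.effResp (dmftP F G) true (uReact α m) s t (uLimVec F G α m ω) =
      effD (fun t s => dmftP F G t s (true, side true ω.2)
        (uFields α m (ω.1 0) (ext0 fun k : Fin K => ω.1 k.succ) F (side true ω.2)))
        (uReact α m) s t :=
  effD_congr _ _ fun r hr q _ => h.congr_p fun s hs => vecX_uLimVec h ω (by omega)

theorem effResp_vLimVec {τ : ℕ} (ω : LimSpace K T) (s : ℕ) {t : ℕ} (ht : t ≤ τ) :
    HorizonLimit.effResp (dmftP F G) false (vReact q) s t (vLimVec F G q ω (τ := τ)) =
      effD (fun t s => dmftP F G t s (false, side false ω.2)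
        (vFields q (ext0 ω.1) G (side false ω.2))) (vReact q) s t :=
  effD_congr _ _ fun r hr q _ => h.congr_p fun s hs => vecX_vLimVec h ω (by omega)

end Values

section Samples

variable (hK : K ≤ T)

theorem procB_toU (ω : LimSpace (K + 1) T) {t : ℕ} (ht : t < K) : procB F α m (toU hK ω) t =
    effB F α m.resp (ω.1 0) (ext0 fun k : Fin K => ω.1 k.succ) (noise (side true ω.2)) t :=
  effB_congr (fun _ hk => (noise_side_eq hK true ω.2 hk).symm) _ _ _ _ _ ht

theorem procU_toU (ω : LimSpace (K + 1) T) {t : ℕ} (ht : t < K) : procU F α m (toU hK ω) t =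
    effU F α m.resp (ω.1 0) (ext0 fun k : Fin K => ω.1 k.succ) (noise (side true ω.2)) t :=
  effU_congr (fun _ hk => (noise_side_eq hK true ω.2 hk).symm) _ _ _ _ _ ht

theorem effDU_toU (ω : LimSpace (K + 1) T) (c : ℝ) (e : ℕ → ℝ) {t : ℕ} (ht : t < K) :
    effDU F α m.resp ((toU hK ω).1 0) (USample.z (toU hK ω)) (ext0 (toU hK ω).2) c e t =
    effDU F α m.resp (ω.1 0) (ext0 fun k : Fin K => ω.1 k.succ) (noise (side true ω.2)) c e t :=
  effDU_congr (fun _ hk => (noise_side_eq hK true ω.2 hk).symm) _ _ _ _ _ _ _ ht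

theorem procV_toV (ω : LimSpace K T) {t : ℕ} (ht : t ≤ K) : procV G q (toV hK ω) t =
    effV G q.respStar q.resp ω.2.1.1 ω.2.1.2 (ext0 ω.1) (noise (side false ω.2)) t :=
  effV_congr (fun _ hk => (noise_side_eq hK false ω.2 hk).symm) _ _ _ _ _ _ ht

theorem procH_toV (ω : LimSpace K T) {t : ℕ} (ht : t ≤ K) : procH G q (toV hK ω) t =
    effH G q.respStar q.resp ω.2.1.1 ω.2.1.2 (ext0 ω.1) (noise (side false ω.2)) t :=
  effH_congr (fun _ hk => (noise_side_eq hK false ω.2 hk).symm) _ _ _ _ _ _ ht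

theorem effDV_toV (ω : LimSpace K T) (s : ℕ) {t : ℕ} (ht : t ≤ K) :
    effDV G q.respStar q.resp (toV hK ω).1.1 (toV hK ω).1.2 (ext0 (toV hK ω).2.1)
      (ext0 (toV hK ω).2.2) s t =
    effDV G q.respStar q.resp ω.2.1.1 ω.2.1.2 (ext0 ω.1) (noise (side false ω.2)) s t :=
  effDV_congr (fun _ hk => (noise_side_eq hK false ω.2 hk).symm) _ _ _ _ _ _ _ ht

end Samples

section SampleContinuity

variable (hF : ∀ s, IsC1b (F s)) (hG : ∀ s, IsC1b (G s))

theorem continuous_USample_z : Continuous (USample.z : USample K → ℕ → ℝ) :=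
  continuous_ext0.comp (by fun_prop)

theorem continuous_USample_side :
    Continuous fun x : USample K => (elim 0 x.2 : Side K → ℝ) :=
  continuous_pi fun a => by
    rcases a with a | a
    · exact continuous_const
    · simp only [elim_inr]
      fun_prop

theorem continuous_VSample_side :
    Continuous fun y : VSample K => (elim ![y.1.1, y.1.2] y.2.2 : Side K → ℝ) :=
  (continuous_side false).comp (continuous_fst.prodMk (continuous_snd.comp continuous_snd))

theorem continuous_VSample_g : Continuous fun y : VSample K => ext0 y.2.1 :=
  continuous_ext0.comp (by fun_prop)

include hF hG

theorem continuous_procU (t : ℕ) : Continuous fun x : USample K => procU F α m x t :=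
  continuous_effU hF hG continuous_USample_side α m (by fun_prop) continuous_USample_z t

theorem continuous_procB (t : ℕ) : Continuous fun x : USample K => procB F α m x t :=
  continuous_effB hF hG continuous_USample_side α m (by fun_prop) continuous_USample_z t

theorem continuous_procV (t : ℕ) : Continuous fun y : VSample K => procV G q y t :=
  continuous_effV hF hG continuous_VSample_side q continuous_VSample_g t

theorem continuous_procH (t : ℕ) : Continuous fun y : VSample K => procH G q y t :=
  continuous_effH hF hG continuous_VSample_side q continuous_VSample_g t

theorem continuous_procThetaV (i : ℕ) : Continuous fun y : VSample K => procThetaV G q y i := by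
  rcases i with _ | i
  · simp only [procThetaV]
    fun_prop
  · exact continuous_procV hF hG i

end SampleContinuity

section Steps

variable {Ω : ℕ → Type*} [∀ n, MeasurableSpace (Ω n)] {P : ∀ n, Measure (Ω n)}
  [∀ n, IsProbabilityMeasure (P n)] {ι : ℕ → Type} [∀ n, Fintype (ι n)] [∀ n, DecidableEq (ι n)]
  {N : ℕ → ℕ} {ty : ∀ n, ι n → Bool} {M : ∀ n, Ω n → Matrix (ι n) (ι n) ℝ}
  {ξ : ∀ n, Ω n → ι n → (Side T → ℝ)} {c : ℝ} {ν₀ : Measure (ℝ × ℝ)} [IsProbabilityMeasure ν₀]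

/-- The coordinates `i` converge up to time `K`. -/
abbrev ULimit (P : ∀ n, Measure (Ω n)) (N : ℕ → ℕ) (ty : ∀ n, ι n → Bool)
    (M : ∀ n, Ω n → Matrix (ι n) (ι n) ℝ) (ξ : ∀ n, Ω n → ι n → (Side T → ℝ)) (F : UFun) (G : VFun)
    (ν₀ : Measure (ℝ × ℝ)) (α : ℝ) (m : VStats) (K : ℕ) : Prop :=
  HorizonLimit P N ty M ξ (dmftF F G) (dmftP F G) true (2 * K + 1) (uCov α m) (uReact α m)
    (limLaw ν₀ (of fun i j : Fin (K + 1) => α * m.mom i j) T)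
    (fun ω t => uGauss ω.1 t) (fun ω => side true ω.2)

/-- The coordinates `j` converge up to time `K`. -/
abbrev VLimit (P : ∀ n, Measure (Ω n)) (N : ℕ → ℕ) (ty : ∀ n, ι n → Bool)
    (M : ∀ n, Ω n → Matrix (ι n) (ι n) ℝ) (ξ : ∀ n, Ω n → ι n → (Side T → ℝ)) (F : UFun) (G : VFun)
    (ν₀ : Measure (ℝ × ℝ)) (q : UStats) (K : ℕ) : Prop :=
  HorizonLimit P N ty M ξ (dmftF F G) (dmftP F G) false (2 * K + 2) (vCov q) (vReact q)
    (limLaw ν₀ (of fun i j : Fin K => q.mom i j) T)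
    (fun ω t => vGauss ω.1 t) (fun ω => side false ω.2)

namespace Ensemble

variable (h : Ensemble P N ty M ξ F G L c ν₀ α)
include h

theorem vLimit_of_uLimit (hK : K ≤ T) (H : ULimit P N ty M ξ F G ν₀ α m K) :
    VLimit P N ty M ξ F G ν₀ (uStatsOf F α K m) K := by
  have hF := h.smooth_F
  have hG := h.smooth_G
  have hreg := h.model.reg
  have hlaw := hasLaw_toU (ν₀ := ν₀) hK α m
  refine h.horizon_false _ (fun i j => by simp only [uStatsOf, mul_comm]) (by omega) le_rfl
    (fun s t hs ht => ?_) fun s t hst ht => ?_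
  · have h1 := H.moment_limit h.model (s := s) (t := t) (by omega) (by omega) h.density_true
    rw [one_mul] at h1
    suffices e : vCov (uStatsOf F α K m) s t =
        ∫ ω, dmftF F G s (true, side true ω.2) (vecX (uLimVec F G α m ω)) *
          dmftF F G t (true, side true ω.2) (vecX (uLimVec F G α m ω)) ∂
          (limLaw ν₀ (of fun i j : Fin (K + 1) => α * m.mom i j) T) by
      rw [e]
      exact h1
    rcases time_cases s with rfl | ⟨k, rfl⟩ | ⟨k, rfl⟩
    · simp [vCov]
    · simp [vCov]
    rcases time_cases t with rfl | ⟨l, rfl⟩ | ⟨l, rfl⟩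
    · simp [vCov]
    · simp [vCov]
    simp only [vCov, onTime_even, uStatsOf]
    refine integral_eq_of_hasLaw hlaw ((continuous_procU hF hG k).mul
      (continuous_procU hF hG l)).aestronglyMeasurable fun ω => ?_
    rw [dmftF_uLimVec hreg ω (by omega), dmftF_uLimVec hreg ω (by omega),
      procU_toU hK ω (by omega), procU_toU hK ω (by omega)]
  · have h1 := H.response_limit h.model (s := s) (t := t) (by omega) h.density_true
    rw [one_mul] at h1
    suffices e : vReact (uStatsOf F α K m) t s =
        ∫ ω, HorizonLimit.effResp (dmftP F G) true (uReact α m) s t (uLimVec F G α m ω) ∂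
          (limLaw ν₀ (of fun i j : Fin (K + 1) => α * m.mom i j) T) by
      rw [e]
      exact h1
    simp only [effResp_uLimVec hreg _ s (show t ≤ 2 * K + 1 by omega)]
    rcases time_cases t with rfl | ⟨k, rfl⟩ | ⟨k, rfl⟩
    · omega
    · simp only [effD_true_of_odd]
      simp [vReact]
    rcases time_cases s with rfl | ⟨l, rfl⟩ | ⟨l, rfl⟩
    · simp only [effD_true_star, vReact, onTime_even, onTime_zero, uStatsOf]
      exact integral_eq_of_hasLaw hlaw (continuous_effDUStar hF hG continuous_USample_side α m
        (bs := fun x => x.1 0) (by fun_prop) continuous_USample_z k).aestronglyMeasurable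
        fun ω => effDU_toU hK ω _ _ (by omega)
    · simp only [effD_true_field, vReact, onTime_even, onTime_odd, uStatsOf]
      exact integral_eq_of_hasLaw hlaw (continuous_effDUField hF hG continuous_USample_side α m
        (bs := fun x => x.1 0) (by fun_prop) continuous_USample_z l k).aestronglyMeasurable
        fun ω => effDU_toU hK ω _ _ (by omega)
    · simp only [effD_true_of_even]
      simp [vReact]

theorem uLimit_of_vLimit (hK : K ≤ T) (H : VLimit P N ty M ξ F G ν₀ q K) :
    ULimit P N ty M ξ F G ν₀ α (vStatsOf G ν₀ K q) (K + 1) := by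
  have hF := h.smooth_F
  have hG := h.smooth_G
  have hreg := h.model.reg
  have hlaw := hasLaw_toV (ν₀ := ν₀) hK q
  refine h.horizon_true _ (fun i j => by simp only [vStatsOf, mul_comm])
    (fun s t hs ht => ?_) fun s t hst ht => ?_
  · have h1 := H.moment_limit h.model (s := s) (t := t) (by omega) (by omega) h.density_false
    suffices e : uCov α (vStatsOf G ν₀ K q) s t = α * ∫ ω : LimSpace K T,
        dmftF F G s (false, side false ω.2) (vecX (vLimVec F G q ω (τ := 2 * K + 2))) *
          dmftF F G t (false, side false ω.2) (vecX (vLimVec F G q ω (τ := 2 * K + 2)))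
          ∂(limLaw ν₀ (of fun i j : Fin K => q.mom i j) T) by
      rw [e]
      exact h1
    have key : ∀ i j, 2 * i - 1 ≤ 2 * K + 2 → 2 * j - 1 ≤ 2 * K + 2 →
        α * (vStatsOf G ν₀ K q).mom i j = α * ∫ ω : LimSpace K T,
          dmftF F G (2 * i - 1) (false, side false ω.2)
            (vecX (vLimVec F G q ω (τ := 2 * K + 2))) *
          dmftF F G (2 * j - 1) (false, side false ω.2) (vecX (vLimVec F G q ω (τ := 2 * K + 2)))
          ∂(limLaw ν₀ (of fun i j : Fin K => q.mom i j) T) := by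
      intro i j hi hj
      congr 1
      have hv : ∀ i, 2 * i - 1 ≤ 2 * K + 2 → ∀ ω : LimSpace K T, procThetaV G q (toV hK ω) i =
          dmftF F G (2 * i - 1) (false, side false ω.2)
            (vecX (vLimVec F G q ω (τ := 2 * K + 2))) := by
        intro i hi ω
        rcases i with _ | i
        · rw [dmftF_false_zero]
          rfl
        · have e : 2 * (i + 1) - 1 = 2 * i + 1 := by omega
          rw [e] at hi ⊢
          rw [dmftF_vLimVec hreg ω hi]
          exact procV_toV hK ω (by omega)
      simp only [vStatsOf]
      refine integral_eq_of_hasLaw hlaw ((continuous_procThetaV hF hG i).mul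
        (continuous_procThetaV hF hG j)).aestronglyMeasurable fun ω => ?_
      rw [hv i hi, hv j hj]
    have e1 : ∀ k, 2 * (k + 1) - 1 = 2 * k + 1 := fun k => by omega
    rcases time_cases s with rfl | ⟨k, rfl⟩ | ⟨k, rfl⟩ <;>
      rcases time_cases t with rfl | ⟨l, rfl⟩ | ⟨l, rfl⟩
    · exact key 0 0 (by omega) (by omega)
    · have := key 0 (l + 1) (by omega) (by omega)
      simpa only [uCov, onTime_zero, onTime_odd, e1] using this
    · simp [uCov]
    · have := key (k + 1) 0 (by omega) (by omega)
      simpa only [uCov, onTime_zero, onTime_odd, e1] using this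
    · have := key (k + 1) (l + 1) (by omega) (by omega)
      simpa only [uCov, onTime_zero, onTime_odd, e1] using this
    · simp [uCov]
    · simp [uCov]
    · simp [uCov]
    · simp [uCov]
  · have h1 := H.response_limit h.model (s := s) (t := t) (by omega) h.density_false
    suffices e : uReact α (vStatsOf G ν₀ K q) t s = α * ∫ ω : LimSpace K T,
        HorizonLimit.effResp (dmftP F G) false (vReact q) s t (vLimVec F G q ω (τ := 2 * K + 2))
          ∂(limLaw ν₀ (of fun i j : Fin K => q.mom i j) T) by
      rw [e]
      exact h1
    simp only [effResp_vLimVec hreg _ s (show t ≤ 2 * K + 2 by omega)]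
    rcases time_cases t with rfl | ⟨k, rfl⟩ | ⟨k, rfl⟩
    · omega
    · rcases time_cases s with rfl | ⟨l, rfl⟩ | ⟨l, rfl⟩
      · simp only [effD_false_of_ne _ _ _ (show ∀ r, 0 ≠ 2 * r + 2 by omega)]
        simp [uReact]
      · simp only [effD_false_of_ne _ _ _ (show ∀ r, 2 * l + 1 ≠ 2 * r + 2 by omega)]
        simp [uReact]
      · simp only [effD_false, uReact, onTime_odd, onTime_even, vStatsOf]
        congr 1
        exact integral_eq_of_hasLaw hlaw (continuous_effDV hF hG continuous_VSample_side q
          continuous_VSample_g l k).aestronglyMeasurable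
          fun ω => effDV_toV hK ω _ (by omega)
    · simp only [effD_false_of_even]
      simp [uReact]

theorem uLimit_zero : ULimit P N ty M ξ F G ν₀ α (vStats F G α ν₀ 0) 0 := by
  have H := h.horizon_false ⟨0, 0, 0⟩ (fun _ _ => rfl) (K := 0) (τ := 0) (by simp) (by simp)
    (by simp) (by simp)
  refine h.horizon_true _ (fun _ _ => rfl) (fun s t hs ht => ?_) fun s t hst ht => by omega
  obtain rfl : s = 0 := by omega
  obtain rfl : t = 0 := by omega
  have h1 := H.moment_limit h.model le_rfl le_rfl h.density_false
  simp only [dmftF_false_zero] at h1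
  suffices e : uCov α (vStats F G α ν₀ 0) 0 0 = α * ∫ ω : LimSpace 0 T,
      side false ω.2 (inl 0) * side false ω.2 (inl 0)
        ∂(limLaw ν₀ (of fun i j : Fin 0 => (0 : ℕ → ℕ → ℝ) i j) T) by
    rw [e]
    exact h1
  simp only [uCov, onTime_zero, vStats]
  congr 1
  have hl : HasLaw (fun ω : LimSpace 0 T => ω.2.1) ν₀
      (limLaw ν₀ (of fun i j : Fin 0 => (0 : ℕ → ℕ → ℝ) i j) T) :=
    (measurePreserving_fst.comp measurePreserving_snd).hasLaw
  rw [← hl.integral_comp (f := fun x => x.1 ^ 2) (by fun_prop)]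
  refine integral_congr_ae (.of_forall fun ω => ?_)
  simp [side, sq]

theorem uLimit : ∀ K ≤ T, ULimit P N ty M ξ F G ν₀ α (vStats F G α ν₀ K) K
  | 0, _ => h.uLimit_zero
  | K + 1, hK => h.uLimit_of_vLimit (K := K) (by omega)
      (h.vLimit_of_uLimit (by omega) (uLimit K (by omega)))

theorem vLimit (hK : K ≤ T) : VLimit P N ty M ξ F G ν₀ (uStats F G α ν₀ K) K :=
  h.vLimit_of_uLimit hK (h.uLimit K hK)

end Ensemble

end Steps

end Induction

/-! ### Observables -/

section Observables

variable {Ω : ℕ → Type*} [∀ n, MeasurableSpace (Ω n)] {P : ∀ n, Measure (Ω n)}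
  [∀ n, IsProbabilityMeasure (P n)]

theorem IsC1b.lpBdd {J : ℕ → Type*} {a b : ℕ} {ψ : ℝ × (Fin a → ℝ) × (Fin b → ℝ) → ℝ}
    (hψ : IsC1b ψ) {A : ∀ n, J n → Ω n → ℝ} {B C : ℕ → ∀ n, J n → Ω n → ℝ} (hA : LpBdd P A)
    (hB : ∀ t, LpBdd P (B t)) (hC : ∀ t, LpBdd P (C t)) :
    LpBdd P fun n j ω => ψ (A n j ω, fun t => B t n j ω, fun t => C t n j ω) := by
  obtain ⟨D, hD0, hD⟩ := hψ.exists_lipschitz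
  have hS : LpBdd P fun n j ω => |A n j ω| + ∑ t : Fin a, |B t n j ω| + ∑ t : Fin b, |C t n j ω| :=
    (hA.abs.add (LpBdd.sum univ fun (t : Fin a) _ => (hB t).abs)).add
      (LpBdd.sum univ fun (t : Fin b) _ => (hC t).abs)
  refine ((LpBdd.const |ψ 0|).add (hS.const_mul D)).of_le (fun n j => ?_) fun n j ω => ?_
  · exact hψ.1.continuous.measurable.comp ((hA.meas n j).prodMk
      ((measurable_pi_lambda _ fun t : Fin a => (hB t).meas n j).prodMk
        (measurable_pi_lambda _ fun t : Fin b => (hC t).meas n j)))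
  · have h1 := hD 0 (A n j ω, fun t => B t n j ω, fun t => C t n j ω)
    rw [sub_zero] at h1
    have hb : 0 ≤ ∑ t : Fin a, |B t n j ω| := sum_nonneg fun _ _ => abs_nonneg _
    have hc : 0 ≤ ∑ t : Fin b, |C t n j ω| := sum_nonneg fun _ _ => abs_nonneg _
    have hpi : ∀ {k : ℕ} (x : Fin k → ℝ), ‖x‖ ≤ ∑ t, |x t| := fun x =>
      (pi_norm_le_iff_of_nonneg (sum_nonneg fun _ _ => abs_nonneg _)).2 fun t =>
        single_le_sum (f := fun t => |x t|) (fun _ _ => abs_nonneg _) (mem_univ t)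
    have h2 : ‖(A n j ω, (fun t : Fin a => B t n j ω, fun t : Fin b => C t n j ω))‖ ≤
        |A n j ω| + ∑ t : Fin a, |B t n j ω| + ∑ t : Fin b, |C t n j ω| := by
      refine max_le ?_ (max_le ((hpi _).trans ?_) ((hpi _).trans ?_))
      · rw [norm_eq_abs]; linarith
      · linarith [abs_nonneg (A n j ω)]
      · linarith [abs_nonneg (A n j ω)]
    have h3 := abs_sub_abs_le_abs_sub (ψ (A n j ω, fun t => B t n j ω, fun t => C t n j ω)) (ψ 0)
    have h4 := mul_le_mul_of_nonneg_left h2 hD0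
    linarith

theorem integrable_of_hasLaw {Ω 𝓧 : Type*} [MeasurableSpace Ω] [MeasurableSpace 𝓧]
    {P : Measure Ω} {μ : Measure 𝓧} {X : Ω → 𝓧} (hX : HasLaw X μ P) {f : 𝓧 → ℝ} {g : Ω → ℝ}
    (hf : AEStronglyMeasurable f μ) (hfg : ∀ ω, f (X ω) = g ω) (hg : Integrable g P) :
    Integrable f μ := by
  rw [← hX.map_eq] at hf ⊢
  rw [integrable_map_measure hf hX.aemeasurable]
  exact hg.congr (.of_forall fun ω => (hfg ω).symm)

variable {ι : ℕ → Type} [∀ n, Fintype (ι n)] [∀ n, DecidableEq (ι n)]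
  {N : ℕ → ℕ} {ty : ∀ n, ι n → Bool} {M : ∀ n, Ω n → Matrix (ι n) (ι n) ℝ} {T : ℕ} {F : UFun}
  {G : VFun} {L : ℕ → ℝ} {α : ℝ} {ξ : ∀ n, Ω n → ι n → (Side T → ℝ)} {c : ℝ}
  {ν₀ : Measure (ℝ × ℝ)} [IsProbabilityMeasure ν₀]

/-- Convergence of expectations and decorrelation, uniformly over the coordinates of type `b`. -/
def Decouples (P : ∀ n, Measure (Ω n)) (ty : ∀ n, ι n → Bool) (b : Bool)
    (Ψ : ∀ n, ι n → Ω n → ℝ) (e : ℝ) : Prop :=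
  (∀ n (k : Sites ty b n), MemLp (Ψ n k.1) 2 (P n)) ∧
  (∀ ε > 0, ∀ᶠ n in atTop, ∀ k : Sites ty b n, |∫ ω, Ψ n k.1 ω ∂P n - e| < ε) ∧
  ∀ ε > 0, ∀ᶠ n in atTop, ∀ q : Pairs ty b n, |cov[Ψ n q.1.1, Ψ n q.1.2; P n]| < ε

theorem HorizonLimit.decouples {κ : Type} [Fintype κ] {ξ : ∀ n, Ω n → ι n → (κ → ℝ)}
    {f : Act(Bool × (κ → ℝ))} {p : Grad(Bool × (κ → ℝ))}
    {b : Bool} {τ : ℕ} {C Γ : ℕ → ℕ → ℝ} {Ω' : Type*} [MeasurableSpace Ω'] {γ : Measure Ω'}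
    [IsProbabilityMeasure γ] {Z : Ω' → Fin τ → ℝ} {ζ : Ω' → κ → ℝ}
    (H : HorizonLimit P N ty M ξ f p b τ C Γ γ Z ζ) (h : CavityModel P N ty M ξ f p L c)
    {ψ : (Fin τ ⊕ κ → ℝ) → ℝ} (hψ : Continuous ψ) {Ψ : ∀ n, ι n → Ω n → ℝ}
    (hΨ : ∀ n (k : Sites ty b n) ω, ψ (siteV ty M ξ f τ n k.1 ω) = Ψ n k.1 ω)
    (bΨ : LpBdd P fun n (k : Sites ty b n) => Ψ n k.1) :
    Integrable (fun ω => ψ (effVec f b Γ (elim (Z ω) (ζ ω)))) γ ∧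
      Decouples P ty b Ψ (∫ ω, ψ (effVec f b Γ (elim (Z ω) (ζ ω))) ∂γ) := by
  have bψ : LpBdd P fun n (k : Sites ty b n) ω => ψ (siteV ty M ξ f τ n k.1 ω) := by
    simpa only [hΨ] using bΨ
  refine ⟨H.integrable_test h hψ bψ, fun n k => bΨ.memLp_two n k, fun ε hε => ?_, fun ε hε => ?_⟩
  · simpa only [hΨ] using H.expectation_site h hψ bψ hε
  · filter_upwards [H.covariance_pair h hψ bψ hε] with n hn q
    have h1 : (fun ω => ψ (siteV ty M ξ f τ n q.1.1 ω)) = Ψ n q.1.1 :=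
      funext fun ω => hΨ n ⟨_, q.2.2.1⟩ ω
    have h2 : (fun ω => ψ (siteV ty M ξ f τ n q.1.2 ω)) = Ψ n q.1.2 :=
      funext fun ω => hΨ n ⟨_, q.2.2.2⟩ ω
    rw [← h1, ← h2]
    exact hn q

/-- An observable of a coordinate `i` of the system. -/
def uObs {ι : Type*} [Fintype ι] (ψ : ℝ × (Fin T → ℝ) × (Fin T → ℝ) → ℝ)
    (f : Act(ι)) (A : Matrix ι ι ℝ) (k : ι) : ℝ :=
  ψ (sysX f A 0 k, fun t => sysX f A (2 * t + 1) k, fun t => siteY f A k (2 * t + 2))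

/-- An observable of a coordinate `j` of the system. -/
def vObs {ι : Type*} [Fintype ι] (φ : ℝ × (Fin T → ℝ) × (Fin (T + 1) → ℝ) → ℝ)
    (f : Act(ι)) (A : Matrix ι ι ℝ) (k : ι) : ℝ :=
  φ (siteY f A k 0, fun t => sysX f A (2 * t + 2) k, fun t => siteY f A k (2 * t + 1))

namespace Ensemble

variable (h : Ensemble P N ty M ξ F G L c ν₀ α)
include h

theorem decouples_true {ψ : ℝ × (Fin T → ℝ) × (Fin T → ℝ) → ℝ} (hψ : IsC1b ψ) :
    Integrable ψ (muLaw F G α ν₀ T) ∧ Decouples P ty true (fun n k ω =>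
      uObs ψ (siteF (ty n) (dmftF F G) (ξ n ω)) (M n ω) k)
      (∫ x, ψ x ∂muLaw F G α ν₀ T) := by
  have H := h.uLimit T le_rfl
  set m := vStats F G α ν₀ T
  set ψ' : (Fin (2 * T + 1) ⊕ Side T → ℝ) → ℝ := fun v =>
    ψ (vecX v 0, fun t => vecX v (2 * t + 1),
      fun t => dmftF F G (2 * t + 2) (true, vecΞ v) (vecX v)) with hψ'
  have hX : ∀ t, Continuous fun v : Fin (2 * T + 1) ⊕ Side T → ℝ => vecX v t := fun t =>
    (continuous_apply t).comp continuous_vecX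
  have hc : Continuous ψ' := hψ.1.continuous.comp ((hX 0).prodMk
    ((continuous_pi fun t => hX _).prodMk (continuous_pi fun t =>
      continuous_dmftF_comp h.smooth_F h.smooth_G continuous_vecΞ true _ continuous_vecX)))
  have hb := hψ.lpBdd ((h.model.siteX_bdd 0).reindex (K := Sites ty true) fun n k => k.1)
    (fun t => (h.model.siteX_bdd (2 * t + 1)).reindex (K := Sites ty true) fun n k => k.1)
    fun t => (h.model.siteY_bdd (2 * t + 2)).reindex (K := Sites ty true) fun n k => k.1
  have h1 := H.decouples h.model hc (Ψ := fun n k ω =>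
    uObs ψ (siteF (ty n) (dmftF F G) (ξ n ω)) (M n ω) k) (fun n k ω => ?_) hb
  · have hg : Continuous fun x : USample T => (x.1 0, fun t : Fin T => procB F α m x t,
        fun t : Fin T => procU F α m x t) := Continuous.prodMk (by fun_prop)
      ((continuous_pi fun t : Fin T => continuous_procB h.smooth_F h.smooth_G t).prodMk
        (continuous_pi fun t : Fin T => continuous_procU h.smooth_F h.smooth_G t))
    have hlaw : HasLaw _ (muLaw F G α ν₀ T) _ :=
      HasLaw.comp ⟨hg.aemeasurable, rfl⟩ (hasLaw_toU (ν₀ := ν₀) le_rfl α m)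
    have hval : ∀ ω, ψ (((fun x : USample T => (x.1 0, fun t : Fin T => procB F α m x t,
        fun t : Fin T => procU F α m x t)) ∘ toU le_rfl) ω) = ψ' (uLimVec F G α m ω) := fun ω => by
      simp only [hψ', Function.comp_apply]
      refine congrArg ψ (Prod.ext ?_ (Prod.ext (funext fun t => ?_) (funext fun t => ?_)))
      · exact (vecX_uLimVec (K := T) (t := 0) h.model.reg ω (by omega)).symm
      · refine (procB_toU le_rfl ω t.2).trans (Eq.trans ?_
          (vecX_uLimVec h.model.reg ω (t := 2 * t + 1) (by omega)).symm)
        rw [uFields, onTime_odd]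
      · exact (procU_toU le_rfl ω t.2).trans (dmftF_uLimVec h.model.reg ω t.2).symm
    rw [integral_eq_of_hasLaw hlaw hψ.1.continuous.aestronglyMeasurable hval]
    exact ⟨integrable_of_hasLaw hlaw hψ.1.continuous.aestronglyMeasurable hval h1.1, h1.2⟩
  · refine congrArg ψ (Prod.ext ?_ (Prod.ext (funext fun t => ?_) (funext fun t => ?_)))
    · exact vecX_siteV (τ := 2 * T + 1) (t := 0) k.1 ω (by omega)
    · exact vecX_siteV (τ := 2 * T + 1) (t := 2 * t + 1) k.1 ω (by omega)
    · exact (h.model.siteY_eq (τ := 2 * T + 1) (t := 2 * t + 2) k ω (by omega)).symm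

theorem decouples_false {φ : ℝ × (Fin T → ℝ) × (Fin (T + 1) → ℝ) → ℝ} (hφ : IsC1b φ) :
    Integrable φ (nuLaw F G α ν₀ T) ∧ Decouples P ty false (fun n k ω =>
      vObs φ (siteF (ty n) (dmftF F G) (ξ n ω)) (M n ω) k)
      (∫ x, φ x ∂nuLaw F G α ν₀ T) := by
  have H := h.vLimit (K := T) le_rfl
  set q := uStats F G α ν₀ T
  set φ' : (Fin (2 * T + 2) ⊕ Side T → ℝ) → ℝ := fun v =>
    φ (dmftF F G 0 (false, vecΞ v) (vecX v), fun t => vecX v (2 * t + 2),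
      fun t => dmftF F G (2 * t + 1) (false, vecΞ v) (vecX v)) with hφ'
  have hX : ∀ t, Continuous fun v : Fin (2 * T + 2) ⊕ Side T → ℝ => vecX v t := fun t =>
    (continuous_apply t).comp continuous_vecX
  have hY : ∀ t, Continuous fun v : Fin (2 * T + 2) ⊕ Side T → ℝ =>
      dmftF F G t (false, vecΞ v) (vecX v) := fun t =>
    continuous_dmftF_comp h.smooth_F h.smooth_G continuous_vecΞ false t continuous_vecX
  have hc : Continuous φ' := hφ.1.continuous.comp ((hY 0).prodMk
    ((continuous_pi fun t => hX _).prodMk (continuous_pi fun t => hY _)))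
  have hb := hφ.lpBdd ((h.model.siteY_bdd 0).reindex (K := Sites ty false) fun n k => k.1)
    (fun t => (h.model.siteX_bdd (2 * t + 2)).reindex (K := Sites ty false) fun n k => k.1)
    fun t => (h.model.siteY_bdd (2 * t + 1)).reindex (K := Sites ty false) fun n k => k.1
  have h1 := H.decouples h.model hc (Ψ := fun n k ω =>
    vObs φ (siteF (ty n) (dmftF F G) (ξ n ω)) (M n ω) k) (fun n k ω => ?_) hb
  · have hg : Continuous fun y : VSample T => (y.1.1, fun t : Fin T => procH G q y t,
        fun t : Fin (T + 1) => procV G q y t) := Continuous.prodMk (by fun_prop)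
      ((continuous_pi fun t : Fin T => continuous_procH h.smooth_F h.smooth_G t).prodMk
        (continuous_pi fun t : Fin (T + 1) => continuous_procV h.smooth_F h.smooth_G t))
    have hlaw : HasLaw _ (nuLaw F G α ν₀ T) _ :=
      HasLaw.comp ⟨hg.aemeasurable, rfl⟩ (hasLaw_toV (ν₀ := ν₀) le_rfl q)
    have hval : ∀ ω, φ (((fun y : VSample T => (y.1.1, fun t : Fin T => procH G q y t,
        fun t : Fin (T + 1) => procV G q y t)) ∘ toV le_rfl) ω) = φ' (vLimVec F G q ω) := fun ω => by
      simp only [hφ', Function.comp_apply]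
      refine congrArg φ (Prod.ext ?_ (Prod.ext (funext fun t => ?_) (funext fun t => ?_)))
      · refine Eq.trans ?_ (dmftF_false_zero F G (side false ω.2)
          (vecX (vLimVec F G q ω (τ := 2 * T + 2)))).symm
        rfl
      · refine (procH_toV le_rfl ω t.2.le).trans (Eq.trans ?_
          (vecX_vLimVec h.model.reg ω (t := 2 * t + 2) (by omega)).symm)
        rw [vFields, onTime_even]
        rfl
      · exact (procV_toV le_rfl ω (by omega)).trans
          (dmftF_vLimVec h.model.reg ω (by omega)).symm
    rw [integral_eq_of_hasLaw hlaw hφ.1.continuous.aestronglyMeasurable hval]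
    exact ⟨integrable_of_hasLaw hlaw hφ.1.continuous.aestronglyMeasurable hval h1.1, h1.2⟩
  · refine congrArg φ (Prod.ext ?_ (Prod.ext (funext fun t => ?_) (funext fun t => ?_)))
    · exact (h.model.siteY_eq (τ := 2 * T + 2) (t := 0) k ω (by omega)).symm
    · exact vecX_siteV (τ := 2 * T + 2) (t := 2 * t + 2) k.1 ω (by omega)
    · exact (h.model.siteY_eq (τ := 2 * T + 2) (t := 2 * t + 1) k ω (by omega)).symm

end Ensemble

end Observables

/-! ### Independent families -/

section IndepFamilies

variable {Ω E : Type*} [MeasurableSpace Ω] [MeasurableSpace E] {P : Measure Ω} {J K : Type*}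

theorem iIndepFun_sumElim {f : J → Ω → E} {g : K → Ω → E} (hf : iIndepFun f P) (hg : iIndepFun g P)
    (h : IndepFun (fun ω a => f a ω) (fun ω a => g a ω) P) : iIndepFun (elim f g) P := by
  classical
  rw [iIndepFun_iff_measure_inter_preimage_eq_mul] at hf hg ⊢
  intro S s hs
  have hl : ∀ a ∈ S.toLeft, MeasurableSet (s (inl a)) := fun a ha => hs _ (by simpa using ha)
  have hr : ∀ a ∈ S.toRight, MeasurableSet (s (inr a)) := fun a ha => hs _ (by simpa using ha)
  have e : ⋂ a ∈ S, elim f g a ⁻¹' s a =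
      (fun ω a => f a ω) ⁻¹' (⋂ a ∈ S.toLeft, (fun x => x a) ⁻¹' s (inl a)) ∩
        (fun ω a => g a ω) ⁻¹' (⋂ a ∈ S.toRight, (fun x => x a) ⁻¹' s (inr a)) := by
    ext ω
    simp
  rw [e, h.measure_inter_preimage_eq_mul _ _
    (Finset.measurableSet_biInter _ fun a ha => measurable_pi_apply a (hl a ha))
    (Finset.measurableSet_biInter _ fun a ha => measurable_pi_apply a (hr a ha))]
  simp only [Set.preimage_iInter, ← Set.preimage_comp]
  rw [← Finset.toLeft_disjSum_toRight (u := S), Finset.prod_disjSum, Finset.toLeft_disjSum,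
    Finset.toRight_disjSum]
  exact congrArg₂ _ (hf _ hl) (hg _ hr)

theorem iIndepFun_const [IsProbabilityMeasure P] (x : J → E) : iIndepFun (fun a (_ : Ω) => x a) P := by
  classical
  rw [iIndepFun_iff_measure_inter_preimage_eq_mul]
  intro S s _
  by_cases h : ∀ a ∈ S, x a ∈ s a
  · rw [Finset.prod_eq_one fun a ha => by simp [h a ha]]
    have : ⋂ a ∈ S, (fun _ : Ω => x a) ⁻¹' s a = Set.univ := by
      ext ω
      simpa using h
    rw [this, measure_univ]
  · push Not at h
    obtain ⟨a, ha, hx⟩ := h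
    rw [Finset.prod_eq_zero ha (by simp [hx])]
    have : ⋂ a ∈ S, (fun _ : Ω => x a) ⁻¹' s a = ∅ :=
      Set.eq_empty_of_forall_notMem fun ω hω => hx (by simpa using Set.mem_iInter₂.1 hω a ha)
    rw [this, measure_empty]

/-- The `σ`-algebra generated by a part of a family. -/
abbrev partialFamily (Z : Ω → J → E) (S : Set J) : MeasurableSpace Ω :=
  ⨆ a ∈ S, MeasurableSpace.comap (fun ω => Z ω a) inferInstance

theorem measurable_partial {Z : Ω → J → E} {S : Set J} {a : J} (ha : a ∈ S) :
    Measurable[partialFamily Z S] fun ω => Z ω a :=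
  (comap_measurable _).mono (le_iSup₂_of_le a ha le_rfl) le_rfl

theorem indepFun_of_disjoint {Z : Ω → J → E} (hm : ∀ a, Measurable fun ω => Z ω a)
    (hZ : iIndepFun (fun a ω => Z ω a) P) {S S' : Set J} (hS : Disjoint S S') {A B : Type*}
    [MeasurableSpace A] [MeasurableSpace B] {f : Ω → A} {g : Ω → B}
    (hf : Measurable[partialFamily Z S] f) (hg : Measurable[partialFamily Z S'] g) :
    IndepFun f g P := by
  have h := indep_iSup_of_disjoint (fun a => (hm a).comap_le) hZ.iIndep hS
  exact (IndepFun_iff_Indep f g P).2 (indep_of_indep_of_le_right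
    (indep_of_indep_of_le_left h (measurable_iff_comap_le.1 hf)) (measurable_iff_comap_le.1 hg))

/-- Independent variables may be rearranged and completed by zeros. -/
theorem RowLaw.extend {κ ι : Type*} [Fintype κ] [DecidableEq κ] [Fintype ι] [DecidableEq ι]
    [IsProbabilityMeasure P] {a : Ω → κ → ℝ} {v : κ → ℝ} {c : ℝ} {N : ℕ} (h : RowLaw P a v c N)
    {g : ι → Option κ} (hg : ∀ l l' p, g l = some p → g l' = some p → l = l') :
    RowLaw P (fun ω l => (g l).elim 0 (a ω)) (fun l => (g l).elim 0 v) c N where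
  N_pos := h.N_pos
  c_nonneg := h.c_nonneg
  meas := measurable_pi_lambda _ fun l => by
    rcases g l with _ | p
    · exact measurable_const
    · exact h.meas_apply p
  indep := by
    have h1 := iIndepFun_sumElim h.indep (iIndepFun_const (J := ι) fun _ => (0 : ℝ))
      (indepFun_const_right _ _)
    have h2 := h1.precomp (g := fun l => (g l).elim (inr l) inl) fun l l' hl => by
      rcases e : g l with _ | p <;> rcases e' : g l' with _ | p' <;>
        simp only [e, e', Option.elim_none, Option.elim_some, reduceCtorEq, inl.injEq,
          inr.injEq] at hl
      · exact hl
      · exact hg l l' p e (hl ▸ e')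
    convert h2 using 2 with l
    funext ω
    rcases g l with _ | p <;> simp
  mean l := by
    rcases g l with _ | p
    · simp
    · exact h.mean p
  var l := by
    rcases g l with _ | p
    · simp
    · exact h.var p
  mgf l s := by
    rcases g l with _ | p
    · simp only [Option.elim_none, mul_zero, Real.exp_zero, ofReal_one, lintegral_const,
        measure_univ, mul_one]
      rw [ENNReal.one_le_ofReal, Real.one_le_exp_iff]
      have := h.c_nonneg
      positivity
    · exact h.mgf p s

end IndepFamilies

/-! ### The algorithm as a first-order system -/

section Algorithm

variable {T N d : ℕ}

/-- The labels of the random inputs: the entries of `X`, the initialization, `w` and `w̃`. -/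
abbrev Label (T N d : ℕ) : Type :=
  (Fin N × Fin d) ⊕ (Fin d ⊕ ((Fin T × Fin N) ⊕ (Fin T × Fin d)))

/-- The inputs as one family of pairs. -/
def dataOf (X : Matrix (Fin N) (Fin d) ℝ) (θ v₀ : Fin d → ℝ) (w : ℕ → Fin N → ℝ)
    (w' : ℕ → Fin d → ℝ) : Label T N d → ℝ × ℝ :=
  elim (fun p => (X p.1 p.2, 0)) (elim (fun j => (θ j, v₀ j))
    (elim (fun p => (w p.1 p.2, 0)) fun p => (w' p.1 p.2, 0)))

/-- The symmetric matrix with off-diagonal blocks `X` and `Xᵀ`. -/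
def matOf (z : Label T N d → ℝ × ℝ) : Matrix (Fin N ⊕ Fin d) (Fin N ⊕ Fin d) ℝ :=
  Matrix.fromBlocks 0 (of fun i j => (z (inl (i, j))).1)
    (of fun i j => (z (inl (i, j))).1)ᵀ 0

/-- The side information of the coordinates. -/
def sideOf (z : Label T N d → ℝ × ℝ) : Fin N ⊕ Fin d → Side T → ℝ
  | inl i => elim 0 fun t => (z (inr (inr (inl (t, i))))).1
  | inr j => elim ![(z (inr (inl j))).1, (z (inr (inl j))).2]
      fun t => (z (inr (inr (inr (t, j))))).1

variable {F : UFun} {G : VFun} {L : ℕ → ℝ} (h : Reg (dmftF (T := T) F G) (dmftP F G) L)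
  (X : Matrix (Fin N) (Fin d) ℝ) (θ v₀ : Fin d → ℝ) (w : ℕ → Fin N → ℝ) (w' : ℕ → Fin d → ℝ)

/-- The nonlinearities of the system. -/
abbrev algF (T : ℕ) (F : UFun) (G : VFun) (z : Label T N d → ℝ × ℝ) :
    ℕ → Fin N ⊕ Fin d → (ℕ → ℝ) → ℝ :=
  siteF isLeft (dmftF F G) (sideOf z)

theorem sysX_inl (f : ℕ → Fin N ⊕ Fin d → (ℕ → ℝ) → ℝ) (t : ℕ) (i : Fin N) :
    sysX f (matOf (dataOf (T := T) X θ v₀ w w')) t (inl i) =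
      (X *ᵥ fun j => sysY f (matOf (dataOf (T := T) X θ v₀ w w')) t (inr j)) i := by
  rw [sysX, matOf, Matrix.fromBlocks_mulVec, elim_inl, zero_mulVec, zero_add]
  rfl

theorem sysX_inr (f : ℕ → Fin N ⊕ Fin d → (ℕ → ℝ) → ℝ) (t : ℕ) (j : Fin d) :
    sysX f (matOf (dataOf (T := T) X θ v₀ w w')) t (inr j) =
      (Xᵀ *ᵥ fun i => sysY f (matOf (dataOf (T := T) X θ v₀ w w')) t (inl i)) j := by
  rw [sysX, matOf, Matrix.fromBlocks_mulVec, elim_inr, zero_mulVec, add_zero]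
  rfl

include h

theorem sysY_alg (z : Label T N d → ℝ × ℝ) (A : Matrix (Fin N ⊕ Fin d) (Fin N ⊕ Fin d) ℝ) (t : ℕ)
    (l : Fin N ⊕ Fin d) : sysY (algF T F G z) A t l =
      dmftF F G t (l.isLeft, sideOf z l) fun s => sysX (algF T F G z) A s l :=
  sysY_eq (h.comap fun l => (isLeft l, sideOf z l)) A t l

theorem sysX_zero_eq_orbitBStar (i : Fin N) :
    sysX (algF T F G (dataOf X θ v₀ w w')) (matOf (dataOf (T := T) X θ v₀ w w')) 0 (inl i) =
      orbitBStar X θ i := by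
  rw [sysX_inl]
  simp only [sysY_alg h, Sum.isLeft_inr, dmftF_false_zero]
  rfl

theorem sysY_even_eq_orbitU {t : ℕ} (ht : t < T)
    (hV : ∀ r ≤ t, ∀ j, sysY (algF T F G (dataOf X θ v₀ w w'))
      (matOf (dataOf (T := T) X θ v₀ w w')) (2 * r + 1) (inr j) =
        orbitV F G X θ v₀ w w' r j) (i : Fin N) :
    sysY (algF T F G (dataOf X θ v₀ w w')) (matOf (dataOf (T := T) X θ v₀ w w')) (2 * t + 2)
      (inl i) = orbitU F G X θ v₀ w w' t i := by
  rw [sysY_alg h, Sum.isLeft_inl, dmftF_true_even, orbitU, uPoint]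
  refine congrArg (F t) (Prod.ext (sysX_zero_eq_orbitBStar h X θ v₀ w w' i)
    (Prod.ext (funext fun r => ?_) (funext fun r => ?_)))
  · refine (sysX_inl X θ v₀ w w' _ _ i).trans ?_
    simp only [hV r (Nat.lt_succ_iff.1 r.2)]
    rfl
  · exact dif_pos (show (r : ℕ) < T by omega)

theorem sysY_odd_eq_orbitV (t : ℕ) (ht : t ≤ T) (j : Fin d) :
    sysY (algF T F G (dataOf X θ v₀ w w')) (matOf (dataOf (T := T) X θ v₀ w w')) (2 * t + 1)
      (inr j) = orbitV F G X θ v₀ w w' t j := by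
  induction t using strongRecOn generalizing j with
  | _ t ih =>
    rw [sysY_alg h, Sum.isLeft_inr, dmftF_false_odd]
    rcases t with _ | t
    · rw [orbitV]
      rfl
    · rw [orbitV_succ, vAct, vPoint]
      refine congrArg (G t) (Prod.ext (funext fun r => ?_) (Prod.ext rfl (funext fun r => ?_)))
      · refine (sysX_inr X θ v₀ w w' _ _ j).trans ?_
        simp only [sysY_even_eq_orbitU h X θ v₀ w w' (t := r) (by omega)
          fun q hq j => ih q (by omega) (by omega) j]
        rfl
      · exact dif_pos (show (r : ℕ) < T by omega)

theorem sysY_even_eq_orbitU' {t : ℕ} (ht : t < T) (i : Fin N) :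
    sysY (algF T F G (dataOf X θ v₀ w w')) (matOf (dataOf (T := T) X θ v₀ w w')) (2 * t + 2)
      (inl i) = orbitU F G X θ v₀ w w' t i :=
  sysY_even_eq_orbitU h X θ v₀ w w' ht
    (fun r hr j => sysY_odd_eq_orbitV h X θ v₀ w w' r (by omega) j) i

theorem uObs_eq (ψ : ℝ × (Fin T → ℝ) × (Fin T → ℝ) → ℝ) (i : Fin N) :
    uObs ψ (algF T F G (dataOf X θ v₀ w w')) (matOf (dataOf (T := T) X θ v₀ w w')) (inl i) =
      ψ (uTraj F G X θ v₀ w w' T i) := by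
  refine congrArg ψ (Prod.ext (sysX_zero_eq_orbitBStar h X θ v₀ w w' i)
    (Prod.ext (funext fun t => ?_) (funext fun t => sysY_even_eq_orbitU' h X θ v₀ w w' t.2 i)))
  refine (sysX_inl X θ v₀ w w' _ _ i).trans ?_
  simp only [sysY_odd_eq_orbitV h X θ v₀ w w' t t.2.le]
  rfl

theorem vObs_eq (φ : ℝ × (Fin T → ℝ) × (Fin (T + 1) → ℝ) → ℝ) (j : Fin d) :
    vObs φ (algF T F G (dataOf X θ v₀ w w')) (matOf (dataOf (T := T) X θ v₀ w w')) (inr j) =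
      φ (vTraj F G X θ v₀ w w' T j) := by
  refine congrArg φ (Prod.ext ?_ (Prod.ext (funext fun t => ?_)
    (funext fun t => sysY_odd_eq_orbitV h X θ v₀ w w' t (Nat.lt_succ_iff.1 t.2) j)))
  · exact (sysY_alg h _ _ 0 _).trans (dmftF_false_zero F G _ _)
  · refine (sysX_inr X θ v₀ w w' _ _ j).trans ?_
    simp only [sysY_even_eq_orbitU' h X θ v₀ w w' t.2]
    rfl

end Algorithm

/-! ### The law of the inputs -/

section InputLaw

variable {Ω : Type*} [MeasurableSpace Ω] {P : Measure Ω} [IsProbabilityMeasure P] {T N d : ℕ}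
  {σ : ℝ} {ν₀ : Measure (ℝ × ℝ)} [IsProbabilityMeasure ν₀]

/-- The label of the entry of `X` at the place `(k, l)` of the symmetric matrix. -/
def rowLabel : Fin N ⊕ Fin d → Fin N ⊕ Fin d → Option (Fin N × Fin d)
  | inl i, inr j => some (i, j)
  | inr j, inl i => some (i, j)
  | _, _ => none

theorem rowLabel_inj (k l l' : Fin N ⊕ Fin d) (p : Fin N × Fin d) (h : rowLabel k l = some p)
    (h' : rowLabel k l' = some p) : l = l' := by
  rcases k with i | j <;> rcases l with l | l <;> rcases l' with l' | l' <;> simp_all [rowLabel]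
  all_goals aesop

theorem mem_of_rowLabel {k l : Fin N ⊕ Fin d} {p : Fin N × Fin d} (h : rowLabel k l = some p) :
    k = inl p.1 ∧ l = inr p.2 ∨ k = inr p.2 ∧ l = inl p.1 := by
  rcases k with i | j <;> rcases l with l | l <;> simp only [rowLabel, reduceCtorEq,
    Option.some.injEq] at h <;> subst h <;> simp

theorem matOf_apply (z : Label T N d → ℝ × ℝ) (k l : Fin N ⊕ Fin d) :
    matOf z k l = (rowLabel k l).elim 0 fun p => (z (inl p)).1 := by
  rcases k with i | j <;> rcases l with l | l <;> rfl

theorem varProfile_eq (k l : Fin N ⊕ Fin d) : varProfile N isLeft k l =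
    (rowLabel k l).elim 0 fun _ => (N : ℝ)⁻¹ := by
  rcases k with i | j <;> rcases l with l | l <;> simp [varProfile, rowLabel]

theorem bilin_matOf (z : Label T N d → ℝ × ℝ) (u v : Fin N ⊕ Fin d → ℝ) :
    u ⬝ᵥ (matOf z *ᵥ v) = (fun p => (z (inl p)).1) ⬝ᵥ fun p : Fin N × Fin d =>
      u (inl p.1) * v (inr p.2) + u (inr p.2) * v (inl p.1) := by
  simp only [matOf, mulVec, dotProduct, sum_sum_type, sum_prod_type,
    Matrix.fromBlocks_apply₁₁, Matrix.fromBlocks_apply₁₂, Matrix.fromBlocks_apply₂₁,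
    Matrix.fromBlocks_apply₂₂, Matrix.zero_apply, zero_mul, mul_zero, Finset.sum_const_zero, zero_add,
    add_zero, Matrix.transpose_apply, of_apply, mul_sum, mul_add,
    sum_add_distrib]
  rw [add_comm]
  congr 1
  · exact sum_congr rfl fun i _ => sum_congr rfl fun j _ => by ring
  · rw [sum_comm]
    exact sum_congr rfl fun i _ => sum_congr rfl fun j _ => by ring

theorem nrm_sq_bilin_le (u v : Fin N ⊕ Fin d → ℝ) : nrm (fun p : Fin N × Fin d =>
    u (inl p.1) * v (inr p.2) + u (inr p.2) * v (inl p.1)) ^ 2 ≤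
      2 * (nrm u ^ 2 * nrm v ^ 2) := by
  simp only [nrm_sq, sum_sum_type, sum_prod_type]
  set a := ∑ i, u (inl i) ^ 2
  set b := ∑ j, u (inr j) ^ 2
  set a' := ∑ i, v (inl i) ^ 2
  set b' := ∑ j, v (inr j) ^ 2
  have ha : 0 ≤ a := sum_nonneg fun _ _ => sq_nonneg _
  have hb : 0 ≤ b := sum_nonneg fun _ _ => sq_nonneg _
  have ha' : 0 ≤ a' := sum_nonneg fun _ _ => sq_nonneg _
  have hb' : 0 ≤ b' := sum_nonneg fun _ _ => sq_nonneg _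
  calc _ ≤ ∑ i, ∑ j, (2 * (u (inl i) ^ 2 * v (inr j) ^ 2) +
        2 * (v (inl i) ^ 2 * u (inr j) ^ 2)) :=
        sum_le_sum fun i _ => sum_le_sum fun j _ => by
          nlinarith [sq_nonneg (u (inl i) * v (inr j) - u (inr j) * v (inl i))]
    _ = 2 * (a * b') + 2 * (a' * b) := by
        simp only [sum_add_distrib, ← mul_sum, ← sum_mul, a, b, a', b']
    _ ≤ _ := by nlinarith [mul_nonneg ha ha', mul_nonneg hb hb']

/-- The assumptions on the inputs, for measurable inputs arranged in one family. -/
structure InputLaw (P : Measure Ω) (σ : ℝ) (ν₀ : Measure (ℝ × ℝ))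
    (Z : Ω → Label T N d → ℝ × ℝ) : Prop where
  meas : ∀ a, Measurable fun ω => Z ω a
  indep : iIndepFun (fun a ω => Z ω a) P
  law_entry : ∃ ρ : Measure ℝ, IsSubgaussian (σ / √(N : ℝ)) ρ ∧ ∫ x, x ∂ρ = 0 ∧
    Var[id; ρ] = 1 / (N : ℝ) ∧ ∀ p, HasLaw (fun ω => (Z ω (inl p)).1) ρ P
  law_init : ∀ j, HasLaw (fun ω => Z ω (inr (inl j))) ν₀ P
  law_noise : ∀ a, HasLaw (fun ω => (Z ω (inr (inr a))).1) (gaussianReal 0 1) P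

namespace InputLaw

variable {Z : Ω → Label T N d → ℝ × ℝ}

/-- The side information depends only on the labels of its coordinate. -/
theorem measurable_sideOf_partial (k : Fin N ⊕ Fin d) (S : Set (Label T N d))
    (hw : ∀ t i, k = inl i → inr (inr (inl (t, i))) ∈ S)
    (hθ : ∀ j, k = inr j → inr (inl j) ∈ S)
    (hw' : ∀ t j, k = inr j → inr (inr (inr (t, j))) ∈ S) :
    Measurable[partialFamily Z S] fun ω => sideOf (Z ω) k := by
  refine @measurable_pi_lambda _ _ _ (partialFamily Z S) _ _ fun a => ?_
  rcases k with i | j <;> rcases a with a | a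
  · exact @measurable_const _ _ _ (partialFamily Z S) 0
  · exact measurable_fst.comp (measurable_partial (hw a i rfl))
  · fin_cases a
    · exact measurable_fst.comp (measurable_partial (hθ j rfl))
    · exact measurable_snd.comp (measurable_partial (hθ j rfl))
  · exact measurable_fst.comp (measurable_partial (hw' a j rfl))

variable (h : InputLaw P σ ν₀ Z)
include h

theorem rowLaw_entries (hσ : 0 < σ) (hN : 0 < N) {c : ℝ} (hc : 8 * σ ^ 2 ≤ c) :
    RowLaw P (fun ω (p : Fin N × Fin d) => (Z ω (inl p)).1) (fun _ => (N : ℝ)⁻¹) c N := by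
  obtain ⟨ρ, h1, h2, h3, h4⟩ := h.law_entry
  have hN' : (0 : ℝ) < N := by exact_mod_cast hN
  have hρ : ∀ _ : Fin N × Fin d, IsProbabilityMeasure ρ := fun p =>
    (h4 p).isProbabilityMeasure_iff.1 inferInstance
  obtain ⟨t, ht, ht2, ht3⟩ := h1.exists_lt (by positivity)
  refine ⟨hN, le_trans (by positivity) hc, measurable_pi_lambda _ fun p => (h.meas _).fst, ?_,
    fun p => ?_, fun p => ?_, fun p s => ?_⟩
  · exact (h.indep.precomp Sum.inl_injective).comp (fun _ => Prod.fst) fun _ => measurable_fst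
  · exact (h4 p).integral_eq.trans h2
  · have := hρ p
    have e := (h4 p).integral_comp (f := fun x => x ^ 2) (by fun_prop)
    refine Eq.trans e ?_
    rw [← one_div, ← h3, variance_of_integral_eq_zero aemeasurable_id h2]
    rfl
  · have := hρ p
    have e := (h4 p).lintegral_comp (f := fun x => ofReal (exp (s * x)))
      (by fun_prop)
    refine e.le.trans ((mgf_le_of_exp_sq ht ht3 h2 s).trans
      (ofReal_le_ofReal (exp_le_exp.2 ?_)))
    have h5 : t ^ 2 ≤ 4 * (σ ^ 2 / N) := by
      calc t ^ 2 ≤ (2 * (σ / √N)) ^ 2 := by gcongr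
        _ = _ := by rw [mul_pow, div_pow, sq_sqrt hN'.le]; norm_num
    calc 2 * s ^ 2 * t ^ 2 ≤ 2 * s ^ 2 * (4 * (σ ^ 2 / N)) := by gcongr
      _ = 8 * σ ^ 2 * s ^ 2 / N := by ring
      _ ≤ _ := by gcongr

theorem rowLaw (hσ : 0 < σ) (hN : 0 < N) {c : ℝ} (hc : 8 * σ ^ 2 ≤ c) (k : Fin N ⊕ Fin d) :
    RowLaw P (fun ω => matOf (Z ω) k) (varProfile N isLeft k) c N := by
  convert (h.rowLaw_entries hσ hN hc).extend (rowLabel_inj k) using 1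
  · funext ω l
    exact matOf_apply _ _ _
  · funext l
    exact varProfile_eq k l

theorem mgf_bilin (hσ : 0 < σ) (hN : 0 < N) (u v : Fin N ⊕ Fin d → ℝ) :
    ∫⁻ ω, ofReal (exp (u ⬝ᵥ (matOf (Z ω) *ᵥ v))) ∂P ≤
      ofReal (exp (16 * σ ^ 2 * (nrm u ^ 2 * nrm v ^ 2) / N)) := by
  simp only [bilin_matOf]
  refine ((h.rowLaw_entries hσ hN le_rfl).mgf_dotProduct _).trans
    (ofReal_le_ofReal (exp_le_exp.2 ?_))
  have := nrm_sq_bilin_le u v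
  rw [div_le_div_iff_of_pos_right (by exact_mod_cast hN)]
  nlinarith [sq_nonneg σ]

theorem measurable_matOf (k l : Fin N ⊕ Fin d) : Measurable fun ω => matOf (Z ω) k l := by
  simp only [matOf_apply]
  rcases rowLabel k l with _ | p
  · exact measurable_const
  · exact (h.meas _).fst

theorem measurable_sideOf : Measurable fun ω => sideOf (Z ω) :=
  measurable_pi_lambda _ fun k => (measurable_sideOf_partial (Z := Z) k Set.univ (by simp)
    (by simp) (by simp)).mono (iSup₂_le fun a _ => (h.meas a).comap_le) le_rfl

theorem indepFun_sideOf {k k' : Fin N ⊕ Fin d} (hk : k ≠ k') :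
    IndepFun (fun ω => sideOf (Z ω) k) (fun ω => sideOf (Z ω) k') P := by
  let own : Label T N d → Option (Fin N ⊕ Fin d) := elim (fun _ => none)
    (elim (fun j => some (inr j))
      (elim (fun p => some (inl p.2)) fun p => some (inr p.2)))
  have hm : ∀ k, Measurable[partialFamily Z {a | own a = some k}] fun ω => sideOf (Z ω) k :=
    fun k => measurable_sideOf_partial k _ (by rintro t i rfl; rfl) (by rintro j rfl; rfl)
      (by rintro t j rfl; rfl)
  refine indepFun_of_disjoint h.meas h.indep (Set.disjoint_left.2 fun a ha ha' => hk ?_) (hm k)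
    (hm k')
  exact Option.some_injective _ (Eq.trans (Eq.symm ha) ha')

theorem row_indep (k : Fin N ⊕ Fin d) : IndepFun (fun ω => (matOf (Z ω) k : Fin N ⊕ Fin d → ℝ))
    (fun ω => ((fun i j => mask {k} (matOf (Z ω)) i j : Fin N ⊕ Fin d → Fin N ⊕ Fin d → ℝ),
      sideOf (Z ω))) P := by
  let S : Set (Label T N d) := {a | ∃ l p, rowLabel k l = some p ∧ a = inl p}
  refine indepFun_of_disjoint h.meas h.indep (disjoint_compl_right (a := S)) ?_ ?_
  · refine @measurable_pi_lambda _ _ _ (partialFamily Z S) _ _ fun l => ?_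
    simp only [matOf_apply]
    rcases e : rowLabel k l with _ | p
    · exact @measurable_const _ _ _ (partialFamily Z S) 0
    · exact measurable_fst.comp (measurable_partial (show inl p ∈ S from ⟨l, p, e, rfl⟩))
  · refine Measurable.prodMk ?_ ?_
    · refine @measurable_pi_lambda _ _ _ (partialFamily Z Sᶜ) _ _ fun i =>
        @measurable_pi_lambda _ _ _ (partialFamily Z Sᶜ) _ _ fun j => ?_
      simp only [mask_apply, mem_singleton, matOf_apply]
      by_cases hk : i = k ∨ j = k
      · simp only [hk, if_true]
        exact @measurable_const _ _ _ (partialFamily Z Sᶜ) 0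
      · simp only [hk, if_false]
        rcases e : rowLabel i j with _ | p
        · exact @measurable_const _ _ _ (partialFamily Z Sᶜ) 0
        · refine measurable_fst.comp (measurable_partial (show inl p ∈ Sᶜ from ?_))
          rintro ⟨l, p', hp, hpp⟩
          obtain rfl := Sum.inl_injective hpp
          rcases mem_of_rowLabel e with ⟨h1, h2⟩ | ⟨h1, h2⟩ <;>
            rcases mem_of_rowLabel hp with ⟨h3, h4⟩ | ⟨h3, h4⟩ <;> simp_all
    · refine @measurable_pi_lambda _ _ _ (partialFamily Z Sᶜ) _ _ fun l =>
        measurable_sideOf_partial l _ ?_ ?_ ?_ <;> simp [S]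

theorem law_sideOf (k : Fin N ⊕ Fin d) :
    P.map (fun ω => sideOf (Z ω) k) = (sideLaw ν₀ T).map (side k.isLeft) := by
  have hw : ∀ (g : Fin T → (Fin T × Fin N) ⊕ (Fin T × Fin d)), Function.Injective g →
      HasLaw (fun ω t => (Z ω (inr (inr (g t)))).1)
        (Measure.pi fun _ => gaussianReal 0 1) P := fun g hg =>
    iIndepFun.hasLaw_pi (fun t => h.law_noise (g t))
      ((h.indep.precomp (g := fun t => inr (inr (g t)))
        (Sum.inr_injective.comp (Sum.inr_injective.comp hg))).comp (fun _ => Prod.fst)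
          fun _ => measurable_fst)
  rcases k with i | j
  · have h1 := hw (fun t => inl (t, i)) fun t t' e => by simpa using e
    have hm : Measurable fun x : Fin T → ℝ => (elim 0 x : Side T → ℝ) :=
      (continuous_side true).measurable.comp (measurable_const (a := ((0, 0) : ℝ × ℝ)).prodMk
        measurable_id)
    have e1 := (HasLaw.comp ⟨hm.aemeasurable, rfl⟩ h1).map_eq
    have e2 : (sideLaw ν₀ T).map (side true) =
        ((sideLaw ν₀ T).map Prod.snd).map fun x : Fin T → ℝ => (elim 0 x : Side T → ℝ) := by
      rw [Measure.map_map hm measurable_snd]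
      rfl
    rw [Sum.isLeft_inl, e2, sideLaw, Measure.map_snd_prod, measure_univ, one_smul]
    exact e1
  · have h1 := hw (fun t => inr (t, j)) fun t t' e => by simpa using e
    have hi : IndepFun (fun ω => Z ω (inr (inl j)))
        (fun ω (t : Fin T) => (Z ω (inr (inr (inr (t, j))))).1) P := by
      refine indepFun_of_disjoint h.meas h.indep
        (disjoint_compl_right (a := {(inr (inl j) : Label T N d)}))
        (measurable_partial rfl) ?_
      refine @measurable_pi_lambda _ _ _ (partialFamily Z _) _ _ fun t =>
        measurable_fst.comp (measurable_partial (by simp))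
    have h2 := hi.hasLaw_prod (h.law_init j) h1
    exact (HasLaw.comp ⟨(continuous_side false).aemeasurable, rfl⟩ h2).map_eq

end InputLaw

theorem lintegral_side_lt_top (hσ : 0 < σ) (hθ : IsSubgaussian σ (ν₀.map Prod.fst))
    (hv : IsSubgaussian σ (ν₀.map Prod.snd)) (b : Bool) (a : Side T) (q : ℕ) :
    ∫⁻ y, ofReal (|side b y a| ^ q) ∂sideLaw ν₀ T < ⊤ := by
  have hm : Measurable fun x : ℝ => ofReal (|x| ^ q) := by fun_prop
  rcases a with a | a
  · rcases b with _ | _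
    · have hsub : ∀ g : ℝ × ℝ → ℝ, Measurable g → IsSubgaussian σ (ν₀.map g) →
          ∫⁻ y, ofReal (|g y.1| ^ q) ∂sideLaw ν₀ T < ⊤ := by
        intro g hg hs
        have : IsProbabilityMeasure (ν₀.map g) := Measure.isProbabilityMeasure_map hg.aemeasurable
        obtain ⟨t, ht, -, ht3⟩ := hs.exists_lt hσ
        have h1 := moment_le_of_exp_sq ht ht3 q
        rw [lintegral_map hm hg] at h1
        have e : ∫⁻ y, ofReal (|g y.1| ^ q) ∂sideLaw ν₀ T =
            ∫⁻ x, ofReal (|g x| ^ q) ∂((sideLaw ν₀ T).map Prod.fst) :=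
          (lintegral_map (hm.comp hg) measurable_fst).symm
        rw [e, sideLaw, Measure.map_fst_prod, measure_univ, one_smul]
        exact h1.trans_lt ofReal_lt_top
      fin_cases a
      · exact hsub _ measurable_fst hθ
      · exact hsub _ measurable_snd hv
    · simp [side]
  · have e : ∫⁻ y, ofReal (|y.2 a| ^ q) ∂sideLaw ν₀ T =
        ∫⁻ x, ofReal (|x| ^ q) ∂(((sideLaw ν₀ T).map Prod.snd).map fun x => x a) := by
      rw [lintegral_map hm (measurable_pi_apply a),
        lintegral_map (f := fun x : Fin T → ℝ => ofReal (|x a| ^ q))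
          (hm.comp (measurable_pi_apply a)) measurable_snd]
    refine lt_of_eq_of_lt e ?_
    rw [sideLaw, Measure.map_snd_prod, measure_univ, one_smul,
      (measurePreserving_eval (fun _ : Fin T => gaussianReal 0 1) a).map_eq]
    have h1 := (memLp_id_gaussianReal (μ := 0) (v := 1) q).integrable_norm_pow' 
    have h2 := h1.2
    rw [hasFiniteIntegral_iff_ofReal (.of_forall fun _ => by positivity)] at h2
    simpa using h2

end InputLaw

/-! ### The random system of the algorithm -/

section RandomSystem

open scoped Matrix.Norms.L2Operator

variable {Ω : ℕ → Type*} [∀ n, MeasurableSpace (Ω n)] {P : ∀ n, Measure (Ω n)}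
  [∀ n, IsProbabilityMeasure (P n)] {T : ℕ} {N d : ℕ → ℕ} {σ α : ℝ} {ν₀ : Measure (ℝ × ℝ)}
  [IsProbabilityMeasure ν₀] {Z : ∀ n, Ω n → Label T (N n) (d n) → ℝ × ℝ} {F : UFun} {G : VFun}

theorem exists_dmftF_le (hF : ∀ s, IsC1b (F s)) (hG : ∀ s, IsC1b (G s)) (t : ℕ) :
    ∃ C : ℝ, ∀ b (ξ : Side T → ℝ), |dmftF F G t (b, ξ) 0| ≤ C * (1 + ∑ a, |ξ a|) := by
  have hS : ∀ ξ : Side T → ℝ, 0 ≤ ∑ a, |ξ a| := fun ξ => sum_nonneg fun _ _ => abs_nonneg _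
  have h1 : ∀ (ξ : Side T → ℝ) a, |ξ a| ≤ ∑ a, |ξ a| := fun ξ a =>
    single_le_sum (f := fun a => |ξ a|) (fun _ _ => abs_nonneg _) (mem_univ a)
  have hn : ∀ (ξ : Side T → ℝ) k, ‖(fun r : Fin (k + 1) => noise ξ r)‖ ≤ ∑ a, |ξ a| := fun ξ k => by
    refine (pi_norm_le_iff_of_nonneg (hS ξ)).2 fun r => ?_
    unfold noise ext0
    split_ifs
    · exact h1 ξ _
    · simpa using hS ξ
  have hlip : ∀ {E : Type} [NormedAddCommGroup E] [NormedSpace ℝ E] {f : E → ℝ}, IsC1b f →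
      ∀ g : (Side T → ℝ) → E, (∀ ξ, ‖g ξ‖ ≤ ∑ a, |ξ a|) →
        ∃ C, ∀ ξ, |f (g ξ)| ≤ C * (1 + ∑ a, |ξ a|) := by
    intro E _ _ f hf g hg
    obtain ⟨C, hC0, hC⟩ := hf.exists_lipschitz
    refine ⟨|f 0| + C, fun ξ => ?_⟩
    have h2 := hC 0 (g ξ)
    rw [sub_zero] at h2
    nlinarith [abs_sub_abs_le_abs_sub (f (g ξ)) (f 0), mul_le_mul_of_nonneg_left (hg ξ) hC0,
      mul_nonneg (abs_nonneg (f 0)) (hS ξ)]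
  suffices hb : ∀ b, ∃ C : ℝ, ∀ ξ : Side T → ℝ, |dmftF F G t (b, ξ) 0| ≤ C * (1 + ∑ a, |ξ a|) by
    obtain ⟨C, hC⟩ := hb true
    obtain ⟨D, hD⟩ := hb false
    refine ⟨max C D, fun b ξ => ?_⟩
    have := hS ξ
    rcases b with _ | _
    · exact (hD ξ).trans (by gcongr; exact le_max_right _ _)
    · exact (hC ξ).trans (by gcongr; exact le_max_left _ _)
  have hz : ∃ C : ℝ, ∀ ξ : Side T → ℝ, |(0 : ℝ)| ≤ C * (1 + ∑ a, |ξ a|) := ⟨0, fun ξ => by simp⟩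
  have hc : ∀ a, ∃ C : ℝ, ∀ ξ : Side T → ℝ, |ξ a| ≤ C * (1 + ∑ a, |ξ a|) := fun a =>
    ⟨1, fun ξ => by linarith [h1 ξ a]⟩
  rintro (_ | _)
  · rcases time_cases t with rfl | ⟨k, rfl⟩ | ⟨k, rfl⟩
    · simpa only [dmftF_false_zero] using hc _
    · simp only [dmftF_false_odd]
      rcases k with _ | k
      · exact hc _
      · refine hlip (hG k) (fun ξ => vPoint k ξ 0) fun ξ => ?_
        exact max_le (by simpa [vPoint, Pi.zero_def] using hS ξ) (max_le (h1 ξ _) (hn ξ k))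
    · simpa only [dmftF_false_even] using hz
  · rcases time_cases t with rfl | ⟨k, rfl⟩ | ⟨k, rfl⟩
    · simpa only [dmftF_true_zero] using hz
    · simpa only [dmftF_true_odd] using hz
    · simp only [dmftF_true_even]
      refine hlip (hF k) (fun ξ => uPoint k ξ 0) fun ξ => ?_
      exact max_le (by simpa [uPoint] using hS ξ)
        (max_le (by simpa [uPoint, Pi.zero_def] using hS ξ) (hn ξ k))

variable (h : ∀ n, InputLaw (P n) σ ν₀ (Z n))
include h

theorem lpBdd_sideOf (hσ : 0 < σ) (hθ : IsSubgaussian σ (ν₀.map Prod.fst))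
    (hv : IsSubgaussian σ (ν₀.map Prod.snd)) (a : Side T) :
    LpBdd P fun n (l : Fin (N n) ⊕ Fin (d n)) ω => sideOf (Z n ω) l a := by
  have hm : ∀ n l, Measurable fun ω => sideOf (Z n ω) l := fun n l =>
    measurable_pi_iff.1 (h n).measurable_sideOf l
  refine ⟨fun n l => measurable_pi_iff.1 (hm n l) a, fun q => ?_⟩
  let I : Bool → ℝ≥0∞ := fun b => ∫⁻ y, ofReal (|side b y a| ^ q) ∂sideLaw ν₀ T
  have hI : ∀ b, I b ≠ ⊤ := fun b => (lintegral_side_lt_top hσ hθ hv b a q).ne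
  refine ⟨(I true + I false).toReal, fun n l => ?_⟩
  have hq : Measurable fun x : Side T → ℝ => ofReal (|x a| ^ q) := by fun_prop
  rw [ENNReal.ofReal_toReal (ENNReal.add_ne_top.2 ⟨hI _, hI _⟩),
    ← lintegral_map (f := fun x : Side T → ℝ => ofReal (|x a| ^ q)) hq (hm n l),
    (h n).law_sideOf, lintegral_map hq (continuous_side _).measurable]
  rcases l with i | j
  · exact le_self_add
  · exact le_add_self

theorem cavityModel (hσ : 0 < σ) (hθ : IsSubgaussian σ (ν₀.map Prod.fst))
    (hv : IsSubgaussian σ (ν₀.map Prod.snd)) (hF : ∀ s, IsC1b (F s)) (hG : ∀ s, IsC1b (G s))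
    (hN : Tendsto N atTop atTop) (hN0 : ∀ n, 0 < N n) (hα : ∀ n, (d n : ℝ) = α * N n) {L : ℕ → ℝ}
    (hL : Reg (dmftF (T := T) F G) (dmftP F G) L) :
    CavityModel P N (fun _ => isLeft) (fun n ω => matOf (Z n ω)) (fun n ω => sideOf (Z n ω))
      (dmftF F G) (dmftP F G) L (1 + α + 8 * σ ^ 2) := by
  have hα0 : 0 ≤ α := by
    have h1 : (0 : ℝ) < N 0 := by exact_mod_cast hN0 0
    have h2 : (0 : ℝ) ≤ α * N 0 := hα 0 ▸ Nat.cast_nonneg _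
    exact nonneg_of_mul_nonneg_left h2 h1
  have hcard : ∀ n, (card (Fin (N n) ⊕ Fin (d n)) : ℝ) ≤ (1 + α + 8 * σ ^ 2) * N n := by
    intro n
    rw [Fintype.card_sum, card_fin, card_fin, Nat.cast_add, hα]
    nlinarith [mul_nonneg (sq_nonneg σ) (Nat.cast_nonneg (α := ℝ) (N n))]
  refine ⟨hN, hcard, hL, fun t => measurable_of_bool fun b => continuous_dmftF hF hG b t,
    fun t s => measurable_of_bool fun b => continuous_dmftP hF hG b t s,
    fun n => (h n).measurable_matOf, fun n => (h n).measurable_sideOf, fun n ω k l => ?_,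
    fun n ω k l hkl => ?_, ?_, fun t => ?_, fun n k => ?_, fun n k => (h n).row_indep k⟩
  · rcases k with k | k <;> rcases l with l | l <;> rfl
  · rcases k with k | k <;> rcases l with l | l <;> first | rfl | simp at hkl
  · exact lpBdd_norm (fun n => (h n).measurable_matOf) (by positivity) hN0 hcard
      fun n => (h n).mgf_bilin hσ (hN0 n)
  · obtain ⟨C, hC⟩ := exists_dmftF_le (T := T) hF hG t
    refine (((LpBdd.const 1).add (LpBdd.sum univ fun (a : Side T) _ =>
      (lpBdd_sideOf h hσ hθ hv a).abs)).const_mul C).of_le (fun n l => ?_) fun n l ω => hC _ _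
    exact (continuous_dmftF hF hG _ t).measurable.comp
      ((measurable_pi_iff.1 (h n).measurable_sideOf l).prodMk measurable_const)
  · exact (h n).rowLaw hσ (hN0 n) (by linarith) k

theorem ensemble (hσ : 0 < σ) (hθ : IsSubgaussian σ (ν₀.map Prod.fst))
    (hv : IsSubgaussian σ (ν₀.map Prod.snd)) (hF : ∀ s, IsC1b (F s)) (hG : ∀ s, IsC1b (G s))
    (hN : Tendsto N atTop atTop) (hd : Tendsto d atTop atTop) (hN0 : ∀ n, 0 < N n)
    (hα : ∀ n, (d n : ℝ) = α * N n) {L : ℕ → ℝ} (hL : Reg (dmftF (T := T) F G) (dmftP F G) L) :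
    Ensemble P N (fun _ => isLeft) (fun n ω => matOf (Z n ω)) (fun n ω => sideOf (Z n ω))
      F G L (1 + α + 8 * σ ^ 2) ν₀ α := by
  have hN0' : ∀ n, (N n : ℝ) ≠ 0 := fun n => by exact_mod_cast (hN0 n).ne'
  refine ⟨hF, hG, cavityModel h hσ hθ hv hF hG hN hN0 hα hL, ?_, ?_, ?_, fun n => ?_, fun n => ?_⟩
  · rintro b n ⟨k, rfl⟩
    exact (h n).law_sideOf k
  · exact fun b n q => (h n).indepFun_sideOf q.2.1
  · have hne : ∀ {m : ℕ}, 2 ≤ m → ∀ i : Fin m, ∃ i', i ≠ i' := fun {m} hm i => by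
      have : Nontrivial (Fin m) := Fin.nontrivial_iff_two_le.2 hm
      obtain ⟨i', hi⟩ := exists_ne i
      exact ⟨i', hi.symm⟩
    rintro (_ | _)
    · filter_upwards [hd.eventually_ge_atTop 2] with n hn
      refine ⟨⟨⟨inr ⟨0, by omega⟩, rfl⟩⟩, ?_⟩
      rintro ⟨i | j, hk⟩
      · simp at hk
      · obtain ⟨j', hj⟩ := hne hn j
        exact ⟨⟨(inr j, inr j'), by simpa using hj, rfl, rfl⟩, rfl⟩
    · filter_upwards [hN.eventually_ge_atTop 2] with n hn
      refine ⟨⟨⟨inl ⟨0, by omega⟩, rfl⟩⟩, ?_⟩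
      rintro ⟨i | j, hk⟩
      · obtain ⟨i', hi⟩ := hne hn i
        exact ⟨⟨(inl i, inl i'), by simpa using hi, rfl, rfl⟩, rfl⟩
      · simp at hk
  · rw [Fintype.card_congr (β := Fin (N n))
      ⟨fun k => k.1.getLeft k.2, fun i => ⟨inl i, rfl⟩, fun k => Subtype.ext (by simp),
        fun i => rfl⟩, card_fin, inv_mul_cancel₀ (hN0' n)]
  · rw [Fintype.card_congr (β := Fin (d n))
      ⟨fun k => k.1.getRight (Sum.isLeft_eq_false.1 k.2), fun j => ⟨inr j, rfl⟩,
        fun k => Subtype.ext (by simp), fun j => rfl⟩, card_fin, hα]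
    field_simp [hN0' n]

end RandomSystem

/-! ### Measurable versions of the inputs -/

section Versions

theorem covariance_congr {Ω : Type*} [MeasurableSpace Ω] {P : Measure Ω} {f f' g g' : Ω → ℝ}
    (hf : f =ᵐ[P] f') (hg : g =ᵐ[P] g') : cov[f, g; P] = cov[f', g'; P] := by
  unfold covariance
  rw [integral_congr_ae hf, integral_congr_ae hg]
  refine integral_congr_ae ?_
  filter_upwards [hf, hg] with ω h1 h2
  rw [h1, h2]

theorem IsRandomInput.exists_inputLaw {Ω : Type*} [MeasurableSpace Ω] {P : Measure Ω}
    [IsProbabilityMeasure P] {σ : ℝ} {ν₀ : Measure (ℝ × ℝ)} {N d : ℕ}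
    {X : Ω → Matrix (Fin N) (Fin d) ℝ} {θ v₀ : Ω → Fin d → ℝ} {w : Ω → ℕ → Fin N → ℝ}
    {w' : Ω → ℕ → Fin d → ℝ} (h : IsRandomInput P σ ν₀ X θ v₀ w w') (T : ℕ) :
    ∃ Z : Ω → Label T N d → ℝ × ℝ, InputLaw P σ ν₀ Z ∧
      ∀ᵐ ω ∂P, dataOf (X ω) (θ ω) (v₀ ω) (w ω) (w' ω) = Z ω := by
  let D : Label T N d → Ω → ℝ × ℝ := fun a ω => dataOf (X ω) (θ ω) (v₀ ω) (w ω) (w' ω) a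
  have hx : Measurable fun x : ℝ => (x, (0 : ℝ)) := by fun_prop
  have hinj : ∀ m, Function.Injective fun p : Fin T × Fin m => ((p.1 : ℕ), p.2) := by
    rintro m ⟨s, i⟩ ⟨t, j⟩ e
    simp only [Prod.mk.injEq, Fin.val_inj] at e
    exact Prod.ext e.1 e.2
  have hD : ∀ a, AEMeasurable (D a) P := by
    obtain ⟨ρ, -, -, -, hρ⟩ := h.law_X
    rintro (p | j | p | p)
    · exact hx.comp_aemeasurable (hρ p.1 p.2).aemeasurable
    · exact (h.law_init j).aemeasurable
    · exact hx.comp_aemeasurable (h.law_w p.1 p.2).aemeasurable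
    · exact hx.comp_aemeasurable (h.law_w' p.1 p.2).aemeasurable
  have hi : iIndepFun D P := by
    have i1 := h.indep_X.comp (fun _ x => (x, (0 : ℝ))) fun _ => hx
    have i3 := (h.indep_w.precomp (hinj N)).comp (fun _ x => (x, (0 : ℝ))) fun _ => hx
    have i4 := (h.indep_w'.precomp (hinj d)).comp (fun _ x => (x, (0 : ℝ))) fun _ => hx
    have c34 := h.indep_noise.comp (φ := fun x (p : Fin T × Fin N) => (x p.1 p.2, (0 : ℝ)))
      (ψ := fun x (p : Fin T × Fin d) => (x p.1 p.2, (0 : ℝ))) (by fun_prop) (by fun_prop)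
    have i34 := iIndepFun_sumElim i3 i4 c34
    have i234 := iIndepFun_sumElim h.indep_init i34 ((h.indep_init_noise.comp
      (φ := fun x j => (x.1 j, x.2 j))
      (ψ := fun x => elim (fun p : Fin T × Fin N => (x.1 p.1 p.2, (0 : ℝ)))
        fun p : Fin T × Fin d => (x.2 p.1 p.2, 0)) (by fun_prop)
      (measurable_pi_lambda _ fun a => by rcases a with a | a <;> simp <;> fun_prop)).congr
        EventuallyEq.rfl (.of_forall fun ω => by ext a : 1; rcases a with a | a <;> rfl))
    have i1234 := iIndepFun_sumElim i1 i234 ((h.indep_X_rest.comp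
      (φ := fun x (p : Fin N × Fin d) => (x p.1 p.2, (0 : ℝ)))
      (ψ := fun x => elim (fun j => (x.1 j, x.2.1 j))
        (elim (fun p : Fin T × Fin N => (x.2.2.1 p.1 p.2, (0 : ℝ)))
          fun p : Fin T × Fin d => (x.2.2.2 p.1 p.2, 0))) (by fun_prop)
      (measurable_pi_lambda _ fun a => by rcases a with a | a | a <;> simp <;> fun_prop)).congr
        EventuallyEq.rfl
        (.of_forall fun ω => by ext a : 1; rcases a with a | a | a <;> rfl))
    refine i1234.congr fun a => Eventually.of_forall fun ω => ?_
    rcases a with a | a | a | a <;> rfl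
  let Z : Ω → Label T N d → ℝ × ℝ := fun ω a => (hD a).mk (D a) ω
  have hZ : ∀ a, D a =ᵐ[P] fun ω => Z ω a := fun a => (hD a).ae_eq_mk
  refine ⟨Z, ⟨fun a => (hD a).measurable_mk, hi.congr hZ, ?_, fun j => ?_, fun a => ?_⟩, ?_⟩
  · obtain ⟨ρ, h1, h2, h3, h4⟩ := h.law_X
    refine ⟨ρ, h1, h2, h3, fun p => (h4 p.1 p.2).congr ?_⟩
    exact (hZ (inl p)).symm.fun_comp Prod.fst
  · exact (h.law_init j).congr (hZ (inr (inl j))).symm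
  · have e := (hZ (inr (inr a))).symm.fun_comp Prod.fst
    rcases a with p | p
    · exact (h.law_w p.1 p.2).congr e
    · exact (h.law_w' p.1 p.2).congr e
  · filter_upwards [ae_all_iff.2 hZ] with ω hω
    exact funext hω

end Versions

end

end DMFT

theorem theorem2
    (σ α : ℝ) (hσ : 0 < σ)
    (ν₀ : Measure (ℝ × ℝ)) [IsProbabilityMeasure ν₀]
    (hν₀θ : DMFT.IsSubgaussian σ (ν₀.map Prod.fst))
    (hν₀v : DMFT.IsSubgaussian σ (ν₀.map Prod.snd))
    (F : DMFT.UFun) (G : DMFT.VFun)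
    (hF : ∀ s, DMFT.IsC1b (F s)) (hG : ∀ s, DMFT.IsC1b (G s))
    (N d : ℕ → ℕ) (hN : Tendsto N atTop atTop) (hd : Tendsto d atTop atTop)
    (hα : ∀ n, (d n : ℝ) / (N n : ℝ) = α)
    (Ω : ℕ → Type*) [∀ n, MeasurableSpace (Ω n)]
    (P : ∀ n, Measure (Ω n)) [∀ n, IsProbabilityMeasure (P n)]
    (X : ∀ n, Ω n → Matrix (Fin (N n)) (Fin (d n)) ℝ)
    (θ v₀ : ∀ n, Ω n → Fin (d n) → ℝ)
    (w : ∀ n, Ω n → ℕ → Fin (N n) → ℝ) (w' : ∀ n, Ω n → ℕ → Fin (d n) → ℝ)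
    (hinput : ∀ n, DMFT.IsRandomInput (P n) σ ν₀ (X n) (θ n) (v₀ n) (w n) (w' n))
    (T : ℕ)
    (φ : ℝ × (Fin T → ℝ) × (Fin (T + 1) → ℝ) → ℝ) (hφ : DMFT.IsC1b φ)
    (ψ : ℝ × (Fin T → ℝ) × (Fin T → ℝ) → ℝ) (hψ : DMFT.IsC1b ψ)
    -- the observables of the coordinates `j` and `i`
    (Φ : ∀ n, Fin (d n) → Ω n → ℝ)
    (hΦ : Φ = fun n j ω =>
      φ (DMFT.vTraj F G (X n ω) (θ n ω) (v₀ n ω) (w n ω) (w' n ω) T j))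
    (Ψ : ∀ n, Fin (N n) → Ω n → ℝ)
    (hΨ : Ψ = fun n i ω =>
      ψ (DMFT.uTraj F G (X n ω) (θ n ω) (v₀ n ω) (w n ω) (w' n ω) T i)) :
    -- all the expectations and covariances below exist
    (Integrable φ (DMFT.nuLaw F G α ν₀ T) ∧ Integrable ψ (DMFT.muLaw F G α ν₀ T) ∧
      (∀ n j, MemLp (Φ n j) 2 (P n)) ∧ (∀ n i, MemLp (Ψ n i) 2 (P n))) ∧
    -- convergence of the expectations, for every coordinate
    (∀ ε > 0, ∀ᶠ n in atTop, ∀ j : Fin (d n),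
      |∫ ω, Φ n j ω ∂P n - ∫ x, φ x ∂DMFT.nuLaw F G α ν₀ T| < ε) ∧
    (∀ ε > 0, ∀ᶠ n in atTop, ∀ i : Fin (N n),
      |∫ ω, Ψ n i ω ∂P n - ∫ x, ψ x ∂DMFT.muLaw F G α ν₀ T| < ε) ∧
    -- asymptotic decorrelation of distinct coordinates
    (∀ ε > 0, ∀ᶠ n in atTop, ∀ j j' : Fin (d n), j ≠ j' →
      |cov[Φ n j, Φ n j'; P n]| < ε) ∧
    (∀ ε > 0, ∀ᶠ n in atTop, ∀ i i' : Fin (N n), i ≠ i' →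
      |cov[Ψ n i, Ψ n i'; P n]| < ε) := by
  subst hΦ hΨ
  have hα0 : α ≠ 0 := by
    obtain ⟨n, h1, h2⟩ := ((hN.eventually_gt_atTop 0).and (hd.eventually_gt_atTop 0)).exists
    rw [← hα n]
    positivity
  have hN0 : ∀ n, 0 < N n := fun n => Nat.pos_of_ne_zero fun h => hα0 (by rw [← hα n, h]; simp)
  have hdN : ∀ n, (d n : ℝ) = α * N n := fun n =>
    (div_eq_iff (by exact_mod_cast (hN0 n).ne')).1 (hα n)
  choose Z hZ hZe using fun n => (hinput n).exists_inputLaw T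
  obtain ⟨L, hL⟩ := DMFT.exists_reg (T := T) hF hG
  have hens := DMFT.ensemble hZ hσ hν₀θ hν₀v hF hG hN hd hN0 hdN hL
  obtain ⟨hiψ, hψ1, hψ2, hψ3⟩ := hens.decouples_true hψ
  obtain ⟨hiφ, hφ1, hφ2, hφ3⟩ := hens.decouples_false hφ
  have eΨ : ∀ n i, (fun ω => DMFT.uObs ψ (DMFT.algF T F G (Z n ω)) (DMFT.matOf (Z n ω)) (Sum.inl i))
      =ᵐ[P n] fun ω => ψ (DMFT.uTraj F G (X n ω) (θ n ω) (v₀ n ω) (w n ω) (w' n ω) T i) := by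
    intro n i
    filter_upwards [hZe n] with ω hω
    rw [← hω, DMFT.uObs_eq hL]
  have eΦ : ∀ n j, (fun ω => DMFT.vObs φ (DMFT.algF T F G (Z n ω)) (DMFT.matOf (Z n ω)) (Sum.inr j))
      =ᵐ[P n] fun ω => φ (DMFT.vTraj F G (X n ω) (θ n ω) (v₀ n ω) (w n ω) (w' n ω) T j) := by
    intro n j
    filter_upwards [hZe n] with ω hω
    rw [← hω, DMFT.vObs_eq hL]
  refine ⟨⟨hiφ, hiψ, fun n j => (hφ1 n ⟨Sum.inr j, rfl⟩).ae_eq (eΦ n j),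
    fun n i => (hψ1 n ⟨Sum.inl i, rfl⟩).ae_eq (eΨ n i)⟩, fun ε hε => ?_, fun ε hε => ?_,
    fun ε hε => ?_, fun ε hε => ?_⟩
  · filter_upwards [hφ2 ε hε] with n hn j
    rw [← integral_congr_ae (eΦ n j)]
    exact hn ⟨Sum.inr j, rfl⟩
  · filter_upwards [hψ2 ε hε] with n hn i
    rw [← integral_congr_ae (eΨ n i)]
    exact hn ⟨Sum.inl i, rfl⟩
  · filter_upwards [hφ3 ε hε] with n hn j j' hj
    rw [← DMFT.covariance_congr (eΦ n j) (eΦ n j')]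
    exact hn ⟨(Sum.inr j, Sum.inr j'), by simpa using hj, rfl, rfl⟩
  · filter_upwards [hψ3 ε hε] with n hn i i' hi
    rw [← DMFT.covariance_congr (eΨ n i) (eΨ n i')]
    exact hn ⟨(Sum.inl i, Sum.inl i'), by simpa using hi, rfl, rfl⟩
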